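/- **Theorem 8.** Let $\mathfrak b$ be a field, or the ring $\mathfrak k[[h]]$ of formal power series over a field; in the second case all modules carry the $h$-adic topology and all tensor products are completed. (More generally, $\mathfrak b$ may be any commutative ring that is complete for an ideal $I$.) Let $H$ be a ribbon Hopf algebra over $\mathfrak b$, with comultiplication $\Delta$, counit $\epsilon$, antipode $S$, universal $R$-matrix $R=\sum s\otimes t$ (so $R^{-1}=\sum S(s)\otimes t$), ribbon element $\theta$, and charmed element $k=\theta^{-1}\sum S(t)s$. *Lattice and connections.* Let $\Gamma$ be a lattice: a finite graph with a set $O$ of oriented edges and a linear order (ciliation) of the edge ends at each vertex. Its envelope $F$ is the oriented surface with a disk, marked by a cilium on its boundary, for each vertex, and a band for each $e\in O$, attached in the order given by the ciliations. Each vertex is viewed as the upper half plane with the cilium at infinity, so that the edge ends enter along the bottom from left to right in ciliation order. The connections on $\Gamma$ are $\mathbb A=\bigotimes_{e\in O}H$. An element $a\in H$ acts at an edge end by $x_e\mapsto a x_e$ in the factor of $e$ if the end is initial (directed downwards in the half plane), and by $x_e\mapsto x_eS(a)$ if it is terminal (directed upwards). A crossing of two adjacent strands acts by $R$, with $s$ acting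 on the left strand and $t$ on the right strand, if the left strand (below the crossing) passes over, and by $R^{-1}$, with $S(s)$ acting on the right strand and $t$ on the left strand, if the right strand passes over. Let $\nabla:\mathbb A\to\mathbb A\otimes\mathbb A$ be the map that applies $\Delta$ in every factor, giving parallel edges $e'$ and $e''$ in this order for each $e\in O$, and then, at every vertex, moves all prime strands to the left of all double prime strands by crossings in which the double prime strands pass over. For linear $f,g:\mathbb A\to\mathfrak b$ put $(f\star g)(x)=(f\otimes g)(\nabla x)$, where $f$ is evaluated on the prime copy and $g$ on the double prime copy. *Wilson links.* A base point free q-tangle $L$ with no arc components is a generic immersion of finitely many oriented circles in $F$, with over- and under-crossing data at each double point, whose double points lie in the vertices and which meets each band in arcs parallel to the core. Each component is coloured by a finite dimensional $H$-module (free of finite rank over $\mathfrak b$). Two of them are equivalent if they are related by isotopies of $F$, Reidemeister moves of type II and III, and the framing equivalence, which moves a kink of given sign from one side of a strand to the other. The Wilson link $W_L:\mathbb A\to\mathfrak b$ is the following composition. First, $\Delta^{m_e-1}$ is applied in the factor of each $e\in O$, where $m_e$ is the number of arcs of $L$ in its band ($\Delta^{-1}=\epsilon$, $\Delta^0=\mathrm{id}$).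 Next, $x\mapsto S(xk)$ is applied in the factor of each arc whose direction is opposite to that of $e$. Then the tangle diagrams of $L$ in the vertices are evaluated from the bottom up. A crossing acts as above. A local minimum creates a factor $1$ if it is traversed from left to right and $k^{-1}$ otherwise. A local maximum that joins the factors $x$ (left) and $y$ (right) of two different edges yields $xy$ if it is traversed from left to right and $ykx$ otherwise. A local maximum that joins the two ends of one edge with factor $x$ yields $\operatorname{tr}_V(x)$ if it is traversed from left to right and $\operatorname{tr}_V(xk)$ otherwise, $V$ being the colour. *Superposition.* The superposition $L\star L'$ is the equivalence class of any generic diagram obtained by laying $L'$ over $L$, that is, of any diagram that is the union of a diagram equivalent to $L$ and a diagram equivalent to $L'$, the latter passing over the former at each of their mutual crossings. **Statement.** Let $L$ and $L'$ be coloured base point free q-tangles in $F$ with no arc components. Then, for every representative of $L\star L'$, $$W_L\star W_{L'}=W_{L\star L'} .$$ -/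

import Mathlib

open scoped TensorProduct

universe u

noncomputable section

namespace LGFT

/-! ## Completed modules

The base ring `b` carries an ideal `I` for which it is complete.  The two cases of interest are a
field with `I = ⊥`, where completion changes nothing, and `k⟦h⟧` with `I = (h)`, where completed
tensor products and continuous maps are those of the `h`-adic topology. -/

section Completion

variable {b : Type*} [CommRing b] (I : Ideal b)
  {M N P : Type*} [AddCommGroup M] [Module b M] [AddCommGroup N] [Module b N]
  [AddCommGroup P] [Module b P]

/-- The extension of a linear map to the completions, linear in the map. -/
def cmap : (M →ₗ[b] N) →ₗ[b] (AdicCompletion I M →ₗ[b] AdicCompletion I N) where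
  toFun f := (AdicCompletion.map I f).restrictScalars b
  map_add' f g := by
    ext x n
    simp
  map_smul' r f := by
    ext x n
    simp
    rfl

/-- The continuous extension to the completion of a linear map into a completion. -/
def cext (f : M →ₗ[b] AdicCompletion I N) : AdicCompletion I M →ₗ[b] AdicCompletion I N :=
  AdicCompletion.lift I
    (fun n => (Submodule.liftQ (I ^ n • ⊤ : Submodule b M) (AdicCompletion.eval I N n ∘ₗ f)
      (by
        rw [Submodule.smul_le]
        intro r hr x _
        have h : r • f x ∈ (I ^ n • ⊤ : Submodule b (AdicCompletion I N)) :=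
          Submodule.smul_mem_smul hr Submodule.mem_top
        have := AdicCompletion.pow_smul_top_le_ker_eval (I := I) (M := N) n h
        simpa using this)) ∘ₗ AdicCompletion.eval I M n)
    (by
      intro m n hmn
      ext a
      have hx : (AdicCompletion.mk I M a).val m =
          Submodule.Quotient.mk (p := (I ^ m • ⊤ : Submodule b M)) (a n) := by
        rw [← (AdicCompletion.mk I M a).property hmn]
        rfl
      simp only [LinearMap.comp_apply, AdicCompletion.coe_eval]
      rw [hx]
      exact (f (a n)).property hmn)

/-- The continuous extension of a bilinear map to the completions. -/
def cbilin (B : M →ₗ[b] N →ₗ[b] P) (x : AdicCompletion I M) :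
    AdicCompletion I N →ₗ[b] AdicCompletion I P :=
  cext I ((LinearMap.applyₗ x) ∘ₗ cmap I ∘ₗ B.flip)

/-- The multiplication of the completion of an algebra. -/
def cmul {A : Type*} [Ring A] [Algebra b A] (x y : AdicCompletion I A) : AdicCompletion I A :=
  cbilin I (LinearMap.mul b A) x y

end Completion

/-! ## Ribbon Hopf algebras -/

section Hopf

variable {b H : Type*} [CommRing b] (I : Ideal b) [Ring H] [Algebra b H]

/-- `Δ ⊗ 1` on the completed tensor square, for `Δ` with values in the completed square. -/
def comulLeft (Δ : H →ₗ[b] AdicCompletion I (H ⊗[b] H)) :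
    AdicCompletion I (H ⊗[b] H) →ₗ[b] AdicCompletion I (H ⊗[b] (H ⊗[b] H)) :=
  cext I (TensorProduct.lift (LinearMap.flip
    { toFun := fun y => cmap I ((TensorProduct.assoc b H H H).toLinearMap ∘ₗ
        (TensorProduct.mk b (H ⊗[b] H) H).flip y) ∘ₗ Δ
      map_add' := by
        intro x y
        simp [LinearMap.comp_add, LinearMap.add_comp]
      map_smul' := by
        intro r x
        simp [LinearMap.comp_smul, LinearMap.smul_comp] }))

/-- `1 ⊗ Δ` on the completed tensor square, for `Δ` with values in the completed square. -/
def comulRight (Δ : H →ₗ[b] AdicCompletion I (H ⊗[b] H)) :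
    AdicCompletion I (H ⊗[b] H) →ₗ[b] AdicCompletion I (H ⊗[b] (H ⊗[b] H)) :=
  cext I (TensorProduct.lift
    { toFun := fun x => cmap I (TensorProduct.mk b H (H ⊗[b] H) x) ∘ₗ Δ
      map_add' := by
        intro x y
        simp [LinearMap.add_comp]
      map_smul' := by
        intro r x
        simp [LinearMap.smul_comp] })

/-- Interchange of the two factors of the completed tensor square. -/
def cswap : AdicCompletion I (H ⊗[b] H) →ₗ[b] AdicCompletion I (H ⊗[b] H) :=
  cmap I (TensorProduct.comm b H H).toLinearMap

/-- `s ⊗ t ↦ s ⊗ t ⊗ 1`. -/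
def leg12 : AdicCompletion I (H ⊗[b] H) →ₗ[b] AdicCompletion I (H ⊗[b] (H ⊗[b] H)) :=
  cmap I ((TensorProduct.assoc b H H H).toLinearMap ∘ₗ
    (TensorProduct.mk b (H ⊗[b] H) H).flip 1)

/-- `s ⊗ t ↦ s ⊗ 1 ⊗ t`. -/
def leg13 : AdicCompletion I (H ⊗[b] H) →ₗ[b] AdicCompletion I (H ⊗[b] (H ⊗[b] H)) :=
  cmap I (TensorProduct.map LinearMap.id (TensorProduct.mk b H H 1))

/-- `s ⊗ t ↦ 1 ⊗ s ⊗ t`. -/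
def leg23 : AdicCompletion I (H ⊗[b] H) →ₗ[b] AdicCompletion I (H ⊗[b] (H ⊗[b] H)) :=
  cmap I (TensorProduct.mk b H (H ⊗[b] H) 1)

/-- A ribbon Hopf algebra structure on an algebra `H`.  The comultiplication and the universal
`R`-matrix take values in the `I`-adically completed tensor square. -/
structure RibbonHopfAlgebra {b : Type*} [CommRing b] (I : Ideal b) (H : Type*) [Ring H]
    [Algebra b H] where
  /-- comultiplication -/
  comul : H →ₗ[b] AdicCompletion I (H ⊗[b] H)
  /-- counit -/
  counit : H →ₐ[b] b
  /-- antipode -/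
  antipode : H →ₗ[b] H
  comul_one : comul 1 = AdicCompletion.of I (H ⊗[b] H) 1
  comul_mul : ∀ x y, comul (x * y) = cmul I (comul x) (comul y)
  coassoc : ∀ x, comulLeft I comul (comul x) = comulRight I comul (comul x)
  counit_comul : ∀ x, cmap I ((TensorProduct.lid b H).toLinearMap ∘ₗ
    TensorProduct.map counit.toLinearMap LinearMap.id) (comul x) = AdicCompletion.of I H x
  comul_counit : ∀ x, cmap I ((TensorProduct.rid b H).toLinearMap ∘ₗ
    TensorProduct.map LinearMap.id counit.toLinearMap) (comul x) = AdicCompletion.of I H x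
  antipode_mul : ∀ x, cmap I (LinearMap.mul' b H ∘ₗ
    TensorProduct.map antipode LinearMap.id) (comul x) =
      AdicCompletion.of I H (algebraMap b H (counit x))
  mul_antipode : ∀ x, cmap I (LinearMap.mul' b H ∘ₗ
    TensorProduct.map LinearMap.id antipode) (comul x) =
      AdicCompletion.of I H (algebraMap b H (counit x))
  /-- the universal `R`-matrix `s ⊗ t` -/
  R : AdicCompletion I (H ⊗[b] H)
  /-- its inverse -/
  Rinv : AdicCompletion I (H ⊗[b] H)
  R_mul_Rinv : cmul I R Rinv = AdicCompletion.of I (H ⊗[b] H) 1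
  Rinv_mul_R : cmul I Rinv R = AdicCompletion.of I (H ⊗[b] H) 1
  R_comul : ∀ x, cmul I R (comul x) = cmul I (cswap I (comul x)) R
  comulLeft_R : comulLeft I comul R = cmul I (leg13 I R) (leg23 I R)
  comulRight_R : comulRight I comul R = cmul I (leg13 I R) (leg12 I R)
  /-- the ribbon element -/
  θ : Hˣ
  θ_central : ∀ x : H, θ * x = x * θ
  comul_θ : cmul I (cmul I (cswap I R) R) (comul θ) =
    AdicCompletion.of I (H ⊗[b] H) ((θ : H) ⊗ₜ[b] (θ : H))
  counit_θ : counit θ = 1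
  antipode_θ : antipode θ = θ

variable {I} in
/-- The charmed element `k = θ⁻¹ S(t) s`. -/
def RibbonHopfAlgebra.charm [IsAdicComplete I H] (𝓗 : RibbonHopfAlgebra I H) : H :=
  (↑𝓗.θ⁻¹ : H) * (AdicCompletion.ofLinearEquiv I H).symm
    (cmap I (LinearMap.mul' b H ∘ₗ TensorProduct.map 𝓗.antipode LinearMap.id ∘ₗ
      (TensorProduct.comm b H H).toLinearMap) 𝓗.R)

variable {I} in
/-- The inverse `k⁻¹ = S(k)` of the charmed element. -/
def RibbonHopfAlgebra.charmInv [IsAdicComplete I H] (𝓗 : RibbonHopfAlgebra I H) : H :=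
  𝓗.antipode 𝓗.charm

variable (b H) in
/-- The trace function `x ↦ tr_V(x)` of an `H`-module `V`. -/
def character (V : Type*) [AddCommGroup V] [Module b V] [Module H V] [IsScalarTower b H V] :
    H →ₗ[b] b :=
  LinearMap.trace b V ∘ₗ (Algebra.lsmul b b V : H →ₐ[b] Module.End b V).toLinearMap

end Hopf

/-! ## Connections and the elementary operators on them -/

section Connections

variable {b H : Type*} [CommRing b] (I : Ideal b) [Ring H] [Algebra b H]

variable (b H) in
/-- The tensor power of `H` with one factor for each element of `X`. -/
abbrev Conn (X : Type*) : Type _ := ⨂[b] _ : X, H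

/-- Connections on a lattice with set of oriented edges `X`: the completed tensor power of `H`. -/
abbrev CConn {b : Type*} [CommRing b] (I : Ideal b) (H : Type*) [Ring H] [Algebra b H]
    (X : Type*) : Type _ :=
  AdicCompletion I (Conn b H X)

variable (b) in
/-- `a ↦` the element of a tensor power with `a` in the factor `p` and `1` in all the others. -/
def single {X : Type*} [DecidableEq X] (p : X) : H →ₗ[b] Conn b H X :=
  (PiTensorProduct.singleAlgHom (R := b) (A := fun _ : X => H) p).toLinearMap

theorem extend_update_one {X Y : Type*} [DecidableEq X] [DecidableEq Y] (f : X ↪ Y) (x : X → H)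
    (i : X) (a : H) : Function.extend f (Function.update x i a) (fun _ => (1 : H)) =
      Function.update (Function.extend f x (fun _ => (1 : H))) (f i) a := by
  funext y
  by_cases hy : ∃ z, f z = y
  · obtain ⟨z, rfl⟩ := hy
    rw [f.injective.extend_apply]
    by_cases hz : z = i
    · subst hz
      simp
    · rw [Function.update_of_ne hz, Function.update_of_ne (fun h => hz (f.injective h)),
        f.injective.extend_apply]
  · rw [Function.extend_apply' _ _ _ hy, Function.update_of_ne
      (fun h => hy ⟨i, h.symm⟩), Function.extend_apply' _ _ _ hy]

variable (b H) in
/-- Enlarging the set of factors along an injection; the new factors contain `1`. -/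
def enlarge {X Y : Type*} (f : X ↪ Y) : Conn b H X →ₗ[b] Conn b H Y :=
  PiTensorProduct.lift
    { toFun := fun x => PiTensorProduct.tprod b (Function.extend f x (fun _ => (1 : H)))
      map_update_add' := by
        classical
        intro _ x i a c
        simp only [extend_update_one]
        exact (PiTensorProduct.tprod b).map_update_add _ _ _ _
      map_update_smul' := by
        classical
        intro _ x i r c
        simp only [extend_update_one]
        exact (PiTensorProduct.tprod b).map_update_smul _ _ _ _ }

/-- A factor `p` is taken out of the tensor power and fed to `φ`; the value of `φ` multiplies
the remaining factors: `x_p ⊗ y ↦ φ(x_p) y`. -/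
def absorb {X : Type*} [DecidableEq X] (p : X) (φ : H →ₗ[b] Conn b H ({p}ᶜ : Set X)) :
    Conn b H X →ₗ[b] Conn b H ({p}ᶜ : Set X) :=
  TensorProduct.lift ((LinearMap.mul b (Conn b H ({p}ᶜ : Set X)) ∘ₗ φ).flip) ∘ₗ
    (PiTensorProduct.equivPiTensorComplSingletonTensor b (fun _ : X => H) p).toLinearMap

/-- The action of `a ∈ H` at an end of an edge `p`: left multiplication by `a` in the factor `p` at
the initial end `(p, true)`, right multiplication by `S(a)` at the terminal end `(p, false)`. -/
def endAct {X : Type*} [DecidableEq X] (S : H →ₗ[b] H) (z : X × Bool) :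
    H →ₗ[b] Module.End b (Conn b H X) :=
  if z.2 then LinearMap.mul b (Conn b H X) ∘ₗ single b z.1
  else (LinearMap.mul b (Conn b H X)).flip ∘ₗ single b z.1 ∘ₗ S

variable {I}

namespace RibbonHopfAlgebra

variable (𝓗 : RibbonHopfAlgebra I H)

/-- The operator of a crossing of two adjacent strands, `l` on the left and `r` on the right (below
the crossing).  If `l` passes over, it is the action of `R = s ⊗ t`, with `s` acting on `l` and
`t` on `r`; if `r` passes over, it is the action of `R⁻¹ = S(s) ⊗ t`, with `S(s)` acting on `r` and
`t` on `l`. -/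
def crossing {X : Type*} [DecidableEq X] (leftOver : Bool) (l r : X × Bool) :
    CConn I H X →ₗ[b] CConn I H X :=
  cbilin I (TensorProduct.lift
    (if leftOver then
      (LinearMap.mul b (Module.End b (Conn b H X))).compl₁₂
        (endAct 𝓗.antipode l) (endAct 𝓗.antipode r)
    else
      (LinearMap.mul b (Module.End b (Conn b H X))).compl₁₂
        (endAct 𝓗.antipode r ∘ₗ 𝓗.antipode) (endAct 𝓗.antipode l))) 𝓗.R

/-- The iterated comultiplication `Δ^{m-1}` with values in the `m`-th tensor power; it is the counit
for `m = 0` and the identity for `m = 1`. -/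
def iterComul : (m : ℕ) → H →ₗ[b] CConn I H (Fin m)
  | 0 => AdicCompletion.of I _ ∘ₗ Algebra.linearMap b _ ∘ₗ 𝓗.counit.toLinearMap
  | m + 1 => cext I (TensorProduct.lift
      { toFun := fun a => cmap I (LinearMap.mul b (Conn b H (Fin (m + 1))) (single b 0 a) ∘ₗ
          enlarge b H (Fin.succEmb m)) ∘ₗ iterComul m
        map_add' := by
          intro x y
          simp [LinearMap.add_comp]
        map_smul' := by
          intro r x
          simp [LinearMap.smul_comp] }) ∘ₗ 𝓗.comul

/-- The factor `p` is replaced by `1` and `Δ^{m-1}` of it is distributed over the factors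
`f 0, …, f (m - 1)`, where it multiplies the previous content. -/
def spread {X : Type*} [DecidableEq X] (p : X) {m : ℕ} (f : Fin m ↪ X) :
    CConn I H X →ₗ[b] CConn I H X :=
  cext I (TensorProduct.lift
    { toFun := fun y => cmap I ((LinearMap.mul b (Conn b H X)).flip
        (enlarge b H (Function.Embedding.subtype (· ∈ ({p}ᶜ : Set X))) y) ∘ₗ enlarge b H f) ∘ₗ
          𝓗.iterComul m
      map_add' := by
        intro x y
        simp [LinearMap.add_comp]
      map_smul' := by
        intro r x
        simp [LinearMap.smul_comp] } ∘ₗ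
    (PiTensorProduct.equivPiTensorComplSingletonTensor b (fun _ : X => H) p).toLinearMap)

/-- The operator of the triads and stumps that replace each edge `e` by `m e` parallel edges
`(e, 0), …, (e, m e - 1)`: it is `Δ^{m e - 1}` in the factor of `e`. -/
def expand {O : Type*} [Fintype O] [DecidableEq O] (m : O → ℕ) :
    CConn I H O →ₗ[b] CConn I H (Σ e : O, Fin (m e)) :=
  cmap I ((TensorProduct.lid b _).toLinearMap ∘ₗ
      TensorProduct.map ((PiTensorProduct.constantBaseRingEquiv O b).toLinearMap ∘ₗ
        PiTensorProduct.map (fun _ => 𝓗.counit.toLinearMap)) LinearMap.id ∘ₗ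
      (PiTensorProduct.tmulEquiv b H).symm.toLinearMap) ∘ₗ
    ((Finset.univ : Finset O).toList.map fun e =>
      𝓗.spread (X := O ⊕ Σ e : O, Fin (m e)) (Sum.inl e)
        ((Function.Embedding.sigmaMk (β := fun e : O => Fin (m e)) e).trans
          Function.Embedding.inr)).prod ∘ₗ
    cmap I (enlarge b H Function.Embedding.inl)

/-- The operator of switches on the edges `p` with `dir p = false`: `x ↦ S(x k)` in their
factors. -/
def switches [IsAdicComplete I H] {X : Type*} (dir : X → Bool) : CConn I H X →ₗ[b] CConn I H X :=
  cmap I (PiTensorProduct.map fun p =>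
    if dir p then LinearMap.id else 𝓗.antipode ∘ₗ (LinearMap.mul b H).flip 𝓗.charm)

/-- The operator of a cup: a new factor, which contains `1` if the left end of the cup is the
initial end of the new edge, and `k⁻¹` otherwise. -/
def cup [IsAdicComplete I H] {X : Type*} [DecidableEq X] (d : Bool) :
    CConn I H X →ₗ[b] CConn I H (Option X) :=
  cmap I (LinearMap.mul b (Conn b H (Option X))
      (single b none (if d then 1 else 𝓗.charmInv)) ∘ₗ
    enlarge b H Function.Embedding.some)

/-- The operator of a cap that joins the two ends of one edge `p`, and of the trace function `χ`:
`x_p ↦ χ(x_p)` if the left end of the cap is the terminal end of `p`, and `x_p ↦ χ(x_p k)`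
otherwise. -/
def capTrace [IsAdicComplete I H] {X : Type*} [DecidableEq X] (p : X) (χ : H →ₗ[b] b)
    (leftTerminal : Bool) : CConn I H X →ₗ[b] CConn I H ({p}ᶜ : Set X) :=
  cmap I (absorb p (Algebra.linearMap b _ ∘ₗ χ ∘ₗ
    (LinearMap.mul b H).flip (if leftTerminal then 1 else 𝓗.charm)))

/-- The operator of a cap that joins the terminal end of `p` to the initial end of `q ≠ p`.  The
new edge keeps the name `q`; its factor is `x_p x_q` if the end of `p` is the left one, and
`x_p k x_q` otherwise. -/
def capJoin [IsAdicComplete I H] {X : Type*} [DecidableEq X] (p q : X) (h : q ≠ p)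
    (leftTerminal : Bool) : CConn I H X →ₗ[b] CConn I H ({p}ᶜ : Set X) :=
  cmap I (absorb p (single b (⟨q, h⟩ : ({p}ᶜ : Set X)) ∘ₗ
    (LinearMap.mul b H).flip (if leftTerminal then 1 else 𝓗.charm)))

end RibbonHopfAlgebra

end Connections

/-! ## Lattices and diagrams -/

/-- A finite lattice (oriented ciliated graph) with set of oriented edges `O` and set of vertices
`V`.  The edge set is `O × Bool`: `(e, true)` stands for `e` and `(e, false)` for `-e`. -/
structure Lattice (O V : Type*) where
  /-- the initial vertex of an edge; the terminal vertex of `e` is the initial vertex of `-e` -/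
  vert : O × Bool → V
  /-- the ciliation: the linearly ordered edges that start at a vertex -/
  star : V → List (O × Bool)
  nodup : ∀ v, (star v).Nodup
  mem_star : ∀ x v, x ∈ star v ↔ vert x = v

/-- If every edge `e ∈ O` is replaced by a list of parallel strands (from left to right as seen at
the initial vertex of `e`), the list of strand ends at each vertex, in ciliation order.  A strand
`(a, d)` has a label `a`, and `d = true` if it is directed like `e`.  A strand end `(a, d)` has
`d = true` if it is the initial end of the strand, that is, if in the upper half plane model of the
vertex with the cilium at infinity it is directed downwards. -/
def Lattice.ends {O V α : Type*} (Γ : Lattice O V) (s : O → List (α × Bool)) (v : V) :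
    List (α × Bool) :=
  (Γ.star v).flatMap fun x =>
    if x.2 then s x.1 else ((s x.1).map fun y => (y.1, !y.2)).reverse

/-- The number of strand ends at the vertex of the edge `x` that precede those in `x`. -/
def Lattice.offset {O V α : Type*} [DecidableEq O] (Γ : Lattice O V)
    (s : O → List (α × Bool)) (x : O × Bool) : ℕ :=
  (((Γ.star (Γ.vert x)).takeWhile (fun y => decide (y ≠ x))).map fun y => (s y.1).length).sum

/-- The elementary pieces of a tangle diagram in the vertices (upper half planes, read from the
bottom up).  Positions count strands from the left, starting with `0`. -/
inductive Event (V C : Type*) where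
  /-- a crossing of the strands at positions `i`, `i + 1` of the vertex `v` -/
  | cross (v : V) (i : ℕ) (leftOver : Bool)
  /-- a local maximum that joins the strands at positions `i`, `i + 1` of the vertex `v` -/
  | cap (v : V) (i : ℕ)
  /-- a local minimum of colour `c` whose ends take the positions `i`, `i + 1` of the vertex `v`;
  its left end is directed downwards if `d = true` -/
  | cup (v : V) (i : ℕ) (c : C) (d : Bool)

namespace Event

variable {V C : Type*}

/-- The vertex of an event. -/
def vertex : Event V C → V
  | cross v _ _ => v
  | cap v _ => v
  | cup v _ _ _ => v

/-- The position of an event. -/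
def pos : Event V C → ℕ
  | cross _ i _ => i
  | cap _ i => i
  | cup _ i _ _ => i

/-- The same event at another position. -/
def moveTo : Event V C → ℕ → Event V C
  | cross v _ o, j => cross v j o
  | cap v _, j => cap v j
  | cup v _ c d, j => cup v j c d

/-- The number of strands that enter an event from below. -/
def inWidth : Event V C → ℕ
  | cross _ _ _ => 2
  | cap _ _ => 2
  | cup _ _ _ _ => 0

/-- The number of strands that leave an event at the top. -/
def outWidth : Event V C → ℕ
  | cross _ _ _ => 2
  | cap _ _ => 0
  | cup _ _ _ _ => 2

/-- Change of colours. -/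
def recolor {D : Type*} (f : C → D) : Event V C → Event V D
  | cross v i o => cross v i o
  | cap v i => cap v i
  | cup v i c d => cup v i (f c) d

/-- Whether an event can take place when `st` lists the coloured, directed strands at each vertex:
caps join strands of the same colour with consistent directions. -/
def Admissible (st : V → List (C × Bool)) : Event V C → Prop
  | cross v i _ => i + 1 < (st v).length
  | cap v i => ∃ c d, (st v)[i]? = some (c, d) ∧ (st v)[i + 1]? = some (c, !d)
  | cup v i _ _ => i ≤ (st v).length

/-- The strands after an event. -/
def after [DecidableEq V] (st : V → List (C × Bool)) : Event V C → V → List (C × Bool)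
  | cross v i _ => Function.update st v <|
      match (st v).drop i with
      | l :: r :: tl => (st v).take i ++ r :: l :: tl
      | _ => st v
  | cap v i => Function.update st v ((st v).take i ++ (st v).drop (i + 2))
  | cup v i c d => Function.update st v ((st v).take i ++ (c, d) :: (c, !d) :: (st v).drop i)

end Event

/-- A coloured tangle diagram in the envelope of a lattice.  In the band of each edge `e` it consists
of finitely many coloured directed strands parallel to the core, listed as in `Lattice.ends`; in the
vertices it is a sequence of crossings, caps and cups, listed by increasing height. -/
structure Diagram (O V C : Type*) where
  /-- the strands in the bands -/
  strands : O → List (C × Bool)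
  /-- the events in the vertices -/
  events : List (Event V C)

namespace Diagram

variable {O V C : Type*} [DecidableEq V]

/-- All events can take place, and no strand is left over at the end. -/
def Closes : (V → List (C × Bool)) → List (Event V C) → Prop
  | st, [] => ∀ v, st v = []
  | st, e :: es => e.Admissible st ∧ Closes (e.after st) es

/-- The diagram is that of a base point free q-tangle without arc components. -/
def IsLink (Γ : Lattice O V) (L : Diagram O V C) : Prop :=
  Closes (Γ.ends L.strands) L.events

/-! ### Equivalence -/

/-- The local moves inside the vertices. -/
inductive LocalMove : List (Event V C) → List (Event V C) → Prop
  /-- events in different vertices can change their heights -/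
  | far_vertices (x y : Event V C) (h : x.vertex ≠ y.vertex) : LocalMove [x, y] [y, x]
  /-- events on disjoint sets of strands can change their heights -/
  | far (x y : Event V C) (j : ℕ) (h : x.vertex = y.vertex)
      (hj : x.pos ≤ j) :
      LocalMove [x, y.moveTo (j + x.outWidth)] [y.moveTo (j + x.inWidth), x]
  /-- straightening of a strand -/
  | zigzag_left (v : V) (i : ℕ) (c : C) (d : Bool) :
      LocalMove [.cup v (i + 1) c d, .cap v i] []
  | zigzag_right (v : V) (i : ℕ) (c : C) (d : Bool) :
      LocalMove [.cup v i c d, .cap v (i + 1)] []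
  /-- a strand slides over or under a local maximum -/
  | cross_cap (v : V) (i : ℕ) (o : Bool) :
      LocalMove [.cross v i o, .cap v (i + 1)] [.cross v (i + 1) (!o), .cap v i]
  /-- a strand slides over or under a local minimum -/
  | cup_cross (v : V) (i : ℕ) (c : C) (d o : Bool) :
      LocalMove [.cup v i c d, .cross v (i + 1) o] [.cup v (i + 1) c d, .cross v i (!o)]
  /-- second Reidemeister move -/
  | reidemeister₂ (v : V) (i : ℕ) (o : Bool) :
      LocalMove [.cross v i o, .cross v i (!o)] []
  /-- third Reidemeister move, for three strands that lie above one another in some order -/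
  | reidemeister₃ (v : V) (i : ℕ) (o₁ o₂ o₃ : Bool) (h : o₁ = o₃ → o₂ = o₁) :
      LocalMove [.cross v i o₁, .cross v (i + 1) o₂, .cross v i o₃]
        [.cross v (i + 1) o₃, .cross v i o₂, .cross v (i + 1) o₁]
  /-- framing equivalence: a kink can be moved to the other side of a strand -/
  | framing (v : V) (i : ℕ) (c : C) (d o : Bool) :
      LocalMove [.cup v (i + 1) c d, .cross v i o, .cap v (i + 1)]
        [.cup v i c (!d), .cross v (i + 1) o, .cap v i]

/-- The moves that generate the equivalence of diagrams: those inside the vertices, and the slides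
of a crossing or of a local extremum from one end of a band to the other. -/
inductive Move [DecidableEq O] (Γ : Lattice O V) : Diagram O V C → Diagram O V C → Prop
  | inside (s : O → List (C × Bool)) (A B P Q : List (Event V C)) (h : LocalMove P Q) :
      Move Γ ⟨s, A ++ P ++ B⟩ ⟨s, A ++ Q ++ B⟩
  | slide_cross (s s' : O → List (C × Bool)) (e : O) (l₁ l₂ : List (C × Bool)) (x y : C × Bool)
      (o : Bool) (es : List (Event V C)) (hs : s e = l₁ ++ x :: y :: l₂)
      (hs' : s' = Function.update s e (l₁ ++ y :: x :: l₂)) :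
      Move Γ ⟨s, .cross (Γ.vert (e, true)) (Γ.offset s (e, true) + l₁.length) o :: es⟩
        ⟨s', .cross (Γ.vert (e, false)) (Γ.offset s' (e, false) + l₂.length) o :: es⟩
  | slide_to_initial (s s' : O → List (C × Bool)) (e : O) (l₁ l₂ : List (C × Bool)) (c : C)
      (d : Bool) (es : List (Event V C)) (hs : s e = l₁ ++ (c, d) :: (c, !d) :: l₂)
      (hs' : s' = Function.update s e (l₁ ++ l₂)) :
      Move Γ ⟨s, .cap (Γ.vert (e, false)) (Γ.offset s (e, false) + l₂.length) :: es⟩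
        ⟨s', .cup (Γ.vert (e, true)) (Γ.offset s' (e, true) + l₁.length) c d :: es⟩
  | slide_to_terminal (s s' : O → List (C × Bool)) (e : O) (l₁ l₂ : List (C × Bool)) (c : C)
      (d : Bool) (es : List (Event V C)) (hs : s e = l₁ ++ (c, d) :: (c, !d) :: l₂)
      (hs' : s' = Function.update s e (l₁ ++ l₂)) :
      Move Γ ⟨s, .cap (Γ.vert (e, true)) (Γ.offset s (e, true) + l₁.length) :: es⟩
        ⟨s', .cup (Γ.vert (e, false)) (Γ.offset s' (e, false) + l₂.length) c d :: es⟩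

/-- Equivalence of base point free q-tangles without arc components, on diagrams: isotopy in the
envelope, Reidemeister moves of type II and III, and framing equivalence. -/
def Equivalent [DecidableEq O] (Γ : Lattice O V) : Diagram O V C → Diagram O V C → Prop :=
  Relation.EqvGen fun L L' => L.IsLink Γ ∧ L'.IsLink Γ ∧ Move Γ L L'

/-! ### Superposition -/

/-- Change of colours. -/
def recolor {D : Type*} (f : C → D) (L : Diagram O V C) : Diagram O V D where
  strands e := (L.strands e).map fun x => (f x.1, x.2)
  events := L.events.map (Event.recolor f)

/-- The events of a diagram coloured by `C × Bool` that belong to the layer `a`, with the positions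
that they have when all strands of the other layer are deleted. -/
def layerEvents (a : Bool) : (V → List ((C × Bool) × Bool)) → List (Event V (C × Bool)) →
    List (Event V C)
  | _, [] => []
  | st, .cross v i o :: es =>
      (match (st v).drop i with
      | ((_, a₁), _) :: ((_, a₂), _) :: _ =>
          if a₁ = a ∧ a₂ = a then [.cross v (((st v).take i).countP fun x => x.1.2 == a) o] else []
      | _ => []) ++ layerEvents a ((Event.cross v i o).after st) es
  | st, .cap v i :: es =>
      (match (st v).drop i with
      | ((_, a₁), _) :: _ =>
          if a₁ = a then [.cap v (((st v).take i).countP fun x => x.1.2 == a)] else []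
      | _ => []) ++ layerEvents a ((Event.cap v i).after st) es
  | st, .cup v i c d :: es =>
      (if c.2 = a then [.cup v (((st v).take i).countP fun x => x.1.2 == a) c.1 d] else []) ++
        layerEvents a ((Event.cup v i c d).after st) es

/-- The sub-diagram formed by the components in the layer `a` of a diagram coloured by
`C × Bool`. -/
def layer (Γ : Lattice O V) (a : Bool) (M : Diagram O V (C × Bool)) : Diagram O V C where
  strands e := ((M.strands e).filter fun x => x.1.2 == a).map fun x => (x.1.1, x.2)
  events := layerEvents a (Γ.ends M.strands) M.events

/-- At every crossing of the two layers, the layer `true` passes over the layer `false`. -/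
def LayeredFrom : (V → List ((C × Bool) × Bool)) → List (Event V (C × Bool)) → Prop
  | _, [] => True
  | st, e :: es =>
      (match e with
      | .cross v i o => ∀ x y, (st v)[i]? = some x → (st v)[i + 1]? = some y →
          x.1.2 ≠ y.1.2 → o = x.1.2
      | _ => True) ∧ LayeredFrom (e.after st) es

/-- `N` represents the superposition `L ⋆ L'`: it is equivalent to a diagram whose components fall
into two layers, a lower one equivalent to `L` and an upper one equivalent to `L'`, such that the
upper layer passes over the lower one at each of their crossings. -/
def IsSuperposition [DecidableEq O] (Γ : Lattice O V) (L L' N : Diagram O V C) : Prop :=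
  ∃ M : Diagram O V (C × Bool), M.IsLink Γ ∧ LayeredFrom (Γ.ends M.strands) M.events ∧
    Equivalent Γ (M.layer Γ false) L ∧ Equivalent Γ (M.layer Γ true) L' ∧
    Equivalent Γ (M.recolor Prod.fst) N

end Diagram

/-! ## Wilson links and the product of observables -/

section Wilson

variable {b H : Type*} [CommRing b] {I : Ideal b} [IsAdicComplete I b] [Ring H] [Algebra b H]
  [IsAdicComplete I H] {O : Type u} {V C : Type*} [Fintype O] [DecidableEq O] [DecidableEq V]

namespace RibbonHopfAlgebra

variable (𝓗 : RibbonHopfAlgebra I H)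

open Classical in
/-- The operator of a sequence of events, by composition of the operators of its members.  `X` is the
set of current edges, `col` gives their colours, `st` lists the ends of these edges at the vertices,
`χ c` is the trace in the module of colour `c`.  (The value is `0` if the events do not fit.) -/
def evalEvents (χ : C → H →ₗ[b] b) : List (Event V C) → ∀ (X : Type u) [DecidableEq X],
    (X → C) → (V → List (X × Bool)) → CConn I H X →ₗ[b] b
  | [], X, _, _, _ =>
      if _ : IsEmpty X then
        (AdicCompletion.ofLinearEquiv I b).symm.toLinearMap ∘ₗ
          cmap I (PiTensorProduct.isEmptyEquiv X).toLinearMap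
      else 0
  | .cross v i o :: es, X, _, col, st =>
      match (st v).drop i with
      | l :: r :: tl =>
          evalEvents χ es X col (Function.update st v ((st v).take i ++ r :: l :: tl)) ∘ₗ
            𝓗.crossing o l r
      | _ => 0
  | .cup v i c d :: es, X, _, col, st =>
      evalEvents χ es (Option X) (fun x => x.elim c col)
        (Function.update (fun w => (st w).map fun y => (some y.1, y.2)) v
          (((st v).take i).map (fun y => (some y.1, y.2)) ++ (none, d) :: (none, !d) ::
            ((st v).drop i).map fun y => (some y.1, y.2))) ∘ₗ 𝓗.cup d
  | .cap v i :: es, X, _, col, st =>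
      let st' : V → List (X × Bool) :=
        Function.update st v ((st v).take i ++ (st v).drop (i + 2))
      -- the terminal end of `p` is joined to the initial end of `q`
      let join (p q : X) (leftTerminal : Bool) : CConn I H X →ₗ[b] b :=
        if h : q = p then
          evalEvents χ es ({p}ᶜ : Set X) (fun x => col x)
            (fun w => (st' w).filterMap fun y =>
              if hy : y.1 = p then none else some (⟨y.1, hy⟩, y.2)) ∘ₗ
            𝓗.capTrace p (χ (col p)) leftTerminal
        else
          evalEvents χ es ({p}ᶜ : Set X) (fun x => col x)
            (fun w => (st' w).map fun y =>
              (if hy : y.1 = p then ⟨q, h⟩ else ⟨y.1, hy⟩, y.2)) ∘ₗ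
            𝓗.capJoin p q h leftTerminal
      match (st v).drop i with
      | (p, false) :: (q, true) :: _ => join p q true
      | (q, true) :: (p, false) :: _ => join p q false
      | _ => 0

/-- The Wilson link `W_L` of a coloured diagram: the strands in the bands are created by triads,
stumps and switches, then the events in the vertices are evaluated. -/
def wilson (Γ : Lattice O V) (χ : C → H →ₗ[b] b) (L : Diagram O V C) : CConn I H O →ₗ[b] b :=
  𝓗.evalEvents χ L.events (Σ e : O, Fin (L.strands e).length)
      (fun x => ((L.strands x.1).get x.2).1)
      (Γ.ends fun e => List.ofFn fun j : Fin (L.strands e).length =>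
        ((⟨e, j⟩ : Σ e : O, Fin (L.strands e).length), ((L.strands e).get j).2)) ∘ₗ
    𝓗.switches (fun x => ((L.strands x.1).get x.2).2) ∘ₗ
    𝓗.expand (fun e => (L.strands e).length)

/-- The strand end `a` passes over the strand ends in a list, from left to right. -/
def crossPast {X : Type*} [DecidableEq X] (a : X × Bool) :
    List (X × Bool) → CConn I H X →ₗ[b] CConn I H X
  | [] => LinearMap.id
  | y :: l => crossPast a l ∘ₗ 𝓗.crossing true a y

/-- The strand ends at a vertex that satisfy `prime` are moved to the left of the others, which cross
over. -/
def separate {X : Type*} [DecidableEq X] (prime : X → Bool) :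
    List (X × Bool) → CConn I H X →ₗ[b] CConn I H X
  | [] => LinearMap.id
  | a :: l =>
      if prime a.1 then separate prime l
      else 𝓗.crossPast a (l.filter fun y => prime y.1) ∘ₗ separate prime l

/-- The comultiplication `∇` of connections.  A triad is applied to each edge `e`, with branches
`(e, 0)` (the prime copy) and `(e, 1)` (the double prime copy), and at each vertex the prime strands
are moved to the left of the double prime strands, which cross over. -/
def nabla [Fintype V] (Γ : Lattice O V) : CConn I H O →ₗ[b] CConn I H (Σ _ : O, Fin 2) :=
  ((Finset.univ : Finset V).toList.map fun v =>
    𝓗.separate (X := Σ _ : O, Fin 2) (fun x => x.2 == 0)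
      (Γ.ends (fun e => [(⟨e, 0⟩, true), (⟨e, 1⟩, true)]) v)).prod ∘ₗ
    𝓗.expand (fun _ => 2)

end RibbonHopfAlgebra

/-- The prime and the double prime copy of a set of edges. -/
def copies (O : Type*) : (Σ _ : O, Fin 2) ≃ O ⊕ O where
  toFun x := if x.2 = 0 then Sum.inl x.1 else Sum.inr x.1
  invFun := Sum.elim (fun e => ⟨e, 0⟩) (fun e => ⟨e, 1⟩)
  left_inv := by
    rintro ⟨e, i⟩
    fin_cases i <;> simp
  right_inv := by
    rintro (e | e) <;> simp

/-- `f ⊗ g` on pairs of connections: `f` is evaluated on the prime copy, `g` on the double prime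
copy, and the values are multiplied. -/
def tensorFunctional (f g : CConn I H O →ₗ[b] b) : CConn I H (Σ _ : O, Fin 2) →ₗ[b] b :=
  (AdicCompletion.ofLinearEquiv I b).symm.toLinearMap ∘ₗ
    cmap I (LinearMap.mul' b b ∘ₗ
      TensorProduct.map (f ∘ₗ AdicCompletion.of I _) (g ∘ₗ AdicCompletion.of I _) ∘ₗ
      (PiTensorProduct.tmulEquiv b H).symm.toLinearMap ∘ₗ
      (PiTensorProduct.reindex b (fun _ => H) (copies O)).toLinearMap)

/-- The product `(f ⋆ g)(x) = (f ⊗ g)(∇ x)` of functions of connections. -/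
def star [Fintype V] (𝓗 : RibbonHopfAlgebra I H) (Γ : Lattice O V) (f g : CConn I H O →ₗ[b] b) :
    CConn I H O →ₗ[b] b :=
  tensorFunctional f g ∘ₗ 𝓗.nabla Γ

end Wilson

end LGFT

end

set_option linter.unusedSimpArgs false
set_option linter.unusedSectionVars false

noncomputable section

namespace LGFT

/-! ## Continuous extension of linear maps into complete modules -/

section Integral

variable {b : Type*} [CommRing b] {I : Ideal b}
  {M N P Q : Type*} [AddCommGroup M] [Module b M] [AddCommGroup N] [Module b N]
  [AddCommGroup P] [Module b P] [AddCommGroup Q] [Module b Q]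

/-! All functionals in the statement are continuous for the I-adic topology (`IsCont`), so the
equation has to be checked only on pure tensors x = ⊗ x_e (`IsCont.ext_tprod`). Only finitely many
colours occur in the three diagrams. Bases of their modules and of the dual modules give a `Model`:
matrix coefficients, evaluations and coevaluations (with the charmed element k where the order
requires it), and crossing matrices, obtained by pairing matrix coefficients through the R-matrix.

On a pure tensor a Wilson link is a state sum (`Model.wilson_tprod`). Its variables are words of
basis vectors at the ends of the bands. The band of e contributes a matrix element of x_e on the
tensor product of the modules of its strands (`Model.cable`), and the vertices contribute the
composition of the matrices of crossings, caps and cups (`Model.value`). The identities of a ribbon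
Hopf algebra make these matrices invariant under the local moves (`Model.foldr_localMove`). Since
the matrices are H-linear, crossings and local extrema also slide through the bands
(`Model.cableSum_slide_cross` and its companions). Hence Wilson links are invariants of equivalence
(`Model.wilson_equivalent`).

By this invariance N may be replaced by a diagram M with a copy of L below and a copy of L' above.
Inserting cancelling pairs of crossings and sliding one crossing of each pair through a band, one
arranges that in every band the lower strands precede the upper ones
(`Diagram.IsLayered.exists_sorted`). Now Δ in a band turns the product of the two cables into the
cable of the concatenated strands, and the crossings in ∇ sort the strand ends at each vertex, upper
strands passing over lower ones (`Model.star_tprod`).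

It remains to see that the value of M is that of the two layers, multiplied together and preceded by
the sorting (`Model.value_layered`). This is an induction on the events of M. An event inside one
layer is H-linear, so it passes through the sorting crossings by naturality of the braiding. A
crossing of the two layers belongs to the sorting crossings or cancels one of them. When no strands
are left, there is nothing to sort. -/

theorem eval_cmap (f : M →ₗ[b] N) (z : AdicCompletion I M) (n : ℕ) (m : M)
    (h : AdicCompletion.eval I M n z = Submodule.Quotient.mk m) :
    AdicCompletion.eval I N n (cmap I f z) = Submodule.Quotient.mk (f m) := by
  have : AdicCompletion.eval I N n (cmap I f z) =
      f.reduceModIdeal (I ^ n) (AdicCompletion.eval I M n z) := rfl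
  rw [this, h]
  rfl

/-- `cext` is assembled from its reductions, so modulo I^n it depends only on an approximant `m` of
`z`. Identities between completed maps are proved by choosing such approximants for every `n`. -/
theorem eval_cext (f : M →ₗ[b] AdicCompletion I N) (z : AdicCompletion I M) (n : ℕ) (m : M)
    (h : AdicCompletion.eval I M n z = Submodule.Quotient.mk m) :
    AdicCompletion.eval I N n (cext I f z) = AdicCompletion.eval I N n (f m) := by
  have : AdicCompletion.eval I N n (cext I f z) = (Submodule.liftQ (I ^ n • ⊤ : Submodule b M)
      (AdicCompletion.eval I N n ∘ₗ f) (by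
        rw [Submodule.smul_le]
        intro r hr x _
        have h : r • f x ∈ (I ^ n • ⊤ : Submodule b (AdicCompletion I N)) :=
          Submodule.smul_mem_smul hr Submodule.mem_top
        have := AdicCompletion.pow_smul_top_le_ker_eval (I := I) (M := N) n h
        simpa using this)) (AdicCompletion.eval I M n z) := rfl
  rw [this, h]
  rfl

theorem exists_approx (z : AdicCompletion I M) (n : ℕ) :
    ∃ m : M, AdicCompletion.eval I M n z = Submodule.Quotient.mk m := by
  obtain ⟨m, hm⟩ := Submodule.Quotient.mk_surjective _ (AdicCompletion.eval I M n z)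
  exact ⟨m, hm.symm⟩

theorem eq_of_forall_sub_mem [IsHausdorff I P] {x y : P}
    (h : ∀ n, x - y ∈ (I ^ n • ⊤ : Submodule b P)) : x = y :=
  (IsHausdorff.eq_iff_smodEq (I := I)).mpr fun n => SModEq.sub_mem.mpr (h n)

theorem map_sub_mem (f : P →ₗ[b] Q) {x y : P} {n : ℕ} (h : x - y ∈ (I ^ n • ⊤ : Submodule b P)) :
    f x - f y ∈ (I ^ n • ⊤ : Submodule b Q) := by
  rw [← map_sub]
  have : f (x - y) ∈ (I ^ n • ⊤ : Submodule b P).map f := ⟨_, h, rfl⟩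
  rw [Submodule.map_smul''] at this
  exact Submodule.smul_mono le_rfl le_top this

variable (I) in
/-- The continuous extension of a linear map into a complete module. -/
def cint [IsAdicComplete I P] (f : M →ₗ[b] P) : AdicCompletion I M →ₗ[b] P :=
  (AdicCompletion.ofLinearEquiv I P).symm.toLinearMap ∘ₗ cmap I f

variable [IsAdicComplete I P]

/-- The basic estimate. The exchange rules below compare several estimates of this kind at common
approximants and conclude because the target is Hausdorff. -/
theorem cint_sub_mem (f : M →ₗ[b] P) {z : AdicCompletion I M} {n : ℕ} {m : M}
    (h : AdicCompletion.eval I M n z = Submodule.Quotient.mk m) :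
    cint I f z - f m ∈ (I ^ n • ⊤ : Submodule b P) := by
  rw [← Submodule.Quotient.eq, ← eval_cmap f z n m h]
  have : cmap I f z = AdicCompletion.of I P (cint I f z) := by
    simp [cint]
  rw [this]
  rfl

theorem of_cint (f : M →ₗ[b] P) (z : AdicCompletion I M) :
    AdicCompletion.of I P (cint I f z) = cmap I f z := by
  simp [cint]

theorem eq_cint_of_of_eq {f : M →ₗ[b] P} {z : AdicCompletion I M} {p : P}
    (h : cmap I f z = AdicCompletion.of I P p) : cint I f z = p := by
  apply AdicCompletion.of_injective I P
  rw [of_cint, h]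

@[simp]
theorem cint_of (f : M →ₗ[b] P) (x : M) : cint I f (AdicCompletion.of I M x) = f x :=
  eq_cint_of_of_eq (AdicCompletion.map_of I f x)

theorem cint_add (f g : M →ₗ[b] P) : cint I (f + g) = cint I f + cint I g := by
  simp [cint, LinearMap.comp_add]

theorem cint_smul (r : b) (f : M →ₗ[b] P) : cint I (r • f) = r • cint I f := by
  simp [cint, LinearMap.comp_smul]

theorem comp_cint [IsAdicComplete I Q] (g : P →ₗ[b] Q) (f : M →ₗ[b] P) (z : AdicCompletion I M) :
    g (cint I f z) = cint I (g ∘ₗ f) z := by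
  refine eq_of_forall_sub_mem (I := I) fun n => ?_
  obtain ⟨m, hm⟩ := exists_approx z n
  have h1 := map_sub_mem g (cint_sub_mem f hm)
  have h2 := cint_sub_mem (g ∘ₗ f) hm
  simpa using sub_mem h1 h2

theorem cint_cmap (f : N →ₗ[b] P) (g : M →ₗ[b] N) (z : AdicCompletion I M) :
    cint I f (cmap I g z) = cint I (f ∘ₗ g) z := by
  refine eq_of_forall_sub_mem (I := I) fun n => ?_
  obtain ⟨m, hm⟩ := exists_approx z n
  have h1 := cint_sub_mem f (eval_cmap g z n m hm)
  have h2 := cint_sub_mem (f ∘ₗ g) hm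
  simpa using sub_mem h1 h2

theorem cint_cext (f : N →ₗ[b] P) (g : M →ₗ[b] AdicCompletion I N) (z : AdicCompletion I M) :
    cint I f (cext I g z) = cint I (cint I f ∘ₗ g) z := by
  refine eq_of_forall_sub_mem (I := I) fun n => ?_
  obtain ⟨m, hm⟩ := exists_approx z n
  -- The element `g m` itself lies in a completion, so it needs an approximant of its own.
  obtain ⟨k, hk⟩ := exists_approx (g m) n
  have h1 := cint_sub_mem f ((eval_cext g z n m hm).trans hk)
  have h2 := cint_sub_mem (cint I f ∘ₗ g) hm
  have h3 := cint_sub_mem f hk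
  have := sub_mem (sub_mem h1 h2) h3
  simp only [LinearMap.comp_apply] at this
  convert this using 1
  abel

/-- The continuous extension as a linear function of the linear map. -/
def cintL (z : AdicCompletion I M) : (M →ₗ[b] P) →ₗ[b] P where
  toFun f := cint I f z
  map_add' f g := by rw [cint_add]; rfl
  map_smul' r f := by rw [cint_smul]; rfl

@[simp]
theorem cintL_apply (z : AdicCompletion I M) (f : M →ₗ[b] P) : cintL z f = cint I f z := rfl

theorem cint_cbilin (f : Q →ₗ[b] P) (B : M →ₗ[b] N →ₗ[b] Q) (x : AdicCompletion I M)
    (y : AdicCompletion I N) :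
    cint I f (cbilin I B x y) = cint I (cintL x ∘ₗ (B.compr₂ f).flip) y := by
  rw [cbilin, cint_cext]
  congr 2
  ext m
  simp only [LinearMap.comp_apply, LinearMap.applyₗ_apply_apply, cintL_apply, cint_cmap]
  congr 1

/-- Modulo I^n both iterated integrals equal `B m k`, for approximants `m` of `x` and `k` of `y`. -/
theorem cint_fubini (B : M →ₗ[b] N →ₗ[b] P) (x : AdicCompletion I M) (y : AdicCompletion I N) :
    cint I (cintL x ∘ₗ B.flip) y = cint I (cintL y ∘ₗ B) x := by
  refine eq_of_forall_sub_mem (I := I) fun n => ?_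
  obtain ⟨m, hm⟩ := exists_approx x n
  obtain ⟨k, hk⟩ := exists_approx y n
  have h1 := cint_sub_mem (cintL x ∘ₗ B.flip) hk
  have h2 := cint_sub_mem (cintL y ∘ₗ B) hm
  have h3 := cint_sub_mem (B.flip k) hm
  have h4 := cint_sub_mem (B m) hk
  simp only [LinearMap.comp_apply, cintL_apply, LinearMap.flip_apply] at h1 h2 h3 h4
  have := sub_mem (add_mem h1 h3) (add_mem h2 h4)
  convert this using 1
  abel

theorem cint_cmul {A : Type*} [Ring A] [Algebra b A] (f : A →ₗ[b] P) (x y : AdicCompletion I A) :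
    cint I f (cmul I x y) = cint I (cintL y ∘ₗ (LinearMap.mul b A).compr₂ f) x := by
  rw [cmul]
  have : cint I f (cbilin I (LinearMap.mul b A) x y) =
      cint I (cintL x ∘ₗ ((LinearMap.mul b A).compr₂ f).flip) y := by
    rw [cbilin, cint_cext]
    congr 2
    ext m
    simp only [LinearMap.comp_apply, LinearMap.applyₗ_apply_apply, cintL_apply, cint_cmap]
    congr 1
  rw [this, cint_fubini]

/-- A module that is killed by a power of an ideal is complete. -/
theorem isAdicComplete_of_smul_eq_zero (n : ℕ) (h : ∀ r ∈ I ^ n, ∀ x : N, r • x = 0) :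
    IsAdicComplete I N := by
  have hbot : (I ^ n • ⊤ : Submodule b N) = ⊥ := by
    rw [eq_bot_iff, Submodule.smul_le]
    intro r hr x _
    simp [h r hr x]
  refine { haus' := fun x hx => ?_, prec' := fun f hf => ⟨f n, fun k => ?_⟩ }
  · have := hx n
    rw [hbot] at this
    simpa using SModEq.sub_mem.mp this
  · rcases le_total k n with hk | hk
    · exact hf hk
    · have := hf hk
      rw [hbot] at this
      have h0 : f n = f k := by
        simpa [sub_eq_zero] using SModEq.sub_mem.mp this
      rw [h0]

theorem cint_eq_of_smul_eq_zero (n : ℕ) (h : ∀ r ∈ I ^ n, ∀ x : P, r • x = 0) (f : M →ₗ[b] P)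
    {z : AdicCompletion I M} {m : M}
    (hm : AdicCompletion.eval I M n z = Submodule.Quotient.mk m) : cint I f z = f m := by
  have hbot : (I ^ n • ⊤ : Submodule b P) = ⊥ := by
    rw [eq_bot_iff, Submodule.smul_le]
    intro r hr x _
    simp [h r hr x]
  have := cint_sub_mem f hm
  rw [hbot] at this
  simpa [sub_eq_zero] using this

/-- Continuous linear maps from a completion into a complete module. -/
def IsCont (F : AdicCompletion I M →ₗ[b] P) : Prop :=
  F = cint I (F ∘ₗ AdicCompletion.of I M)

theorem isCont_cint (f : M →ₗ[b] P) : IsCont (cint I f) := by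
  unfold IsCont
  congr 1
  ext x
  simp

/-- The operators from which Wilson links and ∇ are composed are all of the form `cmap` or `cext`.
Stability under precomposition with these two is therefore all that is needed for the continuity of
both sides of the theorem. -/
theorem IsCont.comp_cext {F : AdicCompletion I N →ₗ[b] P} (h : IsCont F)
    (g : M →ₗ[b] AdicCompletion I N) : IsCont (F ∘ₗ cext I g) := by
  have : F ∘ₗ cext I g = cint I (F ∘ₗ g) := by
    refine LinearMap.ext fun z => ?_
    rw [h, LinearMap.comp_apply, cint_cext]
  rw [this]
  exact isCont_cint _

theorem IsCont.comp_cmap {F : AdicCompletion I N →ₗ[b] P} (h : IsCont F)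
    (g : M →ₗ[b] N) : IsCont (F ∘ₗ cmap I g) := by
  have : F ∘ₗ cmap I g = cint I ((F ∘ₗ AdicCompletion.of I N) ∘ₗ g) := by
    refine LinearMap.ext fun z => ?_
    rw [LinearMap.comp_apply, h, cint_cmap, ← h]
  rw [this]
  exact isCont_cint _

/-- The image of an uncompleted module is dense in its completion. This lets all later computations
take place on elements of uncompleted tensor powers. -/
theorem IsCont.ext {F G : AdicCompletion I M →ₗ[b] P} (hF : IsCont F) (hG : IsCont G)
    (h : ∀ x, F (AdicCompletion.of I M x) = G (AdicCompletion.of I M x)) : F = G := by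
  rw [hF, hG]
  congr 1
  ext x
  exact h x

theorem IsCont.cmap_apply {F : AdicCompletion I N →ₗ[b] P} (h : IsCont F)
    (g : M →ₗ[b] N) (z : AdicCompletion I M) :
    F (cmap I g z) = cint I (F ∘ₗ AdicCompletion.of I N ∘ₗ g) z := by
  rw [h, cint_cmap, ← h]
  rfl

theorem cext_of (g : M →ₗ[b] AdicCompletion I N) (x : M) :
    cext I g (AdicCompletion.of I M x) = g x := by
  apply AdicCompletion.ext
  intro n
  have := eval_cext g (AdicCompletion.of I M x) n x rfl
  simpa using this

theorem cmap_of (g : M →ₗ[b] N) (x : M) :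
    cmap I g (AdicCompletion.of I M x) = AdicCompletion.of I N (g x) :=
  AdicCompletion.map_of I g x

end Integral

/-! ## Integrals over coproducts and over the universal `R`-matrix -/

section Pairing

variable {b H : Type*} [CommRing b] {I : Ideal b} [Ring H] [Algebra b H]
  {P Q : Type*} [AddCommGroup P] [Module b P] [IsAdicComplete I P]
  [AddCommGroup Q] [Module b Q] [IsAdicComplete I Q]

/-- The value `∑ B(s, t)` of a bilinear map `B` on an element `∑ s ⊗ t` of the completed tensor
square. -/
def pairing (Z : AdicCompletion I (H ⊗[b] H)) : (H →ₗ[b] H →ₗ[b] P) →ₗ[b] P where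
  toFun B := cint I (TensorProduct.lift B) Z
  map_add' B C := by
    have : TensorProduct.lift (B + C) = TensorProduct.lift B + TensorProduct.lift C := by
      ext; simp
    rw [this, cint_add]
    rfl
  map_smul' r B := by
    have : TensorProduct.lift (r • B) = r • TensorProduct.lift B := by
      ext; simp
    rw [this, cint_smul]
    rfl

theorem pairing_apply (Z : AdicCompletion I (H ⊗[b] H)) (B : H →ₗ[b] H →ₗ[b] P) :
    pairing Z B = cint I (TensorProduct.lift B) Z := rfl

theorem map_pairing (g : P →ₗ[b] Q) (Z : AdicCompletion I (H ⊗[b] H)) (B : H →ₗ[b] H →ₗ[b] P) :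
    g (pairing Z B) = pairing Z (B.compr₂ g) := by
  rw [pairing_apply, pairing_apply, comp_cint]
  congr 2
  ext
  simp

theorem pairing_of (x y : H) (B : H →ₗ[b] H →ₗ[b] P) :
    pairing (AdicCompletion.of I (H ⊗[b] H) (x ⊗ₜ y)) B = B x y := by
  simp [pairing_apply]

theorem pairing_of_one (B : H →ₗ[b] H →ₗ[b] P) :
    pairing (AdicCompletion.of I (H ⊗[b] H) 1) B = B 1 1 :=
  pairing_of 1 1 B

theorem pairing_cswap (Z : AdicCompletion I (H ⊗[b] H)) (B : H →ₗ[b] H →ₗ[b] P) :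
    pairing (cswap I Z) B = pairing Z B.flip := by
  rw [pairing_apply, pairing_apply, cswap, cint_cmap]
  congr 2
  ext
  simp

/-- The bilinear maps `(a, c) ↦ B(s a, t c)`. -/
def mulBoth (B : H →ₗ[b] H →ₗ[b] P) : H →ₗ[b] H →ₗ[b] H →ₗ[b] H →ₗ[b] P :=
  LinearMap.mk₂ b (fun s t => B.compl₁₂ (LinearMap.mulLeft b s) (LinearMap.mulLeft b t))
    (by intros; ext; simp [add_mul]) (by intros; ext; simp)
    (by intros; ext; simp [add_mul]) (by intros; ext; simp)

omit [IsAdicComplete I P] in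
@[simp]
theorem mulBoth_apply (B : H →ₗ[b] H →ₗ[b] P) (s t a c : H) :
    mulBoth B s t a c = B (s * a) (t * c) := rfl

/-- A product in the completed tensor square becomes an iterated pairing. The axioms on R and θ in
that square are used in this form, tested against an arbitrary bilinear map. -/
theorem pairing_cmul (X Y : AdicCompletion I (H ⊗[b] H)) (B : H →ₗ[b] H →ₗ[b] P) :
    pairing (cmul I X Y) B = pairing X ((mulBoth B).compr₂ (pairing Y)) := by
  rw [pairing_apply, pairing_apply, cint_cmul]
  congr 2
  ext s t
  simp only [TensorProduct.AlgebraTensorModule.curry_apply, TensorProduct.curry_apply,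
    LinearMap.coe_restrictScalars, LinearMap.comp_apply, cintL_apply, TensorProduct.lift.tmul,
    LinearMap.compr₂_apply, pairing_apply]
  congr 2
  ext a c
  simp

/-- A trilinear map as a linear map on the tensor cube. -/
def lift₃ (T : H →ₗ[b] H →ₗ[b] H →ₗ[b] P) : H ⊗[b] (H ⊗[b] H) →ₗ[b] P :=
  TensorProduct.lift (LinearMap.mk₂ b (fun x z => TensorProduct.lift (T x) z)
    (by
      intro x y z
      have : TensorProduct.lift (T x + T y) =
          TensorProduct.lift (T x) + TensorProduct.lift (T y) := by
        ext; simp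
      simp [this])
    (by
      intro r x z
      have : TensorProduct.lift (r • T x) = r • TensorProduct.lift (T x) := by
        ext; simp
      simp [this])
    (by simp) (by simp))

omit [IsAdicComplete I P] in
@[simp]
theorem lift₃_tmul (T : H →ₗ[b] H →ₗ[b] H →ₗ[b] P) (x y z : H) :
    lift₃ T (x ⊗ₜ (y ⊗ₜ z)) = T x y z := by
  simp [lift₃]

/-- The last argument of a trilinear map is made the first one. -/
def rotate (T : H →ₗ[b] H →ₗ[b] H →ₗ[b] P) : H →ₗ[b] H →ₗ[b] H →ₗ[b] P :=
  ((LinearMap.lflip (R₀ := b)).toLinearMap ∘ₗ T).flip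

omit [IsAdicComplete I P] in
@[simp]
theorem rotate_apply (T : H →ₗ[b] H →ₗ[b] H →ₗ[b] P) (x y z : H) : rotate T z x y = T x y z := rfl

end Pairing

namespace RibbonHopfAlgebra

variable {b H : Type*} [CommRing b] {I : Ideal b} [Ring H] [Algebra b H]
  (𝓗 : RibbonHopfAlgebra I H) {P Q : Type*} [AddCommGroup P] [Module b P] [IsAdicComplete I P]
  [AddCommGroup Q] [Module b Q] [IsAdicComplete I Q]

/-- The value `∑ B(x', x'')` of a bilinear map on the coproduct of `x`. -/
def dInt : (H →ₗ[b] H →ₗ[b] P) →ₗ[b] H →ₗ[b] P where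
  toFun B := cint I (TensorProduct.lift B) ∘ₗ 𝓗.comul
  map_add' B C := LinearMap.ext fun x => map_add (pairing (𝓗.comul x)) B C
  map_smul' r B := LinearMap.ext fun x => map_smul (pairing (𝓗.comul x)) r B

theorem dInt_apply (B : H →ₗ[b] H →ₗ[b] P) (x : H) :
    𝓗.dInt B x = pairing (𝓗.comul x) B := rfl

theorem dInt_one (B : H →ₗ[b] H →ₗ[b] P) : 𝓗.dInt B 1 = B 1 1 := by
  rw [dInt_apply, 𝓗.comul_one, pairing_of_one]

theorem dInt_mul (B : H →ₗ[b] H →ₗ[b] P) (x y : H) :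
    𝓗.dInt B (x * y) = 𝓗.dInt ((mulBoth B).compr₂ (pairing (𝓗.comul y))) x := by
  rw [dInt_apply, 𝓗.comul_mul, pairing_cmul]
  rfl

theorem dInt_counit_left (f : H →ₗ[b] P) (x : H) :
    𝓗.dInt ((LinearMap.lsmul b P ∘ₗ 𝓗.counit.toLinearMap).compl₂ f) x = f x := by
  have h := congrArg (cint I f) (𝓗.counit_comul x)
  rw [cint_of, cint_cmap] at h
  rw [← h, dInt_apply, pairing_apply]
  congr 2
  ext
  simp

theorem dInt_counit_right (f : H →ₗ[b] P) (x : H) :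
    𝓗.dInt ((LinearMap.lsmul b P ∘ₗ 𝓗.counit.toLinearMap).compl₂ f).flip x = f x := by
  have h := congrArg (cint I f) (𝓗.comul_counit x)
  rw [cint_of, cint_cmap] at h
  rw [← h, dInt_apply, pairing_apply]
  congr 2
  ext
  simp

theorem dInt_antipode_left (f : H →ₗ[b] P) (x : H) :
    𝓗.dInt ((LinearMap.mul b H ∘ₗ 𝓗.antipode).compr₂ f) x = 𝓗.counit x • f 1 := by
  have h := congrArg (cint I f) (𝓗.antipode_mul x)
  rw [cint_of, cint_cmap, Algebra.algebraMap_eq_smul_one, map_smul] at h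
  rw [← h, dInt_apply, pairing_apply]
  congr 2
  ext
  simp

theorem dInt_antipode_right (f : H →ₗ[b] P) (x : H) :
    𝓗.dInt (((LinearMap.mul b H).compl₂ 𝓗.antipode).compr₂ f) x = 𝓗.counit x • f 1 := by
  have h := congrArg (cint I f) (𝓗.mul_antipode x)
  rw [cint_of, cint_cmap, Algebra.algebraMap_eq_smul_one, map_smul] at h
  rw [← h, dInt_apply, pairing_apply]
  congr 2
  ext
  simp

theorem cint_comulLeft (T : H →ₗ[b] H →ₗ[b] H →ₗ[b] P) (Z : AdicCompletion I (H ⊗[b] H)) :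
    cint I (lift₃ T) (comulLeft I 𝓗.comul Z) = pairing Z (𝓗.dInt ∘ₗ rotate T).flip := by
  rw [comulLeft, cint_cext, pairing_apply]
  congr 2
  ext x y
  simp only [TensorProduct.AlgebraTensorModule.curry_apply, TensorProduct.curry_apply,
    LinearMap.coe_restrictScalars, LinearMap.comp_apply, TensorProduct.lift.tmul,
    LinearMap.flip_apply, LinearMap.coe_mk, AddHom.coe_mk, cint_cmap, dInt_apply, pairing_apply]
  congr 2
  ext a c
  simp

theorem cint_comulRight (T : H →ₗ[b] H →ₗ[b] H →ₗ[b] P) (Z : AdicCompletion I (H ⊗[b] H)) :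
    cint I (lift₃ T) (comulRight I 𝓗.comul Z) = pairing Z (𝓗.dInt ∘ₗ T) := by
  rw [comulRight, cint_cext, pairing_apply]
  congr 2
  ext x y
  simp only [TensorProduct.AlgebraTensorModule.curry_apply, TensorProduct.curry_apply,
    LinearMap.coe_restrictScalars, LinearMap.comp_apply, TensorProduct.lift.tmul,
    LinearMap.coe_mk, AddHom.coe_mk, cint_cmap, dInt_apply, pairing_apply]
  congr 2

/-- Splitting the first leg once more leaves the last argument of `T` fixed. `rotate` makes that
argument the outermost one, so that `dInt` can be applied to the other two. -/
theorem dInt_coassoc (T : H →ₗ[b] H →ₗ[b] H →ₗ[b] P) (x : H) :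
    𝓗.dInt (𝓗.dInt ∘ₗ rotate T).flip x = 𝓗.dInt (𝓗.dInt ∘ₗ T) x := by
  rw [dInt_apply, dInt_apply, ← cint_comulLeft, ← cint_comulRight, 𝓗.coassoc]

/-- The trilinear maps `(s', t') ↦ T(s, s', t t')`. -/
def mulThird (T : H →ₗ[b] H →ₗ[b] H →ₗ[b] P) : H →ₗ[b] H →ₗ[b] H →ₗ[b] H →ₗ[b] P :=
  LinearMap.mk₂ b (fun s t => (T s).compl₂ (LinearMap.mulLeft b t))
    (by intros; ext; simp) (by intros; ext; simp)
    (by intros; ext; simp [add_mul]) (by intros; ext; simp)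

/-- The trilinear maps `(s', t') ↦ T(s s', t', t)`. -/
def mulFirst (T : H →ₗ[b] H →ₗ[b] H →ₗ[b] P) : H →ₗ[b] H →ₗ[b] H →ₗ[b] H →ₗ[b] P :=
  LinearMap.mk₂ b (fun s t => (rotate T t).comp (LinearMap.mulLeft b s))
    (by intros; ext; simp [add_mul]) (by intros; ext; simp)
    (by intros; ext; simp) (by intros; ext; simp)

omit [IsAdicComplete I P] in
@[simp]
theorem mulThird_apply (T : H →ₗ[b] H →ₗ[b] H →ₗ[b] P) (s t s' t' : H) :
    mulThird T s t s' t' = T s s' (t * t') := rfl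

omit [IsAdicComplete I P] in
@[simp]
theorem mulFirst_apply (T : H →ₗ[b] H →ₗ[b] H →ₗ[b] P) (s t s' t' : H) :
    mulFirst T s t s' t' = T (s * s') t' t := rfl

theorem pairing_R_comulLeft (T : H →ₗ[b] H →ₗ[b] H →ₗ[b] P) :
    pairing 𝓗.R (𝓗.dInt ∘ₗ rotate T).flip =
      pairing 𝓗.R ((mulThird T).compr₂ (pairing 𝓗.R)) := by
  rw [← cint_comulLeft, 𝓗.comulLeft_R, cint_cmul, leg13, cint_cmap, pairing_apply]
  congr 2
  ext s t
  simp only [TensorProduct.AlgebraTensorModule.curry_apply, TensorProduct.curry_apply,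
    LinearMap.coe_restrictScalars, LinearMap.comp_apply, TensorProduct.lift.tmul,
    TensorProduct.map_tmul, cintL_apply, leg23, cint_cmap, LinearMap.compr₂_apply, pairing_apply]
  congr 2
  ext a c
  simp

theorem pairing_R_comulRight (T : H →ₗ[b] H →ₗ[b] H →ₗ[b] P) :
    pairing 𝓗.R (𝓗.dInt ∘ₗ T) = pairing 𝓗.R ((mulFirst T).compr₂ (pairing 𝓗.R)) := by
  rw [← cint_comulRight, 𝓗.comulRight_R, cint_cmul, leg13, cint_cmap, pairing_apply]
  congr 2
  ext s t
  simp only [TensorProduct.AlgebraTensorModule.curry_apply, TensorProduct.curry_apply,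
    LinearMap.coe_restrictScalars, LinearMap.comp_apply, TensorProduct.lift.tmul,
    TensorProduct.map_tmul, cintL_apply, leg12, cint_cmap, LinearMap.compr₂_apply, pairing_apply]
  congr 2
  ext a c
  simp

theorem pairing_R_dInt (B : H →ₗ[b] H →ₗ[b] P) (x : H) :
    pairing 𝓗.R ((mulBoth B).compr₂ (pairing (𝓗.comul x))) =
      𝓗.dInt ((mulBoth B).flip.compr₂ (pairing 𝓗.R)) x := by
  rw [← pairing_cmul, 𝓗.R_comul, pairing_cmul, pairing_cswap]
  rfl

theorem pairing_R_Rinv (B : H →ₗ[b] H →ₗ[b] P) :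
    pairing 𝓗.R ((mulBoth B).compr₂ (pairing 𝓗.Rinv)) = B 1 1 := by
  rw [← pairing_cmul, 𝓗.R_mul_Rinv, pairing_of_one]

theorem pairing_θ (B : H →ₗ[b] H →ₗ[b] P) :
    pairing 𝓗.R ((mulBoth ((mulBoth B).compr₂ (pairing (𝓗.comul 𝓗.θ)))).flip.compr₂
      (pairing 𝓗.R)) = B 𝓗.θ 𝓗.θ := by
  rw [← pairing_of (I := I), ← 𝓗.comul_θ, pairing_cmul, pairing_cmul, pairing_cswap]
  rfl

end RibbonHopfAlgebra

/-! ## Identities in ribbon Hopf algebras -/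

section Approx

variable {b H : Type*} [CommRing b] {I : Ideal b} [Ring H] [Algebra b H]
  {P : Type*} [AddCommGroup P] [Module b P]

variable (I P) in
/-- The quotient of a module by a power of the ideal. -/
abbrev Trunc (n : ℕ) : Type _ := P ⧸ (I ^ n • ⊤ : Submodule b P)

variable (I P) in
/-- Reduction modulo a power of the ideal. -/
def trunc (n : ℕ) : P →ₗ[b] Trunc I P n := (I ^ n • ⊤ : Submodule b P).mkQ

theorem Trunc.smul_eq_zero (n : ℕ) : ∀ r ∈ I ^ n, ∀ x : Trunc I P n, r • x = 0 := by
  intro r hr x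
  obtain ⟨x, rfl⟩ := Submodule.Quotient.mk_surjective _ x
  rw [← Submodule.Quotient.mk_smul, Submodule.Quotient.mk_eq_zero]
  exact Submodule.smul_mem_smul hr Submodule.mem_top

instance (n : ℕ) : IsAdicComplete I (Trunc I P n) :=
  isAdicComplete_of_smul_eq_zero n (Trunc.smul_eq_zero n)

/-- The method of this part: an identity in a complete module is checked modulo every power of I,
where all integrals become finite sums. -/
theorem eq_of_trunc [IsHausdorff I P] {x y : P} (h : ∀ n, trunc I P n x = trunc I P n y) :
    x = y :=
  eq_of_forall_sub_mem (I := I) fun n => (Submodule.Quotient.eq _).mp (h n)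

theorem trunc_mul {n : ℕ} {x y z w : H} (h : trunc I H n x = trunc I H n y)
    (h' : trunc I H n z = trunc I H n w) : trunc I H n (x * z) = trunc I H n (y * w) := by
  have h1 := (Submodule.Quotient.eq _).mp h
  have h2 := (Submodule.Quotient.eq _).mp h'
  refine (Submodule.Quotient.eq _).mpr ?_
  have h3 := map_sub_mem (LinearMap.mulRight b z) h1
  have h4 := map_sub_mem (LinearMap.mulLeft b y) h2
  simp only [LinearMap.mulRight_apply, LinearMap.mulLeft_apply] at h3 h4
  simpa using add_mem h3 h4

theorem exists_finset_approx (n : ℕ) (Z : AdicCompletion I (H ⊗[b] H)) :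
    ∃ s : Finset (H × H), AdicCompletion.eval I (H ⊗[b] H) n Z =
      Submodule.Quotient.mk (∑ p ∈ s, p.1 ⊗ₜ p.2) := by
  obtain ⟨m, hm⟩ := exists_approx Z n
  obtain ⟨s, hs⟩ := TensorProduct.exists_finset m
  exact ⟨s, hs ▸ hm⟩

/-- A finite sum of tensors that approximates an element of the completed tensor square. -/
def approx (n : ℕ) (Z : AdicCompletion I (H ⊗[b] H)) : Finset (H × H) :=
  (exists_finset_approx n Z).choose

/-- The finite family `approx n Z` does not depend on `B`. This justifies Sweedler notation: modulo
I^n, an element of the completed tensor square may be treated as one fixed finite sum of tensors. -/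
theorem pairing_eq_sum {n : ℕ} (Z : AdicCompletion I (H ⊗[b] H))
    (B : H →ₗ[b] H →ₗ[b] Trunc I P n) :
    pairing Z B = ∑ p ∈ approx n Z, B p.1 p.2 := by
  rw [pairing_apply, cint_eq_of_smul_eq_zero n (Trunc.smul_eq_zero n) _
    (exists_finset_approx n Z).choose_spec]
  simp [approx]

theorem trunc_pairing [IsAdicComplete I P] (n : ℕ) (Z : AdicCompletion I (H ⊗[b] H))
    (B : H →ₗ[b] H →ₗ[b] P) :
    trunc I P n (pairing Z B) = ∑ p ∈ approx n Z, trunc I P n (B p.1 p.2) := by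
  rw [map_pairing, pairing_eq_sum]
  rfl

end Approx

/-! ### Functions that are linear in two or three variables -/

section Multilinear

variable (b : Type*) {H P : Type*} [CommRing b] [Ring H] [Algebra b H] [AddCommGroup P] [Module b P]

/-- Bilinearity of a function. -/
structure IsBil (f : H → H → P) : Prop where
  left : ∀ y, IsLinearMap b fun x => f x y
  right : ∀ x, IsLinearMap b fun y => f x y

/-- Trilinearity of a function. -/
structure IsTri (f : H → H → H → P) : Prop where
  left : ∀ z, IsBil b fun x y => f x y z
  right : ∀ x y, IsLinearMap b fun z => f x y z

variable {b}

/-- The linear map of a bilinear function. -/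
def IsBil.mk' {f : H → H → P} (h : IsBil b f) : H →ₗ[b] H →ₗ[b] P :=
  LinearMap.mk₂ b f (fun x x' y => (h.left y).map_add x x') (fun r x y => (h.left y).map_smul r x)
    (fun x y y' => (h.right x).map_add y y') (fun r x y => (h.right x).map_smul r y)

/-- The linear map of a trilinear function. -/
def IsTri.mk' {f : H → H → H → P} (h : IsTri b f) : H →ₗ[b] H →ₗ[b] H →ₗ[b] P :=
  LinearMap.mk₂ b (fun x y => (h.right x y).mk')
    (fun x x' y => LinearMap.ext fun z => ((h.left z).left y).map_add x x')
    (fun r x y => LinearMap.ext fun z => ((h.left z).left y).map_smul r x)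
    (fun x y y' => LinearMap.ext fun z => ((h.left z).right x).map_add y y')
    (fun r x y => LinearMap.ext fun z => ((h.left z).right x).map_smul r y)

@[simp]
theorem IsBil.mk'_apply {f : H → H → P} (h : IsBil b f) (x y : H) : h.mk' x y = f x y := rfl

@[simp]
theorem IsTri.mk'_apply {f : H → H → H → P} (h : IsTri b f) (x y z : H) :
    h.mk' x y z = f x y z := rfl

end Multilinear

namespace RibbonHopfAlgebra

variable {b H : Type*} [CommRing b] {I : Ideal b} [Ring H] [Algebra b H]
  (𝓗 : RibbonHopfAlgebra I H) {P : Type*} [AddCommGroup P] [Module b P]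

/-- Sweedler components of the coproduct modulo a power of the ideal. -/
def D (n : ℕ) (x : H) : Finset (H × H) := approx n (𝓗.comul x)

/-- Components of the universal `R`-matrix modulo a power of the ideal. -/
def Rc (n : ℕ) : Finset (H × H) := approx n 𝓗.R

variable {n : ℕ}

theorem dInt_eq_sum (B : H →ₗ[b] H →ₗ[b] Trunc I P n) (x : H) :
    𝓗.dInt B x = ∑ d ∈ 𝓗.D n x, B d.1 d.2 := pairing_eq_sum _ _

theorem sum_D_coassoc {T : H → H → H → Trunc I P n} (h : IsTri b T) (x : H) :
    ∑ d ∈ 𝓗.D n x, ∑ e ∈ 𝓗.D n d.1, T e.1 e.2 d.2 =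
      ∑ d ∈ 𝓗.D n x, ∑ e ∈ 𝓗.D n d.2, T d.1 e.1 e.2 := by
  have := 𝓗.dInt_coassoc h.mk' x
  simpa [dInt_eq_sum] using this

theorem sum_D_counit_left {f : H → Trunc I P n} (h : IsLinearMap b f) (x : H) :
    ∑ d ∈ 𝓗.D n x, 𝓗.counit d.1 • f d.2 = f x := by
  have := 𝓗.dInt_counit_left h.mk' x
  simpa [dInt_eq_sum] using this

theorem sum_D_counit_right {f : H → Trunc I P n} (h : IsLinearMap b f) (x : H) :
    ∑ d ∈ 𝓗.D n x, 𝓗.counit d.2 • f d.1 = f x := by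
  have := 𝓗.dInt_counit_right h.mk' x
  simpa [dInt_eq_sum] using this

theorem sum_D_antipode_left {f : H → Trunc I P n} (h : IsLinearMap b f) (x : H) :
    ∑ d ∈ 𝓗.D n x, f (𝓗.antipode d.1 * d.2) = 𝓗.counit x • f 1 := by
  have := 𝓗.dInt_antipode_left h.mk' x
  simpa [dInt_eq_sum] using this

theorem sum_D_antipode_right {f : H → Trunc I P n} (h : IsLinearMap b f) (x : H) :
    ∑ d ∈ 𝓗.D n x, f (d.1 * 𝓗.antipode d.2) = 𝓗.counit x • f 1 := by
  have := 𝓗.dInt_antipode_right h.mk' x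
  simpa [dInt_eq_sum] using this

theorem sum_D_mul {B : H → H → Trunc I P n} (h : IsBil b B) (x y : H) :
    ∑ d ∈ 𝓗.D n (x * y), B d.1 d.2 =
      ∑ d ∈ 𝓗.D n x, ∑ e ∈ 𝓗.D n y, B (d.1 * e.1) (d.2 * e.2) := by
  have := 𝓗.dInt_mul h.mk' x y
  simpa [dInt_eq_sum, pairing_eq_sum, D, Rc] using this

theorem sum_R_comulLeft {T : H → H → H → Trunc I P n} (h : IsTri b T) :
    ∑ r ∈ 𝓗.Rc n, ∑ d ∈ 𝓗.D n r.1, T d.1 d.2 r.2 =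
      ∑ r ∈ 𝓗.Rc n, ∑ q ∈ 𝓗.Rc n, T r.1 q.1 (r.2 * q.2) := by
  have := 𝓗.pairing_R_comulLeft h.mk'
  simpa [dInt_eq_sum, pairing_eq_sum, D, Rc] using this

theorem sum_R_comulRight {T : H → H → H → Trunc I P n} (h : IsTri b T) :
    ∑ r ∈ 𝓗.Rc n, ∑ d ∈ 𝓗.D n r.2, T r.1 d.1 d.2 =
      ∑ r ∈ 𝓗.Rc n, ∑ q ∈ 𝓗.Rc n, T (r.1 * q.1) q.2 r.2 := by
  have := 𝓗.pairing_R_comulRight h.mk'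
  simpa [dInt_eq_sum, pairing_eq_sum, D, Rc] using this

theorem sum_R_D {B : H → H → Trunc I P n} (h : IsBil b B) (x : H) :
    ∑ r ∈ 𝓗.Rc n, ∑ d ∈ 𝓗.D n x, B (r.1 * d.1) (r.2 * d.2) =
      ∑ d ∈ 𝓗.D n x, ∑ r ∈ 𝓗.Rc n, B (d.2 * r.1) (d.1 * r.2) := by
  have := 𝓗.pairing_R_dInt h.mk' x
  simpa [dInt_eq_sum, pairing_eq_sum, D, Rc] using this

theorem sum_R_Rinv {B : H → H → Trunc I P n} (h : IsBil b B) :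
    ∑ r ∈ 𝓗.Rc n, ∑ q ∈ approx n 𝓗.Rinv, B (r.1 * q.1) (r.2 * q.2) = B 1 1 := by
  have := 𝓗.pairing_R_Rinv h.mk'
  simpa [pairing_eq_sum, Rc] using this

theorem sum_R_θ {B : H → H → Trunc I P n} (h : IsBil b B) :
    ∑ r ∈ 𝓗.Rc n, ∑ q ∈ 𝓗.Rc n, ∑ d ∈ 𝓗.D n 𝓗.θ,
      B (r.2 * q.1 * d.1) (r.1 * q.2 * d.2) = B 𝓗.θ 𝓗.θ := by
  have := 𝓗.pairing_θ h.mk'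
  simpa [pairing_eq_sum, mul_assoc, D, Rc] using this

/-! ### The antipode -/

section Antipode

variable [IsAdicComplete I H]

theorem antipode_one : 𝓗.antipode 1 = 1 := by
  have := 𝓗.dInt_antipode_right LinearMap.id 1
  rw [dInt_one] at this
  simpa using this

/-- Uniqueness of convolution inverses: both S(xy) and S(y)S(x) invert the multiplication H ⊗ H → H.
The sum of S(x'y') x''y'' S(y''')S(x''') contracts to S(xy) from the right (`h1`) and to S(y)S(x)
from the left (`h2`), and coassociativity in both variables identifies the two contractions. -/
theorem antipode_mul_antidistrib (x y : H) :
    𝓗.antipode (x * y) = 𝓗.antipode y * 𝓗.antipode x := by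
  refine eq_of_trunc (I := I) fun n => ?_
  set q := trunc I H n
  set S := 𝓗.antipode
  have h1 : ∑ d ∈ 𝓗.D n x, ∑ e ∈ 𝓗.D n d.2, ∑ f ∈ 𝓗.D n y, ∑ g ∈ 𝓗.D n f.2,
      q (S (d.1 * f.1) * (e.1 * g.1) * (S g.2 * S e.2)) = q (S (x * y)) := by
    have h11 : ∀ d e : H × H, ∑ f ∈ 𝓗.D n y, ∑ g ∈ 𝓗.D n f.2,
        q (S (d.1 * f.1) * (e.1 * g.1) * (S g.2 * S e.2)) =
          q (S (d.1 * y) * (e.1 * S e.2)) := by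
      intro d e
      rw [← 𝓗.sum_D_counit_right (f := fun z => q (S (d.1 * z) * (e.1 * S e.2)))
        (by constructor <;> intros <;> simp [mul_add, add_mul])]
      refine Finset.sum_congr rfl fun f _ => ?_
      have := 𝓗.sum_D_antipode_right (f := fun z => q (S (d.1 * f.1) * (e.1 * z * S e.2)))
        (by constructor <;> intros <;> simp [mul_add, add_mul]) f.2
      simpa [mul_assoc] using this
    simp only [h11]
    rw [← 𝓗.sum_D_counit_right (f := fun z => q (S (z * y)))
        (by constructor <;> intros <;> simp [mul_add, add_mul])]
    refine Finset.sum_congr rfl fun d _ => ?_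
    have := 𝓗.sum_D_antipode_right (f := fun z => q (S (d.1 * y) * z))
        (by constructor <;> intros <;> simp [mul_add, add_mul]) d.2
    simpa [mul_assoc] using this
  have h2 : ∑ d ∈ 𝓗.D n x, ∑ e ∈ 𝓗.D n d.1, ∑ f ∈ 𝓗.D n y, ∑ g ∈ 𝓗.D n f.1,
      q (S (e.1 * g.1) * (e.2 * g.2) * (S f.2 * S d.2)) = q (S y * S x) := by
    rw [← 𝓗.sum_D_counit_left (f := fun z => q (S y * S z))
        (by constructor <;> intros <;> simp [mul_add, add_mul])]
    refine Finset.sum_congr rfl fun d _ => ?_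
    rw [Finset.sum_comm, ← 𝓗.sum_D_counit_left (f := fun z => q (S z * S d.2))
        (by constructor <;> intros <;> simp [mul_add, add_mul]), Finset.smul_sum]
    refine Finset.sum_congr rfl fun f _ => ?_
    rw [← 𝓗.sum_D_mul (B := fun a c => q (S a * c * (S f.2 * S d.2)))
      (by constructor <;> intros <;> constructor <;> intros <;> simp [mul_add, add_mul])]
    have := 𝓗.sum_D_antipode_left (f := fun z => q (z * (S f.2 * S d.2)))
        (by constructor <;> intros <;> simp [mul_add, add_mul]) (d.1 * f.1)
    simpa [mul_smul] using this
  rw [← h1, ← h2, ← 𝓗.sum_D_coassoc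
    (T := fun a c d => ∑ f ∈ 𝓗.D n y, ∑ g ∈ 𝓗.D n f.2,
      q (S (a * f.1) * (c * g.1) * (S g.2 * S d)))]
  · refine Finset.sum_congr rfl fun d _ => Finset.sum_congr rfl fun e _ => ?_
    rw [← 𝓗.sum_D_coassoc (T := fun a c f => q (S (e.1 * a) * (e.2 * c) * (S f * S d.2)))]
    constructor <;> intros <;> constructor <;> intros <;> (try constructor) <;> intros <;>
      simp [mul_add, add_mul]
  · constructor <;> intros <;> constructor <;> intros <;> (try constructor) <;> intros <;>
      simp [mul_add, add_mul, Finset.sum_add_distrib, Finset.smul_sum]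

theorem antipode_θ_inv : 𝓗.antipode ↑𝓗.θ⁻¹ = ↑𝓗.θ⁻¹ := by
  have h : 𝓗.antipode ↑𝓗.θ⁻¹ * 𝓗.θ = 1 := by
    have := 𝓗.antipode_mul_antidistrib 𝓗.θ ↑𝓗.θ⁻¹
    rwa [Units.mul_inv, 𝓗.antipode_one, 𝓗.antipode_θ, eq_comm] at this
  rw [← mul_one (𝓗.antipode _), ← Units.mul_inv 𝓗.θ, ← mul_assoc, h, one_mul]

omit [IsAdicComplete I H] in
theorem θ_inv_central (x : H) : (↑𝓗.θ⁻¹ : H) * x = x * ↑𝓗.θ⁻¹ := by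
  rw [Units.inv_mul_eq_iff_eq_mul, ← mul_assoc, 𝓗.θ_central, mul_assoc, Units.mul_inv, mul_one]

/-! ### The universal `R`-matrix -/

/-- `(ε ⊗ 1) R = 1`. -/
theorem counit_left_R :
    pairing 𝓗.R ((LinearMap.lsmul b H) ∘ₗ 𝓗.counit.toLinearMap) = (1 : H) := by
  set e : H := pairing 𝓗.R ((LinearMap.lsmul b H) ∘ₗ 𝓗.counit.toLinearMap) with he
  set e' : H := pairing 𝓗.Rinv ((LinearMap.lsmul b H) ∘ₗ 𝓗.counit.toLinearMap) with he'
  have hq : ∀ n, trunc I H n e = trunc I H n (∑ r ∈ 𝓗.Rc n, 𝓗.counit r.1 • r.2) := by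
    intro n
    rw [he, trunc_pairing, map_sum]
    rfl
  have hq' : ∀ n, trunc I H n e' =
      trunc I H n (∑ r ∈ approx n 𝓗.Rinv, 𝓗.counit r.1 • r.2) := by
    intro n
    rw [he', trunc_pairing, map_sum]
    rfl
  -- The element (ε ⊗ 1)R is idempotent: apply ε ⊗ ε ⊗ 1 to (Δ ⊗ 1)R = R₁₃R₂₃.
  have h1 : e * e = e := by
    refine eq_of_trunc (I := I) fun n => ?_
    rw [trunc_mul (hq n) (hq n), hq n]
    have := 𝓗.sum_R_comulLeft (n := n)
      (T := fun s s' t => (𝓗.counit s * 𝓗.counit s') • trunc I H n t)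
      (by constructor <;> intros <;> constructor <;> intros <;> (try constructor) <;> intros <;>
        simp [add_smul, mul_add, add_mul, smul_smul, mul_assoc, mul_comm, mul_left_comm])
    simp only [Finset.sum_mul, Finset.mul_sum, map_sum]
    simp only [smul_mul_smul_comm, map_smul]
    rw [Finset.sum_comm, ← this]
    refine Finset.sum_congr rfl fun r _ => ?_
    have := 𝓗.sum_D_counit_left (n := n) (f := fun z => trunc I H n (𝓗.counit z • r.2))
      (by constructor <;> intros <;> simp [add_smul, mul_smul]) r.1
    simpa [mul_smul] using this
  -- It is also invertible on the right, because ε ⊗ 1 is multiplicative. An idempotent with a right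
  -- inverse is 1.
  have h2 : e * e' = 1 := by
    refine eq_of_trunc (I := I) fun n => ?_
    rw [trunc_mul (hq n) (hq' n)]
    have := 𝓗.sum_R_Rinv (n := n) (B := fun a c => trunc I H n (𝓗.counit a • c))
      (by constructor <;> intros <;> constructor <;> intros <;>
        simp [add_smul, smul_smul, mul_comm])
    simp only [Finset.sum_mul, Finset.mul_sum, map_sum]
    simp only [smul_mul_smul_comm]
    rw [Finset.sum_comm]
    simpa using this
  calc e = e * (e * e') := by rw [h2, mul_one]
    _ = 1 := by rw [← mul_assoc, h1, h2]

/-- `(1 ⊗ ε) R = 1`. -/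
theorem counit_right_R :
    pairing 𝓗.R ((LinearMap.lsmul b H) ∘ₗ 𝓗.counit.toLinearMap).flip = (1 : H) := by
  set e : H := pairing 𝓗.R ((LinearMap.lsmul b H) ∘ₗ 𝓗.counit.toLinearMap).flip with he
  set e' : H := pairing 𝓗.Rinv ((LinearMap.lsmul b H) ∘ₗ 𝓗.counit.toLinearMap).flip with he'
  have hq : ∀ n, trunc I H n e = trunc I H n (∑ r ∈ 𝓗.Rc n, 𝓗.counit r.2 • r.1) := by
    intro n
    rw [he, trunc_pairing, map_sum]
    rfl
  have hq' : ∀ n, trunc I H n e' =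
      trunc I H n (∑ r ∈ approx n 𝓗.Rinv, 𝓗.counit r.2 • r.1) := by
    intro n
    rw [he', trunc_pairing, map_sum]
    rfl
  have h1 : e * e = e := by
    refine eq_of_trunc (I := I) fun n => ?_
    rw [trunc_mul (hq n) (hq n), hq n]
    have := 𝓗.sum_R_comulRight (n := n)
      (T := fun s t t' => (𝓗.counit t' * 𝓗.counit t) • trunc I H n s)
      (by constructor <;> intros <;> constructor <;> intros <;> (try constructor) <;> intros <;>
        simp [add_smul, mul_add, add_mul, smul_smul, mul_assoc, mul_comm, mul_left_comm])
    simp only [Finset.sum_mul, Finset.mul_sum, map_sum]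
    simp only [smul_mul_smul_comm, map_smul]
    rw [Finset.sum_comm, ← this]
    refine Finset.sum_congr rfl fun r _ => ?_
    have := 𝓗.sum_D_counit_right (n := n) (f := fun z => trunc I H n (𝓗.counit z • r.1))
      (by constructor <;> intros <;> simp [add_smul, mul_smul]) r.2
    simpa [mul_smul] using this
  have h2 : e * e' = 1 := by
    refine eq_of_trunc (I := I) fun n => ?_
    rw [trunc_mul (hq n) (hq' n)]
    have := 𝓗.sum_R_Rinv (n := n) (B := fun a c => trunc I H n (𝓗.counit c • a))
      (by constructor <;> intros <;> constructor <;> intros <;>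
        simp [add_smul, smul_smul, mul_comm])
    simp only [Finset.sum_mul, Finset.mul_sum, map_sum]
    simp only [smul_mul_smul_comm]
    rw [Finset.sum_comm]
    simpa using this
  calc e = e * (e * e') := by rw [h2, mul_one]
    _ = 1 := by rw [← mul_assoc, h1, h2]

theorem sum_R_counit_left {f : H → Trunc I P n} (h : IsLinearMap b f) :
    ∑ r ∈ 𝓗.Rc n, 𝓗.counit r.1 • f r.2 = f 1 := by
  have := congrArg h.mk' 𝓗.counit_left_R
  rw [map_pairing, pairing_eq_sum] at this
  simpa [Rc] using this

theorem sum_R_counit_right {f : H → Trunc I P n} (h : IsLinearMap b f) :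
    ∑ r ∈ 𝓗.Rc n, 𝓗.counit r.2 • f r.1 = f 1 := by
  have := congrArg h.mk' 𝓗.counit_right_R
  rw [map_pairing, pairing_eq_sum] at this
  simpa [Rc] using this

/-- `(S ⊗ 1)(R) R = 1`. -/
theorem sum_R_antipode_mul {B : H → H → Trunc I P n} (h : IsBil b B) :
    ∑ r ∈ 𝓗.Rc n, ∑ q ∈ 𝓗.Rc n, B (𝓗.antipode r.1 * q.1) (r.2 * q.2) = B 1 1 := by
  have := 𝓗.sum_R_comulLeft (n := n) (T := fun s s' t => B (𝓗.antipode s * s') t)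
    (by
      have h1 := fun y => (h.left y).map_add
      have h2 := fun y => (h.left y).map_smul
      have h3 := fun y => (h.right y).map_add
      have h4 := fun y => (h.right y).map_smul
      constructor <;> intros <;> constructor <;> intros <;> (try constructor) <;> intros <;>
        simp_all [add_mul, mul_add])
  rw [← this, ← 𝓗.sum_R_counit_left (h.right 1)]
  exact Finset.sum_congr rfl fun r _ => 𝓗.sum_D_antipode_left (h.left r.2) r.1

/-- `R (S ⊗ 1)(R) = 1`. -/
theorem sum_R_mul_antipode {B : H → H → Trunc I P n} (h : IsBil b B) :
    ∑ r ∈ 𝓗.Rc n, ∑ q ∈ 𝓗.Rc n, B (r.1 * 𝓗.antipode q.1) (r.2 * q.2) = B 1 1 := by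
  have := 𝓗.sum_R_comulLeft (n := n) (T := fun s s' t => B (s * 𝓗.antipode s') t)
    (by
      have h1 := fun y => (h.left y).map_add
      have h2 := fun y => (h.left y).map_smul
      have h3 := fun y => (h.right y).map_add
      have h4 := fun y => (h.right y).map_smul
      constructor <;> intros <;> constructor <;> intros <;> (try constructor) <;> intros <;>
        simp_all [add_mul, mul_add])
  rw [← this, ← 𝓗.sum_R_counit_left (h.right 1)]
  exact Finset.sum_congr rfl fun r _ => 𝓗.sum_D_antipode_right (h.left r.2) r.1

/-- `(S ⊗ S)(R) = R`. -/
theorem sum_R_antipode_antipode {B : H → H → Trunc I P n} (h : IsBil b B) :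
    ∑ r ∈ 𝓗.Rc n, B (𝓗.antipode r.1) (𝓗.antipode r.2) = ∑ r ∈ 𝓗.Rc n, B r.1 r.2 := by
  have h1 := fun y => (h.left y).map_add
  have h2 := fun y => (h.left y).map_smul
  have h3 := fun y => (h.right y).map_add
  have h4 := fun y => (h.right y).map_smul
  -- This says that (S ⊗ 1)(R) · (S ⊗ S)(R) = 1. It follows from (1 ⊗ Δ)R = R₁₃R₁₂ by applying S to
  -- the first leg, which reverses the product there, and contracting the other two legs with the
  -- antipode. Inserting R · (S ⊗ 1)(R) = 1 in front of (S ⊗ S)(R) then leaves R.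
  have key : ∀ p : H × H, ∑ r ∈ 𝓗.Rc n, ∑ q ∈ 𝓗.Rc n,
      B (p.1 * 𝓗.antipode q.1 * 𝓗.antipode r.1) (p.2 * q.2 * 𝓗.antipode r.2) = B p.1 p.2 := by
    intro p
    have := 𝓗.sum_R_comulRight (n := n)
      (T := fun s t t' => B (p.1 * 𝓗.antipode s) (p.2 * (t * 𝓗.antipode t')))
      (by
        constructor <;> intros <;> constructor <;> intros <;> (try constructor) <;> intros <;>
          simp_all [add_mul, mul_add])
    simp only [antipode_mul_antidistrib, ← mul_assoc] at this
    rw [← this]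
    have h5 := 𝓗.sum_R_counit_right (n := n) (f := fun s => B (p.1 * 𝓗.antipode s) p.2)
      (by constructor <;> intros <;> simp_all [mul_add])
    rw [antipode_one, mul_one] at h5
    rw [← h5]
    refine Finset.sum_congr rfl fun r _ => ?_
    have := 𝓗.sum_D_antipode_right (n := n) (f := fun z => B (p.1 * 𝓗.antipode r.1) (p.2 * z))
      (by constructor <;> intros <;> simp_all [mul_add]) r.2
    simpa [mul_assoc] using this
  calc ∑ r ∈ 𝓗.Rc n, B (𝓗.antipode r.1) (𝓗.antipode r.2) =
      ∑ r ∈ 𝓗.Rc n, ∑ p ∈ 𝓗.Rc n, ∑ q ∈ 𝓗.Rc n,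
        B (p.1 * 𝓗.antipode q.1 * 𝓗.antipode r.1) (p.2 * q.2 * 𝓗.antipode r.2) := by
        refine Finset.sum_congr rfl fun r _ => ?_
        have := 𝓗.sum_R_mul_antipode (n := n)
          (B := fun a c => B (a * 𝓗.antipode r.1) (c * 𝓗.antipode r.2))
          (by constructor <;> intros <;> constructor <;> intros <;> simp_all [add_mul])
        simpa using this.symm
    _ = ∑ p ∈ 𝓗.Rc n, ∑ r ∈ 𝓗.Rc n, ∑ q ∈ 𝓗.Rc n,
        B (p.1 * 𝓗.antipode q.1 * 𝓗.antipode r.1) (p.2 * q.2 * 𝓗.antipode r.2) :=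
        Finset.sum_comm
    _ = _ := Finset.sum_congr rfl fun p _ => key p

/-! ### The Drinfeld element and the charmed element -/

/-- The Drinfeld element `u = S(t) s`. -/
def drinfeld : H := pairing 𝓗.R ((LinearMap.mul b H ∘ₗ 𝓗.antipode).flip)

/-- The inverse `t S²(s)` of the Drinfeld element. -/
def drinfeldInv : H :=
  pairing 𝓗.R ((LinearMap.mul b H).compl₂ (𝓗.antipode ∘ₗ 𝓗.antipode)).flip

theorem trunc_drinfeld (n : ℕ) : trunc I H n 𝓗.drinfeld =
    trunc I H n (∑ r ∈ 𝓗.Rc n, 𝓗.antipode r.2 * r.1) := by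
  rw [drinfeld, trunc_pairing, map_sum]
  rfl

theorem trunc_drinfeldInv (n : ℕ) : trunc I H n 𝓗.drinfeldInv =
    trunc I H n (∑ r ∈ 𝓗.Rc n, r.2 * 𝓗.antipode (𝓗.antipode r.1)) := by
  rw [drinfeldInv, trunc_pairing, map_sum]
  rfl

/-- Drinfeld's computation. The sum of S²(x''') S(t x'') s x' contracts to u x, because
S²(x''')S(x'') = S(x''S(x''')). By R Δ = Δ' R it is also the sum of S²(x''') S(x' t) x'' s, which
contracts to S²(x) u. -/
theorem antipode_antipode_mul_drinfeld (x : H) :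
    𝓗.antipode (𝓗.antipode x) * 𝓗.drinfeld = 𝓗.drinfeld * x := by
  refine eq_of_trunc (I := I) fun n => ?_
  rw [trunc_mul rfl (𝓗.trunc_drinfeld n), trunc_mul (𝓗.trunc_drinfeld n) rfl]
  set q := trunc I H n
  set S := 𝓗.antipode with hS
  have h1 : ∑ d ∈ 𝓗.D n x, ∑ e ∈ 𝓗.D n d.2, ∑ r ∈ 𝓗.Rc n,
      q (S (S e.2) * S (r.2 * e.1) * (r.1 * d.1)) = q ((∑ r ∈ 𝓗.Rc n, S r.2 * r.1) * x) := by
    rw [← 𝓗.sum_D_counit_right (f := fun z => q ((∑ r ∈ 𝓗.Rc n, S r.2 * r.1) * z))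
      (by constructor <;> intros <;> simp [mul_add, add_mul])]
    refine Finset.sum_congr rfl fun d _ => ?_
    rw [Finset.sum_comm, Finset.sum_mul, map_sum, Finset.smul_sum]
    refine Finset.sum_congr rfl fun r _ => ?_
    have := 𝓗.sum_D_antipode_right (f := fun z => q (S z * (S r.2 * r.1 * d.1)))
        (by constructor <;> intros <;> simp [mul_add, add_mul]) d.2
    simpa [mul_assoc, hS, antipode_mul_antidistrib, antipode_one] using this
  have h2 : ∑ d ∈ 𝓗.D n x, ∑ e ∈ 𝓗.D n d.1, ∑ r ∈ 𝓗.Rc n,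
      q (S (S d.2) * S (e.1 * r.2) * (e.2 * r.1)) =
        q (S (S x) * ∑ r ∈ 𝓗.Rc n, S r.2 * r.1) := by
    rw [← 𝓗.sum_D_counit_left (f := fun z => q (S (S z) * ∑ r ∈ 𝓗.Rc n, S r.2 * r.1))
      (by constructor <;> intros <;> simp [mul_add, add_mul])]
    refine Finset.sum_congr rfl fun d _ => ?_
    rw [Finset.sum_comm, Finset.mul_sum, map_sum, Finset.smul_sum]
    refine Finset.sum_congr rfl fun r _ => ?_
    have := 𝓗.sum_D_antipode_left (f := fun z => q (S (S d.2) * S r.2 * z * r.1))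
        (by constructor <;> intros <;> simp [mul_add, add_mul]) d.1
    simpa [mul_assoc, hS, antipode_mul_antidistrib, antipode_one] using this
  rw [← h1, ← h2, ← 𝓗.sum_D_coassoc
    (T := fun a c d => ∑ r ∈ 𝓗.Rc n, q (S (S d) * S (r.2 * c) * (r.1 * a)))]
  · refine Finset.sum_congr rfl fun d _ => ?_
    rw [← 𝓗.sum_R_D (B := fun a c => q (S (S d.2) * S c * a))
      (by constructor <;> intros <;> constructor <;> intros <;> simp [mul_add, add_mul])]
    exact Finset.sum_comm
  · constructor <;> intros <;> constructor <;> intros <;> (try constructor) <;> intros <;>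
      simp [mul_add, add_mul, Finset.sum_add_distrib, Finset.smul_sum]

/-- The formula t S²(s) needs no inverse of S. Moving u past t gives S²(t) u S²(s). Since (S ⊗ S)(R)
= R, this is the sum of S(t) S(t') s' S(s) = S(t't) s' S(s), which collapses by R · (S ⊗ 1)(R) = 1.
-/
theorem drinfeld_mul_drinfeldInv : 𝓗.drinfeld * 𝓗.drinfeldInv = 1 := by
  refine eq_of_trunc (I := I) fun n => ?_
  have h : trunc I H n (𝓗.drinfeld * 𝓗.drinfeldInv) =
      ∑ q ∈ 𝓗.Rc n, ∑ r ∈ 𝓗.Rc n,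
        trunc I H n (𝓗.antipode (𝓗.antipode q.2) * (𝓗.antipode r.2 * r.1) *
          𝓗.antipode (𝓗.antipode q.1)) := by
    rw [trunc_mul rfl (𝓗.trunc_drinfeldInv n), Finset.mul_sum, map_sum]
    refine Finset.sum_congr rfl fun q _ => ?_
    rw [← mul_assoc, ← antipode_antipode_mul_drinfeld,
      trunc_mul (trunc_mul rfl (𝓗.trunc_drinfeld n)) rfl, Finset.mul_sum, Finset.sum_mul, map_sum]
  have h2 := 𝓗.sum_R_antipode_antipode (n := n) (B := fun s t => ∑ r ∈ 𝓗.Rc n,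
      trunc I H n (𝓗.antipode t * (𝓗.antipode r.2 * r.1) * 𝓗.antipode s))
    (by constructor <;> intros <;> constructor <;> intros <;>
      simp [mul_add, add_mul, Finset.sum_add_distrib, Finset.smul_sum])
  have h3 := 𝓗.sum_R_mul_antipode (n := n) (B := fun s t => trunc I H n (𝓗.antipode t * s))
    (by constructor <;> intros <;> constructor <;> intros <;> simp [mul_add, add_mul])
  rw [h, h2, Finset.sum_comm]
  simpa [antipode_mul_antidistrib, antipode_one, mul_assoc] using h3

/-- The commutation rule applied to the right inverse v of u gives S²(v) u = u v = 1. So u also has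
a left inverse, which must coincide with v. -/
theorem drinfeldInv_mul_drinfeld : 𝓗.drinfeldInv * 𝓗.drinfeld = 1 := by
  have h := 𝓗.antipode_antipode_mul_drinfeld 𝓗.drinfeldInv
  rw [drinfeld_mul_drinfeldInv] at h
  have : 𝓗.antipode (𝓗.antipode 𝓗.drinfeldInv) = 𝓗.drinfeldInv := by
    rw [← mul_one (𝓗.antipode _), ← 𝓗.drinfeld_mul_drinfeldInv, ← mul_assoc, h, one_mul]
  rwa [this] at h

/-- `S(u⁻¹) = S²(s) t`. -/
theorem trunc_antipode_drinfeldInv (n : ℕ) : trunc I H n (𝓗.antipode 𝓗.drinfeldInv) =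
    trunc I H n (∑ r ∈ 𝓗.Rc n, 𝓗.antipode (𝓗.antipode r.1) * r.2) := by
  have h := 𝓗.sum_R_antipode_antipode (n := n)
    (B := fun s t => trunc I H n (𝓗.antipode (𝓗.antipode s) * t))
    (by constructor <;> intros <;> constructor <;> intros <;> simp [mul_add, add_mul])
  rw [map_sum, ← h, drinfeldInv, map_pairing, trunc_pairing]
  simp [antipode_mul_antidistrib, Rc]

/-- `S(u) = s S(t)`. -/
theorem trunc_antipode_drinfeld (n : ℕ) : trunc I H n (𝓗.antipode 𝓗.drinfeld) =
    trunc I H n (∑ r ∈ 𝓗.Rc n, r.1 * 𝓗.antipode r.2) := by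
  have h := 𝓗.sum_R_antipode_antipode (n := n)
    (B := fun s t => trunc I H n (s * 𝓗.antipode t))
    (by constructor <;> intros <;> constructor <;> intros <;> simp [mul_add, add_mul])
  rw [map_sum, ← h, drinfeld, map_pairing, trunc_pairing]
  simp [antipode_mul_antidistrib, Rc]

theorem antipode_drinfeldInv_mul (x : H) : 𝓗.antipode 𝓗.drinfeldInv * 𝓗.antipode x =
    𝓗.antipode (𝓗.antipode (𝓗.antipode x)) * 𝓗.antipode 𝓗.drinfeldInv := by
  have h : x * 𝓗.drinfeldInv = 𝓗.drinfeldInv * 𝓗.antipode (𝓗.antipode x) := by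
    calc x * 𝓗.drinfeldInv = 𝓗.drinfeldInv * (𝓗.drinfeld * x) * 𝓗.drinfeldInv := by
          rw [← mul_assoc, drinfeldInv_mul_drinfeld, one_mul]
      _ = _ := by
          rw [← antipode_antipode_mul_drinfeld, mul_assoc, mul_assoc, drinfeld_mul_drinfeldInv,
            mul_one]
  have := congrArg 𝓗.antipode h
  rwa [antipode_mul_antidistrib, antipode_mul_antidistrib] at this

/-- The map `B` is designed to undo R₂₁R by two factors (S ⊗ 1)(R) before x ⊗ y is contracted to
S(x)y. On R₂₁RΔ(θ) it therefore yields the sum of S(θ')θ'', which is ε(θ) = 1. On θ ⊗ θ the two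
factors contract to inverse Drinfeld elements, which gives θ² u⁻¹ S(u⁻¹). -/
theorem θ_mul_θ_mul : (𝓗.θ : H) * 𝓗.θ * (𝓗.drinfeldInv * 𝓗.antipode 𝓗.drinfeldInv) = 1 := by
  refine eq_of_trunc (I := I) fun n => ?_
  set q := trunc I H n
  set S := 𝓗.antipode with hS
  set B : H → H → Trunc I H n := fun x y => ∑ r ∈ 𝓗.Rc n, ∑ p ∈ 𝓗.Rc n,
    q (S (S r.1 * (p.2 * x)) * (r.2 * (S p.1 * y))) with hB
  have hlin : IsBil b B := by
    constructor <;> intros <;> constructor <;> intros <;>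
      simp [hB, mul_add, add_mul, Finset.sum_add_distrib, Finset.smul_sum]
  have h1 := 𝓗.sum_R_θ hlin
  have h2 : ∑ r ∈ 𝓗.Rc n, ∑ p ∈ 𝓗.Rc n, ∑ d ∈ 𝓗.D n 𝓗.θ,
      B (r.2 * p.1 * d.1) (r.1 * p.2 * d.2) = q 1 := by
    have e1 : ∀ x y : H, ∑ r ∈ 𝓗.Rc n, B (r.2 * x) (r.1 * y) =
        ∑ r ∈ 𝓗.Rc n, q (S (S r.1 * x) * (r.2 * y)) := by
      intro x y
      simp only [hB]
      rw [Finset.sum_comm]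
      refine Finset.sum_congr rfl fun r _ => ?_
      rw [Finset.sum_comm]
      have := 𝓗.sum_R_antipode_mul (n := n)
        (B := fun s t => q (S (S r.1 * (t * x)) * (r.2 * (s * y))))
        (by constructor <;> intros <;> constructor <;> intros <;> simp [mul_add, add_mul])
      simpa [mul_assoc] using this
    have e2 : ∀ x y : H, ∑ r ∈ 𝓗.Rc n, ∑ p ∈ 𝓗.Rc n, B (r.2 * p.1 * x) (r.1 * p.2 * y) =
        q (S x * y) := by
      intro x y
      rw [Finset.sum_comm]
      simp only [mul_assoc, e1]
      rw [Finset.sum_comm]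
      have := 𝓗.sum_R_antipode_mul (n := n) (B := fun s t => q (S (s * x) * (t * y)))
        (by constructor <;> intros <;> constructor <;> intros <;> simp [mul_add, add_mul])
      simpa [mul_assoc] using this
    have e3 : ∑ r ∈ 𝓗.Rc n, ∑ p ∈ 𝓗.Rc n, ∑ d ∈ 𝓗.D n 𝓗.θ,
        B (r.2 * p.1 * d.1) (r.1 * p.2 * d.2) = ∑ d ∈ 𝓗.D n 𝓗.θ, q (S d.1 * d.2) := by
      simp only [← e2]
      rw [Finset.sum_comm]
      refine (Finset.sum_congr rfl fun r _ => Finset.sum_comm).trans ?_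
      rw [Finset.sum_comm]
      refine (Finset.sum_congr rfl fun r _ => Finset.sum_comm)
    rw [e3]
    have := 𝓗.sum_D_antipode_left (f := fun z => q z)
        (by constructor <;> intros <;> simp) 𝓗.θ
    simpa [𝓗.counit_θ] using this
  have h3 : B 𝓗.θ 𝓗.θ = q (𝓗.θ * 𝓗.θ * (𝓗.drinfeldInv * S 𝓗.drinfeldInv)) := by
    have e1 : ∀ p : H × H, ∑ r ∈ 𝓗.Rc n, q (S (S r.1 * (p.2 * 𝓗.θ)) * (r.2 * (S p.1 * 𝓗.θ))) =
        q (𝓗.θ * 𝓗.θ * (S p.2 * (S (S (S p.1)) * S 𝓗.drinfeldInv))) := by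
      intro p
      rw [hS, ← antipode_drinfeldInv_mul, ← hS, ← mul_assoc (S p.2), ← mul_assoc (𝓗.θ * 𝓗.θ : H),
        trunc_mul (trunc_mul rfl (trunc_mul rfl (𝓗.trunc_antipode_drinfeldInv n))) rfl]
      simp only [Finset.mul_sum, Finset.sum_mul, map_sum]
      refine Finset.sum_congr rfl fun r _ => ?_
      congr 1
      simp only [hS, antipode_mul_antidistrib, antipode_θ, mul_assoc]
      rw [← 𝓗.θ_central (𝓗.antipode p.1)]
      congr 1
      rw [← mul_assoc r.2, ← 𝓗.θ_central r.2]
      simp only [mul_assoc]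
      rw [← mul_assoc _ (𝓗.θ : H), ← 𝓗.θ_central, mul_assoc, ← mul_assoc _ (𝓗.θ : H),
        ← 𝓗.θ_central, mul_assoc]
    simp only [hB]
    rw [Finset.sum_comm]
    simp only [e1]
    have h4 := 𝓗.sum_R_antipode_antipode (n := n) (B := fun s t =>
      q (𝓗.θ * 𝓗.θ * (t * (S (S s) * S 𝓗.drinfeldInv))))
      (by constructor <;> intros <;> constructor <;> intros <;> simp [mul_add, add_mul])
    rw [← hS] at h4
    rw [h4, trunc_mul rfl (trunc_mul (𝓗.trunc_drinfeldInv n) rfl)]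
    simp only [Finset.mul_sum, Finset.sum_mul, map_sum, mul_assoc]
    rfl
  rw [← h3, ← h1, h2]

theorem drinfeld_mul_antipode_drinfeld : 𝓗.antipode 𝓗.drinfeld * 𝓗.drinfeld = 𝓗.θ * 𝓗.θ := by
  have h : 𝓗.antipode 𝓗.drinfeldInv * 𝓗.antipode 𝓗.drinfeld = 1 := by
    rw [← antipode_mul_antidistrib, drinfeld_mul_drinfeldInv, antipode_one]
  calc 𝓗.antipode 𝓗.drinfeld * 𝓗.drinfeld =
      𝓗.θ * 𝓗.θ * (𝓗.drinfeldInv * 𝓗.antipode 𝓗.drinfeldInv) *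
        (𝓗.antipode 𝓗.drinfeld * 𝓗.drinfeld) := by rw [θ_mul_θ_mul, one_mul]
    _ = 𝓗.θ * 𝓗.θ * (𝓗.drinfeldInv * ((𝓗.antipode 𝓗.drinfeldInv * 𝓗.antipode 𝓗.drinfeld) *
        𝓗.drinfeld)) := by simp only [mul_assoc]
    _ = 𝓗.θ * 𝓗.θ := by rw [h, one_mul, drinfeldInv_mul_drinfeld, mul_one]

theorem charm_eq : 𝓗.charm = ↑𝓗.θ⁻¹ * 𝓗.drinfeld := by
  rw [charm, drinfeld, pairing_apply]
  congr 1
  change cint I _ _ = _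
  congr 2
  ext
  simp

theorem charmInv_eq : 𝓗.charmInv = 𝓗.antipode 𝓗.drinfeld * ↑𝓗.θ⁻¹ := by
  rw [charmInv, charm_eq, antipode_mul_antidistrib, antipode_θ_inv]

/-- With k = θ⁻¹u and θ central this is S(u)u = θ². -/
theorem charmInv_mul_charm : 𝓗.charmInv * 𝓗.charm = 1 := by
  rw [charm_eq, charmInv_eq, mul_assoc, θ_inv_central 𝓗 𝓗.drinfeld,
    ← mul_assoc (↑𝓗.θ⁻¹ : H), θ_inv_central 𝓗 𝓗.drinfeld, ← mul_assoc, ← mul_assoc,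
    drinfeld_mul_antipode_drinfeld, mul_assoc (𝓗.θ : H), Units.mul_inv, mul_one, Units.mul_inv]

/-- The element u⁻¹θ is a right inverse of k, hence it equals the left inverse S(k). -/
theorem charm_mul_charmInv : 𝓗.charm * 𝓗.charmInv = 1 := by
  have h : 𝓗.charm * (𝓗.drinfeldInv * 𝓗.θ) = 1 := by
    rw [charm_eq, mul_assoc, ← mul_assoc 𝓗.drinfeld, drinfeld_mul_drinfeldInv, one_mul,
      Units.inv_mul]
  have : 𝓗.charmInv = 𝓗.drinfeldInv * 𝓗.θ := by
    rw [← mul_one 𝓗.charmInv, ← h, ← mul_assoc, charmInv_mul_charm, one_mul]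
  rw [this, h]

theorem antipode_antipode_mul_charm (x : H) :
    𝓗.antipode (𝓗.antipode x) * 𝓗.charm = 𝓗.charm * x := by
  rw [charm_eq, ← mul_assoc, ← θ_inv_central, mul_assoc, antipode_antipode_mul_drinfeld, mul_assoc]

theorem mul_charmInv (x : H) :
    x * 𝓗.charmInv = 𝓗.charmInv * 𝓗.antipode (𝓗.antipode x) := by
  calc x * 𝓗.charmInv = 𝓗.charmInv * (𝓗.charm * x) * 𝓗.charmInv := by
        rw [← mul_assoc, charmInv_mul_charm, one_mul]
    _ = _ := by
        rw [← antipode_antipode_mul_charm, mul_assoc, mul_assoc, charm_mul_charmInv, mul_one]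

/-- The two sides are the values of a kink on either side of a strand. Both are θ⁻¹: the left side
is u⁻¹k, because t S²(s) k = t k s, and the right side is k⁻¹S(u⁻¹). This is what the framing
equivalence requires. -/
theorem sum_R_charm (n : ℕ) : ∑ r ∈ 𝓗.Rc n, trunc I H n (r.2 * 𝓗.charm * r.1) =
    ∑ r ∈ 𝓗.Rc n, trunc I H n (r.1 * 𝓗.charmInv * r.2) := by
  have h1 : ∑ r ∈ 𝓗.Rc n, trunc I H n (r.2 * 𝓗.charm * r.1) =
      trunc I H n (𝓗.drinfeldInv * 𝓗.charm) := by
    rw [trunc_mul (𝓗.trunc_drinfeldInv n) rfl, Finset.sum_mul, map_sum]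
    simp only [mul_assoc, antipode_antipode_mul_charm]
  have h2 : ∑ r ∈ 𝓗.Rc n, trunc I H n (r.1 * 𝓗.charmInv * r.2) =
      trunc I H n (𝓗.charmInv * 𝓗.antipode 𝓗.drinfeldInv) := by
    rw [trunc_mul rfl (𝓗.trunc_antipode_drinfeldInv n), Finset.mul_sum, map_sum]
    simp only [mul_charmInv, mul_assoc]
  have h3 : 𝓗.drinfeldInv * 𝓗.charm = ↑𝓗.θ⁻¹ := by
    rw [charm_eq, ← mul_assoc, ← θ_inv_central, mul_assoc, drinfeldInv_mul_drinfeld, mul_one]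
  have h4 : 𝓗.charmInv * 𝓗.antipode 𝓗.drinfeldInv = ↑𝓗.θ⁻¹ := by
    rw [charmInv_eq, ← θ_inv_central, mul_assoc, ← antipode_mul_antidistrib,
      drinfeldInv_mul_drinfeld, antipode_one, mul_one]
  rw [h1, h2, h3, h4]

/-- The same for kinks of the other sign. After S² has been moved past k or k⁻¹, both sides become
S(u) θ⁻¹ u. -/
theorem sum_R_antipode_charm (n : ℕ) :
    ∑ r ∈ 𝓗.Rc n, trunc I H n (𝓗.antipode r.1 * 𝓗.charm * r.2) =
      ∑ r ∈ 𝓗.Rc n, trunc I H n (r.2 * 𝓗.charmInv * 𝓗.antipode r.1) := by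
  have h1 : ∑ r ∈ 𝓗.Rc n, trunc I H n (𝓗.antipode r.1 * 𝓗.charm * r.2) =
      trunc I H n (𝓗.antipode 𝓗.drinfeld * 𝓗.charm) := by
    rw [trunc_mul (𝓗.trunc_antipode_drinfeld n) rfl, Finset.sum_mul, map_sum]
    simp only [mul_assoc, ← antipode_antipode_mul_charm]
    exact 𝓗.sum_R_antipode_antipode (n := n)
      (B := fun s t => trunc I H n (s * (𝓗.antipode t * 𝓗.charm)))
      (by constructor <;> intros <;> constructor <;> intros <;> simp [mul_add, add_mul])
  have h2 : ∑ r ∈ 𝓗.Rc n, trunc I H n (r.2 * 𝓗.charmInv * 𝓗.antipode r.1) =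
      trunc I H n (𝓗.charmInv * 𝓗.drinfeld) := by
    rw [trunc_mul rfl (𝓗.trunc_drinfeld n), Finset.mul_sum, map_sum]
    simp only [mul_charmInv, mul_assoc]
    exact 𝓗.sum_R_antipode_antipode (n := n)
      (B := fun s t => trunc I H n (𝓗.charmInv * (𝓗.antipode t * s)))
      (by constructor <;> intros <;> constructor <;> intros <;> simp [mul_add, add_mul])
  have h3 : 𝓗.antipode 𝓗.drinfeld * 𝓗.charm = 𝓗.charmInv * 𝓗.drinfeld := by
    rw [charm_eq, charmInv_eq, mul_assoc]
  rw [h1, h2, h3]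

end Antipode

end RibbonHopfAlgebra

/-! ## Functionals on a ribbon Hopf algebra -/

namespace RibbonHopfAlgebra

variable {b H : Type*} [CommRing b] {I : Ideal b} [IsAdicComplete I b] [Ring H] [Algebra b H]
  (𝓗 : RibbonHopfAlgebra I H)

/-- The product of functionals that is dual to the comultiplication. -/
def conv : (H →ₗ[b] b) →ₗ[b] (H →ₗ[b] b) →ₗ[b] H →ₗ[b] b :=
  LinearMap.mk₂ b (fun f g => 𝓗.dInt ((LinearMap.mul b b).compl₁₂ f g))
    (by intros; rw [← map_add]; congr 1; ext; simp [add_mul])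
    (by intros; rw [← map_smul]; congr 1; ext; simp [mul_assoc, mul_left_comm])
    (by intros; rw [← map_add]; congr 1; ext; simp [mul_add])
    (by intros; rw [← map_smul]; congr 1; ext; simp [mul_assoc, mul_left_comm])

/-- The pairing of functionals by the universal `R`-matrix. -/
def rPair : (H →ₗ[b] b) →ₗ[b] (H →ₗ[b] b) →ₗ[b] b :=
  LinearMap.mk₂ b (fun f g => pairing 𝓗.R ((LinearMap.mul b b).compl₁₂ f g))
    (by intros; rw [← map_add]; congr 1; ext; simp [add_mul])
    (by intros; rw [← map_smul]; congr 1; ext; simp [mul_assoc, mul_left_comm])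
    (by intros; rw [← map_add]; congr 1; ext; simp [mul_add])
    (by intros; rw [← map_smul]; congr 1; ext; simp [mul_assoc, mul_left_comm])

variable {n : ℕ}

theorem sum₄_comm {A ι κ μ ν : Type*} [AddCommMonoid A] {s : Finset ι} {t : Finset κ}
    {u : Finset μ} {v : Finset ν} (F : ι → κ → μ → ν → A) :
    ∑ i ∈ s, ∑ j ∈ t, ∑ k ∈ u, ∑ l ∈ v, F i j k l =
      ∑ k ∈ u, ∑ l ∈ v, ∑ i ∈ s, ∑ j ∈ t, F i j k l :=
  calc _ = ∑ i ∈ s, ∑ k ∈ u, ∑ j ∈ t, ∑ l ∈ v, F i j k l :=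
        Finset.sum_congr rfl fun _ _ => Finset.sum_comm
    _ = ∑ k ∈ u, ∑ i ∈ s, ∑ j ∈ t, ∑ l ∈ v, F i j k l := Finset.sum_comm
    _ = ∑ k ∈ u, ∑ i ∈ s, ∑ l ∈ v, ∑ j ∈ t, F i j k l :=
        Finset.sum_congr rfl fun _ _ => Finset.sum_congr rfl fun _ _ => Finset.sum_comm
    _ = _ := Finset.sum_congr rfl fun _ _ => Finset.sum_comm

omit [IsAdicComplete I b] in
theorem isBil_trunc (f g : H →ₗ[b] b) : IsBil b fun y z => trunc I b n (f y * g z) := by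
  constructor <;> intros <;> constructor <;> intros <;>
    simp only [map_add, map_smul, add_mul, mul_add, smul_mul_assoc, mul_smul_comm]

theorem trunc_mul_conv (c : b) (f g : H →ₗ[b] b) (x : H) : trunc I b n (c * 𝓗.conv f g x) =
    ∑ d ∈ 𝓗.D n x, trunc I b n (c * (f d.1 * g d.2)) := by
  have : c * 𝓗.conv f g x = pairing (𝓗.comul x)
      (((LinearMap.mul b b).compl₁₂ f g).compr₂ (LinearMap.mulLeft b c)) := by
    rw [← map_pairing]
    rfl
  rw [this, trunc_pairing]
  rfl

theorem trunc_conv (f g : H →ₗ[b] b) (x : H) : trunc I b n (𝓗.conv f g x) =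
    ∑ d ∈ 𝓗.D n x, trunc I b n (f d.1 * g d.2) := by
  simpa using 𝓗.trunc_mul_conv (n := n) 1 f g x

theorem trunc_rPair (f g : H →ₗ[b] b) : trunc I b n (𝓗.rPair f g) =
    trunc I b n (∑ r ∈ 𝓗.Rc n, f r.1 * g r.2) := by
  rw [map_sum]
  exact trunc_pairing _ _ _

theorem trunc_rPair_mul (f g f' g' : H →ₗ[b] b) :
    trunc I b n (𝓗.rPair f g * 𝓗.rPair f' g') =
      ∑ r ∈ 𝓗.Rc n, ∑ q ∈ 𝓗.Rc n, trunc I b n ((f r.1 * f' q.1) * (g r.2 * g' q.2)) := by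
  rw [trunc_mul (𝓗.trunc_rPair f g) (𝓗.trunc_rPair f' g'), Finset.sum_mul_sum]
  simp only [map_sum]
  refine Finset.sum_congr rfl fun r _ => Finset.sum_congr rfl fun q _ => ?_
  congr 1
  ring

theorem conv_assoc (f g h : H →ₗ[b] b) :
    𝓗.conv (𝓗.conv f g) h = 𝓗.conv f (𝓗.conv g h) := by
  ext x
  refine eq_of_trunc (I := I) fun n => ?_
  have := 𝓗.sum_D_coassoc (n := n) (T := fun x y z => trunc I b n (f x * g y * h z))
    (by constructor <;> intros <;> constructor <;> intros <;> (try constructor) <;> intros <;>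
        simp only [map_add, map_smul, add_mul, mul_add, smul_mul_assoc, mul_smul_comm]) x
  rw [trunc_conv, trunc_conv]
  convert this using 1
  · refine Finset.sum_congr rfl fun d _ => ?_
    rw [mul_comm, trunc_mul_conv]
    refine Finset.sum_congr rfl fun e _ => ?_
    congr 1
    ring
  · refine Finset.sum_congr rfl fun d _ => ?_
    rw [trunc_mul_conv]
    refine Finset.sum_congr rfl fun e _ => ?_
    congr 1
    ring

theorem counit_conv (f : H →ₗ[b] b) : 𝓗.conv 𝓗.counit.toLinearMap f = f := by
  ext x
  exact 𝓗.dInt_counit_left f x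

theorem conv_counit (f : H →ₗ[b] b) : 𝓗.conv f 𝓗.counit.toLinearMap = f := by
  ext x
  rw [← 𝓗.dInt_counit_right f x]
  refine congrArg (fun B => 𝓗.dInt B x) ?_
  ext
  simp [mul_comm]

/-- A finite family of functionals that splits a functional along the multiplication. -/
def Splits {ι : Type*} (s : Finset ι) (f : H →ₗ[b] b) (f₁ f₂ : ι → H →ₗ[b] b) : Prop :=
  ∀ x y, f (x * y) = ∑ i ∈ s, f₁ i x * f₂ i y

variable {ι κ : Type*} {s : Finset ι} {t : Finset κ} {f g : H →ₗ[b] b} {f₁ f₂ : ι → H →ₗ[b] b}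
  {g₁ g₂ : κ → H →ₗ[b] b}

/-- The dual form of (Δ ⊗ 1)R = R₁₃R₂₃. Functionals that split along the multiplication, with `conv`
as product and `rPair` as pairing, satisfy the axioms of a coquasitriangular Hopf algebra. In this
dual form the braid relations become identities between finite sums of scalars. -/
theorem rPair_conv_left (h : Splits s f f₁ f₂) (g g' : H →ₗ[b] b) :
    𝓗.rPair (𝓗.conv g g') f = ∑ i ∈ s, 𝓗.rPair g (f₁ i) * 𝓗.rPair g' (f₂ i) := by
  refine eq_of_trunc (I := I) fun n => ?_
  have := 𝓗.sum_R_comulLeft (n := n) (T := fun x y z => trunc I b n (f z * (g x * g' y)))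
    (by constructor <;> intros <;> constructor <;> intros <;> (try constructor) <;> intros <;>
        simp only [map_add, map_smul, add_mul, mul_add, smul_mul_assoc, mul_smul_comm])
  rw [trunc_rPair, map_sum, map_sum]
  simp only [trunc_rPair_mul]
  rw [Finset.sum_comm]
  simp only [mul_comm _ (f _), trunc_mul_conv]
  rw [this]
  refine Finset.sum_congr rfl fun r _ => ?_
  rw [Finset.sum_comm]
  refine Finset.sum_congr rfl fun q _ => ?_
  rw [h, Finset.sum_mul, map_sum]
  refine Finset.sum_congr rfl fun i _ => ?_
  congr 1
  ring

/-- The order of `g` and `g'` is reversed because (1 ⊗ Δ)R is R₁₃R₁₂ and not R₁₂R₁₃. -/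
theorem rPair_conv_right (h : Splits s f f₁ f₂) (g g' : H →ₗ[b] b) :
    𝓗.rPair f (𝓗.conv g g') = ∑ i ∈ s, 𝓗.rPair (f₁ i) g' * 𝓗.rPair (f₂ i) g := by
  refine eq_of_trunc (I := I) fun n => ?_
  have := 𝓗.sum_R_comulRight (n := n) (T := fun z x y => trunc I b n (f z * (g x * g' y)))
    (by constructor <;> intros <;> constructor <;> intros <;> (try constructor) <;> intros <;>
        simp only [map_add, map_smul, add_mul, mul_add, smul_mul_assoc, mul_smul_comm])
  rw [trunc_rPair, map_sum, map_sum]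
  simp only [trunc_rPair_mul]
  rw [Finset.sum_comm]
  simp only [trunc_mul_conv]
  rw [this]
  refine Finset.sum_congr rfl fun r _ => ?_
  rw [Finset.sum_comm]
  refine Finset.sum_congr rfl fun q _ => ?_
  rw [h, Finset.sum_mul, map_sum]
  refine Finset.sum_congr rfl fun i _ => ?_
  congr 1
  ring

/-- The dual form of `R Δ(x) = Δ'(x) R`. -/
theorem sum_rPair_smul_conv (hf : Splits s f f₁ f₂) (hg : Splits t g g₁ g₂) :
    ∑ i ∈ s, ∑ j ∈ t, 𝓗.rPair (f₁ i) (g₁ j) • 𝓗.conv (f₂ i) (g₂ j) =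
      ∑ i ∈ s, ∑ j ∈ t, 𝓗.rPair (f₂ i) (g₂ j) • 𝓗.conv (g₁ j) (f₁ i) := by
  ext x
  refine eq_of_trunc (I := I) fun n => ?_
  have := 𝓗.sum_R_D (n := n) (B := fun y z => trunc I b n (f y * g z))
    (isBil_trunc f g) x
  have key : ∀ k l k' l' : H →ₗ[b] b, trunc I b n (𝓗.rPair k l * 𝓗.conv k' l' x) =
      ∑ r ∈ 𝓗.Rc n, ∑ d ∈ 𝓗.D n x, trunc I b n (k r.1 * l r.2 * (k' d.1 * l' d.2)) := by
    intro k l k' l'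
    rw [trunc_mul (𝓗.trunc_rPair k l) rfl, Finset.sum_mul, map_sum]
    simp only [trunc_mul_conv]
  simp only [LinearMap.sum_apply, LinearMap.smul_apply, smul_eq_mul, map_sum, key]
  have hl : ∀ r d : H × H, trunc I b n (f (r.1 * d.1) * g (r.2 * d.2)) = ∑ i ∈ s, ∑ j ∈ t,
      trunc I b n (f₁ i r.1 * g₁ j r.2 * (f₂ i d.1 * g₂ j d.2)) := by
    intro r d
    rw [hf, hg, Finset.sum_mul_sum]
    simp only [map_sum]
    refine Finset.sum_congr rfl fun i _ => Finset.sum_congr rfl fun j _ => ?_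
    congr 1
    ring
  have hr : ∀ r d : H × H, trunc I b n (f (d.2 * r.1) * g (d.1 * r.2)) = ∑ i ∈ s, ∑ j ∈ t,
      trunc I b n (f₂ i r.1 * g₂ j r.2 * (g₁ j d.1 * f₁ i d.2)) := by
    intro r d
    rw [hf, hg, Finset.sum_mul_sum]
    simp only [map_sum]
    refine Finset.sum_congr rfl fun i _ => Finset.sum_congr rfl fun j _ => ?_
    congr 1
    ring
  simp only [hl, hr] at this
  refine (sum₄_comm _).trans (this.trans ?_)
  rw [Finset.sum_comm]
  exact sum₄_comm _

theorem conv_mul (hf : Splits s f f₁ f₂) (hg : Splits t g g₁ g₂) :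
    Splits (s ×ˢ t) (𝓗.conv f g) (fun p => 𝓗.conv (f₁ p.1) (g₁ p.2))
      (fun p => 𝓗.conv (f₂ p.1) (g₂ p.2)) := by
  intro x y
  refine eq_of_trunc (I := I) fun n => ?_
  have := 𝓗.sum_D_mul (n := n) (B := fun y z => trunc I b n (f y * g z))
    (isBil_trunc f g) x y
  have key : ∀ k l k' l' : H →ₗ[b] b, trunc I b n (𝓗.conv k l x * 𝓗.conv k' l' y) =
      ∑ r ∈ 𝓗.D n x, ∑ d ∈ 𝓗.D n y, trunc I b n (k r.1 * l r.2 * (k' d.1 * l' d.2)) := by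
    intro k l k' l'
    have h1 : trunc I b n (𝓗.conv k l x) = trunc I b n (∑ r ∈ 𝓗.D n x, k r.1 * l r.2) := by
      simp only [trunc_conv, map_sum]
    rw [trunc_mul h1 rfl, Finset.sum_mul, map_sum]
    simp only [trunc_mul_conv]
  rw [trunc_conv, this]
  simp only [map_sum, key]
  symm
  rw [Finset.sum_comm]
  refine Finset.sum_congr rfl fun r _ => ?_
  rw [Finset.sum_comm]
  refine Finset.sum_congr rfl fun d _ => ?_
  rw [hf, hg, Finset.sum_mul_sum, ← Finset.sum_product', map_sum]
  refine Finset.sum_congr rfl fun i _ => ?_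
  congr 1
  ring

section

variable [IsAdicComplete I H]

theorem rPair_counit_left (f : H →ₗ[b] b) : 𝓗.rPair 𝓗.counit.toLinearMap f = f 1 := by
  have := congrArg f 𝓗.counit_left_R
  rw [map_pairing] at this
  rw [← this]
  refine congrArg (pairing 𝓗.R) ?_
  ext
  simp

theorem rPair_counit_right (f : H →ₗ[b] b) : 𝓗.rPair f 𝓗.counit.toLinearMap = f 1 := by
  have := congrArg f 𝓗.counit_right_R
  rw [map_pairing] at this
  rw [← this]
  refine congrArg (pairing 𝓗.R) ?_
  ext
  simp [mul_comm]

theorem rPair_antipode (f g : H →ₗ[b] b) :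
    𝓗.rPair (f ∘ₗ 𝓗.antipode) (g ∘ₗ 𝓗.antipode) = 𝓗.rPair f g := by
  refine eq_of_trunc (I := I) fun n => ?_
  rw [trunc_rPair, trunc_rPair, map_sum, map_sum]
  exact 𝓗.sum_R_antipode_antipode (n := n) (B := fun y z => trunc I b n (f y * g z))
    (isBil_trunc f g)

/-- The dual form of (S ⊗ 1)(R) R = 1. For matrix coefficients it says that a crossing followed by
the opposite one is the identity. -/
theorem sum_rPair_antipode_mul (hf : Splits s f f₁ f₂) (hg : Splits t g g₁ g₂) :
    ∑ i ∈ s, ∑ j ∈ t, 𝓗.rPair (f₁ i ∘ₗ 𝓗.antipode) (g₁ j) * 𝓗.rPair (f₂ i) (g₂ j) =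
      f 1 * g 1 := by
  refine eq_of_trunc (I := I) fun n => ?_
  have := 𝓗.sum_R_antipode_mul (n := n) (B := fun y z => trunc I b n (f y * g z))
    (isBil_trunc f g)
  rw [← this]
  simp only [map_sum, trunc_rPair_mul]
  rw [sum₄_comm]
  refine Finset.sum_congr rfl fun p _ => Finset.sum_congr rfl fun q _ => ?_
  rw [hf, hg, Finset.sum_mul_sum]
  simp only [map_sum]
  rfl

theorem sum_rPair_mul_antipode (hf : Splits s f f₁ f₂) (hg : Splits t g g₁ g₂) :
    ∑ i ∈ s, ∑ j ∈ t, 𝓗.rPair (f₁ i) (g₁ j) * 𝓗.rPair (f₂ i ∘ₗ 𝓗.antipode) (g₂ j) =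
      f 1 * g 1 := by
  refine eq_of_trunc (I := I) fun n => ?_
  have := 𝓗.sum_R_mul_antipode (n := n) (B := fun y z => trunc I b n (f y * g z))
    (isBil_trunc f g)
  rw [← this]
  simp only [map_sum, trunc_rPair_mul]
  rw [sum₄_comm]
  refine Finset.sum_congr rfl fun p _ => Finset.sum_congr rfl fun q _ => ?_
  rw [hf, hg, Finset.sum_mul_sum]
  simp only [map_sum]
  rfl

end

theorem sum_conv_antipode_left (hf : Splits s f f₁ f₂) :
    ∑ i ∈ s, 𝓗.conv (f₁ i ∘ₗ 𝓗.antipode) (f₂ i) = f 1 • 𝓗.counit.toLinearMap := by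
  ext x
  refine eq_of_trunc (I := I) fun n => ?_
  have := 𝓗.sum_D_antipode_left (n := n) (f := fun y => trunc I b n (f y))
    (by constructor <;> intros <;> simp only [map_add, map_smul]) x
  simp only [LinearMap.sum_apply, map_sum, trunc_conv]
  simp only [hf _ _, map_sum] at this
  rw [Finset.sum_comm]
  have h2 : (f 1 • 𝓗.counit.toLinearMap) x = 𝓗.counit x • f 1 := by simp [mul_comm]
  rw [h2, map_smul]
  exact this

theorem sum_conv_antipode_right (hf : Splits s f f₁ f₂) :
    ∑ i ∈ s, 𝓗.conv (f₁ i) (f₂ i ∘ₗ 𝓗.antipode) = f 1 • 𝓗.counit.toLinearMap := by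
  ext x
  refine eq_of_trunc (I := I) fun n => ?_
  have := 𝓗.sum_D_antipode_right (n := n) (f := fun y => trunc I b n (f y))
    (by constructor <;> intros <;> simp only [map_add, map_smul]) x
  simp only [LinearMap.sum_apply, map_sum, trunc_conv]
  simp only [hf _ _, map_sum] at this
  rw [Finset.sum_comm]
  have h2 : (f 1 • 𝓗.counit.toLinearMap) x = 𝓗.counit x • f 1 := by simp [mul_comm]
  rw [h2, map_smul]
  exact this

end RibbonHopfAlgebra

/-! ## Words -/

section Words

variable {Pt : Type*} [Fintype Pt] {A : Type*} [AddCommMonoid A]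

variable (Pt) in
/-- The words of given length in a finite alphabet. -/
def words : ℕ → Finset (List Pt)
  | 0 => {[]}
  | n + 1 => ((Finset.univ : Finset Pt) ×ˢ words n).map
      ⟨fun p => p.1 :: p.2, fun p q h => by
        rw [List.cons.injEq] at h
        exact Prod.ext h.1 h.2⟩

theorem mem_words {n : ℕ} {a : List Pt} : a ∈ words Pt n ↔ a.length = n := by
  induction n generalizing a with
  | zero => simp [words]
  | succ n ih =>
    cases a with
    | nil => simp [words]
    | cons z a =>
      rw [words, Finset.mem_map]
      constructor
      · rintro ⟨⟨y, c⟩, hc, h⟩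
        obtain ⟨-, rfl⟩ := List.cons.inj h
        simpa [ih] using hc
      · intro h
        exact ⟨(z, a), by simpa [ih] using h, rfl⟩

theorem sum_words_zero (F : List Pt → A) : ∑ a ∈ words Pt 0, F a = F [] := by
  simp [words]

theorem sum_words_succ (n : ℕ) (F : List Pt → A) :
    ∑ a ∈ words Pt (n + 1), F a = ∑ z, ∑ a ∈ words Pt n, F (z :: a) := by
  rw [words, Finset.sum_map, Finset.sum_product]
  rfl

theorem sum_words_two (F : List Pt → A) :
    ∑ a ∈ words Pt 2, F a = ∑ x, ∑ y, F [x, y] := by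
  simp only [sum_words_succ, sum_words_zero]

theorem sum_words_add (m n : ℕ) (F : List Pt → A) :
    ∑ a ∈ words Pt (m + n), F a = ∑ a ∈ words Pt m, ∑ c ∈ words Pt n, F (a ++ c) := by
  induction m generalizing F with
  | zero => simp [sum_words_zero]
  | succ m ih =>
    rw [Nat.succ_add, sum_words_succ, sum_words_succ]
    exact Finset.sum_congr rfl fun z _ => ih _

theorem sum_words_reverse (n : ℕ) (F : List Pt → A) :
    ∑ a ∈ words Pt n, F a.reverse = ∑ a ∈ words Pt n, F a :=
  Finset.sum_nbij' List.reverse List.reverse (by simp [mem_words]) (by simp [mem_words])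
    (by simp) (by simp) (by simp)

end Words

/-! ## Preliminaries -/

theorem trunc_congr {b P Q : Type*} [CommRing b] {I : Ideal b} [AddCommGroup P] [Module b P]
    [AddCommGroup Q] [Module b Q] {n : ℕ} (f : P →ₗ[b] Q) {x y : P}
    (h : trunc I P n x = trunc I P n y) : trunc I Q n (f x) = trunc I Q n (f y) := by
  rw [← sub_eq_zero, ← map_sub] at h ⊢
  rw [← map_sub, trunc, Submodule.mkQ_apply, Submodule.Quotient.mk_eq_zero] at *
  exact Submodule.smul_top_le_comap_smul_top (I ^ n) f h

/-! ## Matrix models of a family of modules -/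

section

variable {b H : Type*} [CommRing b] {I : Ideal b} [IsAdicComplete I b] [Ring H] [Algebra b H]
  [IsAdicComplete I H]

/-- Matrix coefficients of a family of modules and of their duals, with the evaluations and
coevaluations, such that the trace in the module of colour `c` is `χ c`.  A point `z` is a basis
vector of the module of colour `(ty z).1`, or of its dual if `(ty z).2 = false`. -/
structure Model (𝓗 : RibbonHopfAlgebra I H) {C : Type*} (χ : C → H →ₗ[b] b) (Pt : Type*)
    [Fintype Pt] where
  /-- colour and direction of a basis vector -/
  ty : Pt → C × Bool
  /-- matrix coefficients -/
  coef : Pt → Pt → H →ₗ[b] b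
  /-- evaluations -/
  cap : Pt → Pt → b
  /-- coevaluations -/
  cup : C → Bool → Pt → Pt → b
  coef_one_self : ∀ x, coef x x 1 = 1
  coef_one_ne : ∀ x y, x ≠ y → coef x y 1 = 0
  coef_mul : ∀ x y, RibbonHopfAlgebra.Splits Finset.univ (coef x y) (coef x) (fun z => coef z y)
  coef_eq_zero : ∀ x y, ty x ≠ ty y → coef x y = 0
  cup_eq_zero : ∀ c d x y, ¬ (ty x = (c, d) ∧ ty y = (c, !d)) → cup c d x y = 0
  -- Evaluations and coevaluations are invariant under H. The invariance is stated as the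
  -- possibility of moving the action from one leg to the other at the cost of an antipode; this is
  -- how strands slide over local extrema.
  cap_coef : ∀ x z, ∑ x', cap x' z • coef x' x = ∑ z', cap x z' • (coef z' z ∘ₗ 𝓗.antipode)
  cup_coef : ∀ c d x z, ∑ z', cup c d x z' • coef z z' =
    ∑ x', cup c d x' z • (coef x x' ∘ₗ 𝓗.antipode)
  cap_cup : ∀ c d x y, ty x = (c, !d) → ∑ z, cap x z * cup c d z y = coef x y 1
  cup_cap : ∀ c d x y, ty y = (c, d) → ∑ z, cup c d x z * cap z y = coef x y 1
  -- A coevaluation closed on the side opposite to the zigzag side acts by k or its inverse, through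
  -- which a module is identified with its double dual. These two conditions produce the factors k
  -- in kinks and in joined edges.
  cup_cap_right : ∀ c d x y, ty y = (c, d) → ∑ z, cup c d x z * cap y z = coef x y 𝓗.charm
  cup_cap_left : ∀ c d x y, ty y = (c, !d) → ∑ z, cup c d z x * cap z y = coef x y 𝓗.charmInv
  trace_eq : ∀ c, ∃ s : Finset Pt, (∀ z, z ∈ s ↔ ty z = (c, true)) ∧ χ c = ∑ z ∈ s, coef z z

namespace Model

variable {𝓗 : RibbonHopfAlgebra I H} {C : Type*} {χ : C → H →ₗ[b] b} {Pt : Type*} [Fintype Pt]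
  (𝓜 : Model 𝓗 χ Pt)

/-- The matrix of a crossing, with output `(y', x')` and input `(x, y)`. -/
def cross (o : Bool) (y' x' x y : Pt) : b :=
  if o then 𝓗.rPair (𝓜.coef x' x) (𝓜.coef y' y)
  else 𝓗.rPair (𝓜.coef y' y ∘ₗ 𝓗.antipode) (𝓜.coef x' x)

theorem cross_eq_zero (o : Bool) (y' x' x y : Pt) (h : ¬ (𝓜.ty x' = 𝓜.ty x ∧ 𝓜.ty y' = 𝓜.ty y)) :
    𝓜.cross o y' x' x y = 0 := by
  by_cases hx : 𝓜.ty x' = 𝓜.ty x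
  · have hy : 𝓜.ty y' ≠ 𝓜.ty y := fun hy => h ⟨hx, hy⟩
    cases o <;> simp [cross, 𝓜.coef_eq_zero _ _ hy]
  · cases o <;> simp [cross, 𝓜.coef_eq_zero _ _ hx]

theorem coef_mul₃ (x y : Pt) (p q r : H) : 𝓜.coef x y (p * q * r) =
    ∑ z, ∑ w, 𝓜.coef x z p * 𝓜.coef w y r * 𝓜.coef z w q := by
  rw [𝓜.coef_mul, Finset.sum_comm]
  refine Finset.sum_congr rfl fun z _ => ?_
  rw [𝓜.coef_mul, Finset.sum_mul]
  refine Finset.sum_congr rfl fun w _ => ?_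
  ring

theorem sum_coef_one_mul (x : Pt) (F : Pt → b) : ∑ y, 𝓜.coef x y 1 * F y = F x := by
  rw [Finset.sum_eq_single x]
  · rw [𝓜.coef_one_self, one_mul]
  · intro y _ hy
    rw [𝓜.coef_one_ne _ _ (Ne.symm hy), zero_mul]
  · simp

theorem sum_coef_one_mul' (x : Pt) (F : Pt → b) : ∑ y, 𝓜.coef y x 1 * F y = F x := by
  rw [Finset.sum_eq_single x]
  · rw [𝓜.coef_one_self, one_mul]
  · intro y _ hy
    rw [𝓜.coef_one_ne _ _ hy, zero_mul]
  · simp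

/-- The second Reidemeister move. -/
theorem cross_cross (o : Bool) (x'' y'' x y : Pt) :
    ∑ y', ∑ x', 𝓜.cross o y' x' x y * 𝓜.cross (!o) x'' y'' y' x' =
      𝓜.coef x'' x 1 * 𝓜.coef y'' y 1 := by
  cases o
  · have := 𝓗.sum_rPair_mul_antipode (𝓜.coef_mul y'' y) (𝓜.coef_mul x'' x)
    rw [mul_comm, ← this]
    refine Finset.sum_congr rfl fun y' _ => Finset.sum_congr rfl fun x' _ => ?_
    simp [cross, mul_comm]
  · have := 𝓗.sum_rPair_antipode_mul (𝓜.coef_mul x'' x) (𝓜.coef_mul y'' y)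
    rw [← this, Finset.sum_comm]
    refine Finset.sum_congr rfl fun y' _ => Finset.sum_congr rfl fun x' _ => ?_
    simp [cross, mul_comm]

/-- The Yang-Baxter equation. -/
theorem yang_baxter (x y z x' y' z' : Pt) :
    (∑ y₁, ∑ x₁, ∑ z₁, 𝓜.cross true y₁ x₁ x y * (𝓜.cross true z₁ x' x₁ z *
      𝓜.cross true z' y' y₁ z₁)) =
    ∑ z₁, ∑ y₁, ∑ x₁, 𝓜.cross true z₁ y₁ y z * (𝓜.cross true z' x₁ x z₁ *
      𝓜.cross true y' x' x₁ y₁) := by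
  -- The third strand is brought in by pairing the identity R Δ = Δ' R with its matrix coefficient.
  -- Each of the two convolutions then splits into two crossings by (Δ ⊗ 1)R = R₁₃R₂₃.
  have := congrArg (fun f => 𝓗.rPair f (𝓜.coef z' z))
    (𝓗.sum_rPair_smul_conv (𝓜.coef_mul x' x) (𝓜.coef_mul y' y))
  simp only [map_sum, LinearMap.sum_apply, map_smul, LinearMap.smul_apply, smul_eq_mul,
    𝓗.rPair_conv_left (𝓜.coef_mul z' z), Finset.mul_sum] at this
  simp only [cross, if_true]
  symm
  calc _ = _ := ?_
    _ = _ := this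
    _ = _ := ?_
  · rw [Finset.sum_comm]
    rw [Finset.sum_congr rfl fun _ _ => Finset.sum_comm]
    rw [Finset.sum_comm]
    refine Finset.sum_congr rfl fun _ _ => Finset.sum_congr rfl fun _ _ =>
      Finset.sum_congr rfl fun _ _ => ?_
    ring
  · rw [Finset.sum_comm]
    refine Finset.sum_congr rfl fun _ _ => Finset.sum_congr rfl fun _ _ =>
      Finset.sum_congr rfl fun _ _ => ?_
    ring

theorem sum_cap_coef (x z : Pt) (φ : (H →ₗ[b] b) →ₗ[b] b) :
    ∑ x', 𝓜.cap x' z * φ (𝓜.coef x' x) =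
      ∑ z', 𝓜.cap x z' * φ (𝓜.coef z' z ∘ₗ 𝓗.antipode) := by
  simpa [map_sum] using congrArg φ (𝓜.cap_coef x z)

theorem sum_cup_coef (c : C) (d : Bool) (x z : Pt) (φ : (H →ₗ[b] b) →ₗ[b] b) :
    ∑ z', 𝓜.cup c d x z' * φ (𝓜.coef z z') =
      ∑ x', 𝓜.cup c d x' z * φ (𝓜.coef x x' ∘ₗ 𝓗.antipode) := by
  simpa [map_sum] using congrArg φ (𝓜.cup_coef c d x z)

/-- Moving the action from one leg of the cap to the other adds an antipode. For a positive crossing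
this is the antipode in R⁻¹ = (S ⊗ 1)(R); for a negative one there are then two antipodes, which
cancel by (S ⊗ S)(R) = R. -/
theorem cross_cap (o : Bool) (x y z y' : Pt) :
    ∑ x', 𝓜.cross o y' x' x y * 𝓜.cap x' z = ∑ z', 𝓜.cross (!o) z' y' y z * 𝓜.cap x z' := by
  cases o
  · have := 𝓜.sum_cap_coef x z (𝓗.rPair (𝓜.coef y' y ∘ₗ 𝓗.antipode))
    simpa [cross, 𝓗.rPair_antipode, mul_comm] using this
  · have := 𝓜.sum_cap_coef x z (𝓗.rPair.flip (𝓜.coef y' y))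
    simpa [cross, 𝓗.rPair_antipode, mul_comm] using this

theorem cup_cross (o : Bool) (c : C) (d : Bool) (x x' z₁ z₂ : Pt) :
    ∑ z, 𝓜.cup c d z₁ z * 𝓜.cross o x' z₂ z x =
      ∑ z, 𝓜.cup c d z z₂ * 𝓜.cross (!o) z₁ x' x z := by
  cases o
  · have := 𝓜.sum_cup_coef c d z₁ z₂ (𝓗.rPair (𝓜.coef x' x ∘ₗ 𝓗.antipode))
    simpa [cross, 𝓗.rPair_antipode, mul_comm] using this
  · have := 𝓜.sum_cup_coef c d z₁ z₂ (𝓗.rPair.flip (𝓜.coef x' x))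
    simpa [cross, 𝓗.rPair_antipode, mul_comm] using this

/-- A crossing and two coevaluations. -/
theorem cross_cup_cup (o : Bool) (c c' : C) (d d' : Bool) (u v x y : Pt) :
    ∑ p, ∑ q, 𝓜.cross o u v p q * (𝓜.cup c d p x * 𝓜.cup c' d' q y) =
      ∑ p, ∑ q, 𝓜.cross o y x q p * (𝓜.cup c' d' u p * 𝓜.cup c d v q) := by
  cases o
  · have h1 : ∀ q, ∑ p, 𝓜.cup c d p x * 𝓗.rPair (𝓜.coef u q ∘ₗ 𝓗.antipode)
        (𝓜.coef v p) = ∑ p, 𝓜.cup c d p x * 𝓗.rPair (𝓜.coef u q ∘ₗ 𝓗.antipode)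
        (𝓜.coef v p) := fun _ => rfl
    -- Each coevaluation carries one of the two actions to its other leg and adds an antipode, and
    -- the two antipodes cancel. The result is the crossing turned by half a revolution, which is
    -- how it looks from the other end of a band.
    have h2 := fun p => 𝓜.sum_cup_coef c' d' u y (𝓗.rPair.flip (𝓜.coef v p))
    have h3 := fun p => 𝓜.sum_cup_coef c d v x (𝓗.rPair (𝓜.coef y p ∘ₗ 𝓗.antipode))
    simp only [LinearMap.flip_apply, 𝓗.rPair_antipode] at h2 h3
    simp only [cross, Bool.false_eq_true, if_false]
    calc _ = ∑ p, 𝓜.cup c d p x * ∑ q, 𝓜.cup c' d' q y *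
          𝓗.rPair (𝓜.coef u q ∘ₗ 𝓗.antipode) (𝓜.coef v p) := by
          refine Finset.sum_congr rfl fun p _ => ?_
          rw [Finset.mul_sum]
          refine Finset.sum_congr rfl fun q _ => ?_
          ring
      _ = ∑ p, 𝓜.cup c d p x * ∑ q, 𝓜.cup c' d' u q *
          𝓗.rPair (𝓜.coef y q) (𝓜.coef v p) := by simp only [h2]
      _ = ∑ q, 𝓜.cup c' d' u q * ∑ p, 𝓜.cup c d p x *
          𝓗.rPair (𝓜.coef y q) (𝓜.coef v p) := by
          simp only [Finset.mul_sum]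
          rw [Finset.sum_comm]
          refine Finset.sum_congr rfl fun p _ => Finset.sum_congr rfl fun q _ => ?_
          ring
      _ = _ := by
          simp only [← h3, Finset.mul_sum]
          refine Finset.sum_congr rfl fun p _ => Finset.sum_congr rfl fun q _ => ?_
          ring
  · have h2 := fun p => 𝓜.sum_cup_coef c' d' u y (𝓗.rPair (𝓜.coef v p ∘ₗ 𝓗.antipode))
    have h3 := fun p => 𝓜.sum_cup_coef c d v x (𝓗.rPair.flip (𝓜.coef y p))
    simp only [LinearMap.flip_apply, 𝓗.rPair_antipode] at h2 h3
    simp only [cross, if_true]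
    calc _ = ∑ p, 𝓜.cup c d p x * ∑ q, 𝓜.cup c' d' q y *
          𝓗.rPair (𝓜.coef v p) (𝓜.coef u q) := by
          refine Finset.sum_congr rfl fun p _ => ?_
          rw [Finset.mul_sum]
          refine Finset.sum_congr rfl fun q _ => ?_
          ring
      _ = ∑ p, 𝓜.cup c d p x * ∑ q, 𝓜.cup c' d' u q *
          𝓗.rPair (𝓜.coef v p ∘ₗ 𝓗.antipode) (𝓜.coef y q) := by simp only [h2]
      _ = ∑ q, 𝓜.cup c' d' u q * ∑ p, 𝓜.cup c d p x *
          𝓗.rPair (𝓜.coef v p ∘ₗ 𝓗.antipode) (𝓜.coef y q) := by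
          simp only [Finset.mul_sum]
          rw [Finset.sum_comm]
          refine Finset.sum_congr rfl fun p _ => Finset.sum_congr rfl fun q _ => ?_
          ring
      _ = _ := by
          simp only [← h3, Finset.mul_sum]
          refine Finset.sum_congr rfl fun p _ => Finset.sum_congr rfl fun q _ => ?_
          ring

/-- A positive kink on either side of a strand. -/
theorem framing (o : Bool) (c : C) (d : Bool) (x w : Pt) (hx : 𝓜.ty x = (c, d)) :
    ∑ z₁, ∑ z₂, 𝓜.cup c d z₁ z₂ * ∑ x', 𝓜.cross o w x' x z₁ * 𝓜.cap x' z₂ =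
      ∑ z₁, ∑ z₂, 𝓜.cup c (!d) z₁ z₂ * ∑ x', 𝓜.cross o x' w z₂ x * 𝓜.cap z₁ x' := by
  -- The coevaluation and the evaluation of a kink contract to a matrix coefficient of k on the left
  -- side and of k⁻¹ on the right side. Labels of the wrong type are excluded because the crossing
  -- preserves types.
  have hl : ∀ z₁, ∑ z₂, 𝓜.cup c d z₁ z₂ * ∑ x', 𝓜.cross o w x' x z₁ * 𝓜.cap x' z₂ =
      ∑ x', 𝓜.cross o w x' x z₁ * 𝓜.coef z₁ x' 𝓗.charm := by
    intro z₁
    simp only [Finset.mul_sum]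
    rw [Finset.sum_comm]
    refine Finset.sum_congr rfl fun x' _ => ?_
    by_cases hx' : 𝓜.ty x' = 𝓜.ty x
    · rw [← 𝓜.cup_cap_right c d z₁ x' (hx'.trans hx), Finset.mul_sum]
      refine Finset.sum_congr rfl fun z₂ _ => ?_
      ring
    · simp [𝓜.cross_eq_zero _ _ _ _ _ fun h => hx' h.1]
  have hr : ∀ z₂, ∑ z₁, 𝓜.cup c (!d) z₁ z₂ * ∑ x', 𝓜.cross o x' w z₂ x * 𝓜.cap z₁ x' =
      ∑ x', 𝓜.cross o x' w z₂ x * 𝓜.coef z₂ x' 𝓗.charmInv := by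
    intro z₂
    simp only [Finset.mul_sum]
    rw [Finset.sum_comm]
    refine Finset.sum_congr rfl fun x' _ => ?_
    by_cases hx' : 𝓜.ty x' = 𝓜.ty x
    · rw [← 𝓜.cup_cap_left c (!d) z₂ x' (by simpa using hx'.trans hx), Finset.mul_sum]
      refine Finset.sum_congr rfl fun z₁ _ => ?_
      ring
    · simp [𝓜.cross_eq_zero _ _ _ _ _ fun h => hx' h.2]
  rw [Finset.sum_congr rfl fun z _ => hl z]
  rw [Finset.sum_comm (f := fun z₁ z₂ => 𝓜.cup c (!d) z₁ z₂ * _),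
    Finset.sum_congr rfl fun z _ => hr z]
  refine eq_of_trunc (I := I) fun n => ?_
  -- The crossing is expanded over the components of R modulo I^n, so that the identity between
  -- kinks in H / I^n H can be transported to b by the matrix coefficient `coef w x`.
  have key : ∀ (f g : Pt → Pt → H →ₗ[b] b) (h : Pt → Pt → b), ∑ p, ∑ q,
      trunc I b n (𝓗.rPair (f p q) (g p q) * h p q) =
      ∑ r ∈ 𝓗.Rc n, ∑ p, ∑ q, trunc I b n (f p q r.1 * g p q r.2 * h p q) := by
    intro f g h
    rw [Finset.sum_comm (s := 𝓗.Rc n)]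
    refine Finset.sum_congr rfl fun p _ => ?_
    rw [Finset.sum_comm (s := 𝓗.Rc n)]
    refine Finset.sum_congr rfl fun q _ => ?_
    rw [trunc_mul (𝓗.trunc_rPair (f p q) (g p q)) (rfl : trunc I b n (h p q) = _),
      Finset.sum_mul, map_sum]
  cases o
  · have := trunc_congr (𝓜.coef w x) ((map_sum _ _ _).trans ((𝓗.sum_R_antipode_charm n).trans
      (map_sum _ _ _).symm))
    simp only [map_sum, 𝓜.coef_mul₃] at this
    simp only [cross, Bool.false_eq_true, if_false, map_sum, key]
    simp only [LinearMap.comp_apply]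
    rw [this]
    simp only [mul_comm, mul_left_comm]
  · have := trunc_congr (𝓜.coef w x) ((map_sum _ _ _).trans ((𝓗.sum_R_charm n).trans
      (map_sum _ _ _).symm))
    simp only [map_sum, 𝓜.coef_mul₃] at this
    simp only [cross, if_true, map_sum, key]
    simp only [mul_comm (𝓜.coef _ x _)]
    rw [this]

end Model

end

/-! ### Matrix coefficients of tensor products -/

section

variable {b H : Type*} [CommRing b] {I : Ideal b} [IsAdicComplete I b] [Ring H] [Algebra b H]
  [IsAdicComplete I H]

theorem RibbonHopfAlgebra.conv_one (𝓗 : RibbonHopfAlgebra I H) (f g : H →ₗ[b] b) :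
    𝓗.conv f g 1 = f 1 * g 1 :=
  𝓗.dInt_one _

namespace Model

variable {𝓗 : RibbonHopfAlgebra I H} {C : Type*} {χ : C → H →ₗ[b] b} {Pt : Type*} [Fintype Pt]
  (𝓜 : Model 𝓗 χ Pt)

/-- The matrix coefficients of tensor products. -/
def wc : List Pt → List Pt → H →ₗ[b] b
  | [], [] => 𝓗.counit.toLinearMap
  | x :: a, y :: c => 𝓗.conv (𝓜.coef x y) (wc a c)
  | [], _ :: _ => 0
  | _ :: _, [] => 0

@[simp]
theorem wc_nil : 𝓜.wc [] [] = 𝓗.counit.toLinearMap := rfl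

theorem wc_cons (x y : Pt) (a c : List Pt) :
    𝓜.wc (x :: a) (y :: c) = 𝓗.conv (𝓜.coef x y) (𝓜.wc a c) := rfl

theorem wc_eq_zero_of_length : ∀ {a c : List Pt}, a.length ≠ c.length → 𝓜.wc a c = 0
  | [], [], h => absurd rfl h
  | [], _ :: _, _ => rfl
  | _ :: _, [], _ => rfl
  | x :: a, y :: c, h => by
    rw [wc_cons, wc_eq_zero_of_length (a := a) (c := c) (by simpa using h), map_zero]

/-- Tensor products of matrix representations are again matrix representations, since Δ is
multiplicative. Hence all identities for splitting functionals apply to words as well as to letters.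
-/
theorem wc_mul : ∀ a c : List Pt, RibbonHopfAlgebra.Splits (words Pt a.length) (𝓜.wc a c)
    (𝓜.wc a) (fun w => 𝓜.wc w c)
  | [], [], x, y => by simp [sum_words_zero]
  | [], _ :: _, x, y => by
    rw [List.length_nil, sum_words_zero, wc_eq_zero_of_length _ (by simp)]
    exact (mul_zero _).symm
  | _ :: _, [], x, y => by
    rw [List.length_cons, sum_words_succ, wc_eq_zero_of_length _ (by simp)]
    symm
    refine Finset.sum_eq_zero fun z _ => Finset.sum_eq_zero fun w _ => ?_
    exact mul_zero _
  | p :: a, q :: c, x, y => by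
    rw [List.length_cons, sum_words_succ, wc_cons,
      𝓗.conv_mul (𝓜.coef_mul p q) (wc_mul a c), Finset.sum_product]
    rfl

theorem wc_one_self (a : List Pt) : 𝓜.wc a a 1 = 1 := by
  induction a with
  | nil => simp
  | cons x a ih => rw [wc_cons, 𝓗.conv_one, 𝓜.coef_one_self, ih, mul_one]

theorem wc_one_ne {a c : List Pt} (h : a ≠ c) : 𝓜.wc a c 1 = 0 := by
  induction a generalizing c with
  | nil =>
    cases c with
    | nil => exact absurd rfl h
    | cons => rfl
  | cons x a ih =>
    cases c with
    | nil => rfl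
    | cons y c =>
      rw [wc_cons, 𝓗.conv_one]
      by_cases hx : x = y
      · rw [ih (fun e => h (by rw [hx, e])), mul_zero]
      · rw [𝓜.coef_one_ne _ _ hx, zero_mul]

theorem wc_append {a₁ c₁ : List Pt} (h : a₁.length = c₁.length) (a₂ c₂ : List Pt) :
    𝓜.wc (a₁ ++ a₂) (c₁ ++ c₂) = 𝓗.conv (𝓜.wc a₁ c₁) (𝓜.wc a₂ c₂) := by
  induction a₁ generalizing c₁ with
  | nil =>
    obtain rfl : c₁ = [] := by simpa using h.symm
    rw [List.nil_append, List.nil_append, wc_nil, 𝓗.counit_conv]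
  | cons x a₁ ih =>
    cases c₁ with
    | nil => simp at h
    | cons y c₁ =>
      rw [List.cons_append, List.cons_append, wc_cons, wc_cons, ih (by simpa using h),
        𝓗.conv_assoc]

theorem wc_singleton (x y : Pt) : 𝓜.wc [x] [y] = 𝓜.coef x y := by
  rw [wc_cons, wc_nil, 𝓗.conv_counit]

theorem wc_pair (x y z w : Pt) :
    𝓜.wc [x, y] [z, w] = 𝓗.conv (𝓜.coef x z) (𝓜.coef y w) := by
  rw [wc_cons, wc_singleton]

theorem sum_wc_one_smul {M : Type*} [AddCommGroup M] [Module b M] {n : ℕ} {a : List Pt}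
    (ha : a.length = n) (F : List Pt → M) : ∑ c ∈ words Pt n, 𝓜.wc a c 1 • F c = F a := by
  rw [Finset.sum_eq_single a]
  · rw [𝓜.wc_one_self, one_smul]
  · intro c _ hc
    rw [𝓜.wc_one_ne (Ne.symm hc), zero_smul]
  · intro h
    exact absurd (mem_words.mpr ha) h

theorem sum_wc_one_smul' {M : Type*} [AddCommGroup M] [Module b M] {n : ℕ} {a : List Pt}
    (ha : a.length = n) (F : List Pt → M) : ∑ c ∈ words Pt n, 𝓜.wc c a 1 • F c = F a := by
  rw [Finset.sum_eq_single a]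
  · rw [𝓜.wc_one_self, one_smul]
  · intro c _ hc
    rw [𝓜.wc_one_ne hc, zero_smul]
  · intro h
    exact absurd (mem_words.mpr ha) h

/-- The antipode reverses the comultiplication of matrix coefficients. -/
theorem wc_cons_antipode (x y : Pt) (a c : List Pt) :
    𝓜.wc (x :: a) (y :: c) ∘ₗ 𝓗.antipode =
      𝓗.conv (𝓜.wc a c ∘ₗ 𝓗.antipode) (𝓜.coef x y ∘ₗ 𝓗.antipode) := by
  by_cases hlen : a.length = c.length
  swap
  · rw [wc_eq_zero_of_length _ (by simpa using hlen), wc_eq_zero_of_length _ hlen]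
    simp
  -- The dual of the argument for S(xy) = S(y)S(x). By `hl` the left side of the claim is a left
  -- inverse, under convolution, of the matrix of coefficients on words, and by `hr` the right side
  -- is a right inverse. The triple product, bracketed in both ways, shows that they coincide.
  have hl : ∀ e ∈ words Pt (a.length + 1), ∑ w ∈ words Pt (a.length + 1),
      𝓗.conv (𝓜.wc (x :: a) w ∘ₗ 𝓗.antipode) (𝓜.wc w e) =
        𝓜.wc (x :: a) e 1 • 𝓗.counit.toLinearMap := fun e _ =>
    𝓗.sum_conv_antipode_left (𝓜.wc_mul (x :: a) e)
  have hr : ∀ w ∈ words Pt (a.length + 1), ∑ z, ∑ e ∈ words Pt a.length,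
      𝓗.conv (𝓜.wc w (z :: e)) (𝓗.conv (𝓜.wc e c ∘ₗ 𝓗.antipode) (𝓜.coef z y ∘ₗ 𝓗.antipode)) =
        𝓜.wc w (y :: c) 1 • 𝓗.counit.toLinearMap := by
    intro w hw
    cases w with
    | nil => simp [mem_words] at hw
    | cons p w =>
      have hw' : w.length = a.length := by simpa [mem_words] using hw
      have h1 := 𝓗.sum_conv_antipode_right (𝓜.wc_mul w c)
      have h2 := 𝓗.sum_conv_antipode_right (𝓜.coef_mul p y)
      simp only [wc_cons, 𝓗.conv_assoc, ← map_sum]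
      simp only [← 𝓗.conv_assoc (𝓜.wc w _)]
      rw [hw'] at h1
      simp only [← LinearMap.sum_apply, ← map_sum, h1]
      simp only [map_smul, LinearMap.smul_apply, 𝓗.counit_conv, ← Finset.smul_sum, h2]
      rw [𝓗.conv_one, smul_smul, mul_comm]
  have key : ∑ w ∈ words Pt (a.length + 1), ∑ z, ∑ e ∈ words Pt a.length,
      𝓗.conv (𝓜.wc (x :: a) w ∘ₗ 𝓗.antipode) (𝓗.conv (𝓜.wc w (z :: e))
        (𝓗.conv (𝓜.wc e c ∘ₗ 𝓗.antipode) (𝓜.coef z y ∘ₗ 𝓗.antipode))) =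
      ∑ z, ∑ e ∈ words Pt a.length, ∑ w ∈ words Pt (a.length + 1),
      𝓗.conv (𝓗.conv (𝓜.wc (x :: a) w ∘ₗ 𝓗.antipode) (𝓜.wc w (z :: e)))
        (𝓗.conv (𝓜.wc e c ∘ₗ 𝓗.antipode) (𝓜.coef z y ∘ₗ 𝓗.antipode)) := by
    rw [Finset.sum_comm]
    refine Finset.sum_congr rfl fun z _ => ?_
    rw [Finset.sum_comm]
    refine Finset.sum_congr rfl fun e _ => Finset.sum_congr rfl fun w _ => ?_
    rw [𝓗.conv_assoc]
  have e1 := Finset.sum_congr rfl fun w hw => congrArg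
    (𝓗.conv (𝓜.wc (x :: a) w ∘ₗ 𝓗.antipode)) (hr w hw)
  have e2 : ∀ z, ∀ e ∈ words Pt a.length, _ := fun z e he => congrArg
    (fun f => 𝓗.conv f (𝓗.conv (𝓜.wc e c ∘ₗ 𝓗.antipode) (𝓜.coef z y ∘ₗ 𝓗.antipode)))
      (hl (z :: e) (by simpa [mem_words] using he))
  simp only [map_sum, LinearMap.sum_apply, map_smul, LinearMap.smul_apply, 𝓗.counit_conv,
    𝓗.conv_counit] at e1 e2
  rw [e1, Finset.sum_congr rfl fun z _ => Finset.sum_congr rfl fun e he => e2 z e he,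
    sum_wc_one_smul' _ (by simp [hlen]) fun w => 𝓜.wc (x :: a) w ∘ₗ 𝓗.antipode] at key
  have := 𝓜.sum_wc_one_smul (a := x :: a) (n := a.length + 1) rfl fun w => match w with
    | [] => 0
    | z :: e => 𝓗.conv (𝓜.wc e c ∘ₗ 𝓗.antipode) (𝓜.coef z y ∘ₗ 𝓗.antipode)
  rw [sum_words_succ] at this
  exact key.trans this

/-! ### Intertwiners -/

/-- Crossings are H-linear. For the positive crossing this is the dual form of R Δ = Δ' R. The
negative crossing is its inverse matrix by the second Reidemeister move, and the inverse of a matrix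
that commutes with the action commutes with it too. -/
theorem sum_cross_wc (o : Bool) (u v p q : Pt) :
    ∑ x, ∑ y, 𝓜.cross o u v x y • 𝓜.wc [x, y] [p, q] =
      ∑ x, ∑ y, 𝓜.cross o x y p q • 𝓜.wc [u, v] [x, y] := by
  have ht : ∀ u v p q, ∑ x, ∑ y, 𝓜.cross true u v x y • 𝓜.wc [x, y] [p, q] =
      ∑ x, ∑ y, 𝓜.cross true x y p q • 𝓜.wc [u, v] [x, y] := by
    intro u v p q
    have := 𝓗.sum_rPair_smul_conv (𝓜.coef_mul v p) (𝓜.coef_mul u q)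
    simp only [cross, if_true, wc_pair]
    rw [this, Finset.sum_comm]
  cases o
  swap
  · exact ht u v p q
  classical
  let K : Bool → Matrix (Pt × Pt) (Pt × Pt) b := fun o => .of fun p q => 𝓜.cross o p.1 p.2 q.1 q.2
  have hK : ∀ o, K (!o) * K o = 1 := by
    intro o
    ext r s
    rw [Matrix.mul_apply, Fintype.sum_prod_type, Matrix.one_apply]
    refine (Finset.sum_congr rfl fun _ _ => Finset.sum_congr rfl fun _ _ => mul_comm _ _).trans
      ((𝓜.cross_cross o r.1 r.2 s.1 s.2).trans ?_)
    split_ifs with h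
    · rw [h, 𝓜.coef_one_self, 𝓜.coef_one_self, mul_one]
    · by_cases h1 : r.1 = s.1
      · rw [𝓜.coef_one_ne r.2 s.2 fun h2 => h (Prod.ext h1 h2), mul_zero]
      · rw [𝓜.coef_one_ne r.1 s.1 h1, zero_mul]
  ext h
  let X : Matrix (Pt × Pt) (Pt × Pt) b := .of fun p q => 𝓜.wc [p.1, p.2] [q.1, q.2] h
  have hX : K true * X = X * K true := by
    ext r s
    rw [Matrix.mul_apply, Matrix.mul_apply, Fintype.sum_prod_type, Fintype.sum_prod_type]
    have := congrArg (fun f => f h) (ht r.1 r.2 s.1 s.2)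
    simpa [LinearMap.sum_apply, K, X, mul_comm] using this
  have hX' : K false * X = X * K false :=
    calc K false * X = K false * (X * K true) * K false := by
          rw [mul_assoc, mul_assoc, show K true * K false = 1 from hK false, mul_one]
      _ = X * K false := by
          rw [← hX, ← mul_assoc, show K false * K true = 1 from hK true, one_mul]
  have := congrFun (congrFun hX' (u, v)) (p, q)
  rw [Matrix.mul_apply, Matrix.mul_apply, Fintype.sum_prod_type, Fintype.sum_prod_type] at this
  simpa [LinearMap.sum_apply, K, X, mul_comm] using this

/-- Evaluations are H-linear: after the action on the left leg has been moved to the right one, the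
two actions combine to S(h')h'' = ε(h). -/
theorem sum_cap_wc (p q : Pt) :
    ∑ x, ∑ y, 𝓜.cap x y • 𝓜.wc [x, y] [p, q] = 𝓜.cap p q • 𝓗.counit.toLinearMap := by
  have h : ∀ y, ∑ x, 𝓜.cap x y • 𝓜.wc [x, y] [p, q] =
      ∑ z, 𝓜.cap p z • 𝓗.conv (𝓜.coef z y ∘ₗ 𝓗.antipode) (𝓜.coef y q) := by
    intro y
    have := congrArg (fun f => 𝓗.conv f (𝓜.coef y q)) (𝓜.cap_coef p y)
    simpa [wc_pair, map_sum] using this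
  rw [Finset.sum_comm, Finset.sum_congr rfl fun y _ => h y, Finset.sum_comm]
  simp only [← Finset.smul_sum, 𝓗.sum_conv_antipode_left (𝓜.coef_mul _ _), smul_smul,
    ← Finset.sum_smul]
  rw [Finset.sum_congr rfl fun z _ => mul_comm _ _, 𝓜.sum_coef_one_mul']

theorem sum_cup_wc (c : C) (d : Bool) (u v : Pt) :
    ∑ x, ∑ y, 𝓜.cup c d x y • 𝓜.wc [u, v] [x, y] = 𝓜.cup c d u v • 𝓗.counit.toLinearMap := by
  have h : ∀ x, ∑ y, 𝓜.cup c d x y • 𝓜.wc [u, v] [x, y] =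
      ∑ z, 𝓜.cup c d z v • 𝓗.conv (𝓜.coef u x) (𝓜.coef x z ∘ₗ 𝓗.antipode) := by
    intro x
    have := congrArg (𝓗.conv (𝓜.coef u x)) (𝓜.cup_coef c d x v)
    simpa [wc_pair, map_sum] using this
  rw [Finset.sum_congr rfl fun y _ => h y, Finset.sum_comm]
  simp only [← Finset.smul_sum, 𝓗.sum_conv_antipode_right (𝓜.coef_mul _ _), smul_smul,
    ← Finset.sum_smul]
  rw [Finset.sum_congr rfl fun z _ => mul_comm _ _, 𝓜.sum_coef_one_mul]

end Model

end

theorem exists_append_of_le_length {α : Type*} {l : List α} {i : ℕ} (h : i ≤ l.length) :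
    ∃ p s, l = p ++ s ∧ p.length = i :=
  ⟨l.take i, l.drop i, (List.take_append_drop i l).symm, by simp [h]⟩

namespace Event

variable {V C : Type*}

theorem moveTo_pos (e : Event V C) (i : ℕ) : (e.moveTo i).pos = i := by
  cases e <;> rfl

theorem moveTo_vertex (e : Event V C) (i : ℕ) : (e.moveTo i).vertex = e.vertex := by
  cases e <;> rfl

theorem moveTo_inWidth (e : Event V C) (i : ℕ) : (e.moveTo i).inWidth = e.inWidth := by
  cases e <;> rfl

theorem moveTo_outWidth (e : Event V C) (i : ℕ) : (e.moveTo i).outWidth = e.outWidth := by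
  cases e <;> rfl

theorem Admissible.le_length {st : V → List (C × Bool)} {e : Event V C} (h : e.Admissible st) :
    e.pos + e.inWidth ≤ (st e.vertex).length := by
  cases e with
  | cross v i o => exact h
  | cap v i =>
    obtain ⟨c, d, -, h⟩ := h
    obtain ⟨h, -⟩ := List.getElem?_eq_some_iff.mp h
    exact h
  | cup v i c d => exact h

end Event

namespace Model

variable {b H : Type*} [CommRing b] {I : Ideal b} [IsAdicComplete I b] [Ring H] [Algebra b H]
  [IsAdicComplete I H] {𝓗 : RibbonHopfAlgebra I H} {C : Type*} {χ : C → H →ₗ[b] b}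
  {Pt : Type*} [Fintype Pt] (𝓜 : Model 𝓗 χ Pt) {V : Type*} [DecidableEq V]

/-! ### State sums of events -/

/-- The matrix of a crossing on words. -/
def crossWord (o : Bool) : List Pt → List Pt → b
  | [y', x'], [x, y] => 𝓜.cross o y' x' x y
  | _, _ => 0

/-- The matrix of a local maximum on words. -/
def capWord : List Pt → List Pt → b
  | [], [x, y] => 𝓜.cap x y
  | _, _ => 0

/-- The matrix of a local minimum on words. -/
def cupWord (c : C) (d : Bool) : List Pt → List Pt → b
  | [x, y], [] => 𝓜.cup c d x y
  | _, _ => 0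

/-- The matrix of an event, from its incoming strands to its outgoing strands. -/
def kernel : Event V C → List Pt → List Pt → b
  | .cross _ _ o => 𝓜.crossWord o
  | .cap _ _ => 𝓜.capWord
  | .cup _ _ c d => 𝓜.cupWord c d

theorem kernel_moveTo (e : Event V C) (i : ℕ) : 𝓜.kernel (e.moveTo i) = 𝓜.kernel e := by
  cases e <;> rfl

/-- The operator of an event on functions of the strands at its vertex. -/
def localStep (e : Event V C) (θ : List Pt → b) (l : List Pt) : b :=
  ∑ o ∈ words Pt e.outWidth, 𝓜.kernel e o ((l.drop e.pos).take e.inWidth) *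
    θ (l.take e.pos ++ (o ++ l.drop (e.pos + e.inWidth)))

/-- The operator of an event on functions of states. -/
def step (e : Event V C) (Θ : (V → List Pt) → b) (σ : V → List Pt) : b :=
  𝓜.localStep e (fun l => Θ (Function.update σ e.vertex l)) (σ e.vertex)

open Classical in
/-- The state sum of a sequence of events. -/
def value (es : List (Event V C)) : (V → List Pt) → b :=
  es.foldr 𝓜.step fun σ => if ∀ v, σ v = [] then 1 else 0

theorem localStep_append (e : Event V C) (θ : List Pt → b) {p w : List Pt} (s : List Pt)
    (hp : p.length = e.pos) (hw : w.length = e.inWidth) :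
    𝓜.localStep e θ (p ++ (w ++ s)) =
      ∑ o ∈ words Pt e.outWidth, 𝓜.kernel e o w * θ (p ++ (o ++ s)) := by
  rw [localStep, ← hp, ← hw, List.drop_left, List.take_left, List.take_left]
  congr! 5
  rw [← List.append_assoc, ← List.length_append, List.drop_left]

/-- The strands to the left of an event are spectators. It is therefore enough to check the local
moves next to the left end of a word. -/
theorem localStep_shift (e : Event V C) (θ : List Pt → b) (p l : List Pt) (i : ℕ) :
    𝓜.localStep (e.moveTo (p.length + i)) θ (p ++ l) =
      𝓜.localStep (e.moveTo i) (fun l' => θ (p ++ l')) l := by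
  simp only [localStep, kernel_moveTo, Event.moveTo_pos, Event.moveTo_inWidth,
    Event.moveTo_outWidth, add_assoc, List.drop_append, List.take_append]
  simp [List.append_assoc, add_assoc, List.drop_eq_nil_of_le, List.take_of_length_le]

theorem localStep_cross_shift (v : V) (o : Bool) (θ : List Pt → b) (p l : List Pt) (i : ℕ) :
    𝓜.localStep (.cross v (p.length + i) o) θ (p ++ l) =
      𝓜.localStep (.cross v i o) (fun l' => θ (p ++ l')) l :=
  𝓜.localStep_shift (.cross v 0 o) θ p l i

theorem localStep_cap_shift (v : V) (θ : List Pt → b) (p l : List Pt) (i : ℕ) :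
    𝓜.localStep (.cap v (p.length + i)) θ (p ++ l) =
      𝓜.localStep (.cap v i) (fun l' => θ (p ++ l')) l :=
  𝓜.localStep_shift (.cap v 0) θ p l i

theorem localStep_cup_shift (v : V) (c : C) (d : Bool) (θ : List Pt → b) (p l : List Pt) (i : ℕ) :
    𝓜.localStep (.cup v (p.length + i) c d) θ (p ++ l) =
      𝓜.localStep (.cup v i c d) (fun l' => θ (p ++ l')) l :=
  𝓜.localStep_shift (.cup v 0 c d) θ p l i

theorem localStep_cross_zero (v : V) (o : Bool) (θ : List Pt → b) (x y : Pt) (s : List Pt) :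
    𝓜.localStep (.cross v 0 o) θ (x :: y :: s) =
      ∑ y', ∑ x', 𝓜.cross o y' x' x y * θ (y' :: x' :: s) := by
  simp [localStep, Event.outWidth, Event.inWidth, Event.pos, sum_words_two, kernel, crossWord,
    cupWord]

theorem localStep_cap_zero (v : V) (θ : List Pt → b) (x y : Pt) (s : List Pt) :
    𝓜.localStep (.cap v 0 : Event V C) θ (x :: y :: s) = 𝓜.cap x y * θ s := by
  simp [localStep, Event.outWidth, Event.inWidth, Event.pos, sum_words_zero, kernel, capWord]

theorem localStep_cup_zero (v : V) (c : C) (d : Bool) (θ : List Pt → b) (s : List Pt) :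
    𝓜.localStep (.cup v 0 c d) θ s = ∑ x, ∑ y, 𝓜.cup c d x y * θ (x :: y :: s) := by
  simp [localStep, Event.outWidth, Event.inWidth, Event.pos, sum_words_two, kernel, crossWord,
    cupWord]

theorem localStep_cross_one (v : V) (o : Bool) (θ : List Pt → b) (z x y : Pt) (s : List Pt) :
    𝓜.localStep (.cross v 1 o) θ (z :: x :: y :: s) =
      ∑ y', ∑ x', 𝓜.cross o y' x' x y * θ (z :: y' :: x' :: s) :=
  (𝓜.localStep_cross_shift v o θ [z] (x :: y :: s) 0).trans (localStep_cross_zero ..)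

theorem localStep_cap_one (v : V) (θ : List Pt → b) (z x y : Pt) (s : List Pt) :
    𝓜.localStep (.cap v 1 : Event V C) θ (z :: x :: y :: s) = 𝓜.cap x y * θ (z :: s) :=
  (𝓜.localStep_cap_shift v θ [z] (x :: y :: s) 0).trans (localStep_cap_zero ..)

theorem localStep_cup_one (v : V) (c : C) (d : Bool) (θ : List Pt → b) (z : Pt) (s : List Pt) :
    𝓜.localStep (.cup v 1 c d) θ (z :: s) =
      ∑ x, ∑ y, 𝓜.cup c d x y * θ (z :: x :: y :: s) :=
  (𝓜.localStep_cup_shift v c d θ [z] s 0).trans (localStep_cup_zero ..)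

/-- Events at one vertex see only the word at that vertex, so a local move becomes an identity
between operators on functions of a single word. -/
theorem foldr_step (v : V) (es : List (Event V C)) (h : ∀ e ∈ es, e.vertex = v)
    (Θ : (V → List Pt) → b) (σ : V → List Pt) : es.foldr 𝓜.step Θ σ =
      es.foldr 𝓜.localStep (fun l => Θ (Function.update σ v l)) (σ v) := by
  induction es generalizing σ with
  | nil => simp
  | cons e es ih =>
    obtain rfl := h e (by simp)
    rw [List.foldr_cons, List.foldr_cons, step]
    congr 1
    funext l
    rw [ih fun e' he' => h e' (by simp [he'])]
    simp

/-! ### Local moves -/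

/-- The operator of a crossing of the first two of three strands. -/
def crossLeft (o : Bool) : Module.End b (Pt → Pt → Pt → b) where
  toFun F x y z := ∑ y', ∑ x', 𝓜.cross o y' x' x y * F y' x' z
  map_add' F G := by
    funext x y z
    simp [mul_add, Finset.sum_add_distrib]
  map_smul' r F := by
    funext x y z
    simp [Finset.mul_sum, mul_left_comm]

/-- The operator of a crossing of the last two of three strands. -/
def crossRight (o : Bool) : Module.End b (Pt → Pt → Pt → b) where
  toFun F x y z := ∑ z', ∑ y', 𝓜.cross o z' y' y z * F x z' y'
  map_add' F G := by
    funext x y z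
    simp [mul_add, Finset.sum_add_distrib]
  map_smul' r F := by
    funext x y z
    simp [Finset.mul_sum, mul_left_comm]

theorem sum_cross_cross (o : Bool) (x y : Pt) (F : Pt → Pt → b) :
    ∑ y', ∑ x', 𝓜.cross o y' x' x y * ∑ x'', ∑ y'', 𝓜.cross (!o) x'' y'' y' x' * F x'' y'' =
      F x y := by
  calc _ = ∑ x'', ∑ y'', (∑ y', ∑ x', 𝓜.cross o y' x' x y * 𝓜.cross (!o) x'' y'' y' x') *
        F x'' y'' := by
        simp only [Finset.mul_sum, Finset.sum_mul]
        rw [RibbonHopfAlgebra.sum₄_comm]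
        simp only [mul_assoc]
    _ = _ := by
        simp only [cross_cross, mul_assoc, ← Finset.mul_sum, sum_coef_one_mul']

theorem crossLeft_mul_crossLeft (o : Bool) : 𝓜.crossLeft o * 𝓜.crossLeft (!o) = 1 := by
  ext F x y z
  exact 𝓜.sum_cross_cross o x y fun x y => F x y z

theorem crossRight_mul_crossRight (o : Bool) : 𝓜.crossRight o * 𝓜.crossRight (!o) = 1 := by
  ext F x y z
  exact 𝓜.sum_cross_cross o y z fun y z => F x y z

/-- The Yang-Baxter equation as a relation between operators, which makes group theory available for
crossings of mixed signs. -/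
theorem braid : 𝓜.crossLeft true * (𝓜.crossRight true * 𝓜.crossLeft true) =
    𝓜.crossRight true * (𝓜.crossLeft true * 𝓜.crossRight true) := by
  ext F x y z
  have h : ∀ G : Pt → Pt → Pt → Pt → Pt → Pt → b,
      ∑ y₁, ∑ x₁, ∑ z₁, ∑ x', ∑ z', ∑ y', G y₁ x₁ z₁ x' z' y' =
      ∑ x', ∑ z', ∑ y', ∑ y₁, ∑ x₁, ∑ z₁, G y₁ x₁ z₁ x' z' y' := by
    intro G
    have : ∑ p : Pt × Pt × Pt, ∑ q : Pt × Pt × Pt, G p.1 p.2.1 p.2.2 q.1 q.2.1 q.2.2 =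
      ∑ q : Pt × Pt × Pt, ∑ p : Pt × Pt × Pt, G p.1 p.2.1 p.2.2 q.1 q.2.1 q.2.2 := Finset.sum_comm
    simpa only [Fintype.sum_prod_type] using this
  change ∑ y₁, ∑ x₁, 𝓜.cross true y₁ x₁ x y * ∑ z₁, ∑ x', 𝓜.cross true z₁ x' x₁ z *
      ∑ z', ∑ y', 𝓜.cross true z' y' y₁ z₁ * F z' y' x' =
    ∑ z₁, ∑ y₁, 𝓜.cross true z₁ y₁ y z * ∑ z', ∑ x₁, 𝓜.cross true z' x₁ x z₁ *
      ∑ y', ∑ x', 𝓜.cross true y' x' x₁ y₁ * F z' y' x'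
  simp only [Finset.mul_sum]
  symm
  calc _ = ∑ z₁, ∑ y₁, ∑ x₁, ∑ z', ∑ y', ∑ x', _ :=
        Finset.sum_congr rfl fun _ _ => Finset.sum_congr rfl fun _ _ => Finset.sum_comm
    _ = _ := h _
    _ = ∑ z', ∑ x', ∑ y', _ := Finset.sum_congr rfl fun _ _ => Finset.sum_comm
    _ = ∑ x', ∑ z', ∑ y', _ := Finset.sum_comm
    _ = ∑ x', ∑ z', ∑ y', ∑ y₁, ∑ x₁, ∑ z₁, _ := ?_
    _ = _ := (h _).symm
  refine Finset.sum_congr rfl fun x' _ => Finset.sum_congr rfl fun z' _ =>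
    Finset.sum_congr rfl fun y' _ => ?_
  have := congrArg (· * F z' y' x') (𝓜.yang_baxter x y z x' y' z')
  simp only [Finset.sum_mul, mul_assoc] at this
  exact this.symm

/-- Crossings of opposite signs are inverse units, so all cases are consequences of the positive
braid relation in a group. The hypothesis leaves six patterns; the two excluded ones, with `o₁ = o₃
≠ o₂`, do not come from three strands lying one above the other. -/
theorem reidemeister₃ (o₁ o₂ o₃ : Bool) (h : o₁ = o₃ → o₂ = o₁) :
    𝓜.crossLeft o₁ * (𝓜.crossRight o₂ * 𝓜.crossLeft o₃) =
      𝓜.crossRight o₃ * (𝓜.crossLeft o₂ * 𝓜.crossRight o₁) := by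
  let u : (Module.End b (Pt → Pt → Pt → b))ˣ := ⟨𝓜.crossLeft true, 𝓜.crossLeft false,
    𝓜.crossLeft_mul_crossLeft true, 𝓜.crossLeft_mul_crossLeft false⟩
  let w : (Module.End b (Pt → Pt → Pt → b))ˣ := ⟨𝓜.crossRight true, 𝓜.crossRight false,
    𝓜.crossRight_mul_crossRight true, 𝓜.crossRight_mul_crossRight false⟩
  have hb : u * (w * u) = w * (u * w) := Units.ext 𝓜.braid
  have h1 : u * (w * u⁻¹) = w⁻¹ * (u * w) := by
    rw [eq_inv_mul_iff_mul_eq, ← mul_assoc u w, ← mul_assoc w, mul_inv_eq_iff_eq_mul, mul_assoc u w,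
      hb]
  have h2 : u⁻¹ * (w * u) = w * (u * w⁻¹) := by
    rw [inv_mul_eq_iff_eq_mul, ← mul_assoc w, ← mul_assoc u, eq_mul_inv_iff_mul_eq, mul_assoc w, hb]
  have h3 : u⁻¹ * (w⁻¹ * u⁻¹) = w⁻¹ * (u⁻¹ * w⁻¹) := by
    simpa [mul_assoc] using congrArg (fun g => g⁻¹) hb
  have h4 : u * (w⁻¹ * u⁻¹) = w⁻¹ * (u⁻¹ * w) := by
    simpa [mul_assoc] using congrArg (fun g => g⁻¹) h1
  have h5 : u⁻¹ * (w⁻¹ * u) = w * (u⁻¹ * w⁻¹) := by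
    simpa [mul_assoc] using congrArg (fun g => g⁻¹) h2
  have e := fun (g : Units (Module.End b (Pt → Pt → Pt → b))) g' (h : g = g') =>
    congrArg Units.val h
  cases o₁ <;> cases o₂ <;> cases o₃ <;> simp at h
  · exact e _ _ h3
  · exact e _ _ h5
  · exact e _ _ h2
  · exact e _ _ h4
  · exact e _ _ h1
  · exact e _ _ hb

theorem localStep_reidemeister₃ (v : V) (o₁ o₂ o₃ : Bool) (h : o₁ = o₃ → o₂ = o₁)
    (θ : List Pt → b) (x y z : Pt) (s : List Pt) :
    𝓜.localStep (.cross v 0 o₁) (𝓜.localStep (.cross v 1 o₂)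
      (𝓜.localStep (.cross v 0 o₃) θ)) (x :: y :: z :: s) =
    𝓜.localStep (.cross v 1 o₃) (𝓜.localStep (.cross v 0 o₂)
      (𝓜.localStep (.cross v 1 o₁) θ)) (x :: y :: z :: s) := by
  simp only [localStep_cross_zero, localStep_cross_one]
  exact congrFun (congrFun (congrFun (LinearMap.congr_fun (𝓜.reidemeister₃ o₁ o₂ o₃ h)
    fun x y z => θ (x :: y :: z :: s)) x) y) z

theorem localStep_zigzag_left (v : V) (c : C) (d : Bool) (θ : List Pt → b) (x : Pt) (s : List Pt)
    (hx : 𝓜.ty x = (c, !d)) :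
    𝓜.localStep (.cup v 1 c d) (𝓜.localStep (.cap v 0 : Event V C) θ) (x :: s) = θ (x :: s) := by
  simp only [localStep_cup_one, localStep_cap_zero]
  rw [Finset.sum_comm, ← 𝓜.sum_coef_one_mul x fun y => θ (y :: s)]
  refine Finset.sum_congr rfl fun y _ => ?_
  rw [← 𝓜.cap_cup c d x y hx, Finset.sum_mul]
  refine Finset.sum_congr rfl fun z _ => ?_
  ring

theorem localStep_zigzag_right (v : V) (c : C) (d : Bool) (θ : List Pt → b) (x : Pt)
    (s : List Pt) (hx : 𝓜.ty x = (c, d)) :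
    𝓜.localStep (.cup v 0 c d) (𝓜.localStep (.cap v 1 : Event V C) θ) (x :: s) = θ (x :: s) := by
  simp only [localStep_cup_zero, localStep_cap_one]
  rw [← 𝓜.sum_coef_one_mul' x fun y => θ (y :: s)]
  refine Finset.sum_congr rfl fun y _ => ?_
  rw [← 𝓜.cup_cap c d y x hx, Finset.sum_mul]
  refine Finset.sum_congr rfl fun z _ => ?_
  ring

theorem localStep_cross_cap (v : V) (o : Bool) (θ : List Pt → b) (x y z : Pt) (s : List Pt) :
    𝓜.localStep (.cross v 0 o) (𝓜.localStep (.cap v 1 : Event V C) θ) (x :: y :: z :: s) =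
      𝓜.localStep (.cross v 1 (!o)) (𝓜.localStep (.cap v 0 : Event V C) θ)
        (x :: y :: z :: s) := by
  simp only [localStep_cross_zero, localStep_cross_one, localStep_cap_zero, localStep_cap_one,
    ← mul_assoc]
  rw [Finset.sum_comm (f := fun z' y' => 𝓜.cross (!o) z' y' y z * _ * _)]
  refine Finset.sum_congr rfl fun y' _ => ?_
  rw [← Finset.sum_mul, ← Finset.sum_mul, cross_cap]

theorem localStep_cup_cross (v : V) (c : C) (d o : Bool) (θ : List Pt → b) (x : Pt)
    (s : List Pt) :
    𝓜.localStep (.cup v 0 c d) (𝓜.localStep (.cross v 1 o) θ) (x :: s) =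
      𝓜.localStep (.cup v 1 c d) (𝓜.localStep (.cross v 0 (!o)) θ) (x :: s) := by
  simp only [localStep_cross_zero, localStep_cross_one, localStep_cup_zero, localStep_cup_one,
    Finset.mul_sum, ← mul_assoc]
  calc _ = ∑ z₁, ∑ x', ∑ z₂, ∑ z, 𝓜.cup c d z₁ z * 𝓜.cross o x' z₂ z x *
        θ (z₁ :: x' :: z₂ :: s) := by
        refine Finset.sum_congr rfl fun z₁ _ => ?_
        rw [Finset.sum_comm]
        exact Finset.sum_congr rfl fun x' _ => Finset.sum_comm
    _ = ∑ z₁, ∑ x', ∑ z₂, ∑ z, 𝓜.cup c d z z₂ * 𝓜.cross (!o) z₁ x' x z *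
        θ (z₁ :: x' :: z₂ :: s) := by
        simp only [← Finset.sum_mul, cup_cross]
    _ = ∑ z₁, ∑ x', ∑ z, ∑ z₂, _ :=
        Finset.sum_congr rfl fun _ _ => Finset.sum_congr rfl fun _ _ => Finset.sum_comm
    _ = _ := RibbonHopfAlgebra.sum₄_comm _

theorem localStep_reidemeister₂ (v : V) (o : Bool) (θ : List Pt → b) (x y : Pt) (s : List Pt) :
    𝓜.localStep (.cross v 0 o) (𝓜.localStep (.cross v 0 (!o) : Event V C) θ) (x :: y :: s) =
      θ (x :: y :: s) := by
  simp only [localStep_cross_zero]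
  exact 𝓜.sum_cross_cross o x y fun x y => θ (x :: y :: s)

theorem localStep_framing (v : V) (c : C) (d o : Bool) (θ : List Pt → b) (x : Pt) (s : List Pt)
    (hx : 𝓜.ty x = (c, d)) :
    𝓜.localStep (.cup v 1 c d) (𝓜.localStep (.cross v 0 o)
      (𝓜.localStep (.cap v 1 : Event V C) θ)) (x :: s) =
    𝓜.localStep (.cup v 0 c (!d)) (𝓜.localStep (.cross v 1 o)
      (𝓜.localStep (.cap v 0 : Event V C) θ)) (x :: s) := by
  simp only [localStep_cross_zero, localStep_cross_one, localStep_cup_zero, localStep_cup_one,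
    localStep_cap_zero, localStep_cap_one]
  calc _ = ∑ w, (∑ z₁, ∑ z₂, 𝓜.cup c d z₁ z₂ * ∑ x', 𝓜.cross o w x' x z₁ * 𝓜.cap x' z₂) *
        θ (w :: s) := by
        simp only [Finset.mul_sum, Finset.sum_mul]
        rw [Finset.sum_comm (s := Finset.univ (α := Pt)) (t := Finset.univ (α := Pt))
          (f := fun w z₁ => ∑ z₂, ∑ x', 𝓜.cup c d z₁ z₂ *
            (𝓜.cross o w x' x z₁ * 𝓜.cap x' z₂) * θ (w :: s))]
        refine Finset.sum_congr rfl fun z₁ _ => ?_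
        rw [Finset.sum_comm (s := Finset.univ (α := Pt)) (t := Finset.univ (α := Pt))
          (f := fun w z₂ => ∑ x', 𝓜.cup c d z₁ z₂ *
            (𝓜.cross o w x' x z₁ * 𝓜.cap x' z₂) * θ (w :: s))]
        refine Finset.sum_congr rfl fun z₂ _ => Finset.sum_congr rfl fun w _ =>
          Finset.sum_congr rfl fun x' _ => ?_
        ring
    _ = ∑ w, (∑ z₁, ∑ z₂, 𝓜.cup c (!d) z₁ z₂ * ∑ x', 𝓜.cross o x' w z₂ x * 𝓜.cap z₁ x') *
        θ (w :: s) := by simp only [𝓜.framing o c d x _ hx]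
    _ = _ := by
        simp only [Finset.mul_sum, Finset.sum_mul]
        rw [Finset.sum_comm]
        refine Finset.sum_congr rfl fun z₁ _ => ?_
        rw [Finset.sum_comm]
        refine Finset.sum_congr rfl fun z₂ _ => ?_
        rw [Finset.sum_comm]
        refine Finset.sum_congr rfl fun w _ => Finset.sum_congr rfl fun x' _ => ?_
        ring

theorem step_comm_of_vertex_ne {x y : Event V C} (h : x.vertex ≠ y.vertex)
    (Θ : (V → List Pt) → b) (σ : V → List Pt) :
    𝓜.step x (𝓜.step y Θ) σ = 𝓜.step y (𝓜.step x Θ) σ := by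
  simp only [step, localStep, Function.update_of_ne h, Function.update_of_ne h.symm,
    Finset.mul_sum]
  rw [Finset.sum_comm]
  refine Finset.sum_congr rfl fun o _ => Finset.sum_congr rfl fun o' _ => ?_
  rw [Function.update_comm h]
  ring

/-- The word splits into the strands before `x`, those of `x`, those between the events, those of
`y`, and the rest. The position of `y` depends on whether the strands of `x` are counted before or
after `x`, hence `inWidth` on one side and `outWidth` on the other. -/
theorem localStep_far (x y : Event V C) (θ : List Pt → b) {p w m w' s : List Pt}
    (hp : p.length = x.pos) (hw : w.length = x.inWidth) (hw' : w'.length = y.inWidth) :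
    𝓜.localStep x (𝓜.localStep (y.moveTo (p.length + m.length + x.outWidth)) θ)
        (p ++ (w ++ (m ++ (w' ++ s)))) =
      𝓜.localStep (y.moveTo (p.length + m.length + x.inWidth)) (𝓜.localStep x θ)
        (p ++ (w ++ (m ++ (w' ++ s)))) := by
  rw [localStep_append _ _ _ _ hp hw]
  have h1 : ∀ o ∈ words Pt x.outWidth,
      𝓜.localStep (y.moveTo (p.length + m.length + x.outWidth)) θ
        (p ++ (o ++ (m ++ (w' ++ s)))) = ∑ o' ∈ words Pt y.outWidth, 𝓜.kernel y o' w' *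
          θ (p ++ (o ++ (m ++ (o' ++ s)))) := by
    intro o ho
    have := 𝓜.localStep_append (y.moveTo (p.length + m.length + x.outWidth)) θ
      (p := p ++ o ++ m) (w := w') s
      (by rw [Event.moveTo_pos, ← mem_words.mp ho]; simp; omega) (by rw [Event.moveTo_inWidth, hw'])
    simpa only [List.append_assoc, kernel_moveTo, Event.moveTo_outWidth] using this
  have h2 := 𝓜.localStep_append (y.moveTo (p.length + m.length + x.inWidth)) (𝓜.localStep x θ)
      (p := p ++ w ++ m) (w := w') s
      (by rw [Event.moveTo_pos, ← hw]; simp; omega) (by rw [Event.moveTo_inWidth, hw'])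
  simp only [List.append_assoc, kernel_moveTo, Event.moveTo_outWidth] at h2
  rw [h2, Finset.sum_congr rfl fun o ho => by rw [h1 o ho]]
  simp only [𝓜.localStep_append x θ _ hp hw, Finset.mul_sum]
  rw [Finset.sum_comm]
  refine Finset.sum_congr rfl fun o _ => Finset.sum_congr rfl fun o' _ => ?_
  ring

end Model

namespace Event

variable {V C : Type*} [DecidableEq V] {st : V → List (C × Bool)} {v : V} {i : ℕ}
  {p s : List (C × Bool)} {x y : C × Bool}

theorem after_cross (o : Bool) (h : st v = p ++ x :: y :: s) (hi : i = p.length) :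
    (cross v i o : Event V C).after st = Function.update st v (p ++ y :: x :: s) := by
  subst hi
  simp [after, h]

theorem after_cap (h : st v = p ++ x :: y :: s) (hi : i = p.length) :
    (cap v i : Event V C).after st = Function.update st v (p ++ s) := by
  subst hi
  simp [after, h, List.drop_append, List.drop_eq_nil_of_le]

theorem after_cup (c : C) (d : Bool) (h : st v = p ++ s) (hi : i = p.length) :
    (cup v i c d : Event V C).after st =
      Function.update st v (p ++ (c, d) :: (c, !d) :: s) := by
  subst hi
  simp [after, h]

theorem admissible_cap (h : st v = p ++ x :: y :: s) (hi : i = p.length) :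
    (cap v i : Event V C).Admissible st ↔ y = (x.1, !x.2) := by
  subst hi
  obtain ⟨x₁, x₂⟩ := x
  obtain ⟨y₁, y₂⟩ := y
  simp only [Admissible, h, List.getElem?_append_right le_rfl, Nat.sub_self,
    List.getElem?_append_right (Nat.le_add_right p.length 1), Nat.add_sub_cancel_left,
    List.getElem?_cons_zero, List.getElem?_cons_succ, Option.some.injEq, Prod.mk.injEq]
  constructor
  · rintro ⟨c, d, ⟨rfl, rfl⟩, rfl, rfl⟩
    exact ⟨rfl, rfl⟩
  · rintro ⟨rfl, rfl⟩
    exact ⟨_, _, ⟨rfl, rfl⟩, rfl, rfl⟩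

/-- The decomposition of the strands at the vertex of a local maximum. -/
theorem Admissible.exists_cap (h : (cap v i : Event V C).Admissible st) :
    ∃ p c d s, st v = p ++ (c, d) :: (c, !d) :: s ∧ p.length = i := by
  have h1 := h.le_length
  simp only [pos, inWidth, vertex] at h1
  obtain ⟨p, s, hs, hp⟩ := exists_append_of_le_length (l := st v) (i := i) (by omega)
  obtain _ | ⟨x, s⟩ := s
  · simp [hs] at h1; omega
  obtain _ | ⟨y, s⟩ := s
  · simp [hs] at h1; omega
  have := (admissible_cap hs hp.symm).mp h
  exact ⟨p, x.1, x.2, s, by rw [hs, this], hp⟩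

/-- The decomposition of the strands at the vertex of a crossing. -/
theorem Admissible.exists_cross {o : Bool} (h : (cross v i o : Event V C).Admissible st) :
    ∃ p x y s, st v = p ++ x :: y :: s ∧ p.length = i := by
  have h1 := h.le_length
  simp only [pos, inWidth, vertex] at h1
  obtain ⟨p, s, hs, hp⟩ := exists_append_of_le_length (l := st v) (i := i) (by omega)
  obtain _ | ⟨x, s⟩ := s
  · simp [hs] at h1; omega
  obtain _ | ⟨y, s⟩ := s
  · simp [hs] at h1; omega
  exact ⟨p, x, y, s, hs, hp⟩

end Event

namespace Model

variable {b H : Type*} [CommRing b] {I : Ideal b} [IsAdicComplete I b] [Ring H] [Algebra b H]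
  [IsAdicComplete I H] {𝓗 : RibbonHopfAlgebra I H} {C : Type*} {χ : C → H →ₗ[b] b}
  {Pt : Type*} [Fintype Pt] (𝓜 : Model 𝓗 χ Pt) {V : Type*} [DecidableEq V]

theorem foldr_localStep_shift (es : List (Event V C)) (θ : List Pt → b) (p l : List Pt) :
    (es.map fun e => e.moveTo (p.length + e.pos)).foldr 𝓜.localStep θ (p ++ l) =
      es.foldr 𝓜.localStep (fun l' => θ (p ++ l')) l := by
  induction es generalizing l with
  | nil => rfl
  | cons e es ih =>
    rw [List.map_cons, List.foldr_cons, List.foldr_cons, localStep_shift]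
    have : e.moveTo e.pos = e := by cases e <;> rfl
    rw [this]
    congr 1
    funext l'
    exact ih l'

/-- The state that lists the coloured directed strands at each vertex. -/
def types (σ : V → List Pt) (v : V) : List (C × Bool) := (σ v).map 𝓜.ty

theorem foldr_step_eq_of_shift (v : V) (P Q : List (Event V C)) (hP : ∀ e ∈ P, e.vertex = v)
    (hQ : ∀ e ∈ Q, e.vertex = v) (Θ : (V → List Pt) → b) (σ : V → List Pt) (p s : List Pt)
    (hs : σ v = p ++ s)
    (h : ∀ θ : List Pt → b, P.foldr 𝓜.localStep θ s = Q.foldr 𝓜.localStep θ s) :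
    (P.map fun e => e.moveTo (p.length + e.pos)).foldr 𝓜.step Θ σ =
      (Q.map fun e => e.moveTo (p.length + e.pos)).foldr 𝓜.step Θ σ := by
  rw [foldr_step 𝓜 v, foldr_step 𝓜 v, hs, foldr_localStep_shift, foldr_localStep_shift, h]
  · simpa [Event.moveTo_vertex] using hQ
  · simpa [Event.moveTo_vertex] using hP

/-- That both sides can take place gives more than the necessary number of strands. In the zigzag
moves and the framing move, admissibility of the cap forces the colour and the direction of the
strand that passes through, without which the evaluation and the coevaluation would not match. -/
theorem foldr_localMove {P Q : List (Event V C)} (h : Diagram.LocalMove P Q)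
    (B : List (Event V C)) (σ : V → List Pt) (hP : Diagram.Closes (𝓜.types σ) (P ++ B))
    (hQ : Diagram.Closes (𝓜.types σ) (Q ++ B)) (Θ : (V → List Pt) → b) :
    P.foldr 𝓜.step Θ σ = Q.foldr 𝓜.step Θ σ := by
  cases h with
  | far_vertices x y h => exact 𝓜.step_comm_of_vertex_ne h Θ σ
  | far x y j h hj =>
    have h1 := hP.1.le_length
    have h2 := hQ.1.le_length
    simp only [types, List.length_map, Event.moveTo_pos, Event.moveTo_inWidth,
      Event.moveTo_vertex, ← h] at h1 h2
    obtain ⟨p, s, hs, hp⟩ := exists_append_of_le_length (l := σ x.vertex) (i := x.pos) (by omega)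
    rw [hs, List.length_append] at h1 h2
    obtain ⟨w, s, rfl, hw⟩ := exists_append_of_le_length (l := s) (i := x.inWidth) (by omega)
    rw [List.length_append] at h1 h2
    obtain ⟨m, s, rfl, hm⟩ := exists_append_of_le_length (l := s) (i := j - x.pos) (by omega)
    rw [List.length_append] at h1 h2
    obtain ⟨w', s, rfl, hw'⟩ := exists_append_of_le_length (l := s) (i := y.inWidth) (by omega)
    rw [foldr_step 𝓜 x.vertex _ (by simp [Event.moveTo_vertex, h]),
      foldr_step 𝓜 x.vertex _ (by simp [Event.moveTo_vertex, h]), hs]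
    have := 𝓜.localStep_far x y (fun l => Θ (Function.update σ x.vertex l)) (m := m) (s := s)
      hp hw hw'
    rw [show p.length + m.length = j by omega] at this
    exact this
  | zigzag_left v i c d =>
    have h1 := hP.1.le_length
    simp only [types, List.length_map, Event.pos, Event.inWidth, Event.vertex] at h1
    obtain ⟨p, s, hs, rfl⟩ := exists_append_of_le_length (l := σ v) (i := i) (by omega)
    obtain _ | ⟨x, s⟩ := s
    · simp [hs] at h1
    refine 𝓜.foldr_step_eq_of_shift v [.cup v 1 c d, .cap v 0] [] (by simp [Event.vertex])
      (by simp) Θ σ p _ hs fun θ => 𝓜.localStep_zigzag_left v c d θ x s ?_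
    have h2 := hP.2.1
    have hst : 𝓜.types σ v = (p.map 𝓜.ty ++ [𝓜.ty x]) ++ s.map 𝓜.ty := by simp [types, hs]
    rw [Event.after_cup c d hst (by simp), Event.admissible_cap (p := p.map 𝓜.ty) (x := 𝓜.ty x)
      (y := (c, d)) (s := (c, !d) :: s.map 𝓜.ty) (by simp) (by simp)] at h2
    rw [Prod.ext_iff] at h2
    exact Prod.ext h2.1.symm (by simp [show d = !(𝓜.ty x).2 from h2.2])
  | zigzag_right v i c d =>
    have h2 := hP.2.1
    have h1 := h2.le_length
    simp [types, Event.pos, Event.inWidth, Event.vertex, Event.after] at h1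
    obtain ⟨p, s, hs, rfl⟩ := exists_append_of_le_length (l := σ v) (i := i) (by omega)
    obtain _ | ⟨x, s⟩ := s
    · simp [hs] at h1
    refine 𝓜.foldr_step_eq_of_shift v [.cup v 0 c d, .cap v 1] [] (by simp [Event.vertex])
      (by simp) Θ σ p _ hs fun θ => 𝓜.localStep_zigzag_right v c d θ x s ?_
    have hst : 𝓜.types σ v = p.map 𝓜.ty ++ 𝓜.ty x :: s.map 𝓜.ty := by simp [types, hs]
    rw [Event.after_cup c d hst (by simp), Event.admissible_cap (p := p.map 𝓜.ty ++ [(c, d)])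
      (x := (c, !d)) (y := 𝓜.ty x) (s := s.map 𝓜.ty) (by simp) (by simp)] at h2
    simpa using h2
  | cross_cap v i o =>
    have h1 := hQ.1.le_length
    simp only [types, List.length_map, Event.pos, Event.inWidth, Event.vertex] at h1
    obtain ⟨p, s, hs, rfl⟩ := exists_append_of_le_length (l := σ v) (i := i) (by omega)
    obtain _ | ⟨x, _ | ⟨y, _ | ⟨z, s⟩⟩⟩ := s
    · simp [hs] at h1
      omega
    · simp [hs] at h1
    · simp [hs] at h1
    exact 𝓜.foldr_step_eq_of_shift v [.cross v 0 o, .cap v 1] [.cross v 1 (!o), .cap v 0]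
      (by simp [Event.vertex]) (by simp [Event.vertex]) Θ σ p _ hs
      fun θ => 𝓜.localStep_cross_cap v o θ x y z s
  | cup_cross v i c d o =>
    have h1 := hQ.1.le_length
    simp only [types, List.length_map, Event.pos, Event.inWidth, Event.vertex] at h1
    obtain ⟨p, s, hs, rfl⟩ := exists_append_of_le_length (l := σ v) (i := i) (by omega)
    obtain _ | ⟨x, s⟩ := s
    · simp [hs] at h1
    exact 𝓜.foldr_step_eq_of_shift v [.cup v 0 c d, .cross v 1 o] [.cup v 1 c d, .cross v 0 (!o)]
      (by simp [Event.vertex]) (by simp [Event.vertex]) Θ σ p _ hs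
      fun θ => 𝓜.localStep_cup_cross v c d o θ x s
  | reidemeister₂ v i o =>
    have h1 := hP.1.le_length
    simp only [types, List.length_map, Event.pos, Event.inWidth, Event.vertex] at h1
    obtain ⟨p, s, hs, rfl⟩ := exists_append_of_le_length (l := σ v) (i := i) (by omega)
    obtain _ | ⟨x, _ | ⟨y, s⟩⟩ := s
    · simp [hs] at h1
    · simp [hs] at h1
    exact 𝓜.foldr_step_eq_of_shift v [.cross v 0 o, .cross v 0 (!o)] []
      (by simp [Event.vertex]) (by simp [Event.vertex]) Θ σ p _ hs
      fun θ => 𝓜.localStep_reidemeister₂ v o θ x y s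
  | reidemeister₃ v i o₁ o₂ o₃ h =>
    have h1 := hQ.1.le_length
    simp only [types, List.length_map, Event.pos, Event.inWidth, Event.vertex] at h1
    obtain ⟨p, s, hs, rfl⟩ := exists_append_of_le_length (l := σ v) (i := i) (by omega)
    obtain _ | ⟨x, _ | ⟨y, _ | ⟨z, s⟩⟩⟩ := s
    · simp [hs] at h1
      omega
    · simp [hs] at h1
    · simp [hs] at h1
    exact 𝓜.foldr_step_eq_of_shift v [.cross v 0 o₁, .cross v 1 o₂, .cross v 0 o₃]
      [.cross v 1 o₃, .cross v 0 o₂, .cross v 1 o₁]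
      (by simp [Event.vertex]) (by simp [Event.vertex]) Θ σ p _ hs
      fun θ => 𝓜.localStep_reidemeister₃ v o₁ o₂ o₃ h θ x y z s
  | framing v i c d o =>
    have h1 := hP.1.le_length
    simp only [types, List.length_map, Event.pos, Event.inWidth, Event.vertex] at h1
    obtain ⟨p, s, hs, rfl⟩ := exists_append_of_le_length (l := σ v) (i := i) (by omega)
    obtain _ | ⟨x, s⟩ := s
    · simp [hs] at h1
    refine 𝓜.foldr_step_eq_of_shift v [.cup v 1 c d, .cross v 0 o, .cap v 1]
      [.cup v 0 c (!d), .cross v 1 o, .cap v 0] (by simp [Event.vertex]) (by simp [Event.vertex])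
      Θ σ p _ hs fun θ => 𝓜.localStep_framing v c d o θ x s ?_
    have h2 := hP.2.2.1
    have hst : 𝓜.types σ v = (p.map 𝓜.ty ++ [𝓜.ty x]) ++ s.map 𝓜.ty := by simp [types, hs]
    rw [Event.after_cup c d hst (by simp), Event.after_cross (p := p.map 𝓜.ty) (x := 𝓜.ty x)
      (y := (c, d)) (s := (c, !d) :: s.map 𝓜.ty) o (by simp) (by simp),
      Event.admissible_cap (p := p.map 𝓜.ty ++ [(c, d)])
      (x := 𝓜.ty x) (y := (c, !d)) (s := s.map 𝓜.ty) (by simp) (by simp)] at h2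
    rw [Prod.ext_iff] at h2
    exact Prod.ext h2.1.symm (by simpa using h2.2.symm)

/-- The state that results from the application of a matrix entry of an event to a state. -/
def output (σ : V → List Pt) (e : Event V C) (o : List Pt) : V → List Pt :=
  Function.update σ e.vertex
    ((σ e.vertex).take e.pos ++ (o ++ (σ e.vertex).drop (e.pos + e.inWidth)))

theorem step_eq_sum (e : Event V C) (Θ : (V → List Pt) → b) (σ : V → List Pt) :
    𝓜.step e Θ σ = ∑ o ∈ words Pt e.outWidth,
      𝓜.kernel e o (((σ e.vertex).drop e.pos).take e.inWidth) * Θ (output σ e o) := rfl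

/-- Nonzero matrix entries respect colours and directions. Hence the states that contribute to a
state sum follow the combinatorial states of the diagram. -/
theorem kernel_eq_zero_or_types_output (e : Event V C) (σ : V → List Pt)
    (h : e.Admissible (𝓜.types σ)) (o : List Pt) :
    𝓜.kernel e o (((σ e.vertex).drop e.pos).take e.inWidth) = 0 ∨
      𝓜.types (output σ e o) = e.after (𝓜.types σ) := by
  cases e with
  | cross v i lo =>
    obtain ⟨p, x, y, s, hs, hp⟩ := h.exists_cross
    obtain ⟨p', t, ht, rfl, hst⟩ := List.map_eq_append_iff.mp hs
    obtain ⟨x', t, rfl, rfl, hst'⟩ := List.map_eq_cons_iff.mp hst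
    obtain ⟨y', s', rfl, rfl, rfl⟩ := List.map_eq_cons_iff.mp hst'
    rw [List.length_map] at hp
    subst hp
    by_cases ho : ∃ u w, o = [u, w]
    · obtain ⟨u, w, rfl⟩ := ho
      by_cases htype : 𝓜.ty w = 𝓜.ty x' ∧ 𝓜.ty u = 𝓜.ty y'
      · right
        rw [Event.after_cross lo hs (by simp)]
        funext v'
        by_cases hv : v' = v
        · subst hv
          simp [types, output, Event.vertex, Event.pos, Event.inWidth, ht, htype,
            List.drop_append, List.drop_eq_nil_of_le]
        · simp [types, output, Event.vertex, hv]
      · left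
        simp [Event.vertex, Event.pos, Event.inWidth, ht, kernel, crossWord,
          𝓜.cross_eq_zero _ _ _ _ _ htype]
    · left
      simp only [kernel]
      unfold crossWord
      split
      · exact absurd ⟨_, _, rfl⟩ ho
      · rfl
  | cap v i =>
    obtain ⟨p, c, d, s, hs, hp⟩ := h.exists_cap
    obtain ⟨p', t, ht, rfl, hst⟩ := List.map_eq_append_iff.mp hs
    obtain ⟨x', t, rfl, hx, hst'⟩ := List.map_eq_cons_iff.mp hst
    obtain ⟨y', s', rfl, hy, rfl⟩ := List.map_eq_cons_iff.mp hst'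
    rw [List.length_map] at hp
    subst hp
    by_cases ho : o = []
    · subst ho
      right
      rw [Event.after_cap hs (by simp)]
      funext v'
      by_cases hv : v' = v
      · subst hv
        simp [types, output, Event.vertex, Event.pos, Event.inWidth, ht,
          List.drop_append, List.drop_eq_nil_of_le]
      · simp [types, output, Event.vertex, hv]
    · left
      simp only [kernel]
      unfold capWord
      split
      · exact absurd rfl ho
      · rfl
  | cup v i c d =>
    have h1 : i ≤ (σ v).length := by simpa [types, Event.Admissible] using h
    obtain ⟨p, s, hs, rfl⟩ := exists_append_of_le_length h1
    have hst : 𝓜.types σ v = p.map 𝓜.ty ++ s.map 𝓜.ty := by simp [types, hs]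
    by_cases ho : ∃ u w, o = [u, w]
    · obtain ⟨u, w, rfl⟩ := ho
      by_cases htype : 𝓜.ty u = (c, d) ∧ 𝓜.ty w = (c, !d)
      · right
        rw [Event.after_cup c d hst (by simp)]
        funext v'
        by_cases hv : v' = v
        · subst hv
          simp [types, output, Event.vertex, Event.pos, Event.inWidth, hs, htype,
            List.drop_append, List.drop_eq_nil_of_le]
        · simp [types, output, Event.vertex, hv]
      · left
        simp [Event.vertex, Event.pos, Event.inWidth, hs, kernel, cupWord,
          𝓜.cup_eq_zero _ _ _ _ htype]
    · left
      simp only [kernel]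
      unfold cupWord
      split
      · exact absurd ⟨_, _, rfl⟩ ho
      · rfl

/-- Only outputs of the expected type matter. This carries the typing assumptions of a local move
through the events that precede it. -/
theorem step_congr {e : Event V C} {σ : V → List Pt} (h : e.Admissible (𝓜.types σ))
    {Θ Θ' : (V → List Pt) → b}
    (hΘ : ∀ σ', 𝓜.types σ' = e.after (𝓜.types σ) → Θ σ' = Θ' σ') :
    𝓜.step e Θ σ = 𝓜.step e Θ' σ := by
  rw [step_eq_sum, step_eq_sum]
  refine Finset.sum_congr rfl fun o _ => ?_
  rcases 𝓜.kernel_eq_zero_or_types_output e σ h o with h | h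
  · rw [h, zero_mul, zero_mul]
  · rw [hΘ _ h]

theorem value_inside {P Q : List (Event V C)} (h : Diagram.LocalMove P Q) (A B : List (Event V C))
    (σ : V → List Pt) (hP : Diagram.Closes (𝓜.types σ) (A ++ P ++ B))
    (hQ : Diagram.Closes (𝓜.types σ) (A ++ Q ++ B)) :
    𝓜.value (A ++ P ++ B) σ = 𝓜.value (A ++ Q ++ B) σ := by
  induction A generalizing σ with
  | nil =>
    simp only [value, List.nil_append, List.foldr_append] at hP hQ ⊢
    exact 𝓜.foldr_localMove h B σ hP hQ _
  | cons e A ih =>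
    refine 𝓜.step_congr hP.1 fun σ' hσ' => ih σ' ?_ ?_
    · rw [hσ']
      exact hP.2
    · rw [hσ']
      exact hQ.2

end Model

/-! ## Operators on pure tensors -/

section Pure

variable {b H : Type*} [CommRing b] {I : Ideal b} [Ring H] [Algebra b H] {X Y : Type*}
  [DecidableEq X] [DecidableEq Y]

theorem single_mul_tprod (p : X) (a : H) (x : X → H) :
    single b p a * PiTensorProduct.tprod b x =
      PiTensorProduct.tprod b (Function.update x p (a * x p)) := by
  have : single b p a = PiTensorProduct.tprod b (Pi.mulSingle p a) := rfl
  rw [this, PiTensorProduct.tprod_mul_tprod]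
  congr 1
  funext q
  by_cases h : q = p
  · subst h
    simp
  · simp [h]

theorem tprod_mul_single (p : X) (a : H) (x : X → H) :
    PiTensorProduct.tprod b x * single b p a =
      PiTensorProduct.tprod b (Function.update x p (x p * a)) := by
  have : single b p a = PiTensorProduct.tprod b (Pi.mulSingle p a) := rfl
  rw [this, PiTensorProduct.tprod_mul_tprod]
  congr 1
  funext q
  by_cases h : q = p
  · subst h
    simp
  · simp [h]

/-- The action of an element at an end of an edge, on families of elements. -/
def actAt (S : H →ₗ[b] H) (z : X × Bool) (a : H) (x : X → H) : X → H :=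
  Function.update x z.1 (if z.2 then a * x z.1 else x z.1 * S a)

theorem endAct_tprod (S : H →ₗ[b] H) (z : X × Bool) (a : H) (x : X → H) :
    endAct S z a (PiTensorProduct.tprod b x) = PiTensorProduct.tprod b (actAt S z a x) := by
  obtain ⟨p, d⟩ := z
  cases d
  · exact tprod_mul_single p (S a) x
  · exact single_mul_tprod p a x

theorem enlarge_tprod (f : X ↪ Y) (x : X → H) :
    enlarge b H f (PiTensorProduct.tprod b x) =
      PiTensorProduct.tprod b (Function.extend f x fun _ => 1) := by
  simp [enlarge]

theorem absorb_tprod (p : X) (φ : H →ₗ[b] Conn b H ({p}ᶜ : Set X)) (x : X → H) :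
    absorb p φ (PiTensorProduct.tprod b x) =
      φ (x p) * PiTensorProduct.tprod b fun y : ({p}ᶜ : Set X) => x y := by
  rw [absorb, LinearMap.comp_apply, LinearEquiv.coe_coe,
    PiTensorProduct.equivPiTensorComplSingletonTensor_tprod, TensorProduct.lift.tmul]
  rfl

end Pure

/-! ## Functionals given by matrix coefficients -/

section Labels

variable {b H : Type*} [CommRing b] {I : Ideal b} [IsAdicComplete I b] [Ring H] [Algebra b H]
  (𝓗 : RibbonHopfAlgebra I H)

/-- Functionals on the factors of a tensor power, indexed by labels of the ends of the edges, on
which `H` acts by matrix coefficients. -/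
structure LabelSystem (X J : Type*) where
  /-- the labels of an end -/
  labels : X × Bool → Finset J
  /-- the functionals -/
  func : X → J → J → H →ₗ[b] b
  /-- the matrix coefficients -/
  coef : X × Bool → J → J → H →ₗ[b] b
  func_mul : ∀ p j j' a x, j ∈ labels (p, true) → j' ∈ labels (p, false) →
    func p j j' (a * x) = ∑ u ∈ labels (p, true), coef (p, true) j u a * func p u j' x
  func_mul_antipode : ∀ p j j' a x, j ∈ labels (p, true) → j' ∈ labels (p, false) →
    func p j j' (x * 𝓗.antipode a) =
      ∑ u ∈ labels (p, false), coef (p, false) j' u a * func p j u x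

namespace LabelSystem

variable {𝓗} {X J : Type*} [Fintype X] [DecidableEq X] (E : LabelSystem 𝓗 X J)

/-- The product of the functionals of all edges, for given labels of their ends. -/
def prod (f : X × Bool → J) (x : X → H) : b := ∏ p, E.func p (f (p, true)) (f (p, false)) (x p)

/-- The sum over all labels. -/
def sum (Θ : (X × Bool → J) → b) (x : X → H) : b :=
  ∑ f ∈ Fintype.piFinset E.labels, E.prod f x * Θ f

theorem prod_actAt (z : X × Bool) (a : H) (x : X → H) {f : X × Bool → J}
    (hf : f ∈ Fintype.piFinset E.labels) :
    E.prod f (actAt 𝓗.antipode z a x) =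
      ∑ u ∈ E.labels z, E.coef z (f z) u a * E.prod (Function.update f z u) x := by
  obtain ⟨p, d⟩ := z
  have hf := Fintype.mem_piFinset.mp hf
  have hne : ∀ q ∈ ({p}ᶜ : Finset X), q ≠ p := by simp
  have h : ∀ g : X × Bool → J, E.prod g x = E.func p (g (p, true)) (g (p, false)) (x p) *
      ∏ q ∈ {p}ᶜ, E.func q (g (q, true)) (g (q, false)) (x q) := fun g =>
    Fintype.prod_eq_mul_prod_compl p _
  have h' : E.prod f (actAt 𝓗.antipode (p, d) a x) =
      E.func p (f (p, true)) (f (p, false)) (if d then a * x p else x p * 𝓗.antipode a) *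
      ∏ q ∈ {p}ᶜ, E.func q (f (q, true)) (f (q, false)) (x q) := by
    rw [prod, Fintype.prod_eq_mul_prod_compl p]
    congr 1
    · simp [actAt]
    · exact Finset.prod_congr rfl fun q hq => by simp [actAt, hne q hq]
  rw [h']
  have h'' : ∀ u, ∏ q ∈ {p}ᶜ, E.func q (Function.update f (p, d) u (q, true))
      (Function.update f (p, d) u (q, false)) (x q) =
      ∏ q ∈ {p}ᶜ, E.func q (f (q, true)) (f (q, false)) (x q) := fun u =>
    Finset.prod_congr rfl fun q hq => by
      rw [Function.update_of_ne (by simp [hne q hq]), Function.update_of_ne (by simp [hne q hq])]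
  simp only [h, h'', ← mul_assoc]
  rw [← Finset.sum_mul]
  congr 1
  cases d
  · simpa using E.func_mul_antipode p _ _ a (x p) (hf (p, true)) (hf (p, false))
  · simpa using E.func_mul p _ _ a (x p) (hf (p, true)) (hf (p, false))

theorem update_mem {f : X × Bool → J} (hf : f ∈ Fintype.piFinset E.labels) {z : X × Bool} {u : J}
    (hu : u ∈ E.labels z) : Function.update f z u ∈ Fintype.piFinset E.labels := by
  rw [Fintype.mem_piFinset] at hf ⊢
  intro i
  by_cases hi : i = z
  · subst hi
    simpa using hu
  · simpa [hi] using hf i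

/-- Exchanging the label at `z` with the summation variable, (f, u) ↦ (update f z u, f z), is an
involution of the index set. -/
theorem sum_update_comm (z : X × Bool) (G : (X × Bool → J) → J → (X × Bool → J) → J → b) :
    ∑ f ∈ Fintype.piFinset E.labels, ∑ u ∈ E.labels z, G f (f z) (Function.update f z u) u =
    ∑ f ∈ Fintype.piFinset E.labels, ∑ u ∈ E.labels z, G (Function.update f z u) u f (f z) := by
  rw [← Finset.sum_product', ← Finset.sum_product']
  refine Finset.sum_nbij' (fun q => (Function.update q.1 z q.2, q.1 z))
    (fun q => (Function.update q.1 z q.2, q.1 z)) ?_ ?_ ?_ ?_ ?_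
  · rintro ⟨f, u⟩ hq
    rw [Finset.mem_product] at hq ⊢
    exact ⟨E.update_mem hq.1 hq.2, Fintype.mem_piFinset.mp hq.1 z⟩
  · rintro ⟨f, u⟩ hq
    rw [Finset.mem_product] at hq ⊢
    exact ⟨E.update_mem hq.1 hq.2, Fintype.mem_piFinset.mp hq.1 z⟩
  · rintro ⟨f, u⟩ _
    simp
  · rintro ⟨f, u⟩ _
    simp
  · rintro ⟨f, u⟩ _
    simp

/-- By this transposition an action of H on a connection becomes an action on functions of the
labels. From here on, operators on connections are replaced by matrices acting on labels. -/
theorem sum_actAt (Θ : (X × Bool → J) → b) (z : X × Bool) (a : H) (x : X → H) :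
    E.sum Θ (actAt 𝓗.antipode z a x) =
      E.sum (fun f => ∑ u ∈ E.labels z, E.coef z u (f z) a * Θ (Function.update f z u)) x := by
  simp only [sum]
  rw [Finset.sum_congr rfl fun f hf => by rw [E.prod_actAt z a x hf, Finset.sum_mul]]
  rw [E.sum_update_comm z fun f j g u => E.coef z j u a * E.prod g x * Θ f]
  refine Finset.sum_congr rfl fun f _ => ?_
  rw [Finset.mul_sum]
  refine Finset.sum_congr rfl fun u _ => ?_
  ring

/-- The matrix of the crossing of two ends. -/
def crossCoef (o : Bool) (l r : X × Bool) (y' x' x y : J) : b :=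
  if o then 𝓗.rPair (E.coef l x' x) (E.coef r y' y)
  else 𝓗.rPair (E.coef r y' y ∘ₗ 𝓗.antipode) (E.coef l x' x)

/-- By continuity, F may be applied to the action of R term by term. The actions at the ends `l` and
`r` change two labels, independently because the ends are different, and summation over R turns the
product of the two matrix coefficients into `rPair`. -/
theorem apply_crossing {F : CConn I H X →ₗ[b] b} (hF : IsCont F) (o : Bool) {l r : X × Bool}
    (hlr : l ≠ r) (Θ : (X × Bool → J) → b)
    (h : ∀ x, F (AdicCompletion.of I _ (PiTensorProduct.tprod b x)) = E.sum Θ x) (x : X → H) :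
    F (𝓗.crossing o l r (AdicCompletion.of I _ (PiTensorProduct.tprod b x))) =
      E.sum (fun f => ∑ u ∈ E.labels l, ∑ w ∈ E.labels r, E.crossCoef o l r w u (f l) (f r) *
        Θ (Function.update (Function.update f l u) r w)) x := by
  have hF' : ∀ (B : H →ₗ[b] H →ₗ[b] Module.End b (Conn b H X)),
      F (cbilin I (TensorProduct.lift B) 𝓗.R (AdicCompletion.of I _ (PiTensorProduct.tprod b x))) =
        pairing 𝓗.R ((B.compr₂ (LinearMap.applyₗ (PiTensorProduct.tprod b x))).compr₂
          (F ∘ₗ AdicCompletion.of I _)) := by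
    intro B
    rw [hF, cint_cbilin, cint_of, pairing_apply, LinearMap.comp_apply, cintL_apply]
    congr 2
    ext s t
    simp
  -- `key` serves positive crossings, where the first leg of R acts on `l`. Its counterpart `key'`
  -- serves negative ones, where the first leg acts on `r`.
  have key : ∀ (B : H →ₗ[b] H →ₗ[b] b) (P Q : J → J → H →ₗ[b] b),
      (∀ s t, B s t = E.sum (fun f => ∑ u ∈ E.labels l, ∑ w ∈ E.labels r,
        P (f l) u s * Q (f r) w t * Θ (Function.update (Function.update f l u) r w)) x) →
      pairing 𝓗.R B = E.sum (fun f => ∑ u ∈ E.labels l, ∑ w ∈ E.labels r,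
        𝓗.rPair (P (f l) u) (Q (f r) w) *
          Θ (Function.update (Function.update f l u) r w)) x := by
    intro B P Q hB
    have : B = ∑ f ∈ Fintype.piFinset E.labels, ∑ u ∈ E.labels l, ∑ w ∈ E.labels r,
        (E.prod f x * Θ (Function.update (Function.update f l u) r w)) •
          (LinearMap.mul b b).compl₁₂ (P (f l) u) (Q (f r) w) := by
      ext s t
      simp only [hB, sum, LinearMap.sum_apply, Finset.mul_sum, LinearMap.smul_apply,
        LinearMap.compl₁₂_apply, LinearMap.mul_apply', smul_eq_mul]
      refine Finset.sum_congr rfl fun f _ => Finset.sum_congr rfl fun u _ =>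
        Finset.sum_congr rfl fun w _ => ?_
      ring
    rw [this]
    simp only [map_sum, map_smul, sum, Finset.mul_sum, smul_eq_mul]
    refine Finset.sum_congr rfl fun f _ => Finset.sum_congr rfl fun u _ =>
        Finset.sum_congr rfl fun w _ => ?_
    have : pairing 𝓗.R ((LinearMap.mul b b).compl₁₂ (P (f l) u) (Q (f r) w)) =
      𝓗.rPair (P (f l) u) (Q (f r) w) := rfl
    rw [this]
    ring
  have key' : ∀ (B : H →ₗ[b] H →ₗ[b] b) (P Q : J → J → H →ₗ[b] b),
      (∀ s t, B s t = E.sum (fun f => ∑ u ∈ E.labels l, ∑ w ∈ E.labels r,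
        P (f l) u t * Q (f r) w s * Θ (Function.update (Function.update f l u) r w)) x) →
      pairing 𝓗.R B = E.sum (fun f => ∑ u ∈ E.labels l, ∑ w ∈ E.labels r,
        𝓗.rPair (Q (f r) w) (P (f l) u) *
          Θ (Function.update (Function.update f l u) r w)) x := by
    intro B P Q hB
    have : B = ∑ f ∈ Fintype.piFinset E.labels, ∑ u ∈ E.labels l, ∑ w ∈ E.labels r,
        (E.prod f x * Θ (Function.update (Function.update f l u) r w)) •
          (LinearMap.mul b b).compl₁₂ (Q (f r) w) (P (f l) u) := by
      ext s t
      simp only [hB, sum, LinearMap.sum_apply, Finset.mul_sum, LinearMap.smul_apply,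
        LinearMap.compl₁₂_apply, LinearMap.mul_apply', smul_eq_mul]
      refine Finset.sum_congr rfl fun f _ => Finset.sum_congr rfl fun u _ =>
        Finset.sum_congr rfl fun w _ => ?_
      ring
    rw [this]
    simp only [map_sum, map_smul, sum, Finset.mul_sum, smul_eq_mul]
    refine Finset.sum_congr rfl fun f _ => Finset.sum_congr rfl fun u _ =>
        Finset.sum_congr rfl fun w _ => ?_
    have : pairing 𝓗.R ((LinearMap.mul b b).compl₁₂ (Q (f r) w) (P (f l) u)) =
      𝓗.rPair (Q (f r) w) (P (f l) u) := rfl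
    rw [this]
    ring
  cases o
  · rw [RibbonHopfAlgebra.crossing, if_neg (by simp), hF']
    refine (key' _ (fun j u => E.coef l u j) (fun j w => E.coef r w j ∘ₗ 𝓗.antipode) ?_).trans ?_
    · intro s t
      have : ∀ s t, F (AdicCompletion.of I _ (endAct 𝓗.antipode r (𝓗.antipode s)
          (endAct 𝓗.antipode l t (PiTensorProduct.tprod b x)))) = _ := fun s t => by
        rw [endAct_tprod, endAct_tprod, h, sum_actAt, sum_actAt]
      refine (this s t).trans ?_
      simp only [sum, Function.update_of_ne hlr.symm, Finset.mul_sum, LinearMap.comp_apply,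
        mul_assoc]
    · simp [crossCoef]
  · rw [RibbonHopfAlgebra.crossing, if_pos rfl, hF']
    refine (key _ (fun j u => E.coef l u j) (fun j w => E.coef r w j) ?_).trans ?_
    · intro s t
      have : ∀ s t, F (AdicCompletion.of I _ (endAct 𝓗.antipode l s
          (endAct 𝓗.antipode r t (PiTensorProduct.tprod b x)))) = _ := fun s t => by
        rw [endAct_tprod, endAct_tprod, h, sum_actAt, sum_actAt]
      refine (this s t).trans ?_
      simp only [sum, Function.update_of_ne hlr, Finset.mul_sum, LinearMap.comp_apply,
        mul_assoc]
      refine Finset.sum_congr rfl fun f _ => ?_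
      rw [Finset.sum_comm]
      refine Finset.sum_congr rfl fun u _ => Finset.sum_congr rfl fun w _ => ?_
      rw [Function.update_comm hlr]
      ring
    · simp [crossCoef]

end LabelSystem

end Labels

namespace Model

section

variable {b H : Type*} [CommRing b] {I : Ideal b} [IsAdicComplete I b] [Ring H] [Algebra b H]
  [IsAdicComplete I H] {𝓗 : RibbonHopfAlgebra I H} {C : Type*} {χ : C → H →ₗ[b] b}
  {Pt : Type*} [Fintype Pt] (𝓜 : Model 𝓗 χ Pt)

/-! ### The functionals of an edge -/

/-- The matrix element of an edge with colour `c`, with label `z` at its initial end and `z'` at its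
terminal end. -/
def edge (c : C) (z z' : Pt) : H →ₗ[b] b := ∑ y, 𝓜.cup c true y z' • 𝓜.coef z y

theorem edge_apply (c : C) (z z' : Pt) (x : H) :
    𝓜.edge c z z' x = ∑ y, 𝓜.cup c true y z' * 𝓜.coef z y x := by
  simp [edge, LinearMap.sum_apply]

theorem edge_mul (c : C) (z z' : Pt) (a x : H) :
    𝓜.edge c z z' (a * x) = ∑ u, 𝓜.coef z u a * 𝓜.edge c u z' x := by
  simp only [edge_apply, 𝓜.coef_mul _ _ _ _, Finset.mul_sum]
  rw [Finset.sum_comm]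
  refine Finset.sum_congr rfl fun u _ => Finset.sum_congr rfl fun y _ => ?_
  ring

/-- The label at the terminal end is a label of the dual module. The factor S(a) at the right of x
becomes the action of a on the second leg of the coevaluation. -/
theorem edge_mul_antipode (c : C) (z z' : Pt) (a x : H) :
    𝓜.edge c z z' (x * 𝓗.antipode a) = ∑ u, 𝓜.coef z' u a * 𝓜.edge c z u x := by
  simp only [edge_apply, 𝓜.coef_mul _ _ _ _, Finset.mul_sum]
  rw [Finset.sum_comm, Finset.sum_comm (f := fun u y => 𝓜.coef z' u a * _)]
  refine Finset.sum_congr rfl fun w _ => ?_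
  have := 𝓜.sum_cup_coef c true w z' (LinearMap.applyₗ a)
  simp only [LinearMap.applyₗ_apply_apply, LinearMap.comp_apply] at this
  rw [Finset.sum_congr rfl fun y _ => mul_left_comm _ _ _, ← Finset.mul_sum, ← this,
    Finset.mul_sum]
  refine Finset.sum_congr rfl fun u _ => ?_
  ring

theorem edge_eq_zero (c : C) {z : Pt} (z' : Pt) (h : 𝓜.ty z ≠ (c, true)) : 𝓜.edge c z z' = 0 := by
  refine Finset.sum_eq_zero fun y _ => ?_
  by_cases hy : 𝓜.ty z = 𝓜.ty y
  · rw [𝓜.cup_eq_zero _ _ _ _ fun h' => h (hy.trans h'.1), zero_smul]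
  · rw [𝓜.coef_eq_zero _ _ hy, smul_zero]

theorem sum_edge_cap (c : C) (z w : Pt) (hw : 𝓜.ty w = (c, true)) (x : H) :
    ∑ z', 𝓜.edge c z z' x * 𝓜.cap z' w = 𝓜.coef z w x := by
  simp only [edge_apply, Finset.sum_mul]
  rw [Finset.sum_comm, ← 𝓜.sum_coef_one_mul' w fun y => 𝓜.coef z y x]
  refine Finset.sum_congr rfl fun y _ => ?_
  rw [← 𝓜.cup_cap c true y w hw, Finset.sum_mul]
  refine Finset.sum_congr rfl fun u _ => ?_
  ring

theorem sum_edge_cap_right (c : C) (z w : Pt) (hw : 𝓜.ty w = (c, true)) (x : H) :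
    ∑ z', 𝓜.edge c z z' x * 𝓜.cap w z' = 𝓜.coef z w (x * 𝓗.charm) := by
  simp only [edge_apply, Finset.sum_mul, 𝓜.coef_mul _ _ _ _]
  rw [Finset.sum_comm]
  refine Finset.sum_congr rfl fun y _ => ?_
  rw [← 𝓜.cup_cap_right c true y w hw, Finset.mul_sum]
  refine Finset.sum_congr rfl fun u _ => ?_
  ring

/-- The value of a local maximum on two ends of which one is terminal, the other initial. -/
def capEnds (lt : Bool) (z' z : Pt) : b := if lt then 𝓜.cap z' z else 𝓜.cap z z'

/-- The coevaluation inside the first edge meets the evaluation of the cap. They form a zigzag if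
the terminal end is on the left; otherwise they close on the other side and leave a factor k. -/
theorem sum_edge_capEnds (lt : Bool) (c : C) (z w : Pt) (hw : 𝓜.ty w = (c, true)) (x : H) :
    ∑ z', 𝓜.edge c z z' x * 𝓜.capEnds lt z' w =
      𝓜.coef z w (x * if lt then 1 else 𝓗.charm) := by
  cases lt
  · simpa [capEnds] using 𝓜.sum_edge_cap_right c z w hw x
  · simpa [capEnds] using 𝓜.sum_edge_cap c z w hw x

theorem sum_edge_capEnds_edge (lt : Bool) (c : C) (z z' : Pt) (x y : H) :
    ∑ u, ∑ w, 𝓜.edge c z u x * 𝓜.capEnds lt u w * 𝓜.edge c w z' y =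
      𝓜.edge c z z' (x * (if lt then 1 else 𝓗.charm) * y) := by
  rw [edge_mul, Finset.sum_comm]
  refine Finset.sum_congr rfl fun w _ => ?_
  by_cases hw : 𝓜.ty w = (c, true)
  · rw [← Finset.sum_mul, 𝓜.sum_edge_capEnds lt c z w hw]
  · simp [𝓜.edge_eq_zero c z' hw]

/-- Contracting both labels of one edge gives a sum of diagonal coefficients. Only labels of colour
`c` and direction `true` contribute, and over these the sum is the trace. -/
theorem sum_edge_capEnds_self (lt : Bool) (c : C) (x : H) :
    ∑ z, ∑ z', 𝓜.edge c z z' x * 𝓜.capEnds lt z' z = χ c (x * if lt then 1 else 𝓗.charm) := by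
  obtain ⟨s, hs, h⟩ := 𝓜.trace_eq c
  rw [h, LinearMap.sum_apply]
  refine (Finset.sum_subset (Finset.subset_univ s) fun z _ hz => ?_).symm.trans
    (Finset.sum_congr rfl fun z hz => ?_)
  · simp [𝓜.edge_eq_zero c _ fun h => hz ((hs z).mpr h)]
  · exact 𝓜.sum_edge_capEnds lt c z z ((hs z).mp hz) x

theorem edge_one (c : C) (z z' : Pt) : 𝓜.edge c z z' 1 = 𝓜.cup c true z z' := by
  rw [edge_apply, ← 𝓜.sum_coef_one_mul z fun y => 𝓜.cup c true y z']
  exact Finset.sum_congr rfl fun y _ => mul_comm _ _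

/-- A local minimum traversed from right to left carries k⁻¹. The factor is created by closing the
coevaluation of opposite direction on the wrong side, and a zigzag removes the auxiliary labels. -/
theorem edge_charmInv (c : C) (z z' : Pt) :
    𝓜.edge c z z' 𝓗.charmInv = 𝓜.cup c false z' z := by
  have h1 : ∀ w, 𝓜.cup c true w z' * 𝓜.coef z w 𝓗.charmInv =
      ∑ u, 𝓜.cup c false u z * (𝓜.cap u w * 𝓜.cup c true w z') := by
    intro w
    by_cases hw : 𝓜.ty w = (c, true)
    · rw [← 𝓜.cup_cap_left c false z w hw, Finset.mul_sum]
      refine Finset.sum_congr rfl fun u _ => ?_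
      ring
    · simp [𝓜.cup_eq_zero c true w z' fun h => hw h.1]
  rw [edge_apply, Finset.sum_congr rfl fun w _ => h1 w, Finset.sum_comm,
    ← 𝓜.sum_coef_one_mul' z' fun u => 𝓜.cup c false u z]
  refine Finset.sum_congr rfl fun u _ => ?_
  rw [← Finset.mul_sum]
  by_cases hu : 𝓜.ty u = (c, false)
  · rw [𝓜.cap_cup c true u z' hu, mul_comm]
  · simp [𝓜.cup_eq_zero c false u z fun h => hu h.1]

theorem edge_cup (c : C) (d : Bool) (z z' : Pt) :
    𝓜.edge c z z' (if d then 1 else 𝓗.charmInv) =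
      𝓜.cup c d (if d then z else z') (if d then z' else z) := by
  cases d
  · exact 𝓜.edge_charmInv c z z'
  · exact 𝓜.edge_one c z z'

/-- The labels of the ends of edges of given colours. -/
def system {X : Type*} (col : X → C) : LabelSystem 𝓗 X Pt where
  labels _ := Finset.univ
  func p := 𝓜.edge (col p)
  coef _ := 𝓜.coef
  func_mul _ _ _ _ _ _ _ := 𝓜.edge_mul _ _ _ _ _
  func_mul_antipode _ _ _ _ _ _ _ := 𝓜.edge_mul_antipode _ _ _ _ _

theorem system_sum {X : Type*} [Fintype X] [DecidableEq X] (col : X → C)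
    (Θ : (X × Bool → Pt) → b) (x : X → H) : (𝓜.system col).sum Θ x =
      ∑ f : X × Bool → Pt, (∏ p, 𝓜.edge (col p) (f (p, true)) (f (p, false)) (x p)) * Θ f := by
  rw [LabelSystem.sum]
  exact Finset.sum_congr Fintype.piFinset_univ fun _ _ => rfl

variable {V : Type*} [DecidableEq V]

theorem value_cross (v : V) (o : Bool) (es : List (Event V C)) {σ : V → List Pt} {p s : List Pt}
    {x y : Pt} (h : σ v = p ++ x :: y :: s) : 𝓜.value (.cross v p.length o :: es) σ =
      ∑ y', ∑ x', 𝓜.cross o y' x' x y *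
        𝓜.value es (Function.update σ v (p ++ y' :: x' :: s)) := by
  refine Eq.trans ?_ (𝓜.localStep_cross_zero v o
    (fun l => 𝓜.value es (Function.update σ v (p ++ l))) x y s)
  refine Eq.trans ?_ (𝓜.localStep_cross_shift v o
    (fun l => 𝓜.value es (Function.update σ v l)) p _ 0)
  rw [← h]
  rfl

theorem value_cap (v : V) (es : List (Event V C)) {σ : V → List Pt} {p s : List Pt}
    {x y : Pt} (h : σ v = p ++ x :: y :: s) : 𝓜.value (.cap v p.length :: es) σ =
      𝓜.cap x y * 𝓜.value es (Function.update σ v (p ++ s)) := by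
  refine Eq.trans ?_ (𝓜.localStep_cap_zero v
    (fun l => 𝓜.value es (Function.update σ v (p ++ l))) x y s)
  refine Eq.trans ?_ (𝓜.localStep_cap_shift v
    (fun l => 𝓜.value es (Function.update σ v l)) p _ 0)
  rw [← h]
  rfl

theorem value_cup (v : V) (c : C) (d : Bool) (es : List (Event V C)) {σ : V → List Pt}
    {p s : List Pt} (h : σ v = p ++ s) : 𝓜.value (.cup v p.length c d :: es) σ =
      ∑ x, ∑ y, 𝓜.cup c d x y * 𝓜.value es (Function.update σ v (p ++ x :: y :: s)) := by
  refine Eq.trans ?_ (𝓜.localStep_cup_zero v c d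
    (fun l => 𝓜.value es (Function.update σ v (p ++ l))) s)
  refine Eq.trans ?_ (𝓜.localStep_cup_shift v c d
    (fun l => 𝓜.value es (Function.update σ v l)) p _ 0)
  rw [← h]
  rfl

end

end Model

/-! ### The operators of events -/

section Ends

variable {b H : Type*} [CommRing b] {I : Ideal b} [IsAdicComplete I b] [Ring H] [Algebra b H]
  [IsAdicComplete I H] (𝓗 : RibbonHopfAlgebra I H) {C : Type*} (χ : C → H →ₗ[b] b)
  {V : Type*} [DecidableEq V] {X : Type u} [DecidableEq X]

/-- The two ends of edges `p`, `q` that are joined by a local maximum: the terminal end of `p` and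
the initial end of `q`. -/
def joinedEnds (p q : X) (lt : Bool) : List (X × Bool) :=
  if lt then [(p, false), (q, true)] else [(q, true), (p, false)]

theorem evalEvents_cross (es : List (Event V C)) (col : X → C) {st : V → List (X × Bool)} {v : V}
    (o : Bool) {P S : List (X × Bool)} {l r : X × Bool} (h : st v = P ++ l :: r :: S) :
    𝓗.evalEvents χ (.cross v P.length o :: es) X col st =
      𝓗.evalEvents χ es X col (Function.update st v (P ++ r :: l :: S)) ∘ₗ 𝓗.crossing o l r := by
  simp [RibbonHopfAlgebra.evalEvents, h]

theorem evalEvents_cup (es : List (Event V C)) (col : X → C) {st : V → List (X × Bool)} {v : V}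
    (c : C) (d : Bool) {P S : List (X × Bool)} (h : st v = P ++ S) :
    𝓗.evalEvents χ (.cup v P.length c d :: es) X col st =
      𝓗.evalEvents χ es (Option X) (fun x => x.elim c col)
        (Function.update (fun w => (st w).map fun y => (some y.1, y.2)) v
          (P.map (fun y => (some y.1, y.2)) ++ (none, d) :: (none, !d) ::
            S.map fun y => (some y.1, y.2))) ∘ₗ 𝓗.cup d := by
  simp [RibbonHopfAlgebra.evalEvents, h]

theorem evalEvents_capTrace (es : List (Event V C)) (col : X → C) {st : V → List (X × Bool)}
    {v : V} (p : X) (lt : Bool) {P S : List (X × Bool)} (h : st v = P ++ (joinedEnds p p lt ++ S)) :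
    𝓗.evalEvents χ (.cap v P.length :: es) X col st =
      𝓗.evalEvents χ es ({p}ᶜ : Set X) (fun x => col x)
        (fun w => (Function.update st v (P ++ S) w).filterMap fun y =>
          if hy : y.1 = p then none else some (⟨y.1, hy⟩, y.2)) ∘ₗ
        𝓗.capTrace p (χ (col p)) lt := by
  cases lt
  · simp [RibbonHopfAlgebra.evalEvents, h, joinedEnds, List.drop_append, List.drop_eq_nil_of_le]
  · simp [RibbonHopfAlgebra.evalEvents, h, joinedEnds, List.drop_append, List.drop_eq_nil_of_le]

theorem evalEvents_capJoin (es : List (Event V C)) (col : X → C) {st : V → List (X × Bool)}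
    {v : V} (p q : X) (hpq : q ≠ p) (lt : Bool) {P S : List (X × Bool)}
    (h : st v = P ++ (joinedEnds p q lt ++ S)) :
    𝓗.evalEvents χ (.cap v P.length :: es) X col st =
      𝓗.evalEvents χ es ({p}ᶜ : Set X) (fun x => col x)
        (fun w => (Function.update st v (P ++ S) w).map fun y =>
          (if hy : y.1 = p then ⟨q, hpq⟩ else ⟨y.1, hy⟩, y.2)) ∘ₗ
        𝓗.capJoin p q hpq lt := by
  cases lt
  · simp [RibbonHopfAlgebra.evalEvents, h, joinedEnds, List.drop_append, List.drop_eq_nil_of_le,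
      hpq]
  · simp [RibbonHopfAlgebra.evalEvents, h, joinedEnds, List.drop_append, List.drop_eq_nil_of_le,
      hpq]

theorem cup_tprod (d : Bool) (x : X → H) :
    𝓗.cup d (AdicCompletion.of I _ (PiTensorProduct.tprod b x)) =
      AdicCompletion.of I _ (PiTensorProduct.tprod b fun y : Option X =>
        y.elim (if d then 1 else 𝓗.charmInv) x) := by
  rw [RibbonHopfAlgebra.cup, cmap_of, LinearMap.comp_apply, enlarge_tprod]
  refine congrArg _ ((single_mul_tprod _ _ _).trans (congrArg _ ?_))
  have h : ∀ y : X, Function.extend (Function.Embedding.some (α := X)) x (fun _ => (1 : H))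
      (some y) = x y := fun y => (Function.Embedding.some (α := X)).injective.extend_apply x _ y
  funext y
  cases y with
  | none => simp [Function.extend_apply', Function.Embedding.some]
  | some y => simpa using h y

theorem capTrace_tprod (p : X) (φ : H →ₗ[b] b) (lt : Bool) (x : X → H) :
    𝓗.capTrace p φ lt (AdicCompletion.of I _ (PiTensorProduct.tprod b x)) =
      φ (x p * if lt then 1 else 𝓗.charm) • AdicCompletion.of I _ (PiTensorProduct.tprod b
        fun y : ({p}ᶜ : Set X) => x y) := by
  rw [RibbonHopfAlgebra.capTrace, cmap_of, absorb_tprod, ← map_smul]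
  simp [Algebra.smul_def]

theorem capJoin_tprod (p q : X) (h : q ≠ p) (lt : Bool) (x : X → H) :
    𝓗.capJoin p q h lt (AdicCompletion.of I _ (PiTensorProduct.tprod b x)) =
      AdicCompletion.of I _ (PiTensorProduct.tprod b
        (Function.update (fun y : ({p}ᶜ : Set X) => x y) ⟨q, h⟩
          (x p * (if lt then 1 else 𝓗.charm) * x q))) := by
  rw [RibbonHopfAlgebra.capJoin, cmap_of, absorb_tprod]
  refine congrArg _ ((single_mul_tprod _ _ _).trans ?_)
  simp

theorem isCont_evalEvents (es : List (Event V C)) (X : Type u) [DecidableEq X] (col : X → C)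
    (st : V → List (X × Bool)) : IsCont (𝓗.evalEvents χ es X col st) := by
  have h0 : ∀ (Y : Type u), IsCont (0 : CConn I H Y →ₗ[b] b) := fun Y => by
    have := isCont_cint (I := I) (0 : Conn b H Y →ₗ[b] b)
    have h : cint I (0 : Conn b H Y →ₗ[b] b) = 0 := map_zero (AddMonoidHom.mk' (cint I) cint_add)
    rwa [h] at this
  induction es generalizing X with
  | nil =>
    rw [RibbonHopfAlgebra.evalEvents]
    split_ifs
    · exact isCont_cint _
    · exact h0 _
  | cons e es ih =>
    cases e with
    | cross v i o =>
      simp only [RibbonHopfAlgebra.evalEvents]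
      split
      · exact (ih _ _ _).comp_cext _
      · exact h0 _
    | cup v i c d =>
      simp only [RibbonHopfAlgebra.evalEvents]
      exact (ih _ _ _).comp_cmap _
    | cap v i =>
      simp only [RibbonHopfAlgebra.evalEvents]
      split
      · split_ifs
        · exact (ih _ _ _).comp_cmap _
        · exact (ih _ _ _).comp_cmap _
      · split_ifs
        · exact (ih _ _ _).comp_cmap _
        · exact (ih _ _ _).comp_cmap _
      · exact h0 _

end Ends

/-! ### States in which every end of an edge occurs once -/

section Occurrences

variable {α β : Type*}

open Classical in
/-- The number of occurrences of an element in a list. -/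
def occ (z : α) (l : List α) : ℕ := l.countP fun y => y = z

@[simp]
theorem occ_nil (z : α) : occ z [] = 0 := rfl

theorem occ_cons_self (z : α) (l : List α) : occ z (z :: l) = occ z l + 1 := by
  simp [occ]

theorem occ_cons_of_ne {y z : α} (h : y ≠ z) (l : List α) : occ z (y :: l) = occ z l := by
  simp [occ, h]

@[simp]
theorem occ_append (z : α) (l l' : List α) : occ z (l ++ l') = occ z l + occ z l' := by
  simp [occ]

theorem occ_perm {l l' : List α} (h : l.Perm l') (z : α) : occ z l = occ z l' :=
  h.countP_eq _

theorem occ_eq_zero {z : α} {l : List α} : occ z l = 0 ↔ z ∉ l := by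
  rw [occ, List.countP_eq_zero]
  constructor
  · intro h hz
    simpa using h z hz
  · intro h y hy
    have : y ≠ z := fun e => h (e ▸ hy)
    simpa using this

theorem occ_map {φ : α → β} {z : α} {z' : β} (h : ∀ y, φ y = z' ↔ y = z) (l : List α) :
    occ z' (l.map φ) = occ z l := by
  rw [occ, List.countP_map, occ]
  congr 1
  funext y
  simp [h]

theorem occ_cons (y z : α) (l : List α) : occ z (y :: l) = occ z [y] + occ z l :=
  occ_append z [y] l

end Occurrences

section Ends

variable {V : Type*} [Fintype V] [DecidableEq V] {X : Type*}

/-- Every end of an edge occurs exactly once. -/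
def EndsOnce (st : V → List (X × Bool)) : Prop := ∀ z, ∑ v, occ z (st v) = 1

theorem sum_occ_update (st : V → List (X × Bool)) (v : V) (L : List (X × Bool)) (z : X × Bool) :
    ∑ w, occ z (Function.update st v L w) = occ z L + ∑ w ∈ {v}ᶜ, occ z (st w) := by
  rw [Fintype.sum_eq_add_sum_compl v, Function.update_self]
  congr 1
  refine Finset.sum_congr rfl fun w hw => ?_
  rw [Function.update_of_ne (by simpa using hw)]

theorem EndsOnce.occ_add {st : V → List (X × Bool)} (h : EndsOnce st) (v : V) (z : X × Bool) :
    occ z (st v) + ∑ w ∈ {v}ᶜ, occ z (st w) = 1 := by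
  rw [← h z, Fintype.sum_eq_add_sum_compl v]

theorem not_mem_of_sum_occ {st : V → List (X × Bool)} {z : X × Bool}
    (h : ∑ w, occ z (st w) = 0) (w : V) : z ∉ st w := by
  rw [Finset.sum_eq_zero_iff] at h
  exact occ_eq_zero.mp (h w (Finset.mem_univ w))

theorem EndsOnce.sum_occ_rest {st : V → List (X × Bool)} (h : EndsOnce st) {v : V}
    {P M S : List (X × Bool)} (hv : st v = P ++ (M ++ S)) (z : X × Bool) :
    ∑ w, occ z (Function.update st v (P ++ S) w) + occ z M = 1 := by
  have := h.occ_add v z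
  rw [hv] at this
  rw [sum_occ_update]
  simp only [occ_append] at this ⊢
  omega

theorem EndsOnce.cross {st : V → List (X × Bool)} (h : EndsOnce st) {v : V}
    {P S : List (X × Bool)} {l r : X × Bool} (hv : st v = P ++ l :: r :: S) :
    EndsOnce (Function.update st v (P ++ r :: l :: S)) := by
  intro z
  rw [sum_occ_update, ← h.occ_add v z, hv]
  congr 1
  exact occ_perm (.append_left _ (.swap _ _ _)) _

theorem EndsOnce.cup {st : V → List (X × Bool)} (h : EndsOnce st) {v : V}
    {P S : List (X × Bool)} (hv : st v = P ++ S) (d : Bool) :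
    EndsOnce (Function.update (fun w => (st w).map fun y => (some y.1, y.2)) v
          (P.map (fun y => (some y.1, y.2)) ++ (none, d) :: (none, !d) ::
            S.map fun y => (some y.1, y.2))) := by
  rintro ⟨z, a⟩
  rw [sum_occ_update]
  cases z with
  | none =>
    have : ∀ l : List (X × Bool), occ (none, a) (l.map fun y => (some y.1, y.2)) = 0 := by
      intro l
      rw [occ_eq_zero]
      simp
    rw [Finset.sum_congr rfl fun w _ => this (st w), occ_append, this, occ_cons,
      occ_cons (none, !d), this]
    have h' : ∀ c : Bool, occ ((none : Option X), a) [(none, c)] = if c = a then 1 else 0 := by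
      intro c
      split_ifs with hc
      · rw [hc, occ_cons_self, occ_nil]
      · rw [occ_cons_of_ne (by simpa using hc), occ_nil]
    rw [h', h']
    cases a <;> cases d <;> simp
  | some z =>
    have : ∀ l : List (X × Bool), occ (some z, a) (l.map fun y => (some y.1, y.2)) =
        occ (z, a) l := fun l => occ_map (fun y => by simp [Prod.ext_iff]) l
    have h' := h.occ_add v (z, a)
    rw [hv, occ_append] at h'
    rw [Finset.sum_congr rfl fun w _ => this (st w), occ_append, this,
      occ_cons_of_ne (by simp), occ_cons_of_ne (by simp), this]
    exact h'

theorem occ_joinedEnds (p q : X) (lt : Bool) (z : X × Bool) :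
    occ z (joinedEnds p q lt) = occ z [(p, false)] + occ z [(q, true)] := by
  cases lt
  · exact (occ_cons _ _ _).trans (add_comm _ _)
  · exact occ_cons _ _ _

theorem occ_singleton_self (z : X × Bool) : occ z [z] = 1 := by
  rw [occ_cons_self, occ_nil]

theorem occ_singleton_of_ne {y z : X × Bool} (h : y ≠ z) : occ z [y] = 0 := by
  rw [occ_cons_of_ne h, occ_nil]

variable [DecidableEq X]

theorem occ_filterMap_ne (p : X) (l : List (X × Bool)) (z : X) (hz : z ∈ ({p}ᶜ : Set X))
    (d : Bool) :
    occ ((⟨z, hz⟩ : ({p}ᶜ : Set X)), d) (l.filterMap fun y => if hy : y.1 = p then none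
      else some ((⟨y.1, hy⟩ : ({p}ᶜ : Set X)), y.2)) = occ (z, d) l := by
  induction l with
  | nil => rfl
  | cons y l ih =>
    rw [List.filterMap_cons, occ_cons y]
    by_cases hy : y.1 = p
    · have : y ≠ (z, d) := fun h => hz (by rw [h] at hy; exact hy)
      simp only [hy, dite_true, ih, occ_singleton_of_ne this, zero_add]
    · simp only [hy, dite_false]
      rw [occ_cons, ih]
      by_cases h : y = (z, d)
      · subst h
        rw [occ_singleton_self, occ_singleton_self]
      · rw [occ_singleton_of_ne h, occ_singleton_of_ne]
        intro h'
        have h' := Prod.mk.inj h'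
        exact h (Prod.ext (congrArg Subtype.val h'.1) h'.2)

/-- The renaming of ends when `p` is joined to `q`. -/
def joinName {p q : X} (h : q ∈ ({p}ᶜ : Set X)) (y : X × Bool) : ({p}ᶜ : Set X) × Bool :=
  (if hy : y.1 = p then ⟨q, h⟩ else ⟨y.1, hy⟩, y.2)

theorem joinName_of_ne {p q : X} (h : q ∈ ({p}ᶜ : Set X)) {y : X} (hy : y ∈ ({p}ᶜ : Set X))
    (d : Bool) : joinName h (y, d) = (⟨y, hy⟩, d) :=
  Prod.ext (dif_neg hy) rfl

theorem joinName_self {p q : X} (h : q ∈ ({p}ᶜ : Set X)) (d : Bool) :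
    joinName h (p, d) = (⟨q, h⟩, d) :=
  Prod.ext (dif_pos rfl) rfl

theorem occ_map_joinName {p q : X} (h : q ∈ ({p}ᶜ : Set X)) (l : List (X × Bool)) (z : X)
    (hz : z ∈ ({p}ᶜ : Set X)) (d : Bool) :
    occ ((⟨z, hz⟩ : ({p}ᶜ : Set X)), d) (l.map (joinName h)) =
      occ (z, d) l + if z = q then occ (p, d) l else 0 := by
  induction l with
  | nil => simp
  | cons y l ih =>
    obtain ⟨y, c⟩ := y
    rw [List.map_cons, occ_cons, ih, occ_cons (y, c), occ_cons (y, c) (p, d)]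
    by_cases hy : y = p
    · subst hy
      rw [joinName_self, occ_singleton_of_ne (y := (y, c)) (z := (z, d))
        fun e => hz (Prod.mk.inj e).1.symm]
      by_cases hq : z = q
      · subst hq
        simp only [if_true]
        by_cases hd : c = d
        · subst hd
          simp only [occ_singleton_self]
          omega
        · rw [occ_singleton_of_ne (by simpa using hd), occ_singleton_of_ne (by simpa using hd)]
          omega
      · simp only [hq, if_false]
        rw [occ_singleton_of_ne fun e => hq (congrArg Subtype.val (Prod.mk.inj e).1).symm]
        omega
    · rw [joinName_of_ne h hy, occ_singleton_of_ne (y := (y, c)) (z := (p, d))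
        fun e => hy (Prod.mk.inj e).1]
      have : occ ((⟨z, hz⟩ : ({p}ᶜ : Set X)), d) [((⟨y, hy⟩ : ({p}ᶜ : Set X)), c)] =
          occ (z, d) [(y, c)] := by
        by_cases e : (y, c) = (z, d)
        · obtain ⟨rfl, rfl⟩ := Prod.mk.inj e
          rw [occ_singleton_self, occ_singleton_self]
        · rw [occ_singleton_of_ne e, occ_singleton_of_ne]
          intro e'
          have e' := Prod.mk.inj e'
          exact e (Prod.ext (congrArg Subtype.val e'.1) e'.2)
      rw [this, zero_add, add_assoc]

theorem EndsOnce.capTrace {st : V → List (X × Bool)} (h : EndsOnce st) {v : V} (p : X) {lt : Bool}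
    {P S : List (X × Bool)} (hv : st v = P ++ (joinedEnds p p lt ++ S)) :
    EndsOnce fun w => (Function.update st v (P ++ S) w).filterMap fun y =>
      if hy : y.1 = p then none else some ((⟨y.1, hy⟩ : ({p}ᶜ : Set X)), y.2) := by
  rintro ⟨⟨z, hz⟩, d⟩
  have := h.sum_occ_rest hv (z, d)
  rw [Finset.sum_congr rfl fun w _ => occ_filterMap_ne p _ z hz d]
  have hne : ∀ c : Bool, (p, c) ≠ (z, d) := fun c e => hz (Prod.mk.inj e).1.symm
  rwa [occ_joinedEnds, occ_singleton_of_ne (hne _), occ_singleton_of_ne (hne _)] at this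

/-- Two ends disappear, the terminal end of `p` and the initial end of `q`. The initial end of `p`
takes over the name of the initial end of `q`, so the renamed ends are still counted once each. -/
theorem EndsOnce.capJoin {st : V → List (X × Bool)} (h : EndsOnce st) {v : V} {p q : X}
    (hpq : q ∈ ({p}ᶜ : Set X)) {lt : Bool} {P S : List (X × Bool)}
    (hv : st v = P ++ (joinedEnds p q lt ++ S)) :
    EndsOnce fun w => (Function.update st v (P ++ S) w).map (joinName hpq) := by
  rintro ⟨⟨z, hz⟩, d⟩
  have hzp : p ≠ z := fun e => hz e.symm
  have h1 := h.sum_occ_rest hv (z, d)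
  have h2 := h.sum_occ_rest hv (p, d)
  rw [Finset.sum_congr rfl fun w _ => occ_map_joinName hpq _ z hz d, Finset.sum_add_distrib]
  rw [occ_joinedEnds] at h1 h2
  rw [occ_singleton_of_ne (y := (p, false)) (fun e => hzp (Prod.mk.inj e).1)] at h1
  rw [occ_singleton_of_ne (y := (q, true)) (z := (p, d)) (fun e => hpq (Prod.mk.inj e).1)] at h2
  by_cases hq : z = q
  · subst hq
    simp only [if_true]
    cases d
    · rw [occ_singleton_of_ne (by simp)] at h1
      rw [occ_singleton_self] at h2
      omega
    · rw [occ_singleton_self] at h1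
      rw [occ_singleton_of_ne (by simp)] at h2
      omega
  · rw [occ_singleton_of_ne (y := (q, true)) (fun e => hq (Prod.mk.inj e).1.symm)] at h1
    simpa [hq] using h1

end Ends

/-! ### Reindexing of labels -/

section Reindex

variable {X J : Type*} [DecidableEq X]

/-- Labels of the ends of a set of edges with one more edge. -/
def optionEnds : (Option X × Bool → J) ≃ (J × J) × (X × Bool → J) where
  toFun g := ((g (none, true), g (none, false)), fun z => g (some z.1, z.2))
  invFun q z := z.1.elim (if z.2 then q.1.1 else q.1.2) fun y => q.2 (y, z.2)
  left_inv g := by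
    funext ⟨z, d⟩
    cases z <;> cases d <;> rfl
  right_inv q := rfl

/-- Labels of the ends of an edge and of those of the other edges. -/
def splitEnds (p : X) : (X × Bool → J) ≃ (J × J) × (({p}ᶜ : Set X) × Bool → J) where
  toFun g := ((g (p, true), g (p, false)), fun z => g (z.1, z.2))
  invFun q z := if h : z.1 = p then (if z.2 then q.1.1 else q.1.2) else q.2 (⟨z.1, h⟩, z.2)
  left_inv g := by
    funext ⟨z, d⟩
    by_cases h : z = p
    · subst h
      cases d <;> simp
    · simp [h]
  right_inv q := by
    refine Prod.ext (Prod.ext (by simp) (by simp)) ?_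
    funext ⟨⟨z, hz⟩, d⟩
    have hz : z ≠ p := hz
    simp [hz]

/-- Labels of two ends that are joined and of the remaining ends, where the edge obtained by
joining `p` to `q` keeps the name `q`. -/
def joinEnds {p q : X} (h : q ≠ p) :
    (X × Bool → J) ≃ (J × J) × (({p}ᶜ : Set X) × Bool → J) where
  toFun g := ((g (p, false), g (q, true)), fun z =>
    if z.1.1 = q ∧ z.2 = true then g (p, true) else g (z.1, z.2))
  invFun r z := if hz : z.1 = p then (if z.2 then r.2 (⟨q, h⟩, true) else r.1.1)
    else if z.1 = q ∧ z.2 = true then r.1.2 else r.2 (⟨z.1, hz⟩, z.2)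
  left_inv g := by
    funext ⟨z, d⟩
    by_cases hz : z = p
    · subst hz
      cases d <;> simp
    · by_cases hq : z = q ∧ d = true
      · obtain ⟨rfl, rfl⟩ := hq
        simp [hz]
      · simp [hz, hq]
  right_inv r := by
    refine Prod.ext (Prod.ext (by simp) (by simp [h])) ?_
    funext ⟨⟨z, hz⟩, d⟩
    have hz : z ≠ p := hz
    by_cases hq : z = q ∧ d = true
    · obtain ⟨rfl, rfl⟩ := hq
      simp
    · simp [hz, hq]

end Reindex

theorem prod_eq_mul_prod_compl {X A : Type*} [Fintype X] [DecidableEq X] [CommMonoid A] (p : X)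
    [Fintype ({p}ᶜ : Set X)] (f : X → A) :
    ∏ x, f x = f p * ∏ x : ({p}ᶜ : Set X), f x := by
  rw [Fintype.prod_eq_mul_prod_compl p]
  congr 1
  exact Finset.prod_subtype _ (by simp) f

/-! ### The evaluation of events as a state sum -/

namespace Model

variable {b H : Type*} [CommRing b] {I : Ideal b} [IsAdicComplete I b] [Ring H] [Algebra b H]
  [IsAdicComplete I H] {𝓗 : RibbonHopfAlgebra I H} {C : Type*} {χ : C → H →ₗ[b] b}
  {Pt : Type*} [Fintype Pt] (𝓜 : Model 𝓗 χ Pt) {V : Type*} [Fintype V] [DecidableEq V]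

/-- The state that lists the labels of the ends of edges. -/
def labelState {X : Type*} (f : X × Bool → Pt) (st : V → List (X × Bool)) (v : V) : List Pt :=
  (st v).map f

/-- The coloured directed strands that belong to a list of ends of edges. -/
def endTypes {X : Type*} (col : X → C) (st : V → List (X × Bool)) (v : V) : List (C × Bool) :=
  (st v).map fun y => (col y.1, y.2)

/-- Evaluation of a sequence of events as a state sum. -/
def StateSum (es : List (Event V C)) : Prop :=
  ∀ (X : Type u) [DecidableEq X] [Fintype X] (col : X → C) (st : V → List (X × Bool)),
    EndsOnce st → Diagram.Closes (endTypes col st) es → ∀ x : X → H,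
    𝓗.evalEvents χ es X col st (AdicCompletion.of I _ (PiTensorProduct.tprod b x)) =
      ∑ f : X × Bool → Pt, (∏ p, 𝓜.edge (col p) (f (p, true)) (f (p, false)) (x p)) *
        𝓜.value es (labelState f st)

theorem stateSum_nil : StateSum.{u} (V := V) 𝓜 [] := by
  intro X _ _ col st hst hc x
  -- All lists of ends are empty, while every end of an edge has to occur in one of them.
  have hX : IsEmpty X := by
    refine ⟨fun p => ?_⟩
    have h1 := hst (p, true)
    have h2 : ∀ v, st v = [] := fun v => List.map_eq_nil_iff.mp (hc v)
    simp [h2] at h1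
  rw [RibbonHopfAlgebra.evalEvents, dif_pos hX]
  have h : ∀ v, labelState (default : X × Bool → Pt) st v = [] := fun v => by
    rw [labelState, List.map_eq_nil_iff]
    exact List.map_eq_nil_iff.mp (hc v)
  have h' : 𝓜.value ([] : List (Event V C)) (labelState (default : X × Bool → Pt) st) = 1 :=
    if_pos h
  rw [Fintype.sum_unique, h']
  have := cint_of (I := I) (PiTensorProduct.isEmptyEquiv X : Conn b H X ≃ₗ[b] b).toLinearMap
    (PiTensorProduct.tprod b x)
  refine this.trans ?_
  simp

theorem not_mem_update_of_endsOnce {X : Type*} {st : V → List (X × Bool)} (hst : EndsOnce st)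
    {v : V} {P S : List (X × Bool)} {l r : X × Bool} (hv : st v = P ++ l :: r :: S) :
    l ≠ r ∧ (∀ w, l ∉ Function.update st v (P ++ S) w) ∧
      ∀ w, r ∉ Function.update st v (P ++ S) w := by
  have hl := hst.sum_occ_rest (M := [l, r]) hv l
  have hr := hst.sum_occ_rest (M := [l, r]) hv r
  rw [occ_cons_self] at hl
  have hlr : l ≠ r := by
    intro e
    rw [← e, occ_cons_self] at hl
    omega
  rw [occ_cons_of_ne hlr, occ_cons_self] at hr
  exact ⟨hlr, not_mem_of_sum_occ (by omega), not_mem_of_sum_occ (by omega)⟩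

/-- Since every end occurs only once, a change of the labels of `l` and `r` is visible only at the
two positions of the crossing. -/
theorem labelState_cross {X : Type*} [DecidableEq X] {st : V → List (X × Bool)}
    (hst : EndsOnce st) {v : V} {P S : List (X × Bool)} {l r : X × Bool}
    (hv : st v = P ++ l :: r :: S) (f : X × Bool → Pt) (x' y' : Pt) :
    labelState (Function.update (Function.update f l x') r y')
      (Function.update st v (P ++ r :: l :: S)) =
    Function.update (labelState f st) v (P.map f ++ y' :: x' :: S.map f) := by
  obtain ⟨hlr, hl, hr⟩ := not_mem_update_of_endsOnce hst hv
  funext w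
  have h1 := hl w
  have h2 := hr w
  have hmap : ∀ L : List (X × Bool), l ∉ L → r ∉ L →
      L.map (Function.update (Function.update f l x') r y') = L.map f := by
    intro L hl hr
    refine List.map_congr_left fun z hz => ?_
    rw [Function.update_of_ne fun e => hr (by rwa [← e]),
      Function.update_of_ne fun e => hl (by rwa [← e])]
  by_cases hw : w = v
  · subst hw
    rw [Function.update_self, List.mem_append, not_or] at h1 h2
    rw [labelState, Function.update_self, Function.update_self, List.map_append, List.map_cons,
      List.map_cons, Function.update_self, Function.update_of_ne hlr, Function.update_self,
      hmap P h1.1 h2.1, hmap S h1.2 h2.2]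
  · rw [Function.update_of_ne hw] at h1 h2
    rw [labelState, Function.update_of_ne hw, Function.update_of_ne hw, labelState, hmap _ h1 h2]

theorem evalEvents_crossing {es : List (Event V C)} (X : Type u) [DecidableEq X] [Fintype X]
    (col : X → C) (st : V → List (X × Bool)) (o : Bool) {l r : X × Bool} (hlr : l ≠ r)
    (h : ∀ x : X → H, 𝓗.evalEvents χ es X col st
      (AdicCompletion.of I _ (PiTensorProduct.tprod b x)) =
      ∑ f : X × Bool → Pt, (∏ p, 𝓜.edge (col p) (f (p, true)) (f (p, false)) (x p)) *
        𝓜.value es (labelState f st)) (x : X → H) :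
    𝓗.evalEvents χ es X col st
      (𝓗.crossing o l r (AdicCompletion.of I _ (PiTensorProduct.tprod b x))) =
      ∑ f : X × Bool → Pt, (∏ p, 𝓜.edge (col p) (f (p, true)) (f (p, false)) (x p)) *
        ∑ u, ∑ w, 𝓜.cross o w u (f l) (f r) *
          𝓜.value es (labelState (Function.update (Function.update f l u) r w) st) := by
  have := (𝓜.system col).apply_crossing (isCont_evalEvents 𝓗 χ es X col st) o hlr
    (fun f => 𝓜.value es (labelState f st)) (fun x => by rw [system_sum]; exact h x) x
  rw [system_sum] at this
  exact this

theorem stateSum_cross {es : List (Event V C)} (ih : StateSum.{u} 𝓜 es) (v : V) (i : ℕ)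
    (o : Bool) : StateSum.{u} 𝓜 (.cross v i o :: es) := by
  intro X _ _ col st hst hc x
  obtain ⟨p, c, d, s, hs, rfl⟩ := hc.1.exists_cross
  obtain ⟨P, T, hv, rfl, hT⟩ := List.map_eq_append_iff.mp hs
  obtain ⟨l, T, rfl, rfl, hT'⟩ := List.map_eq_cons_iff.mp hT
  obtain ⟨r, S, rfl, rfl, rfl⟩ := List.map_eq_cons_iff.mp hT'
  have hclose : Diagram.Closes (endTypes col (Function.update st v (P ++ r :: l :: S))) es := by
    have := hc.2
    rw [Event.after_cross o hs rfl] at this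
    convert this using 1
    funext w
    by_cases hw : w = v
    · subst hw
      simp [endTypes]
    · simp [endTypes, hw]
  rw [List.length_map, evalEvents_cross 𝓗 χ es col o hv, LinearMap.comp_apply]
  refine (𝓜.evalEvents_crossing X col _ o (not_mem_update_of_endsOnce hst hv).1
    (ih X col _ (hst.cross hv) hclose) x).trans ?_
  refine Finset.sum_congr rfl fun f _ => congrArg _ ?_
  have := 𝓜.value_cross v o es (σ := labelState f st) (p := P.map f) (s := S.map f)
    (x := f l) (y := f r) (by simp [labelState, hv])
  rw [List.length_map] at this
  rw [this, Finset.sum_comm]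
  refine Finset.sum_congr rfl fun y' _ => Finset.sum_congr rfl fun x' _ => ?_
  rw [labelState_cross hst hv]

theorem stateSum_cup {es : List (Event V C)} (ih : StateSum.{u} 𝓜 es) (v : V) (i : ℕ) (c : C)
    (d : Bool) : StateSum.{u} 𝓜 (.cup v i c d :: es) := by
  intro X _ _ col st hst hc x
  have hi : i ≤ (st v).length := by simpa [endTypes, Event.Admissible] using hc.1
  obtain ⟨P, S, hv, rfl⟩ := exists_append_of_le_length hi
  rw [evalEvents_cup 𝓗 χ es col c d hv, LinearMap.comp_apply, cup_tprod]
  refine (ih (Option X) _ _ (hst.cup hv d) ?_ _).trans ?_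
  · have := hc.2
    rw [Event.after_cup (p := P.map fun y => (col y.1, y.2)) (s := S.map fun y => (col y.1, y.2))
      c d (by simp [endTypes, hv]) (by simp)] at this
    convert this using 1
    funext w
    by_cases hw : w = v
    · subst hw
      simp [endTypes, Function.comp_def]
    · simp [endTypes, hw, Function.comp_def]
  -- The sum over the two labels of the new edge is separated from the others. Its edge functional,
  -- evaluated at 1 or k⁻¹, is the matrix of the local minimum.
  · rw [← optionEnds.symm.sum_comp, Fintype.sum_prod_type, Finset.sum_comm]
    refine Finset.sum_congr rfl fun f _ => ?_
    have hcup := 𝓜.value_cup v c d es (σ := labelState f st) (p := P.map f) (s := S.map f)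
      (by simp [labelState, hv])
    rw [List.length_map] at hcup
    rw [hcup, Fintype.sum_prod_type]
    simp only [Fintype.prod_option]
    have hstate : ∀ y y' : Pt, labelState (optionEnds.symm ((y, y'), f))
        (Function.update (fun w => (st w).map fun y => (some y.1, y.2)) v
          (P.map (fun y => (some y.1, y.2)) ++ (none, d) :: (none, !d) ::
            S.map fun y => (some y.1, y.2))) =
        Function.update (labelState f st) v
          (P.map f ++ (if d then y else y') :: (if d then y' else y) :: S.map f) := by
      intro y y'
      have hsome : ∀ L : List (X × Bool), (L.map fun y => ((some y.1 : Option X), y.2)).map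
          (optionEnds.symm ((y, y'), f)) = L.map f := fun L => by
        rw [List.map_map]
        rfl
      have hnone : ∀ d : Bool, optionEnds.symm ((y, y'), f) ((none : Option X), d) =
          if d then y else y' := fun _ => rfl
      funext w
      by_cases hw : w = v
      · subst hw
        rw [labelState, Function.update_self, Function.update_self, List.map_append, List.map_cons,
          List.map_cons, hsome, hsome, hnone, hnone]
        cases d <;> rfl
      · rw [labelState, Function.update_of_ne hw, Function.update_of_ne hw, hsome]
        rfl
    simp only [hstate]
    have hedge : ∀ y y' : Pt, 𝓜.edge ((none : Option X).elim c col)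
        (optionEnds.symm ((y, y'), f) (none, true)) (optionEnds.symm ((y, y'), f) (none, false))
        ((none : Option X).elim (if d then 1 else 𝓗.charmInv) x) =
        𝓜.cup c d (if d then y else y') (if d then y' else y) := fun y y' =>
      𝓜.edge_cup c d y y'
    simp only [hedge, Finset.mul_sum]
    have hprod : ∀ y y' : Pt, (∏ p : X, 𝓜.edge ((some p : Option X).elim c col)
        (optionEnds.symm ((y, y'), f) (some p, true)) (optionEnds.symm ((y, y'), f) (some p, false))
        ((some p : Option X).elim (if d then 1 else 𝓗.charmInv) x)) =
        ∏ p, 𝓜.edge (col p) (f (p, true)) (f (p, false)) (x p) := fun _ _ => rfl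
    simp only [hprod]
    cases d
    · rw [Finset.sum_comm]
      refine Finset.sum_congr rfl fun y _ => Finset.sum_congr rfl fun y' _ => ?_
      simp only [Bool.false_eq_true, if_false]
      ring
    · refine Finset.sum_congr rfl fun y _ => Finset.sum_congr rfl fun y' _ => ?_
      simp only [if_true]
      ring

theorem exists_joinedEnds {X : Type*} (col : X → C) {y₁ y₂ : X × Bool}
    (h : (col y₂.1, y₂.2) = (col y₁.1, !y₁.2)) :
    ∃ p q lt, [y₁, y₂] = joinedEnds p q lt ∧ col p = col q := by
  obtain ⟨p, d⟩ := y₁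
  obtain ⟨q, d'⟩ := y₂
  obtain ⟨h1, rfl⟩ := Prod.mk.inj h
  cases d
  · exact ⟨p, q, true, rfl, h1.symm⟩
  · exact ⟨q, p, false, rfl, h1⟩

theorem value_cap_joinedEnds {X : Type*} {es : List (Event V C)} {st : V → List (X × Bool)} {v : V}
    {p q : X} {lt : Bool} {P S : List (X × Bool)} (hv : st v = P ++ (joinedEnds p q lt ++ S))
    (f : X × Bool → Pt) : 𝓜.value (.cap v P.length :: es) (labelState f st) =
      𝓜.capEnds lt (f (p, false)) (f (q, true)) *
        𝓜.value es (labelState f (Function.update st v (P ++ S))) := by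
  have hstate : Function.update (labelState f st) v (P.map f ++ S.map f) =
      labelState f (Function.update st v (P ++ S)) := by
    funext w
    by_cases hw : w = v
    · subst hw
      simp [labelState]
    · simp [labelState, hw]
  have hl : (P.map f).length = P.length := List.length_map _
  rw [← hstate, ← hl]
  cases lt
  · exact 𝓜.value_cap v es (by simp [labelState, hv, joinedEnds])
  · exact 𝓜.value_cap v es (by simp [labelState, hv, joinedEnds])

theorem stateSum_cap {es : List (Event V C)} (ih : StateSum.{u} 𝓜 es) (v : V) (i : ℕ) :
    StateSum.{u} 𝓜 (.cap v i :: es) := by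
  intro X _ _ col st hst hc x
  obtain ⟨p, c, d, s, hs, rfl⟩ := hc.1.exists_cap
  obtain ⟨P, T, hv, rfl, hT⟩ := List.map_eq_append_iff.mp hs
  obtain ⟨l, T, rfl, hl, hT'⟩ := List.map_eq_cons_iff.mp hT
  obtain ⟨r, S, rfl, hr, rfl⟩ := List.map_eq_cons_iff.mp hT'
  obtain ⟨p, q, lt, hlr, hcol⟩ := exists_joinedEnds col (y₁ := l) (y₂ := r) (by
    rw [hr, Prod.mk.injEq]
    obtain ⟨h1, h2⟩ := Prod.mk.inj hl
    exact ⟨h1.symm, by rw [h2]⟩)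
  have hv : st v = P ++ (joinedEnds p q lt ++ S) := by rw [hv, ← hlr]; rfl
  have hclose : Diagram.Closes (endTypes col (Function.update st v (P ++ S))) es := by
    have := hc.2
    rw [Event.after_cap hs (by simp)] at this
    convert this using 1
    funext w
    by_cases hw : w = v
    · subst hw
      simp [endTypes]
    · simp [endTypes, hw]
  rw [List.length_map]
  simp only [𝓜.value_cap_joinedEnds hv]
  have hrest : ∀ z, _ := hst.sum_occ_rest hv
  -- If both ends belong to one edge, a component closes up: both labels of the edge are contracted
  -- and a trace results.
  by_cases hqp : q = p
  · subst hqp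
    have hq : ∀ d w, (q, d) ∉ Function.update st v (P ++ S) w := fun d => not_mem_of_sum_occ (by
      have := hrest (q, d)
      rw [occ_joinedEnds] at this
      cases d
      · rw [occ_singleton_self] at this
        omega
      · rw [occ_singleton_self] at this
        omega)
    rw [evalEvents_capTrace 𝓗 χ es col q lt hv, LinearMap.comp_apply, capTrace_tprod, map_smul,
      ih ({q}ᶜ : Set X) _ _ (hst.capTrace q hv), ← (splitEnds q).symm.sum_comp,
      Fintype.sum_prod_type, Finset.sum_comm, smul_eq_mul, Finset.mul_sum]
    · refine Finset.sum_congr rfl fun f _ => ?_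
      have hstate : ∀ a, labelState ((splitEnds q).symm (a, f)) (Function.update st v (P ++ S)) =
          labelState f (fun w => (Function.update st v (P ++ S) w).filterMap fun y =>
            if hy : y.1 = q then none else some ((⟨y.1, hy⟩ : ({q}ᶜ : Set X)), y.2)) := by
        intro a
        funext w
        have : ∀ l : List (X × Bool), (∀ d, (q, d) ∉ l) → l.map ((splitEnds q).symm (a, f)) =
            (l.filterMap fun y => if hy : y.1 = q then none
              else some ((⟨y.1, hy⟩ : ({q}ᶜ : Set X)), y.2)).map f := by
          intro l hl
          induction l with
          | nil => rfl
          | cons y l ih =>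
            have hy : y.1 ≠ q := fun e => hl y.2 (by rw [← e]; exact List.mem_cons_self)
            rw [List.map_cons, List.filterMap_cons, ih fun d hd => hl d (List.mem_cons_of_mem _ hd)]
            simp [hy, splitEnds]
        exact this _ fun d => hq d w
      have hval : ∀ a : Pt × Pt, (splitEnds q).symm (a, f) (q, true) = a.1 ∧
          (splitEnds q).symm (a, f) (q, false) = a.2 ∧ ∀ (y : ({q}ᶜ : Set X)) d,
          (splitEnds q).symm (a, f) (y.1, d) = f (y, d) := by
        intro a
        have h := (splitEnds (J := Pt) q).apply_symm_apply (a, f)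
        exact ⟨congrArg (fun r => r.1.1) h, congrArg (fun r => r.1.2) h,
          fun y d => congrArg (fun r => r.2 (y, d)) h⟩
      rw [Fintype.sum_prod_type, ← 𝓜.sum_edge_capEnds_self lt (col q) (x q)]
      simp only [prod_eq_mul_prod_compl q, hstate, (hval _).1, (hval _).2.1, (hval _).2.2,
        Finset.sum_mul]
      refine Finset.sum_congr rfl fun z _ => Finset.sum_congr rfl fun z' _ => ?_
      ring
    · convert hclose using 1
      funext w
      have : ∀ l : List (X × Bool), (∀ d, (q, d) ∉ l) → (l.filterMap fun y =>
          if hy : y.1 = q then none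
            else some ((⟨y.1, hy⟩ : ({q}ᶜ : Set X)), y.2)).map (fun y => (col y.1, y.2)) =
            l.map fun y => (col y.1, y.2) := by
        intro l hl
        induction l with
        | nil => rfl
        | cons y l ih =>
          have hy : y.1 ≠ q := fun e => hl y.2 (by rw [← e]; exact List.mem_cons_self)
          rw [List.map_cons, List.filterMap_cons, ← ih fun d hd => hl d (List.mem_cons_of_mem _ hd)]
          simp [hy]
      exact this _ fun d => hq d w
  -- Otherwise two edges merge. The two labels at the cap are summed, while the initial label of `p`
  -- becomes that of the merged edge; the remaining labels are only renamed.
  · have hqp' : q ∈ ({p}ᶜ : Set X) := hqp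
    have hp : ∀ w, (p, false) ∉ Function.update st v (P ++ S) w := not_mem_of_sum_occ (by
      have := hrest (p, false)
      rw [occ_joinedEnds, occ_singleton_self] at this
      omega)
    have hq : ∀ w, (q, true) ∉ Function.update st v (P ++ S) w := not_mem_of_sum_occ (by
      have := hrest (q, true)
      rw [occ_joinedEnds, occ_singleton_self] at this
      omega)
    rw [evalEvents_capJoin 𝓗 χ es col p q hqp lt hv, LinearMap.comp_apply, capJoin_tprod]
    refine (ih ({p}ᶜ : Set X) (fun x => col x) _ (hst.capJoin hqp' hv) ?_ _).trans ?_
    · convert hclose using 1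
      funext w
      rw [endTypes, endTypes, List.map_map]
      refine List.map_congr_left fun y _ => ?_
      by_cases hy : y.1 = p
      · simp [joinName, hy, hcol]
      · simp [joinName, hy]
    · rw [← (joinEnds (J := Pt) hqp).symm.sum_comp, Fintype.sum_prod_type, Finset.sum_comm]
      refine Finset.sum_congr rfl fun f _ => ?_
      have hval : ∀ a : Pt × Pt, (joinEnds hqp).symm (a, f) (p, false) = a.1 ∧
          (joinEnds hqp).symm (a, f) (q, true) = a.2 ∧
          (joinEnds hqp).symm (a, f) (p, true) = f (⟨q, hqp'⟩, true) ∧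
          ∀ (y : ({p}ᶜ : Set X)) d, ¬ (y.1 = q ∧ d = true) →
          (joinEnds hqp).symm (a, f) (y.1, d) = f (y, d) := by
        intro a
        have h := (joinEnds (J := Pt) hqp).apply_symm_apply (a, f)
        refine ⟨congrArg (fun r => r.1.1) h, congrArg (fun r => r.1.2) h, ?_, fun y d hy => ?_⟩
        · simp [joinEnds]
        · have := congrArg (fun r => r.2 (y, d)) h
          simpa only [joinEnds, Equiv.coe_fn_mk, if_neg hy] using this
      have hstate : ∀ a, labelState ((joinEnds hqp).symm (a, f)) (Function.update st v (P ++ S)) =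
          labelState f (fun w => (Function.update st v (P ++ S) w).map (joinName hqp')) := by
        intro a
        funext w
        rw [labelState, labelState, List.map_map]
        refine List.map_congr_left fun y hy => ?_
        obtain ⟨y, d⟩ := y
        rw [Function.comp_apply]
        by_cases hyp : y = p
        · subst hyp
          cases d
          · exact absurd hy (hp w)
          · rw [joinName_self, (hval a).2.2.1]
        · rw [joinName_of_ne hqp' hyp]
          refine (hval a).2.2.2 ⟨y, hyp⟩ d ?_
          rintro ⟨e, rfl⟩
          have e : y = q := e
          subst e
          exact hq w hy
      have hrest : ∀ (a : Pt × Pt), ∀ y ∈ ({⟨q, hqp'⟩}ᶜ : Finset ({p}ᶜ : Set X)),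
          𝓜.edge (col y) ((joinEnds hqp).symm (a, f) (y.1, true))
            ((joinEnds hqp).symm (a, f) (y.1, false)) (x y) =
          𝓜.edge (col y) (f (y, true)) (f (y, false)) (x y) := by
        intro a y hy
        have hy' : y.1 ≠ q := fun e => by
          rw [Finset.mem_compl, Finset.mem_singleton] at hy
          exact hy (Subtype.ext e)
        rw [(hval a).2.2.2 y true fun e => hy' e.1, (hval a).2.2.2 y false fun e => hy' e.1]
      have hqf : ∀ a, (joinEnds hqp).symm (a, f) (q, false) = f (⟨q, hqp'⟩, false) := fun a =>
        (hval a).2.2.2 ⟨q, hqp'⟩ false (by simp)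
      simp only [prod_eq_mul_prod_compl p, hstate, (hval _).1, (hval _).2.1, (hval _).2.2.1]
      simp only [Fintype.prod_eq_mul_prod_compl (⟨q, hqp'⟩ : ({p}ᶜ : Set X)), (hval _).2.1, hqf]
      rw [Function.update_self, ← hcol, ← 𝓜.sum_edge_capEnds_edge lt (col p)]
      rw [Fintype.sum_prod_type, Finset.sum_mul, Finset.sum_mul]
      refine Finset.sum_congr rfl fun u _ => ?_
      rw [Finset.sum_mul, Finset.sum_mul]
      refine Finset.sum_congr rfl fun w _ => ?_
      rw [Finset.prod_congr rfl (hrest (u, w))]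
      have : ∀ y ∈ ({⟨q, hqp'⟩}ᶜ : Finset ({p}ᶜ : Set X)),
          Function.update (fun y : ({p}ᶜ : Set X) => x y) ⟨q, hqp'⟩
            (x p * (if lt then 1 else 𝓗.charm) * x q) y = x y := by
        intro y hy
        rw [Finset.mem_compl, Finset.mem_singleton] at hy
        rw [Function.update_of_ne hy]
      rw [Finset.prod_congr rfl fun y hy => by rw [this y hy]]
      change _ * 𝓜.value es (labelState f fun w =>
        (Function.update st v (P ++ S) w).map (joinName hqp')) = _
      ring

theorem stateSum (es : List (Event V C)) : StateSum.{u} 𝓜 es := by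
  induction es with
  | nil => exact 𝓜.stateSum_nil
  | cons e es ih =>
    cases e with
    | cross v i o => exact 𝓜.stateSum_cross ih v i o
    | cap v i => exact 𝓜.stateSum_cap ih v i
    | cup v i c d => exact 𝓜.stateSum_cup ih v i c d

end Model

/-! ### Product functionals and cables -/

section Product

variable {b H : Type*} [CommRing b] {I : Ideal b} [IsAdicComplete I b] [Ring H] [Algebra b H]

/-- The product of functionals on the factors of a tensor power. -/
def prodFun {X : Type*} [Fintype X] (g : X → H →ₗ[b] b) : Conn b H X →ₗ[b] b :=
  PiTensorProduct.lift ((MultilinearMap.mkPiAlgebra b X b).compLinearMap g)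

@[simp]
theorem prodFun_tprod {X : Type*} [Fintype X] (g : X → H →ₗ[b] b) (x : X → H) :
    prodFun g (PiTensorProduct.tprod b x) = ∏ p, g p (x p) := by
  simp [prodFun]

namespace RibbonHopfAlgebra

variable (𝓗 : RibbonHopfAlgebra I H)

/-- The convolution of a list of functionals. -/
def convList : List (H →ₗ[b] b) → H →ₗ[b] b
  | [] => 𝓗.counit.toLinearMap
  | f :: l => 𝓗.conv f (convList l)

/-- Convolution of functionals is dual to Δ, so a product of functionals on the parallel strands of
a band is a single functional on the factor of its edge. -/
theorem cint_iterComul {m : ℕ} (g : Fin m → H →ₗ[b] b) (a : H) :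
    cint I (prodFun g) (𝓗.iterComul m a) = 𝓗.convList (List.ofFn g) a := by
  induction m generalizing a with
  | zero =>
    rw [iterComul, LinearMap.comp_apply, LinearMap.comp_apply, cint_of, List.ofFn_zero, convList]
    have h1 : (1 : Conn b H (Fin 0)) = PiTensorProduct.tprod b (fun _ => 1) := rfl
    rw [Algebra.linearMap_apply, Algebra.algebraMap_eq_smul_one, map_smul, h1, prodFun_tprod]
    simp
  | succ m ih =>
    rw [iterComul, LinearMap.comp_apply, cint_cext, List.ofFn_succ, convList]
    refine Eq.trans ?_ (𝓗.dInt_apply _ a).symm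
    rw [pairing_apply]
    congr 2
    ext x y
    simp only [TensorProduct.AlgebraTensorModule.curry_apply, TensorProduct.curry_apply,
      LinearMap.coe_restrictScalars, LinearMap.comp_apply, TensorProduct.lift.tmul]
    refine (cint_cmap _ _ _).trans ?_
    have h : prodFun g ∘ₗ (LinearMap.mul b (Conn b H (Fin (m + 1))) (single b 0 x) ∘ₗ
        enlarge b H (Fin.succEmb m)) = g 0 x • prodFun fun i => g i.succ := by
      ext u
      simp only [LinearMap.compMultilinearMap_apply, LinearMap.comp_apply, LinearMap.smul_apply,
        enlarge_tprod, LinearMap.mul_apply', single_mul_tprod, prodFun_tprod, Fin.prod_univ_succ,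
        Function.update_self, smul_eq_mul]
      have h0 : Function.extend (Fin.succEmb m) u (fun _ => (1 : H)) 0 = 1 :=
        Function.extend_apply' _ _ _ fun ⟨i, hi⟩ => Fin.succ_ne_zero i hi
      rw [h0, mul_one]
      congr 1
      refine Finset.prod_congr rfl fun i _ => ?_
      rw [Function.update_of_ne (Fin.succ_ne_zero i)]
      congr 1
      exact (Fin.succEmb m).injective.extend_apply _ _ i
    rw [h, cint_smul, LinearMap.smul_apply, ih]
    rfl

variable {O : Type*} [Fintype O] [DecidableEq O] {m : O → ℕ}

theorem isCont_spread {X : Type*} [DecidableEq X] {P : Type*} [AddCommGroup P] [Module b P]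
    [IsAdicComplete I P] (l : List X) {k : X → ℕ} (f : ∀ p, Fin (k p) ↪ X)
    {F : CConn I H X →ₗ[b] P} (hF : IsCont F) :
    IsCont (F ∘ₗ (l.map fun p => 𝓗.spread p (f p)).prod) := by
  induction l generalizing F with
  | nil => exact hF
  | cons p l ih =>
    rw [List.map_cons, List.prod_cons]
    exact ih (hF.comp_cext _)

theorem spread_tprod {X : Type*} [DecidableEq X] (p : X) {k : ℕ} (f : Fin k ↪ X) (y : X → H) :
    𝓗.spread p f (AdicCompletion.of I _ (PiTensorProduct.tprod b y)) =
      cmap I ((LinearMap.mul b (Conn b H X)).flip (PiTensorProduct.tprod b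
        (Function.update y p 1)) ∘ₗ enlarge b H f) (𝓗.iterComul k (y p)) := by
  rw [spread, cext_of, LinearMap.comp_apply, LinearEquiv.coe_coe,
    PiTensorProduct.equivPiTensorComplSingletonTensor_tprod, TensorProduct.lift.tmul]
  refine (LinearMap.comp_apply _ _ _).trans ?_
  rw [enlarge_tprod]
  congr 5
  funext q
  by_cases hq : q = p
  · subst hq
    rw [Function.update_self]
    refine Function.extend_apply' _ _ _ ?_
    rintro ⟨⟨r, hr⟩, h⟩
    exact hr h
  · rw [Function.update_of_ne hq]
    exact (Function.Embedding.subtype (· ∈ ({p}ᶜ : Set X))).injective.extend_apply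
      (fun i => y i) _ ⟨q, hq⟩

/-- The embedding of the branches of an edge. -/
abbrev branches (m : O → ℕ) (e : O) : Fin (m e) ↪ O ⊕ Σ e : O, Fin (m e) :=
  (Function.Embedding.sigmaMk (β := fun e : O => Fin (m e)) e).trans Function.Embedding.inr

/-- Induction on the edges that are spread, from the end of the list, since the last operator of the
product acts first. An edge that has been spread keeps a factor 1, on which the counit is 1, and an
edge still to be spread has only factors 1 on its branches; so the two kinds contribute
independently. -/
theorem spread_list_tprod (g : (Σ e : O, Fin (m e)) → H →ₗ[b] b)
    {F : CConn I H (O ⊕ Σ e : O, Fin (m e)) →ₗ[b] b}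
    (hF : IsCont F)
    (h : ∀ y, F (AdicCompletion.of I _ (PiTensorProduct.tprod b y)) =
      ∏ e, 𝓗.counit (y (.inl e)) * ∏ j, g ⟨e, j⟩ (y (.inr ⟨e, j⟩)))
    (l : List O) (hl : l.Nodup) (y : O ⊕ (Σ e : O, Fin (m e)) → H)
    (hy : ∀ e ∈ l, ∀ j, y (.inr ⟨e, j⟩) = 1) :
    F ((l.map fun e => 𝓗.spread (X := O ⊕ Σ e : O, Fin (m e)) (.inl e) (branches m e)).prod
      (AdicCompletion.of I _ (PiTensorProduct.tprod b y))) =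
      ∏ e, if e ∈ l then 𝓗.convList (List.ofFn fun j => g ⟨e, j⟩) (y (.inl e)) else
        𝓗.counit (y (.inl e)) * ∏ j, g ⟨e, j⟩ (y (.inr ⟨e, j⟩)) := by
  induction l using List.reverseRecOn generalizing y with
  | nil => simpa using h y
  | append_singleton l e ih =>
    have hle : e ∉ l := by
      rw [List.nodup_append] at hl
      intro he
      exact hl.2.2 e he e (by simp) rfl
    rw [List.map_append, List.prod_append, List.map_singleton, List.prod_singleton,
      Module.End.mul_apply, spread_tprod]
    -- Continuity was stated for a family of embeddings over all factors. Branch factors are never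
    -- spread, so they receive an empty dummy embedding.
    have hc := 𝓗.isCont_spread (l.map Sum.inl)
      (k := fun p : O ⊕ Σ e : O, Fin (m e) => p.elim m fun _ => 0)
      (fun p => match p with
        | .inl e => branches m e
        | .inr _ => ⟨Fin.elim0, fun i => i.elim0⟩) hF
    rw [List.map_map] at hc
    refine (IsCont.cmap_apply hc _ _).trans ?_
    have hfun : (F ∘ₗ (l.map fun e => 𝓗.spread (X := O ⊕ Σ e : O, Fin (m e)) (.inl e)
        (branches m e)).prod) ∘ₗ AdicCompletion.of I _ ∘ₗ
        ((LinearMap.mul b (Conn b H (O ⊕ Σ e : O, Fin (m e)))).flip (PiTensorProduct.tprod b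
        (Function.update y (.inl e) 1)) ∘ₗ enlarge b H (branches m e)) =
        (∏ e' ∈ {e}ᶜ, if e' ∈ l then 𝓗.convList (List.ofFn fun j => g ⟨e', j⟩) (y (.inl e')) else
          𝓗.counit (y (.inl e')) * ∏ j, g ⟨e', j⟩ (y (.inr ⟨e', j⟩))) •
          prodFun fun j => g ⟨e, j⟩ := by
      ext u
      simp only [LinearMap.compMultilinearMap_apply, LinearMap.comp_apply, LinearMap.smul_apply,
        enlarge_tprod, LinearMap.flip_apply, LinearMap.mul_apply', PiTensorProduct.tprod_mul_tprod,
        prodFun_tprod]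
      have hin : ∀ j, (Function.extend (branches m e) u (fun _ => (1 : H)) *
          Function.update y (.inl e) 1) (.inr ⟨e, j⟩) = u j := by
        intro j
        have : Function.extend (branches m e) u (fun _ => (1 : H)) (.inr ⟨e, j⟩) = u j :=
          (branches m e).injective.extend_apply u _ j
        rw [Pi.mul_apply, this, Function.update_of_ne (by simp), hy e (by simp), mul_one]
      have hout : ∀ q, (∀ j, q ≠ .inr ⟨e, j⟩) →
          (Function.extend (branches m e) u (fun _ => (1 : H)) *
          Function.update y (.inl e) 1) q = Function.update y (.inl e) 1 q := by
        intro q hq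
        rw [Pi.mul_apply, Function.extend_apply' _ _ _ (by rintro ⟨j, rfl⟩; exact hq j rfl),
          one_mul]
      rw [ih (hl.sublist (List.sublist_append_left l [e]))]
      · rw [Fintype.prod_eq_mul_prod_compl e, if_neg hle, hout _ (by simp), Function.update_self,
          map_one, one_mul, mul_comm, smul_eq_mul]
        congr 1
        · refine Finset.prod_congr rfl fun e' he' => ?_
          have he' : e' ≠ e := by simpa using he'
          rw [hout _ (by simp), Function.update_of_ne (by simpa using he')]
          congr 2
          refine Finset.prod_congr rfl fun j _ => ?_
          rw [hout, Function.update_of_ne (by simp)]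
          intro j' h'
          exact he' (congrArg Sigma.fst (Sum.inr.inj h'))
        · exact Finset.prod_congr rfl fun j _ => by rw [hin]
      · intro e' he' j
        rw [hout, Function.update_of_ne (by simp)]
        · exact hy e' (by simp [he']) j
        · rintro j' h'
          have h' : e' = e := congrArg Sigma.fst (Sum.inr.inj h')
          exact hle (h' ▸ he')
    refine (congrArg (fun φ => cint I φ (𝓗.iterComul (m e) (y (.inl e)))) hfun).trans ?_
    rw [cint_smul, LinearMap.smul_apply, cint_iterComul, Fintype.prod_eq_mul_prod_compl e,
      if_pos (by simp), smul_eq_mul, mul_comm]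
    congr 1
    refine Finset.prod_congr rfl fun e' he' => ?_
    have he' : e' ≠ e := by simpa using he'
    simp [he']

theorem cint_expand (g : (Σ e : O, Fin (m e)) → H →ₗ[b] b) (x : O → H) :
    cint I (prodFun g) (𝓗.expand m (AdicCompletion.of I _ (PiTensorProduct.tprod b x))) =
      ∏ e, 𝓗.convList (List.ofFn fun j => g ⟨e, j⟩) (x e) := by
  rw [expand, LinearMap.comp_apply, LinearMap.comp_apply, cmap_of, enlarge_tprod]
  have hx : ∀ e, Function.extend (Function.Embedding.inl (β := Σ e : O, Fin (m e))) x
      (fun _ => (1 : H)) (.inl e) = x e := fun e =>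
    (Function.Embedding.inl (β := Σ e : O, Fin (m e))).injective.extend_apply x _ e
  refine (𝓗.spread_list_tprod g ((isCont_cint (I := I) (prodFun g)).comp_cmap _) (fun y => ?_) _
    (Finset.nodup_toList _) _ fun e _ j => ?_).trans ?_
  · rw [LinearMap.comp_apply, cmap_of, cint_of]
    simp only [LinearMap.comp_apply, LinearEquiv.coe_coe, PiTensorProduct.tmulEquiv_symm_apply,
      TensorProduct.map_tmul, PiTensorProduct.map_tprod, TensorProduct.lid_tmul,
      PiTensorProduct.constantBaseRingEquiv_tprod, LinearMap.id_apply, map_smul, prodFun_tprod,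
      Finset.prod_mul_distrib, smul_eq_mul]
    congr 1
    · exact PiTensorProduct.constantBaseRingEquiv_tprod _
    · exact Fintype.prod_sigma fun p : (Σ e : O, Fin (m e)) => g p (y (.inr p))
  · exact Function.extend_apply' _ _ _ (by rintro ⟨q, hq⟩; cases hq)
  · refine Finset.prod_congr rfl fun e _ => ?_
    rw [if_pos (Finset.mem_toList.mpr (Finset.mem_univ e)), hx]

end RibbonHopfAlgebra

end Product

/-! ### Sums over words -/

section Words

variable {Pt : Type*} [Fintype Pt] {A : Type*} [AddCommMonoid A]

theorem sum_words_eq_sum_ofFn {O : Type*} [Fintype O] [DecidableEq O] (n : O → ℕ)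
    (F : (O → List Pt) → A) :
    ∑ a ∈ Fintype.piFinset fun e => words Pt (n e), F a =
      ∑ v : ∀ e, Fin (n e) → Pt, F fun e => List.ofFn (v e) := by
  symm
  refine Finset.sum_bij (fun v _ e => List.ofFn (v e)) (fun v _ => ?_) (fun v _ w _ h => ?_)
    (fun a ha => ?_) fun v _ => rfl
  · simp [Fintype.mem_piFinset, mem_words]
  · funext e
    exact List.ofFn_injective (congrFun h e)
  · have ha : ∀ e, (a e).length = n e := fun e => mem_words.mp (Fintype.mem_piFinset.mp ha e)
    refine ⟨fun e j => (a e).get (j.cast (ha e).symm), Finset.mem_univ _, ?_⟩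
    funext e
    refine List.ext_get (by simp [ha]) fun i h1 h2 => ?_
    simp

end Words

namespace RibbonHopfAlgebra

/-- The states of the vertices when words are attached to the ends of the bands. -/
def endWords {O V J : Type*} (Γ : Lattice O V) (f : O × Bool → List J) (v : V) : List J :=
  (Γ.star v).flatMap f

end RibbonHopfAlgebra

namespace Model

variable {b H : Type*} [CommRing b] {I : Ideal b} [IsAdicComplete I b] [Ring H] [Algebra b H]
  [IsAdicComplete I H] {𝓗 : RibbonHopfAlgebra I H} {C : Type*} {χ : C → H →ₗ[b] b}
  {Pt : Type*} [Fintype Pt] (𝓜 : Model 𝓗 χ Pt)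

/-- The matrix elements of a strand in a band, with labels at the initial and the terminal end of
the band. -/
def strand (s : C × Bool) (x y : Pt) : H →ₗ[b] b := ∑ z, 𝓜.cup s.1 s.2 z y • 𝓜.coef x z

theorem strand_apply (s : C × Bool) (x y : Pt) (h : H) :
    𝓜.strand s x y h = ∑ z, 𝓜.cup s.1 s.2 z y * 𝓜.coef x z h := by
  simp [strand, LinearMap.sum_apply]

/-- The meaning of a switch: S(hk) = k⁻¹S(h), where k⁻¹ reverses the coevaluation and S(h) moves to
the other label as an action of h. A strand directed against its band therefore carries a matrix
element of the dual module. -/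
theorem edge_antipode_charm (c : C) (x y : Pt) :
    𝓜.edge c y x ∘ₗ 𝓗.antipode ∘ₗ (LinearMap.mul b H).flip 𝓗.charm = 𝓜.strand (c, false) x y := by
  refine LinearMap.ext fun h => ?_
  rw [LinearMap.comp_apply, LinearMap.comp_apply, LinearMap.flip_apply, LinearMap.mul_apply',
    𝓗.antipode_mul_antidistrib, edge_mul_antipode, strand_apply]
  refine Finset.sum_congr rfl fun z _ => ?_
  rw [mul_comm]
  congr 1
  exact 𝓜.edge_charmInv c y z

/-- The matrix elements of the strands in a band, with words at the initial and the terminal end of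
the band, both read from the left to the right as seen from the initial vertex. -/
def cable : List (C × Bool) → List Pt → List Pt → H →ₗ[b] b
  | [], [], [] => 𝓗.counit.toLinearMap
  | s :: l, x :: a, y :: c => 𝓗.conv (𝓜.strand s x y) (cable l a c)
  | _, _, _ => 0

theorem cable_ofFn {n : ℕ} (s : Fin n → C × Bool) (a c : Fin n → Pt) :
    𝓜.cable (List.ofFn s) (List.ofFn a) (List.ofFn c) =
      𝓗.convList (List.ofFn fun j => 𝓜.strand (s j) (a j) (c j)) := by
  induction n with
  | zero => simp [cable, RibbonHopfAlgebra.convList]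
  | succ n ih =>
    rw [List.ofFn_succ, List.ofFn_succ, List.ofFn_succ, List.ofFn_succ, cable,
      RibbonHopfAlgebra.convList, ih]

variable {O : Type u} {V : Type*} [Fintype O] [DecidableEq O] [DecidableEq V] [Fintype V]

theorem occ_of_nodup {α : Type*} [DecidableEq α] {l : List α} (h : l.Nodup) (z : α) :
    occ z l = if z ∈ l then 1 else 0 := by
  induction l with
  | nil => simp
  | cons y l ih =>
    obtain ⟨hy, hl⟩ := List.nodup_cons.mp h
    by_cases hyz : y = z
    · subst hyz
      rw [occ_cons_self, occ_eq_zero.mpr hy]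
      simp
    · rw [occ_cons_of_ne hyz, ih hl]
      simp [Ne.symm hyz]

theorem endsOnce_ends (Γ : Lattice O V) {n : O → ℕ} (d : (Σ e, Fin (n e)) → Bool) :
    EndsOnce (Γ.ends fun e => List.ofFn fun j : Fin (n e) =>
      ((⟨e, j⟩ : Σ e, Fin (n e)), d ⟨e, j⟩)) := by
  classical
  rintro ⟨⟨e, j⟩, t⟩
  have hflat : ∀ (l : List (O × Bool)) (g : O × Bool → List ((Σ e, Fin (n e)) × Bool))
      (z : (Σ e, Fin (n e)) × Bool) (y₀ : O × Bool)
      (_ : ∀ y, occ z (g y) = if y₀ = y then 1 else 0), occ z (l.flatMap g) = occ y₀ l := by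
    intro l g z y₀ h
    induction l with
    | nil => rfl
    | cons y l ih =>
      rw [List.flatMap_cons, occ_append, ih, h, occ_cons]
      congr 1
      by_cases hy : y = y₀
      · rw [if_pos hy.symm, hy, occ_singleton_self]
      · rw [if_neg (Ne.symm hy), occ_singleton_of_ne hy]
  have hinj : ∀ (e' : O) (g : Bool → Bool), Function.Injective fun j : Fin (n e') =>
      ((⟨e', j⟩ : Σ e, Fin (n e)), g (d ⟨e', j⟩)) := by
    intro e' g i i' h
    exact eq_of_heq (Sigma.mk.inj (Prod.mk.inj h).1).2
  have hmem : ∀ (e' : O) (g : Bool → Bool), ((⟨e, j⟩ : Σ e, Fin (n e)), t) ∈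
      (List.ofFn fun j : Fin (n e') => ((⟨e', j⟩ : Σ e, Fin (n e)), g (d ⟨e', j⟩))) ↔
      e' = e ∧ g (d ⟨e, j⟩) = t := by
    intro e' g
    rw [List.mem_ofFn]
    constructor
    · rintro ⟨i, hi⟩
      obtain ⟨h1, h2⟩ := Prod.mk.inj hi
      obtain ⟨rfl, h3⟩ := Sigma.mk.inj h1
      obtain rfl := eq_of_heq h3
      exact ⟨rfl, h2⟩
    · rintro ⟨rfl, h⟩
      exact ⟨j, by rw [h]⟩
  -- A strand end lies at the initial vertex of `e` exactly when it is the initial end of a strand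
  -- directed like `e` or the terminal end of one directed against it, that is, when the two truth
  -- values agree.
  have key : ∀ v, occ ((⟨e, j⟩ : Σ e, Fin (n e)), t)
      (Γ.ends (fun e => List.ofFn fun j : Fin (n e) =>
      ((⟨e, j⟩ : Σ e, Fin (n e)), d ⟨e, j⟩)) v) =
      if v = Γ.vert (e, d ⟨e, j⟩ == t) then 1 else 0 := by
    intro v
    refine (hflat _ _ _ (e, d ⟨e, j⟩ == t) fun y => ?_).trans ?_
    · obtain ⟨e', t'⟩ := y
      cases t'
      · rw [if_neg Bool.false_ne_true, occ_perm (List.reverse_perm _), List.map_ofFn]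
        refine (occ_of_nodup (List.nodup_ofFn.mpr (hinj e' not)) _).trans ?_
        simp only [hmem e' not]
        congr 1
        rw [Prod.mk.injEq, eq_comm (a := e), eq_iff_iff]
        cases d ⟨e, j⟩ <;> cases t <;> simp
      · rw [if_pos rfl]
        refine (occ_of_nodup (List.nodup_ofFn.mpr (hinj e' id)) _).trans ?_
        simp only [hmem e' id]
        congr 1
        rw [Prod.mk.injEq, eq_comm (a := e), eq_iff_iff]
        cases d ⟨e, j⟩ <;> cases t <;> simp
    · rw [occ_of_nodup (Γ.nodup v)]
      simp only [Γ.mem_star, eq_comm]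
  simp only [key]
  simp

theorem map_ends {α β : Type*} (Γ : Lattice O V) (c : α → β) (s : O → List (α × Bool)) (v : V) :
    (Γ.ends s v).map (fun y => (c y.1, y.2)) =
      Γ.ends (fun e => (s e).map fun y => (c y.1, y.2)) v := by
  rw [Lattice.ends, List.map_flatMap, Lattice.ends]
  congr 1
  funext z
  split_ifs
  · rfl
  · rw [List.map_reverse, List.map_map, List.map_map]
    rfl

/-- The words on the ends of the bands that belong to labels of the strands. -/
def strandLabels {n : O → ℕ} (d : (Σ e, Fin (n e)) → Bool) :
    ((Σ e, Fin (n e)) × Bool → Pt) ≃ (∀ z : O × Bool, Fin (n z.1) → Pt) where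
  -- At the terminal vertex the strands of a band appear in reverse order, hence `j.rev`.
  toFun f z j := if z.2 then f (⟨z.1, j⟩, d ⟨z.1, j⟩) else f (⟨z.1, j.rev⟩, !d ⟨z.1, j.rev⟩)
  invFun v z := if z.2 = d z.1 then v (z.1.1, true) z.1.2 else v (z.1.1, false) z.1.2.rev
  left_inv f := by
    funext ⟨⟨e, j⟩, t⟩
    by_cases h : t = d ⟨e, j⟩
    · simp [h]
    · have : (!d ⟨e, j⟩) = t := by
        cases t <;> cases hd : d ⟨e, j⟩ <;> simp_all
      simp [h, this]
  right_inv v := by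
    funext ⟨e, t⟩ j
    cases t <;> simp

theorem reverse_ofFn {α : Type*} {n : ℕ} (g : Fin n → α) :
    (List.ofFn g).reverse = List.ofFn fun j => g j.rev := by
  refine List.ext_get (by simp) fun i h1 h2 => ?_
  simp only [List.get_eq_getElem, List.getElem_reverse, List.getElem_ofFn]
  congr 1
  ext
  simp
  omega

theorem labelState_ends (Γ : Lattice O V) {n : O → ℕ} (d : (Σ e, Fin (n e)) → Bool)
    (f : (Σ e, Fin (n e)) × Bool → Pt) :
    labelState f (Γ.ends fun e => List.ofFn fun j : Fin (n e) =>
      ((⟨e, j⟩ : Σ e, Fin (n e)), d ⟨e, j⟩)) =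
      RibbonHopfAlgebra.endWords Γ fun z => List.ofFn (strandLabels d f z) := by
  funext v
  rw [labelState, Lattice.ends, List.map_flatMap, RibbonHopfAlgebra.endWords]
  congr 1
  funext ⟨e, t⟩
  cases t
  · rw [if_neg Bool.false_ne_true, List.map_ofFn, reverse_ofFn, List.map_ofFn]
    rfl
  · rw [if_pos rfl, List.map_ofFn]
    rfl

/-- The state sum of the whole diagram, with labels collected in one word for each end of a band.
Cables read both ends as seen from the initial vertex, whereas `endWords` uses the reading order at
each vertex; this is why the word at the terminal end is reversed. -/
theorem wilson_tprod (Γ : Lattice O V) (L : Diagram O V C) (hL : L.IsLink Γ) (x : O → H) :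
    𝓗.wilson Γ χ L (AdicCompletion.of I _ (PiTensorProduct.tprod b x)) =
      ∑ f ∈ Fintype.piFinset fun z : O × Bool => words Pt (L.strands z.1).length,
        (∏ e, 𝓜.cable (L.strands e) (f (e, true)) (f (e, false)).reverse (x e)) *
          𝓜.value L.events (RibbonHopfAlgebra.endWords Γ f) := by
  set n : O → ℕ := fun e => (L.strands e).length with hn
  set s : (Σ e, Fin (n e)) → C × Bool := fun p => (L.strands p.1).get p.2 with hs
  set st := Γ.ends fun e => List.ofFn fun j : Fin (n e) =>
    ((⟨e, j⟩ : Σ e, Fin (n e)), (s ⟨e, j⟩).2) with hst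
  have hclose : Diagram.Closes (endTypes (fun p => (s p).1) st) L.events := by
    have : endTypes (fun p => (s p).1) st = Γ.ends L.strands := by
      funext v
      refine (map_ends Γ (fun p => (s p).1) _ v).trans ?_
      congr 1
      funext e
      rw [List.map_ofFn]
      exact List.ofFn_get (L.strands e)
    rw [this]
    exact hL
  have hsum := 𝓜.stateSum L.events (Σ e, Fin (n e)) (fun p => (s p).1) st
    (endsOnce_ends Γ fun p => (s p).2) hclose
  rw [RibbonHopfAlgebra.wilson, LinearMap.comp_apply, LinearMap.comp_apply,
    RibbonHopfAlgebra.switches]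
  refine (IsCont.cmap_apply (isCont_evalEvents 𝓗 χ L.events _ _ _) _ _).trans ?_
  -- After the switches the evaluation is a finite combination of product functionals, and these can
  -- be evaluated on iterated coproducts by `cint_expand`.
  have hfun : 𝓗.evalEvents χ L.events (Σ e, Fin (n e)) (fun p => (s p).1) st ∘ₗ
      AdicCompletion.of I _ ∘ₗ PiTensorProduct.map (fun p =>
        if (s p).2 then LinearMap.id else 𝓗.antipode ∘ₗ (LinearMap.mul b H).flip 𝓗.charm) =
      ∑ f : (Σ e, Fin (n e)) × Bool → Pt, 𝓜.value L.events (labelState f st) •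
        prodFun fun p => 𝓜.strand (s p) (f (p, (s p).2)) (f (p, !(s p).2)) := by
    ext y
    rw [LinearMap.compMultilinearMap_apply, LinearMap.comp_apply, LinearMap.comp_apply,
      PiTensorProduct.map_tprod, hsum, LinearMap.compMultilinearMap_apply, LinearMap.sum_apply]
    refine Finset.sum_congr rfl fun f _ => ?_
    rw [LinearMap.smul_apply, prodFun_tprod, smul_eq_mul, mul_comm]
    congr 1
    refine Finset.prod_congr rfl fun p _ => ?_
    cases hp : (s p).2
    · have := congrArg (fun φ => φ (y p))
        (𝓜.edge_antipode_charm (s p).1 (f (p, false)) (f (p, true)))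
      rw [show s p = ((s p).1, false) from Prod.ext rfl hp]
      exact this
    · rw [show s p = ((s p).1, true) from Prod.ext rfl hp]
      rfl
  refine (congrArg (fun φ => cint I φ _) hfun).trans ?_
  refine (map_sum (cintL (I := I) _) _ _).trans ?_
  rw [sum_words_eq_sum_ofFn fun z : O × Bool => n z.1,
    ← (strandLabels fun p => (s p).2).sum_comp]
  refine Finset.sum_congr rfl fun f _ => ?_
  rw [map_smul, cintL_apply, 𝓗.cint_expand, smul_eq_mul, mul_comm]
  refine congrArg₂ (· * ·) ?_ (congrArg _ (labelState_ends Γ (fun p => (s p).2) f))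
  refine Finset.prod_congr rfl fun e _ => ?_
  rw [← 𝓜.cable_ofFn, reverse_ofFn]
  congr 1
  have h1 : L.strands e = List.ofFn fun j => s ⟨e, j⟩ := (List.ofFn_get (L.strands e)).symm
  rw [h1]
  congr 1
  congr 1
  funext j
  simp [strandLabels]

end Model

theorem RibbonHopfAlgebra.counit_antipode {b H : Type*} [CommRing b] {I : Ideal b}
    [IsAdicComplete I b] [Ring H] [Algebra b H] (𝓗 : RibbonHopfAlgebra I H) [IsAdicComplete I H]
    (h : H) : 𝓗.counit (𝓗.antipode h) = 𝓗.counit h := by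
  have h1 := 𝓗.dInt_antipode_left 𝓗.counit.toLinearMap h
  have h2 := congrArg (fun φ => φ h) (𝓗.conv_counit (𝓗.counit.toLinearMap ∘ₗ 𝓗.antipode))
  have h3 : ((LinearMap.mul b H ∘ₗ 𝓗.antipode).compr₂ 𝓗.counit.toLinearMap) =
      (LinearMap.mul b b).compl₁₂ (𝓗.counit.toLinearMap ∘ₗ 𝓗.antipode) 𝓗.counit.toLinearMap := by
    ext x y
    simp
  rw [h3] at h1
  refine h2.symm.trans (h1.trans ?_)
  simp

namespace Model

variable {b H : Type*} [CommRing b] {I : Ideal b} [IsAdicComplete I b] [Ring H] [Algebra b H]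
  [IsAdicComplete I H] {𝓗 : RibbonHopfAlgebra I H} {C : Type*} {χ : C → H →ₗ[b] b}
  {Pt : Type*} [Fintype Pt] (𝓜 : Model 𝓗 χ Pt)

/-! ### Functionals of a cable -/

/-- The coevaluations along a list of strands. -/
def cupLabels : List (C × Bool) → List Pt → List Pt → b
  | [], [], [] => 1
  | s :: l, y :: a, x :: c => 𝓜.cup s.1 s.2 y x * cupLabels l a c
  | _, _, _ => 0

theorem cable_eq_sum (l : List (C × Bool)) (a c : List Pt) :
    𝓜.cable l a c = ∑ w ∈ words Pt a.length, 𝓜.cupLabels l w c • 𝓜.wc a w := by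
  induction a generalizing l c with
  | nil =>
    rw [List.length_nil, sum_words_zero]
    cases l <;> cases c <;> simp [cable, cupLabels]
  | cons x a ih =>
    rw [List.length_cons, sum_words_succ]
    cases l with
    | nil => simp [cable, cupLabels]
    | cons s l =>
      cases c with
      | nil => simp [cable, cupLabels]
      | cons z c =>
        simp only [cable, cupLabels, strand, ih, map_sum, LinearMap.sum_apply, map_smul,
          LinearMap.smul_apply, smul_smul, wc_cons]
        rw [Finset.sum_comm]
        refine Finset.sum_congr rfl fun w _ => ?_
        simp only [Finset.smul_sum, smul_smul, mul_comm]

theorem cable_append {l₁ : List (C × Bool)} {a₁ c₁ : List Pt} (ha : a₁.length = l₁.length)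
    (hc : c₁.length = l₁.length) (l₂ : List (C × Bool)) (a₂ c₂ : List Pt) :
    𝓜.cable (l₁ ++ l₂) (a₁ ++ a₂) (c₁ ++ c₂) = 𝓗.conv (𝓜.cable l₁ a₁ c₁) (𝓜.cable l₂ a₂ c₂) := by
  induction l₁ generalizing a₁ c₁ with
  | nil =>
    obtain rfl := List.length_eq_zero_iff.mp ha
    obtain rfl := List.length_eq_zero_iff.mp hc
    rw [List.nil_append, List.nil_append, List.nil_append, cable, 𝓗.counit_conv]
  | cons s l ih =>
    obtain ⟨x, a, rfl⟩ := List.exists_cons_of_length_eq_add_one ha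
    obtain ⟨z, c, rfl⟩ := List.exists_cons_of_length_eq_add_one hc
    rw [List.cons_append, List.cons_append, List.cons_append, cable, cable,
      ih (by simpa using ha) (by simpa using hc), 𝓗.conv_assoc]

theorem cable_mul {l : List (C × Bool)} {a : List Pt} (ha : a.length = l.length) (c : List Pt)
    (h x : H) : 𝓜.cable l a c (h * x) =
      ∑ u ∈ words Pt l.length, 𝓜.wc a u h * 𝓜.cable l u c x := by
  simp only [cable_eq_sum, LinearMap.sum_apply, LinearMap.smul_apply, 𝓜.wc_mul a _ h x,
    smul_eq_mul, Finset.mul_sum, ha]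
  rw [Finset.sum_comm]
  refine Finset.sum_congr rfl fun u hu => ?_
  rw [mem_words.mp hu]
  refine Finset.sum_congr rfl fun w _ => ?_
  ring

/-- The invariance of coevaluations, iterated along the strands of a band. The antipode reverses the
tensor factors, so the action reappears on the reversed word at the other end, in the order in which
the terminal vertex reads it. -/
theorem sum_cupLabels_wc {l : List (C × Bool)} {w c : List Pt} (hw : w.length = l.length)
    (hc : c.length = l.length) :
    ∑ y ∈ words Pt l.length, 𝓜.cupLabels l y c • (𝓜.wc w y ∘ₗ 𝓗.antipode) =
      ∑ v ∈ words Pt l.length, 𝓜.cupLabels l w v • 𝓜.wc c.reverse v.reverse := by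
  induction l generalizing w c with
  | nil =>
    obtain rfl := List.length_eq_zero_iff.mp hw
    obtain rfl := List.length_eq_zero_iff.mp hc
    rw [List.length_nil, sum_words_zero, sum_words_zero]
    congr 1
    refine LinearMap.ext fun h => ?_
    exact 𝓗.counit_antipode h
  | cons s l ih =>
    obtain ⟨u, w, rfl⟩ := List.exists_cons_of_length_eq_add_one hw
    obtain ⟨z, c, rfl⟩ := List.exists_cons_of_length_eq_add_one hc
    have hw : w.length = l.length := by simpa using hw
    have hc : c.length = l.length := by simpa using hc
    rw [List.length_cons, sum_words_succ, sum_words_succ]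
    have h1 : ∀ y v, 𝓜.cupLabels (s :: l) (y :: v) (z :: c) •
        (𝓜.wc (u :: w) (y :: v) ∘ₗ 𝓗.antipode) =
        𝓗.conv (𝓜.cupLabels l v c • (𝓜.wc w v ∘ₗ 𝓗.antipode))
          (𝓜.cup s.1 s.2 y z • (𝓜.coef u y ∘ₗ 𝓗.antipode)) := by
      intro y v
      rw [wc_cons_antipode, cupLabels, map_smul, LinearMap.map_smul₂, smul_smul]
    have h2 : ∀ y, ∀ v ∈ words Pt l.length, 𝓜.cupLabels (s :: l) (u :: w) (y :: v) •
        𝓜.wc (z :: c).reverse (y :: v).reverse =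
        𝓗.conv (𝓜.cupLabels l w v • 𝓜.wc c.reverse v.reverse)
          (𝓜.cup s.1 s.2 u y • 𝓜.coef z y) := by
      intro y v hv
      rw [List.reverse_cons, List.reverse_cons,
        wc_append _ (by rw [List.length_reverse, List.length_reverse, hc, mem_words.mp hv]),
        wc_singleton, cupLabels, map_smul, LinearMap.map_smul₂, smul_smul]
    simp only [h1]
    rw [Finset.sum_congr rfl fun y _ => Finset.sum_congr rfl fun v hv => h2 y v hv]
    have hsum : ∀ (F : List Pt → H →ₗ[b] b) (G : Pt → H →ₗ[b] b),
        ∑ y, ∑ v ∈ words Pt l.length, 𝓗.conv (F v) (G y) =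
          𝓗.conv (∑ v ∈ words Pt l.length, F v) (∑ y, G y) := by
      intro F G
      simp only [map_sum, LinearMap.sum_apply]
    rw [hsum, hsum, ih hw hc, 𝓜.cup_coef]

theorem cable_mul_antipode {l : List (C × Bool)} {a c : List Pt} (ha : a.length = l.length)
    (hc : c.length = l.length) (h x : H) : 𝓜.cable l a c (x * 𝓗.antipode h) =
      ∑ u ∈ words Pt l.length, 𝓜.wc c.reverse u.reverse h * 𝓜.cable l a u x := by
  have key : ∀ w ∈ words Pt l.length, ∑ y ∈ words Pt l.length, 𝓜.cupLabels l y c *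
      𝓜.wc w y (𝓗.antipode h) =
      ∑ v ∈ words Pt l.length, 𝓜.cupLabels l w v * 𝓜.wc c.reverse v.reverse h := by
    intro w hw
    have := congrArg (fun φ => φ h) (𝓜.sum_cupLabels_wc (mem_words.mp hw) hc)
    simpa [LinearMap.sum_apply] using this
  simp only [cable_eq_sum, LinearMap.sum_apply, LinearMap.smul_apply, 𝓜.wc_mul a _ x _,
    smul_eq_mul, ha]
  calc _ = ∑ w ∈ words Pt l.length, 𝓜.wc a w x * ∑ y ∈ words Pt l.length, 𝓜.cupLabels l y c *
      𝓜.wc w y (𝓗.antipode h) := by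
        simp only [Finset.mul_sum]
        rw [Finset.sum_comm]
        refine Finset.sum_congr rfl fun u _ => Finset.sum_congr rfl fun w _ => ?_
        ring
    _ = _ := by
        rw [Finset.sum_congr rfl fun w hw => congrArg _ (key w hw)]
        simp only [Finset.mul_sum]
        rw [Finset.sum_comm]
        refine Finset.sum_congr rfl fun u _ => Finset.sum_congr rfl fun w _ => ?_
        ring

theorem cable_pair (x y : C × Bool) (p q m n : Pt) : 𝓜.cable [x, y] [p, q] [m, n] =
    ∑ z, ∑ w, (𝓜.cup x.1 x.2 z m * 𝓜.cup y.1 y.2 w n) • 𝓜.wc [p, q] [z, w] := by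
  rw [cable_eq_sum]
  refine (sum_words_two _).trans ?_
  simp [cupLabels]

/-- A crossing at the initial end commutes with the action of H along the band and is then turned
over by the two coevaluations, so it reappears at the terminal end with the two strands exchanged.
-/
theorem sum_cross_cable_pair (o : Bool) (x y : C × Bool) (u v m n : Pt) :
    ∑ p, ∑ q, 𝓜.cross o u v p q • 𝓜.cable [x, y] [p, q] [m, n] =
      ∑ r, ∑ s, 𝓜.cross o n m s r • 𝓜.cable [y, x] [u, v] [r, s] := by
  simp only [cable_pair, Finset.smul_sum, smul_smul]
  rw [RibbonHopfAlgebra.sum₄_comm]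
  calc _ = ∑ z, ∑ w, (𝓜.cup x.1 x.2 z m * 𝓜.cup y.1 y.2 w n) •
        ∑ p, ∑ q, 𝓜.cross o u v p q • 𝓜.wc [p, q] [z, w] := by
        simp only [Finset.smul_sum, smul_smul]
        refine Finset.sum_congr rfl fun z _ => Finset.sum_congr rfl fun w _ => ?_
        refine Finset.sum_congr rfl fun p _ => Finset.sum_congr rfl fun q _ => ?_
        rw [mul_comm]
    _ = ∑ z, ∑ w, ∑ p, ∑ q, (𝓜.cross o p q z w *
        (𝓜.cup x.1 x.2 z m * 𝓜.cup y.1 y.2 w n)) • 𝓜.wc [u, v] [p, q] := by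
        simp only [sum_cross_wc]
        simp only [Finset.smul_sum, smul_smul, mul_comm]
    _ = _ := by
        refine (RibbonHopfAlgebra.sum₄_comm _).trans (Eq.trans ?_ (RibbonHopfAlgebra.sum₄_comm _))
        refine Finset.sum_congr rfl fun p _ => Finset.sum_congr rfl fun q _ => ?_
        simp only [← Finset.sum_smul]
        rw [cross_cup_cup]

/-- A cap at the terminal end joins the two coevaluations to a single one by a zigzag. A
coevaluation is invariant under H, so it leaves only the counit in the band and appears as a cup at
the initial end. -/
theorem sum_cap_cable_pair_terminal (c : C) (d : Bool) (u v : Pt) :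
    ∑ m, ∑ n, 𝓜.cap n m • 𝓜.cable [(c, d), (c, !d)] [u, v] [m, n] =
      𝓜.cup c d u v • 𝓗.counit.toLinearMap := by
  simp only [cable_pair, Finset.smul_sum, smul_smul]
  rw [RibbonHopfAlgebra.sum₄_comm, ← sum_cup_wc]
  refine Finset.sum_congr rfl fun z _ => Finset.sum_congr rfl fun w _ => ?_
  simp only [← Finset.sum_smul]
  congr 1
  have h : ∀ m, ∑ n, 𝓜.cap n m * (𝓜.cup c d z m * 𝓜.cup c (!d) w n) =
      𝓜.cup c d z m * 𝓜.coef w m 1 := by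
    intro m
    by_cases hm : 𝓜.ty m = (c, !d)
    · rw [← 𝓜.cup_cap c (!d) w m hm, Finset.mul_sum]
      refine Finset.sum_congr rfl fun n _ => ?_
      ring
    · simp [𝓜.cup_eq_zero c d z m fun h => hm h.2]
  rw [Finset.sum_congr rfl fun m _ => h m]
  simpa [mul_comm] using 𝓜.sum_coef_one_mul w fun m => 𝓜.cup c d z m

/-- Here the cap itself is invariant under H: it passes along the band, leaving the counit, and then
a zigzag with the coevaluations turns it into a cup at the terminal end. -/
theorem sum_cap_cable_pair_initial (c : C) (d : Bool) (m n : Pt) :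
    ∑ p, ∑ q, 𝓜.cap p q • 𝓜.cable [(c, d), (c, !d)] [p, q] [m, n] =
      𝓜.cup c d n m • 𝓗.counit.toLinearMap := by
  simp only [cable_pair, Finset.smul_sum, smul_smul]
  rw [RibbonHopfAlgebra.sum₄_comm]
  have h : ∀ z w, ∑ p, ∑ q, (𝓜.cap p q * (𝓜.cup c d z m * 𝓜.cup c (!d) w n)) •
      𝓜.wc [p, q] [z, w] = (𝓜.cup c d z m * (𝓜.cap z w * 𝓜.cup c (!d) w n)) •
        𝓗.counit.toLinearMap := by
    intro z w
    have := congrArg (fun φ => (𝓜.cup c d z m * 𝓜.cup c (!d) w n) • φ) (𝓜.sum_cap_wc z w)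
    simp only [Finset.smul_sum, smul_smul] at this
    rw [show 𝓜.cup c d z m * (𝓜.cap z w * 𝓜.cup c (!d) w n) =
      𝓜.cup c d z m * 𝓜.cup c (!d) w n * 𝓜.cap z w by ring, ← this]
    refine Finset.sum_congr rfl fun p _ => Finset.sum_congr rfl fun q _ => ?_
    rw [mul_comm]
  simp only [h, ← Finset.sum_smul, ← Finset.mul_sum]
  congr 1
  have h' : ∀ z, 𝓜.cup c d z m * ∑ w, 𝓜.cap z w * 𝓜.cup c (!d) w n =
      𝓜.coef z n 1 * 𝓜.cup c d z m := by
    intro z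
    by_cases hz : 𝓜.ty z = (c, d)
    · rw [𝓜.cap_cup c (!d) z n (by simpa using hz), mul_comm]
    · simp [𝓜.cup_eq_zero c d z m fun h => hz h.1]
  rw [Finset.sum_congr rfl fun z _ => h' z]
  exact 𝓜.sum_coef_one_mul' n fun z => 𝓜.cup c d z m

/-! ### Slides along a cable -/

section Slides

variable {l₁ l₂ : List (C × Bool)} {a₁ c₁ a₂ c₂ : List Pt} (ha : a₁.length = l₁.length)
  (hc : c₁.length = l₁.length)

include ha hc

theorem cable_insert (x y : C × Bool) (p q m n : Pt) :
    𝓜.cable (l₁ ++ x :: y :: l₂) (a₁ ++ p :: q :: a₂) (c₁ ++ m :: n :: c₂) =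
      𝓗.conv (𝓜.cable l₁ a₁ c₁) (𝓗.conv (𝓜.cable [x, y] [p, q] [m, n]) (𝓜.cable l₂ a₂ c₂)) := by
  rw [cable_append _ ha hc]
  congr 1
  exact cable_append 𝓜 (l₁ := [x, y]) (a₁ := [p, q]) (c₁ := [m, n]) rfl rfl _ _ _

theorem sum_cross_cable (o : Bool) (x y : C × Bool) (u v m n : Pt) (h : H) :
    ∑ p, ∑ q, 𝓜.cross o u v p q *
        𝓜.cable (l₁ ++ x :: y :: l₂) (a₁ ++ p :: q :: a₂) (c₁ ++ m :: n :: c₂) h =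
      ∑ r, ∑ s, 𝓜.cross o n m s r *
        𝓜.cable (l₁ ++ y :: x :: l₂) (a₁ ++ u :: v :: a₂) (c₁ ++ r :: s :: c₂) h := by
  have := congrArg (fun φ => 𝓗.conv (𝓜.cable l₁ a₁ c₁) (𝓗.conv φ (𝓜.cable l₂ a₂ c₂)) h)
    (𝓜.sum_cross_cable_pair o x y u v m n)
  simpa [cable_insert 𝓜 ha hc, map_sum, LinearMap.sum_apply] using this

theorem sum_cap_cable_terminal (c : C) (d : Bool) (u v : Pt) (h : H) :
    ∑ m, ∑ n, 𝓜.cap n m *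
        𝓜.cable (l₁ ++ (c, d) :: (c, !d) :: l₂) (a₁ ++ u :: v :: a₂) (c₁ ++ m :: n :: c₂) h =
      𝓜.cup c d u v * 𝓜.cable (l₁ ++ l₂) (a₁ ++ a₂) (c₁ ++ c₂) h := by
  have := congrArg (fun φ => 𝓗.conv (𝓜.cable l₁ a₁ c₁) (𝓗.conv φ (𝓜.cable l₂ a₂ c₂)) h)
    (𝓜.sum_cap_cable_pair_terminal c d u v)
  simpa [cable_insert 𝓜 ha hc, cable_append 𝓜 ha hc, map_sum, LinearMap.sum_apply,
    𝓗.counit_conv] using this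

theorem sum_cap_cable_initial (c : C) (d : Bool) (m n : Pt) (h : H) :
    ∑ p, ∑ q, 𝓜.cap p q *
        𝓜.cable (l₁ ++ (c, d) :: (c, !d) :: l₂) (a₁ ++ p :: q :: a₂) (c₁ ++ m :: n :: c₂) h =
      𝓜.cup c d n m * 𝓜.cable (l₁ ++ l₂) (a₁ ++ a₂) (c₁ ++ c₂) h := by
  have := congrArg (fun φ => 𝓗.conv (𝓜.cable l₁ a₁ c₁) (𝓗.conv φ (𝓜.cable l₂ a₂ c₂)) h)
    (𝓜.sum_cap_cable_pair_initial c d m n)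
  simpa [cable_insert 𝓜 ha hc, cable_append 𝓜 ha hc, map_sum, LinearMap.sum_apply,
    𝓗.counit_conv] using this

end Slides

end Model

/-! ### Families of words -/

/-- One coordinate is split off as a separate summation variable. The dummy value `j₀` keeps its
place in the remaining families. -/
theorem sum_piFinset_update {α J A : Type*} [Fintype α] [DecidableEq α] [AddCommMonoid A]
    (L : α → Finset J) (z : α) (j₀ : J) (h : (α → J) → A) :
    ∑ f ∈ Fintype.piFinset L, h f =
      ∑ f ∈ Fintype.piFinset (Function.update L z {j₀}), ∑ u ∈ L z, h (Function.update f z u) := by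
  rw [← Finset.sum_product']
  refine Finset.sum_nbij' (fun f => (Function.update f z j₀, f z))
    (fun q => Function.update q.1 z q.2) ?_ ?_ ?_ ?_ ?_
  · intro f hf
    rw [Fintype.mem_piFinset] at hf
    rw [Finset.mem_product, Fintype.mem_piFinset]
    refine ⟨fun y => ?_, hf z⟩
    by_cases hy : y = z
    · subst hy
      simp
    · simpa [hy] using hf y
  · rintro ⟨f, u⟩ hq
    rw [Finset.mem_product, Fintype.mem_piFinset] at hq
    rw [Fintype.mem_piFinset]
    intro y
    by_cases hy : y = z
    · subst hy
      simpa using hq.2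
    · simpa [hy] using hq.1 y
  · intro f _
    simp
  · rintro ⟨f, u⟩ hq
    rw [Finset.mem_product, Fintype.mem_piFinset] at hq
    have : f z = j₀ := by simpa using hq.1 z
    simp [← this]
  · intro f _
    simp

theorem sum_words_insert {Pt A : Type*} [Fintype Pt] [AddCommMonoid A] (n m : ℕ)
    (F : List Pt → A) : ∑ a ∈ words Pt (n + (m + 1 + 1)), F a =
      ∑ a ∈ words Pt n, ∑ c ∈ words Pt m, ∑ p, ∑ q, F (a ++ p :: q :: c) := by
  rw [sum_words_add]
  refine Finset.sum_congr rfl fun a _ => ?_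
  simp only [sum_words_succ]
  rw [Finset.sum_comm]
  refine (Finset.sum_congr rfl fun q _ => Finset.sum_comm).trans ?_
  rw [Finset.sum_comm]
  exact Finset.sum_congr rfl fun c _ => Finset.sum_comm

theorem sum_words_insert₂ {Pt A : Type*} [Fintype Pt] [AddCommMonoid A] (n m : ℕ)
    (F : List Pt → List Pt → A) :
    ∑ a ∈ words Pt (n + (m + 1 + 1)), ∑ c ∈ words Pt (n + (m + 1 + 1)), F a c =
      ∑ a₁ ∈ words Pt n, ∑ a₂ ∈ words Pt m, ∑ c₁ ∈ words Pt n, ∑ c₂ ∈ words Pt m,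
        ∑ p, ∑ q, ∑ p', ∑ q', F (a₁ ++ p :: q :: a₂) (c₁ ++ p' :: q' :: c₂) := by
  rw [sum_words_insert]
  refine Finset.sum_congr rfl fun a₁ _ => Finset.sum_congr rfl fun a₂ _ => ?_
  simp only [sum_words_insert]
  exact RibbonHopfAlgebra.sum₄_comm _

theorem sum_words_add₂ {Pt A : Type*} [Fintype Pt] [AddCommMonoid A] (n m : ℕ)
    (F : List Pt → List Pt → A) :
    ∑ a ∈ words Pt (n + m), ∑ c ∈ words Pt (n + m), F a c =
      ∑ a₁ ∈ words Pt n, ∑ a₂ ∈ words Pt m, ∑ c₁ ∈ words Pt n, ∑ c₂ ∈ words Pt m,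
        F (a₁ ++ a₂) (c₁ ++ c₂) := by
  rw [sum_words_add]
  refine Finset.sum_congr rfl fun a₁ _ => Finset.sum_congr rfl fun a₂ _ => ?_
  rw [sum_words_add]

theorem sum_mul_sum_mul {α β A : Type*} [CommRing A] [Fintype α] [Fintype β]
    (G : α → α → β → β → A) (K : α → α → α → α → A) (X : α → α → β → β → A) :
    ∑ p, ∑ q, ∑ m, ∑ n, G p q m n * ∑ u, ∑ v, K u v p q * X u v m n =
      ∑ u, ∑ v, ∑ m, ∑ n, (∑ p, ∑ q, K u v p q * G p q m n) * X u v m n := by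
  simp only [Finset.mul_sum, Finset.sum_mul]
  calc _ = ∑ p, ∑ q, ∑ u, ∑ v, ∑ m, ∑ n, G p q m n * (K u v p q * X u v m n) :=
        Finset.sum_congr rfl fun p _ => Finset.sum_congr rfl fun q _ =>
          RibbonHopfAlgebra.sum₄_comm _
    _ = ∑ u, ∑ v, ∑ p, ∑ q, ∑ m, ∑ n, G p q m n * (K u v p q * X u v m n) :=
        RibbonHopfAlgebra.sum₄_comm _
    _ = ∑ u, ∑ v, ∑ m, ∑ n, ∑ p, ∑ q, G p q m n * (K u v p q * X u v m n) :=
        Finset.sum_congr rfl fun p _ => Finset.sum_congr rfl fun q _ =>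
          RibbonHopfAlgebra.sum₄_comm _
    _ = _ := by
        simp only [mul_assoc, mul_left_comm]

/-! ### States in which the word at one end of a band varies -/

section EndWords

variable {O V J α : Type*} [DecidableEq O] [DecidableEq V] (Γ : Lattice O V)

/-- Since `z` occurs once in the ciliation of its vertex, its word is a contiguous block there,
between words `P` and `S` that do not depend on it. The lengths of the other words suffice to
identify the length of `P` with the offset. -/
theorem exists_endWords_update (f : O × Bool → List J) (z : O × Bool)
    (s : O → List (α × Bool)) (hs : ∀ y, y ≠ z → (f y).length = (s y.1).length) :
    ∃ P S : List J, P.length = Γ.offset s z ∧ ∀ A,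
      RibbonHopfAlgebra.endWords Γ (Function.update f z A) =
        Function.update (RibbonHopfAlgebra.endWords Γ f) (Γ.vert z) (P ++ (A ++ S)) := by
  obtain ⟨T, R, hTR⟩ := List.append_of_mem ((Γ.mem_star z (Γ.vert z)).mpr rfl)
  have hnd := Γ.nodup (Γ.vert z)
  rw [hTR, List.nodup_middle, List.nodup_cons, List.mem_append, not_or] at hnd
  have hT : (Γ.star (Γ.vert z)).takeWhile (fun y => decide (y ≠ z)) = T := by
    rw [hTR, List.takeWhile_append_of_pos, List.takeWhile_cons_of_neg (by simp), List.append_nil]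
    intro y hy
    have : y ≠ z := fun e => hnd.1.1 (e ▸ hy)
    simpa using this
  have hcongr : ∀ (l : List (O × Bool)) (_ : z ∉ l) (A : List J),
      l.flatMap (Function.update f z A) = l.flatMap f := by
    intro l hl A
    rw [List.flatMap_def, List.flatMap_def]
    congr 1
    refine List.map_congr_left fun y hy => ?_
    have hyz : y ≠ z := fun e => hl (by rwa [← e])
    rw [Function.update_of_ne hyz]
  refine ⟨T.flatMap f, R.flatMap f, ?_, fun A => ?_⟩
  · rw [Lattice.offset, hT, List.length_flatMap]
    congr 1
    refine List.map_congr_left fun y hy => hs y fun e => hnd.1.1 (e ▸ hy)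
  · funext v
    by_cases hv : v = Γ.vert z
    · subst hv
      rw [Function.update_self, RibbonHopfAlgebra.endWords, hTR, List.flatMap_append,
        List.flatMap_cons, hcongr T hnd.1.1, hcongr R hnd.1.2, Function.update_self]
    · rw [Function.update_of_ne hv, RibbonHopfAlgebra.endWords, hcongr _ _ A,
        RibbonHopfAlgebra.endWords]
      intro h
      exact hv ((Γ.mem_star z v).mp h).symm

end EndWords

/-! ### Slides of crossings and local extrema through a band -/

namespace Model

variable {b H : Type*} [CommRing b] {I : Ideal b} [IsAdicComplete I b] [Ring H] [Algebra b H]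
  [IsAdicComplete I H] {𝓗 : RibbonHopfAlgebra I H} {C : Type*} {χ : C → H →ₗ[b] b}
  {Pt : Type*} [Fintype Pt] (𝓜 : Model 𝓗 χ Pt)
  {O V : Type*} [Fintype O] [DecidableEq O] [DecidableEq V]

open RibbonHopfAlgebra (endWords)

section BandEvents

variable (Γ : Lattice O V) {s : O → List (C × Bool)} {f : O × Bool → List Pt} {z : O × Bool}
  (hs : ∀ y, y ≠ z → (f y).length = (s y.1).length) (es : List (Event V C)) {a c : List Pt}

include hs

theorem value_cross_endWords (o : Bool) {x y : Pt} (hz : f z = a ++ x :: y :: c) :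
    𝓜.value (.cross (Γ.vert z) (Γ.offset s z + a.length) o :: es) (endWords Γ f) =
      ∑ y', ∑ x', 𝓜.cross o y' x' x y *
        𝓜.value es (endWords Γ (Function.update f z (a ++ y' :: x' :: c))) := by
  obtain ⟨P, S, hP, h⟩ := exists_endWords_update Γ f z s hs
  have hf : endWords Γ f (Γ.vert z) = (P ++ a) ++ x :: y :: (c ++ S) := by
    have := congrFun (h (f z)) (Γ.vert z)
    rw [Function.update_eq_self, Function.update_self, hz] at this
    simpa using this
  rw [← hP, ← List.length_append, 𝓜.value_cross _ o es hf]
  simp [h]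

theorem value_cap_endWords {x y : Pt} (hz : f z = a ++ x :: y :: c) :
    𝓜.value (.cap (Γ.vert z) (Γ.offset s z + a.length) :: es) (endWords Γ f) =
      𝓜.cap x y * 𝓜.value es (endWords Γ (Function.update f z (a ++ c))) := by
  obtain ⟨P, S, hP, h⟩ := exists_endWords_update Γ f z s hs
  have hf : endWords Γ f (Γ.vert z) = (P ++ a) ++ x :: y :: (c ++ S) := by
    have := congrFun (h (f z)) (Γ.vert z)
    rw [Function.update_eq_self, Function.update_self, hz] at this
    simpa using this
  rw [← hP, ← List.length_append, 𝓜.value_cap _ es hf]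
  simp [h]

theorem value_cup_endWords (k : C) (d : Bool) (hz : f z = a ++ c) :
    𝓜.value (.cup (Γ.vert z) (Γ.offset s z + a.length) k d :: es) (endWords Γ f) =
      ∑ x, ∑ y, 𝓜.cup k d x y *
        𝓜.value es (endWords Γ (Function.update f z (a ++ x :: y :: c))) := by
  obtain ⟨P, S, hP, h⟩ := exists_endWords_update Γ f z s hs
  have hf : endWords Γ f (Γ.vert z) = (P ++ a) ++ (c ++ S) := by
    have := congrFun (h (f z)) (Γ.vert z)
    rw [Function.update_eq_self, Function.update_self, hz] at this
    simpa using this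
  rw [← hP, ← List.length_append, 𝓜.value_cup _ k d es hf]
  simp [h]

end BandEvents

/-- The sum over the labels of all strands in the bands. -/
def cableSum (s : O → List (C × Bool)) (Θ : (O × Bool → List Pt) → b) (x : O → H) : b :=
  ∑ f ∈ Fintype.piFinset fun z : O × Bool => words Pt (s z.1).length,
    (∏ e, 𝓜.cable (s e) (f (e, true)) (f (e, false)).reverse (x e)) * Θ f

/-- Attaching words to the two ends of a band. -/
def attach (f : O × Bool → List Pt) (e : O) (a c : List Pt) : O × Bool → List Pt :=
  Function.update (Function.update f (e, true) a) (e, false) c.reverse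

@[simp]
theorem attach_true (f : O × Bool → List Pt) (e : O) (a c : List Pt) :
    attach f e a c (e, true) = a := by
  simp [attach]

@[simp]
theorem attach_false (f : O × Bool → List Pt) (e : O) (a c : List Pt) :
    attach f e a c (e, false) = c.reverse := by
  simp [attach]

theorem attach_of_ne (f : O × Bool → List Pt) {e e' : O} (h : e' ≠ e) (a c : List Pt) (d : Bool) :
    attach f e a c (e', d) = f (e', d) := by
  simp [attach, h]

theorem update_attach_true (f : O × Bool → List Pt) (e : O) (a c a' : List Pt) :
    Function.update (attach f e a c) (e, true) a' = attach f e a' c := by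
  rw [attach, Function.update_comm (by simp), Function.update_idem, attach]

theorem update_attach_false (f : O × Bool → List Pt) (e : O) (a c c' : List Pt) :
    Function.update (attach f e a c) (e, false) c'.reverse = attach f e a c' := by
  rw [attach, Function.update_idem, attach]

/-- The summation over the two words of the band of `e` is isolated. The words in `f` at the ends of
this band are empty dummies, to be overwritten by `attach`. -/
theorem cableSum_eq (s : O → List (C × Bool)) (Θ : (O × Bool → List Pt) → b) (x : O → H) (e : O) :
    𝓜.cableSum s Θ x = ∑ f ∈ Fintype.piFinset (Function.update (Function.update
        (fun z : O × Bool => words Pt (s z.1).length) (e, true) {[]}) (e, false) {[]}),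
      (∏ p ∈ {e}ᶜ, 𝓜.cable (s p) (f (p, true)) (f (p, false)).reverse (x p)) *
        ∑ a ∈ words Pt (s e).length, ∑ c ∈ words Pt (s e).length,
          𝓜.cable (s e) a c (x e) * Θ (attach f e a c) := by
  rw [cableSum, sum_piFinset_update _ (e, true) [], sum_piFinset_update _ (e, false) []]
  refine Finset.sum_congr rfl fun f _ => ?_
  rw [Function.update_of_ne (by simp), Finset.sum_comm, Finset.mul_sum]
  refine Finset.sum_congr rfl fun a _ => ?_
  rw [← sum_words_reverse, Finset.mul_sum]
  refine Finset.sum_congr rfl fun c _ => ?_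
  rw [Function.update_comm (by simp)]
  change (∏ p, 𝓜.cable (s p) (attach f e a c (p, true)) (attach f e a c (p, false)).reverse (x p)) *
    Θ (attach f e a c) = _
  rw [Fintype.prod_eq_mul_prod_compl e, attach_true, attach_false, List.reverse_reverse,
    Finset.prod_congr rfl fun p hp => by
      rw [attach_of_ne f (by simpa using hp), attach_of_ne f (by simpa using hp)]]
  ring

/-- A modification of one band can be checked with fixed words in all others. The dummies at the
ends of `e` make the outer index set the same for `s` and `s'`. -/
theorem cableSum_congr_band {s s' : O → List (C × Bool)} (e : O) {l : List (C × Bool)}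
    (hs' : s' = Function.update s e l) {Θ Θ' : (O × Bool → List Pt) → b} {x : O → H}
    (h : ∀ f : O × Bool → List Pt, (∀ z : O × Bool, z.1 ≠ e → (f z).length = (s z.1).length) →
      ∑ a ∈ words Pt (s e).length, ∑ c ∈ words Pt (s e).length,
          𝓜.cable (s e) a c (x e) * Θ (attach f e a c) =
      ∑ a ∈ words Pt l.length, ∑ c ∈ words Pt l.length,
          𝓜.cable l a c (x e) * Θ' (attach f e a c)) :
    𝓜.cableSum s Θ x = 𝓜.cableSum s' Θ' x := by
  subst hs'
  rw [𝓜.cableSum_eq s Θ x e, 𝓜.cableSum_eq _ Θ' x e]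
  have hK : Function.update (Function.update
      (fun z : O × Bool => words Pt (Function.update s e l z.1).length) (e, true) {[]})
        (e, false) {[]} = Function.update (Function.update
      (fun z : O × Bool => words Pt (s z.1).length) (e, true) {[]}) (e, false) {[]} := by
    funext ⟨e', d⟩
    by_cases he : e' = e
    · subst he
      cases d <;> simp
    · simp [he]
  rw [hK, Function.update_self]
  refine Finset.sum_congr rfl fun f hf => ?_
  rw [h f]
  · congr 1
    refine Finset.prod_congr rfl fun p hp => ?_
    rw [Function.update_of_ne (by simpa using hp)]
  · rintro ⟨e', d⟩ he
    have he : e' ≠ e := he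
    have := Fintype.mem_piFinset.mp hf (e', d)
    simpa [he, mem_words] using this

variable (Γ : Lattice O V) {s s' : O → List (C × Bool)} (e : O) (l₁ l₂ : List (C × Bool))
  (es : List (Event V C)) (x : O → H)

theorem length_attach {f : O × Bool → List Pt} {e : O}
    (hf : ∀ z : O × Bool, z.1 ≠ e → (f z).length = (s z.1).length) {a c : List Pt}
    (ha : a.length = (s e).length) (hc : c.length = (s e).length) (y : O × Bool) :
    (attach f e a c y).length = (s y.1).length := by
  obtain ⟨e', d⟩ := y
  by_cases he : e' = e
  · subst he
    cases d
    · simpa using hc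
    · simpa using ha
  · rw [attach_of_ne f he]
    exact hf _ he

theorem length_append_cons_cons {α : Type*} (l₁ l₂ : List α) (x y : α) :
    (l₁ ++ x :: y :: l₂).length = l₁.length + (l₂.length + 1 + 1) := by
  simp

/-- Once the two letters of the crossing strands are separated from the words of the band, the claim
is `sum_cross_cable`. The letters at the terminal end are read in reverse there, which is why the
position after the slide counts the strands of `l₂`. -/
theorem cableSum_slide_cross (p q : C × Bool) (o : Bool) (hs : s e = l₁ ++ p :: q :: l₂)
    (hs' : s' = Function.update s e (l₁ ++ q :: p :: l₂)) :
    𝓜.cableSum s (fun f => 𝓜.value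
      (.cross (Γ.vert (e, true)) (Γ.offset s (e, true) + l₁.length) o :: es) (endWords Γ f)) x =
    𝓜.cableSum s' (fun f => 𝓜.value
      (.cross (Γ.vert (e, false)) (Γ.offset s' (e, false) + l₂.length) o :: es)
        (endWords Γ f)) x := by
  refine 𝓜.cableSum_congr_band e hs' fun f hf => ?_
  have hf' : ∀ z : O × Bool, z.1 ≠ e → (f z).length = (s' z.1).length := by
    intro z hz
    rw [hs', Function.update_of_ne hz, hf z hz]
  rw [hs, length_append_cons_cons, length_append_cons_cons, sum_words_insert₂, sum_words_insert₂]
  refine Finset.sum_congr rfl fun a₁ ha₁ => Finset.sum_congr rfl fun a₂ ha₂ => ?_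
  refine Finset.sum_congr rfl fun c₁ hc₁ => Finset.sum_congr rfl fun c₂ hc₂ => ?_
  rw [mem_words] at ha₁ ha₂ hc₁ hc₂
  have h1 : ∀ u v m n, 𝓜.value
      (.cross (Γ.vert (e, true)) (Γ.offset s (e, true) + l₁.length) o :: es)
      (endWords Γ (attach f e (a₁ ++ u :: v :: a₂) (c₁ ++ m :: n :: c₂))) =
      ∑ y', ∑ x', 𝓜.cross o y' x' u v *
        𝓜.value es (endWords Γ (attach f e (a₁ ++ y' :: x' :: a₂) (c₁ ++ m :: n :: c₂))) := by
    intro u v m n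
    rw [← ha₁, 𝓜.value_cross_endWords Γ (fun y _ => length_attach hf (by simp [hs, ha₁, ha₂])
      (by simp [hs, hc₁, hc₂]) y) es o (attach_true _ _ _ _)]
    simp only [update_attach_true]
  have h2 : ∀ u v m n, 𝓜.value
      (.cross (Γ.vert (e, false)) (Γ.offset s' (e, false) + l₂.length) o :: es)
      (endWords Γ (attach f e (a₁ ++ u :: v :: a₂) (c₁ ++ m :: n :: c₂))) =
      ∑ y', ∑ x', 𝓜.cross o y' x' n m *
        𝓜.value es (endWords Γ (attach f e (a₁ ++ u :: v :: a₂) (c₁ ++ x' :: y' :: c₂))) := by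
    intro u v m n
    have hrev : ∀ m n, (c₁ ++ m :: n :: c₂).reverse = c₂.reverse ++ n :: m :: c₁.reverse := by
      simp
    rw [show l₂.length = c₂.reverse.length by simp [hc₂],
      𝓜.value_cross_endWords Γ (fun y _ => length_attach hf' (by simp [hs', ha₁, ha₂])
      (by simp [hs', hc₁, hc₂]) y) es o ((attach_false _ _ _ _).trans (hrev m n))]
    simp only [← hrev, update_attach_false]
  simp only [h1, h2]
  calc _ = ∑ u, ∑ v, ∑ m, ∑ n, (∑ p', ∑ q', 𝓜.cross o u v p' q' *
        𝓜.cable (l₁ ++ p :: q :: l₂) (a₁ ++ p' :: q' :: a₂) (c₁ ++ m :: n :: c₂) (x e)) *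
          𝓜.value es (endWords Γ (attach f e (a₁ ++ u :: v :: a₂) (c₁ ++ m :: n :: c₂))) := by
        refine sum_mul_sum_mul (fun p' q' m n => 𝓜.cable (l₁ ++ p :: q :: l₂)
          (a₁ ++ p' :: q' :: a₂) (c₁ ++ m :: n :: c₂) (x e)) (𝓜.cross o)
          (fun u v m n => 𝓜.value es
            (endWords Γ (attach f e (a₁ ++ u :: v :: a₂) (c₁ ++ m :: n :: c₂))))
    _ = _ := by
        refine Finset.sum_congr rfl fun u _ => Finset.sum_congr rfl fun v _ => ?_
        simp only [𝓜.sum_cross_cable ha₁ hc₁, Finset.sum_mul, Finset.mul_sum]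
        rw [RibbonHopfAlgebra.sum₄_comm]
        refine Finset.sum_congr rfl fun r _ => Finset.sum_congr rfl fun t _ => ?_
        rw [Finset.sum_comm]
        refine Finset.sum_congr rfl fun n _ => Finset.sum_congr rfl fun m _ => ?_
        ring

theorem cableSum_slide_to_initial (c : C) (d : Bool) (hs : s e = l₁ ++ (c, d) :: (c, !d) :: l₂)
    (hs' : s' = Function.update s e (l₁ ++ l₂)) :
    𝓜.cableSum s (fun f => 𝓜.value
      (.cap (Γ.vert (e, false)) (Γ.offset s (e, false) + l₂.length) :: es) (endWords Γ f)) x =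
    𝓜.cableSum s' (fun f => 𝓜.value
      (.cup (Γ.vert (e, true)) (Γ.offset s' (e, true) + l₁.length) c d :: es)
        (endWords Γ f)) x := by
  refine 𝓜.cableSum_congr_band e hs' fun f hf => ?_
  have hf' : ∀ z : O × Bool, z.1 ≠ e → (f z).length = (s' z.1).length := by
    intro z hz
    rw [hs', Function.update_of_ne hz, hf z hz]
  rw [hs, length_append_cons_cons, List.length_append, sum_words_insert₂, sum_words_add₂]
  refine Finset.sum_congr rfl fun a₁ ha₁ => Finset.sum_congr rfl fun a₂ ha₂ => ?_
  refine Finset.sum_congr rfl fun c₁ hc₁ => Finset.sum_congr rfl fun c₂ hc₂ => ?_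
  rw [mem_words] at ha₁ ha₂ hc₁ hc₂
  have h1 : ∀ u v m n, 𝓜.value
      (.cap (Γ.vert (e, false)) (Γ.offset s (e, false) + l₂.length) :: es)
      (endWords Γ (attach f e (a₁ ++ u :: v :: a₂) (c₁ ++ m :: n :: c₂))) =
      𝓜.cap n m * 𝓜.value es (endWords Γ (attach f e (a₁ ++ u :: v :: a₂) (c₁ ++ c₂))) := by
    intro u v m n
    have hrev : (c₁ ++ m :: n :: c₂).reverse = c₂.reverse ++ n :: m :: c₁.reverse := by
      simp
    rw [show l₂.length = c₂.reverse.length by simp [hc₂],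
      𝓜.value_cap_endWords Γ (fun y _ => length_attach hf (by simp [hs, ha₁, ha₂])
      (by simp [hs, hc₁, hc₂]) y) es ((attach_false _ _ _ _).trans hrev), ← List.reverse_append,
      update_attach_false]
  have h2 : 𝓜.value (.cup (Γ.vert (e, true)) (Γ.offset s' (e, true) + l₁.length) c d :: es)
      (endWords Γ (attach f e (a₁ ++ a₂) (c₁ ++ c₂))) = ∑ u, ∑ v, 𝓜.cup c d u v *
        𝓜.value es (endWords Γ (attach f e (a₁ ++ u :: v :: a₂) (c₁ ++ c₂))) := by
    rw [← ha₁, 𝓜.value_cup_endWords Γ (fun y _ => length_attach hf' (by simp [hs', ha₁, ha₂])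
      (by simp [hs', hc₁, hc₂]) y) es c d (attach_true _ _ _ _)]
    simp only [update_attach_true]
  simp only [h1, h2, Finset.mul_sum]
  refine Finset.sum_congr rfl fun u _ => Finset.sum_congr rfl fun v _ => ?_
  rw [← mul_assoc, mul_comm (𝓜.cable _ _ _ _), ← 𝓜.sum_cap_cable_terminal ha₁ hc₁]
  simp only [Finset.sum_mul]
  refine Finset.sum_congr rfl fun m _ => Finset.sum_congr rfl fun n _ => ?_
  ring

theorem cableSum_slide_to_terminal (c : C) (d : Bool) (hs : s e = l₁ ++ (c, d) :: (c, !d) :: l₂)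
    (hs' : s' = Function.update s e (l₁ ++ l₂)) :
    𝓜.cableSum s (fun f => 𝓜.value
      (.cap (Γ.vert (e, true)) (Γ.offset s (e, true) + l₁.length) :: es) (endWords Γ f)) x =
    𝓜.cableSum s' (fun f => 𝓜.value
      (.cup (Γ.vert (e, false)) (Γ.offset s' (e, false) + l₂.length) c d :: es)
        (endWords Γ f)) x := by
  refine 𝓜.cableSum_congr_band e hs' fun f hf => ?_
  have hf' : ∀ z : O × Bool, z.1 ≠ e → (f z).length = (s' z.1).length := by
    intro z hz
    rw [hs', Function.update_of_ne hz, hf z hz]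
  rw [hs, length_append_cons_cons, List.length_append, sum_words_insert₂, sum_words_add₂]
  refine Finset.sum_congr rfl fun a₁ ha₁ => Finset.sum_congr rfl fun a₂ ha₂ => ?_
  refine Finset.sum_congr rfl fun c₁ hc₁ => Finset.sum_congr rfl fun c₂ hc₂ => ?_
  rw [mem_words] at ha₁ ha₂ hc₁ hc₂
  have h1 : ∀ u v m n, 𝓜.value
      (.cap (Γ.vert (e, true)) (Γ.offset s (e, true) + l₁.length) :: es)
      (endWords Γ (attach f e (a₁ ++ u :: v :: a₂) (c₁ ++ m :: n :: c₂))) =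
      𝓜.cap u v * 𝓜.value es (endWords Γ (attach f e (a₁ ++ a₂) (c₁ ++ m :: n :: c₂))) := by
    intro u v m n
    rw [← ha₁, 𝓜.value_cap_endWords Γ (fun y _ => length_attach hf (by simp [hs, ha₁, ha₂])
      (by simp [hs, hc₁, hc₂]) y) es (attach_true _ _ _ _), update_attach_true]
  have h2 : 𝓜.value (.cup (Γ.vert (e, false)) (Γ.offset s' (e, false) + l₂.length) c d :: es)
      (endWords Γ (attach f e (a₁ ++ a₂) (c₁ ++ c₂))) = ∑ n, ∑ m, 𝓜.cup c d n m *
        𝓜.value es (endWords Γ (attach f e (a₁ ++ a₂) (c₁ ++ m :: n :: c₂))) := by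
    have hrev : ∀ m n, (c₁ ++ m :: n :: c₂).reverse = c₂.reverse ++ n :: m :: c₁.reverse := by
      simp
    rw [show l₂.length = c₂.reverse.length by simp [hc₂],
      𝓜.value_cup_endWords Γ (fun y _ => length_attach hf' (by simp [hs', ha₁, ha₂])
      (by simp [hs', hc₁, hc₂]) y) es c d ((attach_false _ _ _ _).trans List.reverse_append)]
    simp only [← hrev, update_attach_false]
  simp only [h1, h2, Finset.mul_sum]
  rw [RibbonHopfAlgebra.sum₄_comm, Finset.sum_comm]
  refine Finset.sum_congr rfl fun n _ => Finset.sum_congr rfl fun m _ => ?_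
  rw [← mul_assoc, mul_comm (𝓜.cable _ _ _ _), ← 𝓜.sum_cap_cable_initial ha₁ hc₁]
  simp only [Finset.sum_mul]
  refine Finset.sum_congr rfl fun p _ => Finset.sum_congr rfl fun q _ => ?_
  ring

end Model

namespace Model

variable {b H : Type*} [CommRing b] {I : Ideal b} [IsAdicComplete I b] [Ring H] [Algebra b H]
  [IsAdicComplete I H] {𝓗 : RibbonHopfAlgebra I H} {C : Type*} {χ : C → H →ₗ[b] b}
  {Pt : Type*} [Fintype Pt] (𝓜 : Model 𝓗 χ Pt)
  {O : Type u} {V : Type*} [Fintype O] [DecidableEq O] [DecidableEq V] [Fintype V]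

open RibbonHopfAlgebra (endWords)

/-! ### Invariance of Wilson links -/

theorem strand_eq_zero (s : C × Bool) (x y : Pt)
    (h : ¬ (𝓜.ty x = s ∧ 𝓜.ty y = (s.1, !s.2))) : 𝓜.strand s x y = 0 := by
  refine Finset.sum_eq_zero fun z _ => ?_
  by_cases hx : 𝓜.ty x = 𝓜.ty z
  · rw [𝓜.cup_eq_zero _ _ _ _ fun h' => h ⟨hx.trans h'.1, h'.2⟩, zero_smul]
  · rw [𝓜.coef_eq_zero _ _ hx, smul_zero]

theorem cable_eq_zero (l : List (C × Bool)) (a c : List Pt)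
    (h : ¬ (a.map 𝓜.ty = l ∧ c.map 𝓜.ty = l.map fun y => (y.1, !y.2))) : 𝓜.cable l a c = 0 := by
  induction l generalizing a c with
  | nil => cases a <;> cases c <;> simp_all [cable]
  | cons s l ih =>
    cases a with
    | nil => rfl
    | cons x a =>
      cases c with
      | nil => rfl
      | cons z c =>
        rw [cable]
        by_cases hs : 𝓜.ty x = s ∧ 𝓜.ty z = (s.1, !s.2)
        · rw [ih, map_zero]
          rintro ⟨h1, h2⟩
          exact h (by simp [h1, h2, hs])
        · rw [strand_eq_zero _ _ _ _ hs, map_zero, LinearMap.zero_apply]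

theorem types_endWords (Γ : Lattice O V) (s : O → List (C × Bool)) (f : O × Bool → List Pt)
    (h : ∀ e, (f (e, true)).map 𝓜.ty = s e ∧
      (f (e, false)).reverse.map 𝓜.ty = (s e).map fun y => (y.1, !y.2)) :
    𝓜.types (endWords Γ f) = Γ.ends s := by
  funext v
  rw [types, endWords, List.map_flatMap, Lattice.ends]
  congr 1
  funext ⟨e, d⟩
  cases d
  · rw [if_neg Bool.false_ne_true, ← (h e).2, List.map_reverse, List.reverse_reverse]
  · rw [if_pos rfl, ← (h e).1]

/-- Cables vanish unless the letters have the colours and directions of the strands. Hence only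
states of the type prescribed by the diagram enter, and for these the local moves are valid. -/
theorem cableSum_congr (Γ : Lattice O V) {s : O → List (C × Bool)}
    {Θ Θ' : (O × Bool → List Pt) → b} (x : O → H)
    (h : ∀ f, 𝓜.types (endWords Γ f) = Γ.ends s → Θ f = Θ' f) :
    𝓜.cableSum s Θ x = 𝓜.cableSum s Θ' x := by
  refine Finset.sum_congr rfl fun f _ => ?_
  by_cases hf : ∀ e, (f (e, true)).map 𝓜.ty = s e ∧
      (f (e, false)).reverse.map 𝓜.ty = (s e).map fun y => (y.1, !y.2)
  · rw [h f (𝓜.types_endWords Γ s f hf)]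
  · obtain ⟨e, he⟩ := not_forall.mp hf
    rw [Finset.prod_eq_zero (Finset.mem_univ e), zero_mul, zero_mul]
    rw [cable_eq_zero _ _ _ _ he, LinearMap.zero_apply]

theorem cableSum_move (Γ : Lattice O V) {L L' : Diagram O V C} (h : Diagram.Move Γ L L')
    (hL : L.IsLink Γ) (hL' : L'.IsLink Γ) (x : O → H) :
    𝓜.cableSum L.strands (fun f => 𝓜.value L.events (endWords Γ f)) x =
      𝓜.cableSum L'.strands (fun f => 𝓜.value L'.events (endWords Γ f)) x := by
  cases h with
  | inside s A B P Q h =>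
    refine 𝓜.cableSum_congr Γ x fun f hf => 𝓜.value_inside h A B _ ?_ ?_
    · rw [hf]
      exact hL
    · rw [hf]
      exact hL'
  | slide_cross s s' e l₁ l₂ p q o es hs hs' =>
    exact 𝓜.cableSum_slide_cross Γ e l₁ l₂ es x p q o hs hs'
  | slide_to_initial s s' e l₁ l₂ c d es hs hs' =>
    exact 𝓜.cableSum_slide_to_initial Γ e l₁ l₂ es x c d hs hs'
  | slide_to_terminal s s' e l₁ l₂ c d es hs hs' =>
    exact 𝓜.cableSum_slide_to_terminal Γ e l₁ l₂ es x c d hs hs'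

theorem cableSum_equivalent (Γ : Lattice O V) {L L' : Diagram O V C}
    (h : Diagram.Equivalent Γ L L') (x : O → H) :
    𝓜.cableSum L.strands (fun f => 𝓜.value L.events (endWords Γ f)) x =
      𝓜.cableSum L'.strands (fun f => 𝓜.value L'.events (endWords Γ f)) x := by
  induction h with
  | rel L L' h => exact 𝓜.cableSum_move Γ h.2.2 h.1 h.2.1 x
  | refl L => rfl
  | symm L L' _ ih => exact ih.symm
  | trans L L' L'' _ _ ih ih' => exact ih.trans ih'

end Model

theorem Diagram.Equivalent.isLink_iff {O V C : Type*} [DecidableEq O] [DecidableEq V]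
    {Γ : Lattice O V} {L L' : Diagram O V C} (h : Diagram.Equivalent Γ L L') :
    L.IsLink Γ ↔ L'.IsLink Γ := by
  induction h with
  | rel L L' h => exact ⟨fun _ => h.2.1, fun _ => h.1⟩
  | refl L => rfl
  | symm L L' _ ih => exact ih.symm
  | trans L L' L'' _ _ ih ih' => exact ih.trans ih'

/-! ### Sorting of layered strands -/

/-- The number of entries of a list in a layer. -/
def countLayer {α : Type*} (a : Bool) (l : List (α × Bool)) : ℕ := l.countP fun x => x.2 == a

section CountLayer

variable {α : Type*} (a : Bool) (z : α) (l l' : List (α × Bool))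

@[simp]
theorem countLayer_nil : countLayer a ([] : List (α × Bool)) = 0 := rfl

@[simp]
theorem countLayer_cons_self : countLayer a ((z, a) :: l) = countLayer a l + 1 := by
  simp [countLayer]

theorem countLayer_cons_of_ne {a a' : Bool} (h : a' ≠ a) :
    countLayer a ((z, a') :: l) = countLayer a l := by
  simp [countLayer, h]

end CountLayer

namespace Model

variable {b H : Type*} [CommRing b] {I : Ideal b} [IsAdicComplete I b] [Ring H] [Algebra b H]
  [IsAdicComplete I H] {𝓗 : RibbonHopfAlgebra I H} {C : Type*} {χ : C → H →ₗ[b] b}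
  {Pt : Type*} [Fintype Pt] (𝓜 : Model 𝓗 χ Pt)

/-- The matrix that moves the strands of the layer `false` to the left of those of the layer `true`,
which pass over. -/
def sepKernel : List (Pt × Bool) → List Pt → List Pt → b
  | [], [], [] => 1
  | (z, false) :: l, y :: a, c => 𝓜.coef y z 1 * sepKernel l a c
  -- A strand of the upper layer passes over all strands of the lower layer to its right at once.
  -- The matrix of this multiple crossing is the R-pairing of its coefficient with that of a tensor
  -- product.
  | (z, true) :: l, a, y :: c =>
      ∑ a' ∈ words Pt a.length, 𝓗.rPair (𝓜.coef y z) (𝓜.wc a a') * sepKernel l a' c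
  | _, _, _ => 0

/-- The operator that moves the strands of the layer `false` to the left of those of the layer
`true`, which pass over. -/
def separated (l : List (Pt × Bool)) (Θ : List Pt → List Pt → b) : b :=
  ∑ a ∈ words Pt (countLayer false l), ∑ c ∈ words Pt (countLayer true l),
    𝓜.sepKernel l a c * Θ a c

theorem separated_congr {l : List (Pt × Bool)} {Θ Θ' : List Pt → List Pt → b}
    (h : ∀ a c, a.length = countLayer false l → c.length = countLayer true l → Θ a c = Θ' a c) :
    𝓜.separated l Θ = 𝓜.separated l Θ' :=
  Finset.sum_congr rfl fun a ha => Finset.sum_congr rfl fun c hc => by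
    rw [h a c (mem_words.mp ha) (mem_words.mp hc)]

theorem separated_sum {ι : Type*} (s : Finset ι) (l : List (Pt × Bool)) (k : ι → b)
    (Θ : ι → List Pt → List Pt → b) :
    ∑ i ∈ s, k i * 𝓜.separated l (Θ i) = 𝓜.separated l fun a c => ∑ i ∈ s, k i * Θ i a c := by
  simp only [separated, Finset.mul_sum]
  rw [Finset.sum_comm]
  refine Finset.sum_congr rfl fun a _ => ?_
  rw [Finset.sum_comm]
  refine Finset.sum_congr rfl fun c _ => Finset.sum_congr rfl fun i _ => ?_
  ring

theorem separated_nil (Θ : List Pt → List Pt → b) : 𝓜.separated [] Θ = Θ [] [] := by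
  simp [separated, sum_words_zero, sepKernel]

theorem separated_cons_false (z : Pt) (l : List (Pt × Bool)) (Θ : List Pt → List Pt → b) :
    𝓜.separated ((z, false) :: l) Θ = 𝓜.separated l fun a c => Θ (z :: a) c := by
  rw [separated, countLayer_cons_self, countLayer_cons_of_ne _ _ (by simp), sum_words_succ]
  simp only [sepKernel, mul_assoc, ← Finset.mul_sum]
  exact 𝓜.sum_coef_one_mul' z fun y => ∑ a ∈ words Pt (countLayer false l),
    ∑ c ∈ words Pt (countLayer true l), 𝓜.sepKernel l a c * Θ (y :: a) c

/-- Seen as an operator on functions, the sorting of the remaining strands comes outside, and the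
passage of `z` over the sorted lower word `a` is applied to `Θ`. -/
theorem separated_cons_true (z : Pt) (l : List (Pt × Bool)) (Θ : List Pt → List Pt → b) :
    𝓜.separated ((z, true) :: l) Θ = 𝓜.separated l fun a c => ∑ y, ∑ a' ∈ words Pt a.length,
      𝓗.rPair (𝓜.coef y z) (𝓜.wc a' a) * Θ a' (y :: c) := by
  rw [separated, separated, countLayer_cons_self, countLayer_cons_of_ne _ _ (by simp)]
  have h : ∀ a : List Pt, ∀ y c, 𝓜.sepKernel ((z, true) :: l) a (y :: c) =
      ∑ a' ∈ words Pt a.length, 𝓗.rPair (𝓜.coef y z) (𝓜.wc a a') * 𝓜.sepKernel l a' c := by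
    intro a y c
    cases a <;> rfl
  simp only [sum_words_succ, h, Finset.mul_sum, Finset.sum_mul]
  set n := countLayer false l
  calc _ = ∑ a ∈ words Pt n, ∑ y, ∑ c ∈ words Pt (countLayer true l), ∑ a' ∈ words Pt n,
        𝓗.rPair (𝓜.coef y z) (𝓜.wc a a') * 𝓜.sepKernel l a' c * Θ a (y :: c) := by
        refine Finset.sum_congr rfl fun a ha => ?_
        rw [mem_words.mp ha]
    _ = ∑ a' ∈ words Pt n, ∑ c ∈ words Pt (countLayer true l), ∑ y, ∑ a ∈ words Pt n,
        𝓗.rPair (𝓜.coef y z) (𝓜.wc a a') * 𝓜.sepKernel l a' c * Θ a (y :: c) := by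
        rw [RibbonHopfAlgebra.sum₄_comm, Finset.sum_comm]
        exact Finset.sum_congr rfl fun a' _ => Finset.sum_congr rfl fun c _ => Finset.sum_comm
    _ = _ := by
        refine Finset.sum_congr rfl fun a' ha' => Finset.sum_congr rfl fun c _ => ?_
        rw [mem_words.mp ha']
        refine Finset.sum_congr rfl fun y _ => Finset.sum_congr rfl fun a _ => ?_
        ring

/-- The operator that moves a sorted list of strands to the right through another one. -/
def merged (a₁ c₁ a₂ c₂ : List Pt) (Θ : List Pt → List Pt → b) : b :=
  ∑ c ∈ words Pt c₁.length, ∑ a ∈ words Pt a₂.length,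
    𝓗.rPair (𝓜.wc c c₁) (𝓜.wc a a₂) * Θ (a₁ ++ a) (c ++ c₂)

/-- Passing over `a₁ ++ a₂` means passing over the two words one after the other, by (1 ⊗ Δ)R =
R₁₃R₁₂. During the second passage `z` travels together with the word `c₁`, by (Δ ⊗ 1)R = R₁₃R₂₃. -/
theorem sum_rPair_merged (z : Pt) (a₁ c₁ a₂ c₂ : List Pt) (Θ : List Pt → List Pt → b) :
    𝓜.merged a₁ c₁ a₂ c₂ (fun a c => ∑ y, ∑ a' ∈ words Pt a.length,
      𝓗.rPair (𝓜.coef y z) (𝓜.wc a' a) * Θ a' (y :: c)) =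
    ∑ w, ∑ a ∈ words Pt a₁.length, 𝓗.rPair (𝓜.coef w z) (𝓜.wc a a₁) *
      𝓜.merged a (w :: c₁) a₂ c₂ Θ := by
  simp only [merged, List.length_append, List.length_cons, sum_words_add, sum_words_succ,
    Finset.mul_sum, wc_cons]
  set F : Pt → List Pt → List Pt → List Pt → List Pt → Pt → b := fun y b₁ c' b₂ a' w =>
    𝓗.rPair (𝓜.wc c' c₁) (𝓜.wc a' a₂) * (𝓗.rPair (𝓜.coef y w) (𝓜.wc b₂ a') *
      𝓗.rPair (𝓜.coef w z) (𝓜.wc b₁ a₁) * Θ (b₁ ++ b₂) (y :: (c' ++ c₂))) with hF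
  calc _ = ∑ c' ∈ words Pt c₁.length, ∑ a' ∈ words Pt a₂.length, ∑ y,
        ∑ b₁ ∈ words Pt a₁.length, ∑ b₂ ∈ words Pt a₂.length, ∑ w, F y b₁ c' b₂ a' w := by
        refine Finset.sum_congr rfl fun c' _ => Finset.sum_congr rfl fun a' ha' => ?_
        refine Finset.sum_congr rfl fun y _ => Finset.sum_congr rfl fun b₁ hb₁ => ?_
        rw [mem_words.mp ha']
        refine Finset.sum_congr rfl fun b₂ _ => ?_
        rw [wc_append _ (mem_words.mp hb₁), 𝓗.rPair_conv_right (𝓜.coef_mul _ _), Finset.sum_mul,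
          Finset.mul_sum]
    _ = ∑ y, ∑ b₁ ∈ words Pt a₁.length, ∑ c' ∈ words Pt c₁.length,
        ∑ b₂ ∈ words Pt a₂.length, ∑ a' ∈ words Pt a₂.length, ∑ w, F y b₁ c' b₂ a' w := by
        rw [RibbonHopfAlgebra.sum₄_comm]
        exact Finset.sum_congr rfl fun y _ => Finset.sum_congr rfl fun b₁ _ =>
          Finset.sum_congr rfl fun c' _ => Finset.sum_comm
    _ = ∑ w, ∑ b₁ ∈ words Pt a₁.length, ∑ y, ∑ c' ∈ words Pt c₁.length,
        ∑ b₂ ∈ words Pt a₂.length, ∑ a' ∈ words Pt a₂.length, F y b₁ c' b₂ a' w := by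
        symm
        rw [Finset.sum_comm]
        refine (Finset.sum_congr rfl fun b₁ _ => Finset.sum_comm).trans ?_
        rw [Finset.sum_comm]
        refine Finset.sum_congr rfl fun y _ => Finset.sum_congr rfl fun b₁ _ => ?_
        rw [Finset.sum_comm]
        refine Finset.sum_congr rfl fun c' _ => ?_
        rw [Finset.sum_comm]
        exact Finset.sum_congr rfl fun b₂ _ => Finset.sum_comm
    _ = _ := by
        refine Finset.sum_congr rfl fun w _ => Finset.sum_congr rfl fun b₁ _ => ?_
        refine Finset.sum_congr rfl fun y _ => Finset.sum_congr rfl fun c' _ => ?_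
        refine Finset.sum_congr rfl fun b₂ hb₂ => ?_
        rw [𝓗.rPair_conv_left (𝓜.wc_mul _ _), mem_words.mp hb₂, Finset.sum_mul, Finset.mul_sum]
        refine Finset.sum_congr rfl fun a' _ => ?_
        simp only [hF, List.cons_append]
        ring

/-- A concatenation is sorted by sorting both parts and then moving the upper strands of `p` over
the lower strands of `q`. This isolates the part of the word where an event takes place. -/
theorem separated_append (p q : List (Pt × Bool)) (Θ : List Pt → List Pt → b) :
    𝓜.separated (p ++ q) Θ =
      𝓜.separated q fun a₂ c₂ => 𝓜.separated p fun a₁ c₁ => 𝓜.merged a₁ c₁ a₂ c₂ Θ := by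
  induction p generalizing Θ with
  | nil =>
    simp only [separated_nil, merged, List.nil_append, List.length_nil, sum_words_zero, wc_nil,
      𝓗.rPair_counit_left]
    congr 1
    funext a c
    exact (𝓜.sum_wc_one_smul' rfl fun a => Θ a c).symm
  | cons x p ih =>
    obtain ⟨z, _ | _⟩ := x
    · rw [List.cons_append, separated_cons_false, ih]
      simp only [separated_cons_false]
      rfl
    · rw [List.cons_append, separated_cons_true, ih]
      simp only [separated_cons_true]
      congr 1
      funext a₂ c₂
      congr 1
      funext a₁ c₁
      exact 𝓜.sum_rPair_merged z a₁ c₁ a₂ c₂ Θ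

theorem separated_map_true (w : List Pt) (Θ : List Pt → List Pt → b) :
    𝓜.separated (w.map fun z => (z, true)) Θ = Θ [] w := by
  induction w generalizing Θ with
  | nil => exact 𝓜.separated_nil Θ
  | cons z w ih =>
    rw [List.map_cons, separated_cons_true, ih]
    simp only [List.length_nil, sum_words_zero, wc_nil, 𝓗.rPair_counit_right]
    exact 𝓜.sum_coef_one_mul' z fun y => Θ [] (y :: w)

theorem separated_map_false_append (w : List Pt) (s : List (Pt × Bool))
    (Θ : List Pt → List Pt → b) : 𝓜.separated (w.map (fun z => (z, false)) ++ s) Θ =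
      𝓜.separated s fun a c => Θ (w ++ a) c := by
  induction w generalizing Θ with
  | nil => rfl
  | cons z w ih =>
    rw [List.map_cons, List.cons_append, separated_cons_false, ih]
    rfl

theorem separated_map_true_append (w : List Pt) (s : List (Pt × Bool))
    (Θ : List Pt → List Pt → b) : 𝓜.separated (w.map (fun z => (z, true)) ++ s) Θ =
      𝓜.separated s fun a c => 𝓜.merged [] w a c Θ := by
  rw [separated_append]
  simp only [separated_map_true]

/-- A matrix between words is compatible with the action of `H`. -/
def Intertwines (n m : ℕ) (K : List Pt → List Pt → b) : Prop :=
  ∀ w ∈ words Pt n, ∀ v ∈ words Pt m,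
    ∑ o ∈ words Pt m, K o w • 𝓜.wc v o = ∑ u ∈ words Pt n, K v u • 𝓜.wc u w

variable {𝓜} in
/-- Strands of the lower layer are sorted before or after an event in this layer. -/
theorem Intertwines.separated_false {n m : ℕ} {K : List Pt → List Pt → b}
    (hK : 𝓜.Intertwines n m K) (p s : List (Pt × Bool)) {w : List Pt} (hw : w ∈ words Pt n)
    (Θ Θ' : List Pt → List Pt → b)
    (h : ∀ a₁ a₂ c u, a₁.length = countLayer false p → u.length = n →
      Θ' (a₁ ++ (u ++ a₂)) c = ∑ o ∈ words Pt m, K o u * Θ (a₁ ++ (o ++ a₂)) c) :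
    ∑ o ∈ words Pt m, K o w * 𝓜.separated (p ++ (o.map (fun z => (z, false)) ++ s)) Θ =
      𝓜.separated (p ++ (w.map (fun z => (z, false)) ++ s)) Θ' := by
  simp only [separated_append _ p, separated_map_false_append, separated_sum]
  refine congrArg _ (funext fun a₂ => funext fun c₂ => ?_)
  refine 𝓜.separated_congr fun a₁ c₁ ha₁ hc₁ => ?_
  simp only [merged, Finset.mul_sum]
  rw [Finset.sum_comm]
  refine Finset.sum_congr rfl fun c _ => ?_
  have hlen : ∀ o ∈ words Pt m, (o ++ a₂).length = m + a₂.length := by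
    intro o ho
    rw [List.length_append, mem_words.mp ho]
  rw [List.length_append, mem_words.mp hw, sum_words_add]
  calc _ = ∑ o ∈ words Pt m, ∑ v ∈ words Pt m, ∑ a ∈ words Pt a₂.length,
        𝓗.rPair (𝓜.wc c c₁) (𝓗.conv (K o w • 𝓜.wc v o) (𝓜.wc a a₂)) *
          Θ (a₁ ++ (v ++ a)) (c ++ c₂) := by
        refine Finset.sum_congr rfl fun o ho => ?_
        rw [hlen o ho, sum_words_add]
        refine Finset.sum_congr rfl fun v hv => Finset.sum_congr rfl fun a _ => ?_
        rw [wc_append _ ((mem_words.mp hv).trans (mem_words.mp ho).symm), map_smul,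
          LinearMap.smul_apply, map_smul, smul_eq_mul, mul_assoc]
    _ = ∑ v ∈ words Pt m, ∑ a ∈ words Pt a₂.length,
        𝓗.rPair (𝓜.wc c c₁) (𝓗.conv (∑ o ∈ words Pt m, K o w • 𝓜.wc v o) (𝓜.wc a a₂)) *
          Θ (a₁ ++ (v ++ a)) (c ++ c₂) := by
        rw [Finset.sum_comm]
        refine Finset.sum_congr rfl fun v _ => ?_
        rw [Finset.sum_comm]
        refine Finset.sum_congr rfl fun a _ => ?_
        simp only [map_sum, LinearMap.sum_apply, Finset.sum_mul]
    _ = ∑ v ∈ words Pt m, ∑ a ∈ words Pt a₂.length, ∑ u ∈ words Pt n,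
        K v u * (𝓗.rPair (𝓜.wc c c₁) (𝓗.conv (𝓜.wc u w) (𝓜.wc a a₂)) *
          Θ (a₁ ++ (v ++ a)) (c ++ c₂)) := by
        refine Finset.sum_congr rfl fun v hv => Finset.sum_congr rfl fun a _ => ?_
        -- Naturality of the braiding: the matrix of the event is H-linear, so it passes under the
        -- upper strands that cross over its legs.
        rw [hK w hw v hv]
        simp only [map_sum, LinearMap.sum_apply, Finset.sum_mul, map_smul, LinearMap.smul_apply,
          smul_eq_mul, mul_assoc]
    _ = ∑ u ∈ words Pt n, ∑ a ∈ words Pt a₂.length, ∑ v ∈ words Pt m,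
        K v u * (𝓗.rPair (𝓜.wc c c₁) (𝓗.conv (𝓜.wc u w) (𝓜.wc a a₂)) *
          Θ (a₁ ++ (v ++ a)) (c ++ c₂)) := by
        rw [Finset.sum_comm, Finset.sum_comm (s := words Pt n)]
        exact Finset.sum_congr rfl fun a _ => Finset.sum_comm
    _ = _ := by
        refine Finset.sum_congr rfl fun u hu => Finset.sum_congr rfl fun a _ => ?_
        rw [wc_append _ ((mem_words.mp hu).trans (mem_words.mp hw).symm),
          h a₁ a _ u ha₁ (mem_words.mp hu), Finset.mul_sum]
        refine Finset.sum_congr rfl fun v _ => ?_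
        ring

variable {𝓜} in
/-- Strands of the upper layer are sorted before or after an event in this layer. -/
theorem Intertwines.separated_true {n m : ℕ} {K : List Pt → List Pt → b}
    (hK : 𝓜.Intertwines n m K) (p s : List (Pt × Bool)) {w : List Pt} (hw : w ∈ words Pt n)
    (Θ Θ' : List Pt → List Pt → b)
    (h : ∀ a c₁ c₂ u, c₁.length = countLayer true p → u.length = n →
      Θ' a (c₁ ++ (u ++ c₂)) = ∑ o ∈ words Pt m, K o u * Θ a (c₁ ++ (o ++ c₂))) :
    ∑ o ∈ words Pt m, K o w * 𝓜.separated (p ++ (o.map (fun z => (z, true)) ++ s)) Θ =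
      𝓜.separated (p ++ (w.map (fun z => (z, true)) ++ s)) Θ' := by
  simp only [separated_append _ p, separated_map_true_append, separated_sum]
  refine congrArg _ (funext fun a₂ => funext fun c₂ => ?_)
  have hmerge : ∀ a c u, u.length = n → 𝓜.separated p (fun a₁ c₁ => 𝓜.merged a₁ c₁ a (u ++ c) Θ') =
      ∑ o ∈ words Pt m, K o u * 𝓜.separated p fun a₁ c₁ => 𝓜.merged a₁ c₁ a (o ++ c) Θ := by
    intro a c u hu
    rw [separated_sum]
    refine 𝓜.separated_congr fun a₁ c₁ ha₁ hc₁ => ?_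
    simp only [merged, Finset.mul_sum]
    symm
    rw [Finset.sum_comm]
    refine Finset.sum_congr rfl fun c' hc' => ?_
    rw [Finset.sum_comm]
    refine Finset.sum_congr rfl fun a' _ => ?_
    symm
    rw [h _ _ _ _ ((mem_words.mp hc').trans hc₁) hu, Finset.mul_sum]
    refine Finset.sum_congr rfl fun o _ => ?_
    ring
  simp only [merged.eq_1 𝓜 [], Finset.mul_sum, List.nil_append, mem_words.mp hw]
  calc _ = ∑ o ∈ words Pt m, ∑ v ∈ words Pt m, ∑ a ∈ words Pt a₂.length,
        𝓗.rPair (K o w • 𝓜.wc v o) (𝓜.wc a a₂) *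
          𝓜.separated p fun a₁ c₁ => 𝓜.merged a₁ c₁ a (v ++ c₂) Θ := by
        refine Finset.sum_congr rfl fun o ho => ?_
        rw [mem_words.mp ho]
        refine Finset.sum_congr rfl fun v hv => Finset.sum_congr rfl fun a _ => ?_
        rw [LinearMap.map_smul₂, smul_eq_mul, mul_assoc]
    _ = ∑ v ∈ words Pt m, ∑ a ∈ words Pt a₂.length,
        𝓗.rPair (∑ o ∈ words Pt m, K o w • 𝓜.wc v o) (𝓜.wc a a₂) *
          𝓜.separated p fun a₁ c₁ => 𝓜.merged a₁ c₁ a (v ++ c₂) Θ := by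
        rw [Finset.sum_comm]
        refine Finset.sum_congr rfl fun v _ => ?_
        rw [Finset.sum_comm]
        refine Finset.sum_congr rfl fun a _ => ?_
        simp only [map_sum, LinearMap.sum_apply, Finset.sum_mul]
    _ = ∑ v ∈ words Pt m, ∑ a ∈ words Pt a₂.length, ∑ u ∈ words Pt n,
        𝓗.rPair (𝓜.wc u w) (𝓜.wc a a₂) * (K v u *
          𝓜.separated p fun a₁ c₁ => 𝓜.merged a₁ c₁ a (v ++ c₂) Θ) := by
        refine Finset.sum_congr rfl fun v hv => Finset.sum_congr rfl fun a _ => ?_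
        -- Likewise, an H-linear matrix in the upper layer passes over the lower strands.
        rw [hK w hw v hv]
        simp only [map_sum, LinearMap.sum_apply, Finset.sum_mul, LinearMap.map_smul₂, smul_eq_mul]
        refine Finset.sum_congr rfl fun u _ => ?_
        ring
    _ = ∑ u ∈ words Pt n, ∑ a ∈ words Pt a₂.length, ∑ v ∈ words Pt m,
        𝓗.rPair (𝓜.wc u w) (𝓜.wc a a₂) * (K v u *
          𝓜.separated p fun a₁ c₁ => 𝓜.merged a₁ c₁ a (v ++ c₂) Θ) := by
        rw [Finset.sum_comm, Finset.sum_comm (s := words Pt n)]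
        exact Finset.sum_congr rfl fun a _ => Finset.sum_comm
    _ = _ := by
        refine Finset.sum_congr rfl fun u hu => Finset.sum_congr rfl fun a _ => ?_
        rw [hmerge a c₂ u (mem_words.mp hu), Finset.mul_sum]

/-- A crossing in which an upper strand passes from the left over a lower one is the one that
sorting begins with at this place, so it may be performed before or counted as part of the sorting.
-/
theorem separated_cross (p s : List (Pt × Bool)) (x y : Pt) (Θ : List Pt → List Pt → b) :
    𝓜.separated (p ++ (x, true) :: (y, false) :: s) Θ = ∑ y', ∑ x', 𝓜.cross true y' x' x y *
      𝓜.separated (p ++ (y', false) :: (x', true) :: s) Θ := by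
  simp only [separated_append _ p]
  generalize (fun a₂ c₂ => 𝓜.separated p fun a₁ c₁ => 𝓜.merged a₁ c₁ a₂ c₂ Θ) = Ψ
  have hsum : ∀ Φ : Pt → List Pt → List Pt → b, ∑ i, 𝓜.separated s (Φ i) =
      𝓜.separated s fun a c => ∑ i, Φ i a c := by
    intro Φ
    simpa using 𝓜.separated_sum Finset.univ s (fun _ => 1) Φ
  simp only [separated_cons_true, separated_cons_false, separated_sum, hsum, cross,
    List.length_cons, sum_words_succ, wc_cons, 𝓗.rPair_conv_right (𝓜.coef_mul _ _),
    Finset.sum_mul, Finset.mul_sum]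
  refine congrArg _ (funext fun a => funext fun c => ?_)
  rw [Finset.sum_comm]
  refine Finset.sum_congr rfl fun y' _ => ?_
  symm
  rw [Finset.sum_comm]
  refine Finset.sum_congr rfl fun z _ => ?_
  rw [Finset.sum_comm]
  refine Finset.sum_congr rfl fun a' _ => Finset.sum_congr rfl fun w _ => ?_
  simp only [if_true]
  ring

/-- A crossing that brings an upper strand to the left, over a lower one, is undone by the sorting,
according to the second Reidemeister move. -/
theorem separated_cross_inv (p s : List (Pt × Bool)) (x y : Pt) (Θ : List Pt → List Pt → b) :
    𝓜.separated (p ++ (x, false) :: (y, true) :: s) Θ = ∑ y', ∑ x', 𝓜.cross false y' x' x y *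
      𝓜.separated (p ++ (y', true) :: (x', false) :: s) Θ := by
  simp only [separated_cross]
  exact (𝓜.sum_cross_cross false x y fun x y =>
    𝓜.separated (p ++ (x, false) :: (y, true) :: s) Θ).symm

end Model

namespace Model

variable {b H : Type*} [CommRing b] {I : Ideal b} [IsAdicComplete I b] [Ring H] [Algebra b H]
  [IsAdicComplete I H] {𝓗 : RibbonHopfAlgebra I H} {C : Type*} {χ : C → H →ₗ[b] b}
  {Pt : Type*} [Fintype Pt] (𝓜 : Model 𝓗 χ Pt) {V : Type*} [DecidableEq V]

/-! ### State sums of layered diagrams -/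

/-- The single property of events that is needed to move them through the crossings between the two
layers. -/
theorem kernel_intertwines (e : Event V C) :
    𝓜.Intertwines e.inWidth e.outWidth (𝓜.kernel e) := by
  intro w hw v hv
  rw [mem_words] at hw hv
  cases e with
  | cross _ _ o =>
    obtain ⟨p, q, rfl⟩ := List.length_eq_two.mp hw
    obtain ⟨x, y, rfl⟩ := List.length_eq_two.mp hv
    simp only [Event.inWidth, Event.outWidth, sum_words_two]
    exact (𝓜.sum_cross_wc o x y p q).symm
  | cap _ _ =>
    obtain ⟨p, q, rfl⟩ := List.length_eq_two.mp hw
    obtain rfl := List.length_eq_zero_iff.mp hv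
    simp only [Event.inWidth, Event.outWidth, sum_words_two, sum_words_zero]
    exact (𝓜.sum_cap_wc p q).symm
  | cup _ _ c d =>
    obtain rfl := List.length_eq_zero_iff.mp hw
    obtain ⟨x, y, rfl⟩ := List.length_eq_two.mp hv
    simp only [Event.inWidth, Event.outWidth, sum_words_two, sum_words_zero]
    exact 𝓜.sum_cup_wc c d x y

theorem value_cons (e : Event V C) (es : List (Event V C)) {σ : V → List Pt} {p w s : List Pt}
    (h : σ e.vertex = p ++ (w ++ s)) (hp : p.length = e.pos) (hw : w.length = e.inWidth) :
    𝓜.value (e :: es) σ = ∑ o ∈ words Pt e.outWidth, 𝓜.kernel e o w *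
      𝓜.value es (Function.update σ e.vertex (p ++ (o ++ s))) := by
  refine Eq.trans ?_ (𝓜.localStep_append e
    (fun l => 𝓜.value es (Function.update σ e.vertex l)) s hp hw)
  rw [← h]
  rfl

/-- The strands at a vertex are sorted by layers, in a function of the states of both layers. -/
def separatedAt (τ : V → List (Pt × Bool)) (v : V) (Ω : (V → List Pt) → (V → List Pt) → b) :
    (V → List Pt) → (V → List Pt) → b := fun α β =>
  𝓜.separated (τ v) fun a c => Ω (Function.update α v a) (Function.update β v c)

/-- The strands at several vertices are sorted by layers. -/
def separatedOver (τ : V → List (Pt × Bool)) (vs : List V)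
    (Ω : (V → List Pt) → (V → List Pt) → b) : (V → List Pt) → (V → List Pt) → b :=
  vs.foldl (fun Ω v => 𝓜.separatedAt τ v Ω) Ω

theorem separatedOver_cons (τ : V → List (Pt × Bool)) (v : V) (vs : List V)
    (Ω : (V → List Pt) → (V → List Pt) → b) :
    𝓜.separatedOver τ (v :: vs) Ω = 𝓜.separatedOver τ vs (𝓜.separatedAt τ v Ω) := rfl

theorem separatedAt_congr {τ τ' : V → List (Pt × Bool)} {v : V} (h : τ v = τ' v)
    (Ω : (V → List Pt) → (V → List Pt) → b) : 𝓜.separatedAt τ v Ω = 𝓜.separatedAt τ' v Ω := by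
  funext α β
  rw [separatedAt, separatedAt, h]

theorem separated_comm (l l' : List (Pt × Bool)) (Φ : List Pt → List Pt → List Pt → List Pt → b) :
    𝓜.separated l (fun a c => 𝓜.separated l' fun a' c' => Φ a c a' c') =
      𝓜.separated l' fun a' c' => 𝓜.separated l fun a c => Φ a c a' c' := by
  simp only [separated, Finset.mul_sum]
  rw [RibbonHopfAlgebra.sum₄_comm]
  simp only [mul_left_comm]

theorem separatedAt_comm (τ : V → List (Pt × Bool)) (v w : V)
    (Ω : (V → List Pt) → (V → List Pt) → b) :
    𝓜.separatedAt τ v (𝓜.separatedAt τ w Ω) = 𝓜.separatedAt τ w (𝓜.separatedAt τ v Ω) := by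
  by_cases h : v = w
  · rw [h]
  · funext α β
    refine (𝓜.separated_comm _ _ _).trans ?_
    simp only [Function.update_comm h]
    rfl

/-- Sortings at different vertices act on different words. The vertex of the event under
consideration can therefore be taken first. -/
theorem separatedOver_perm (τ : V → List (Pt × Bool)) {vs ws : List V} (h : vs.Perm ws)
    (Ω : (V → List Pt) → (V → List Pt) → b) :
    𝓜.separatedOver τ vs Ω = 𝓜.separatedOver τ ws Ω :=
  h.foldl_eq' (fun _ _ _ _ _ => 𝓜.separatedAt_comm τ _ _ _) Ω

theorem separatedOver_congr {τ τ' : V → List (Pt × Bool)} {vs : List V}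
    (h : ∀ v ∈ vs, τ v = τ' v) (Ω : (V → List Pt) → (V → List Pt) → b) :
    𝓜.separatedOver τ vs Ω = 𝓜.separatedOver τ' vs Ω := by
  induction vs generalizing Ω with
  | nil => rfl
  | cons v vs ih =>
    rw [separatedOver_cons, separatedOver_cons, ih fun w hw => h w (List.mem_cons_of_mem _ hw),
      𝓜.separatedAt_congr (h v List.mem_cons_self)]

theorem separatedOver_sum {ι : Type*} (s : Finset ι) (τ : V → List (Pt × Bool)) (vs : List V)
    (k : ι → b) (Ω : ι → (V → List Pt) → (V → List Pt) → b) (α β : V → List Pt) :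
    ∑ i ∈ s, k i * 𝓜.separatedOver τ vs (Ω i) α β =
      𝓜.separatedOver τ vs (fun α β => ∑ i ∈ s, k i * Ω i α β) α β := by
  induction vs generalizing Ω with
  | nil => rfl
  | cons v vs ih =>
    refine (ih _).trans ?_
    simp only [separatedAt, separated_sum, separatedOver_cons]
    rfl

theorem separatedOver_nil {τ : V → List (Pt × Bool)} (hτ : ∀ v, τ v = []) {vs : List V}
    (Ω : (V → List Pt) → (V → List Pt) → b) (α β : V → List Pt) :
    𝓜.separatedOver τ vs Ω α β =
      Ω (fun v => if v ∈ vs then [] else α v) (fun v => if v ∈ vs then [] else β v) := by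
  induction vs generalizing Ω with
  | nil => simp [separatedOver]
  | cons v vs ih =>
    refine (ih _).trans ?_
    change 𝓜.separated (τ v) _ = _
    rw [hτ, separated_nil]
    congr 1 <;>
    · funext w
      by_cases hw : w = v <;> simp [hw]

/-- The common induction step for all events. Sortings at other vertices do not interfere, so only
the comparison `hΩ` at the vertex of `e` has to be supplied. `g` restores the layers of the outgoing
strands. The induction hypothesis `hes` is required only for nonzero matrix entries, since only
these have the correct types. -/
theorem value_eq_separatedOver (e : Event V C) (es : List (Event V C)) {τ : V → List (Pt × Bool)}
    {vs : List V} (hvs : vs.Nodup) (hmem : e.vertex ∈ vs) {p w s : List (Pt × Bool)}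
    (g : List Pt → List (Pt × Bool)) (hg : ∀ o ∈ words Pt e.outWidth, (g o).map Prod.fst = o)
    (hτ : τ e.vertex = p ++ (w ++ s)) (hp : p.length = e.pos) (hw : w.length = e.inWidth)
    {Ω Ω' : (V → List Pt) → (V → List Pt) → b} {α β : V → List Pt}
    (hes : ∀ o ∈ words Pt e.outWidth, 𝓜.kernel e o (w.map Prod.fst) ≠ 0 →
      𝓜.value es (fun v => (Function.update τ e.vertex (p ++ (g o ++ s)) v).map Prod.fst) =
        𝓜.separatedOver (Function.update τ e.vertex (p ++ (g o ++ s))) vs Ω α β)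
    (hΩ : ∀ α β, ∑ o ∈ words Pt e.outWidth, 𝓜.kernel e o (w.map Prod.fst) *
        𝓜.separated (p ++ (g o ++ s)) (fun a c =>
          Ω (Function.update α e.vertex a) (Function.update β e.vertex c)) =
      𝓜.separated (p ++ (w ++ s)) fun a c =>
        Ω' (Function.update α e.vertex a) (Function.update β e.vertex c)) :
    𝓜.value (e :: es) (fun v => (τ v).map Prod.fst) = 𝓜.separatedOver τ vs Ω' α β := by
  have hperm := List.perm_cons_erase hmem
  rw [𝓜.value_cons e es (p := p.map Prod.fst) (w := w.map Prod.fst) (s := s.map Prod.fst)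
    (by simp [hτ]) (by simpa using hp) (by simpa using hw)]
  calc _ = ∑ o ∈ words Pt e.outWidth, 𝓜.kernel e o (w.map Prod.fst) *
        𝓜.separatedOver τ (vs.erase e.vertex) (fun α β => 𝓜.separated (p ++ (g o ++ s)) fun a c =>
          Ω (Function.update α e.vertex a) (Function.update β e.vertex c)) α β := by
        refine Finset.sum_congr rfl fun o ho => ?_
        by_cases hk : 𝓜.kernel e o (w.map Prod.fst) = 0
        · rw [hk, zero_mul, zero_mul]
        have h1 : Function.update (fun v => (τ v).map Prod.fst) e.vertex
            (p.map Prod.fst ++ (o ++ s.map Prod.fst)) =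
            fun v => (Function.update τ e.vertex (p ++ (g o ++ s)) v).map Prod.fst := by
          funext v
          by_cases hv : v = e.vertex
          · subst hv
            simp [hg o ho]
          · simp [hv]
        rw [h1, hes o ho hk, separatedOver_perm _ _ hperm]
        rw [separatedOver_cons, 𝓜.separatedOver_congr (τ' := τ) fun v hv => ?_]
        · unfold separatedAt
          rw [Function.update_self]
        · exact Function.update_of_ne (fun h => hvs.not_mem_erase (h ▸ hv)) _ _
    _ = _ := by
        rw [separatedOver_sum, separatedOver_perm _ _ hperm]
        simp only [hΩ, ← hτ, separatedOver_cons]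
        rfl

/-- An event inside the layer `a` is performed before the sorting on one side and after it on the
other. Among the strands of its own layer its position is the number of strands of that layer to its
left. -/
theorem separated_event (e : Event V C) (a : Bool) (E : Bool → List (Event V C))
    (p s : List (Pt × Bool)) {w : List Pt} (hw : w ∈ words Pt e.inWidth) (α β : V → List Pt)
    {E' : Bool → List (Event V C)}
    (hE : E' = Function.update E a (e.moveTo (countLayer a p) :: E a)) :
    ∑ o ∈ words Pt e.outWidth, 𝓜.kernel e o w *
      𝓜.separated (p ++ (o.map (fun z => (z, a)) ++ s)) (fun x y =>
        𝓜.value (E false) (Function.update α e.vertex x) *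
          𝓜.value (E true) (Function.update β e.vertex y)) =
      𝓜.separated (p ++ (w.map (fun z => (z, a)) ++ s)) (fun x y =>
        𝓜.value (E' false) (Function.update α e.vertex x) *
          𝓜.value (E' true) (Function.update β e.vertex y)) := by
  subst hE
  have key : ∀ (F : List (Event V C)) (γ : V → List Pt) (a₁ u a₂ : List Pt) (n : ℕ), a₁.length = n →
      u.length = e.inWidth →
      𝓜.value (e.moveTo n :: F) (Function.update γ e.vertex (a₁ ++ (u ++ a₂))) =
        ∑ o ∈ words Pt e.outWidth, 𝓜.kernel e o u *
          𝓜.value F (Function.update γ e.vertex (a₁ ++ (o ++ a₂))) := by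
    intro F γ a₁ u a₂ n h1 hu
    have := 𝓜.value_cons (e.moveTo n) F (p := a₁) (w := u) (s := a₂)
      (σ := Function.update γ e.vertex (a₁ ++ (u ++ a₂))) (by simp [Event.moveTo_vertex])
      (by rw [h1, Event.moveTo_pos]) (by rw [hu, Event.moveTo_inWidth])
    simpa [Event.moveTo_vertex, Event.moveTo_outWidth, kernel_moveTo] using this
  cases a with
  | false =>
    refine (𝓜.kernel_intertwines e).separated_false p s hw _ _ fun a₁ a₂ c u h1 hu => ?_
    simp only [Function.update_self, key _ _ _ _ _ _ h1 hu, Finset.sum_mul, mul_assoc]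
    simp
  | true =>
    refine (𝓜.kernel_intertwines e).separated_true p s hw _ _ fun a c₁ c₂ u h1 hu => ?_
    simp only [Function.update_self, key _ _ _ _ _ _ h1 hu, Finset.mul_sum]
    simp [mul_left_comm]

/-- The colours, layers and directions of layered points. -/
def layeredTypes (τ : V → List (Pt × Bool)) (v : V) : List ((C × Bool) × Bool) :=
  (τ v).map fun z => (((𝓜.ty z.1).1, z.2), (𝓜.ty z.1).2)

theorem layeredTypes_update (τ : V → List (Pt × Bool)) (v : V) (l : List (Pt × Bool)) :
    𝓜.layeredTypes (Function.update τ v l) = Function.update (𝓜.layeredTypes τ) v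
      (l.map fun z => (((𝓜.ty z.1).1, z.2), (𝓜.ty z.1).2)) := by
  funext w
  by_cases hw : w = v
  · subst hw
    simp [layeredTypes]
  · simp [layeredTypes, hw]

/-- The state sum of a layered diagram is the product of those of its layers, after a separation of
the layers. -/
theorem value_layered {vs : List V} (hvs : vs.Nodup) (hmem : ∀ v, v ∈ vs)
    (es : List (Event V (C × Bool))) (τ : V → List (Pt × Bool))
    (hc : Diagram.Closes (𝓜.layeredTypes τ) es) (hl : Diagram.LayeredFrom (𝓜.layeredTypes τ) es)
    (α β : V → List Pt) :
    𝓜.value (es.map (Event.recolor Prod.fst)) (fun v => (τ v).map Prod.fst) =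
      𝓜.separatedOver τ vs (fun α β =>
        𝓜.value (Diagram.layerEvents false (𝓜.layeredTypes τ) es) α *
          𝓜.value (Diagram.layerEvents true (𝓜.layeredTypes τ) es) β) α β := by
  induction es generalizing τ with
  | nil =>
    have hτ : ∀ v, τ v = [] := fun v => List.map_eq_nil_iff.mp (hc v)
    simp [separatedOver_nil 𝓜 hτ, value, Diagram.layerEvents, hmem, hτ]
  | cons e es ih =>
    -- This treats every event whose strands all lie in one layer `a`: it becomes an event of that
    -- layer and leaves the other layer unchanged.
    have pure : ∀ (e' : Event V C) (a : Bool) (p s : List (Pt × Bool)) (w : List Pt),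
        e' = e.recolor Prod.fst → w ∈ words Pt e'.inWidth → p.length = e'.pos →
        τ e'.vertex = p ++ (w.map (fun z => (z, a)) ++ s) →
        (fun c => Diagram.layerEvents c (𝓜.layeredTypes τ) (e :: es)) =
          Function.update (fun c => Diagram.layerEvents c (e.after (𝓜.layeredTypes τ)) es) a
            (e'.moveTo (countLayer a p) ::
              Diagram.layerEvents a (e.after (𝓜.layeredTypes τ)) es) →
        (∀ o ∈ words Pt e'.outWidth, 𝓜.kernel e' o w ≠ 0 → e.after (𝓜.layeredTypes τ) =
          𝓜.layeredTypes (Function.update τ e'.vertex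
            (p ++ (o.map (fun z => (z, a)) ++ s)))) →
        𝓜.value ((e :: es).map (Event.recolor Prod.fst)) (fun v => (τ v).map Prod.fst) =
          𝓜.separatedOver τ vs (fun α β =>
            𝓜.value (Diagram.layerEvents false (𝓜.layeredTypes τ) (e :: es)) α *
              𝓜.value (Diagram.layerEvents true (𝓜.layeredTypes τ) (e :: es)) β) α β := by
      intro e' a p s w he hw hp hτ hE hk
      have hww : (w.map fun z => (z, a)).map Prod.fst = w := by simp [Function.comp_def]
      rw [List.map_cons, ← he]
      refine 𝓜.value_eq_separatedOver e' _ hvs (hmem _) (w := w.map fun z => (z, a))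
        (fun o => o.map fun z => (z, a)) (fun o _ => by simp [Function.comp_def])
        hτ hp (by simpa using mem_words.mp hw) (Ω := fun α β =>
          𝓜.value (Diagram.layerEvents false (e.after (𝓜.layeredTypes τ)) es) α *
            𝓜.value (Diagram.layerEvents true (e.after (𝓜.layeredTypes τ)) es) β) ?_ ?_
      · intro o ho hne
        have h1 := hk o ho (by rwa [hww] at hne)
        have h2 := hc.2
        have h3 := hl.2
        rw [h1] at h2 h3 ⊢
        exact ih _ h2 h3
      · intro α β
        have := 𝓜.separated_event e' a
          (fun c => Diagram.layerEvents c (e.after (𝓜.layeredTypes τ)) es) p s hw α β hE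
        simpa only [hww] using this
    have split : ∀ {v : V} {p' s' : List ((C × Bool) × Bool)}, 𝓜.layeredTypes τ v = p' ++ s' →
        ∃ p s, τ v = p ++ s ∧ p.map (fun z => (((𝓜.ty z.1).1, z.2), (𝓜.ty z.1).2)) = p' ∧
          s.map (fun z => (((𝓜.ty z.1).1, z.2), (𝓜.ty z.1).2)) = s' :=
      fun h => List.map_eq_append_iff.mp h
    cases e with
    | cross v i o =>
      obtain ⟨p', x', y', s', hs, rfl⟩ := hc.1.exists_cross
      obtain ⟨p, t, ht, rfl, hst⟩ := split hs
      obtain ⟨⟨x, a⟩, t, rfl, rfl, hst'⟩ := List.map_eq_cons_iff.mp hst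
      obtain ⟨⟨y, a'⟩, s, rfl, rfl, rfl⟩ := List.map_eq_cons_iff.mp hst'
      have hafter : ∀ u w, 𝓜.ty w = 𝓜.ty x ∧ 𝓜.ty u = 𝓜.ty y →
          (Event.cross v (p.map fun z => (((𝓜.ty z.1).1, z.2), (𝓜.ty z.1).2)).length o :
            Event V (C × Bool)).after (𝓜.layeredTypes τ) =
          𝓜.layeredTypes (Function.update τ v (p ++ ([(u, a'), (w, a)] ++ s))) := by
        intro u w h
        rw [Event.after_cross o hs rfl, layeredTypes_update]
        simp [h.1, h.2]
      by_cases haa : a' = a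
      · subst haa
        refine pure (.cross v p.length o) a' p s [x, y] (by simp [Event.recolor]) (by
          simp [mem_words, Event.inWidth]) rfl ht ?_ ?_
        · funext c
          by_cases hca : c = a'
          · subst hca
            simp [Diagram.layerEvents, hs, countLayer, List.countP_map, Function.comp_def,
              Event.moveTo]
          · simp [Diagram.layerEvents, hs, Ne.symm hca, hca]
        · intro o' ho' hne
          obtain ⟨u, w, rfl⟩ := List.length_eq_two.mp (mem_words.mp ho')
          exact hafter u w (by_contra fun h => hne (𝓜.cross_eq_zero o u w x y h))
      -- A crossing of the two layers is an event of neither layer. It is absorbed by the sorting,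
      -- or cancels against it; which case occurs is decided by the layer of the left strand, since
      -- the upper strand passes over.
      · have hE : ∀ c, Diagram.layerEvents c (𝓜.layeredTypes τ)
            (.cross v (p.map fun z => (((𝓜.ty z.1).1, z.2), (𝓜.ty z.1).2)).length o :: es) =
            Diagram.layerEvents c ((Event.cross v (p.map fun z =>
              (((𝓜.ty z.1).1, z.2), (𝓜.ty z.1).2)).length o).after (𝓜.layeredTypes τ)) es := by
          intro c
          have : ¬ (a = c ∧ a' = c) := fun h => haa (h.2.trans h.1.symm)
          simp [Diagram.layerEvents, hs, this]
        have ho : o = a := hl.1 _ _ (by simp [hs]; rfl) (by simp [hs]; rfl) (Ne.symm haa)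
        simp only [hE]
        have h2 := hc.2
        have h3 := hl.2
        generalize (Event.cross v (p.map fun z => (((𝓜.ty z.1).1, z.2), (𝓜.ty z.1).2)).length o :
          Event V (C × Bool)).after (𝓜.layeredTypes τ) = st at h2 h3 hafter ⊢
        refine 𝓜.value_eq_separatedOver (.cross v _ o) _ hvs (hmem _) (p := p)
          (Ω := fun α β => 𝓜.value (Diagram.layerEvents false st es) α *
            𝓜.value (Diagram.layerEvents true st es) β)
          (w := [(x, a), (y, a')]) (s := s) (fun l => l.zip [a', a]) ?_ ht (by simp [Event.pos]) rfl
          ?_ ?_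
        · intro o' ho'
          obtain ⟨u, w, rfl⟩ := List.length_eq_two.mp (mem_words.mp ho')
          rfl
        · intro o' ho' hne
          obtain ⟨u, w, rfl⟩ := List.length_eq_two.mp (mem_words.mp ho')
          have := hafter u w (by_contra fun h => hne (𝓜.cross_eq_zero o u w x y h))
          rw [this] at h2 h3 ⊢
          exact ih _ h2 h3
        · intro α β
          simp only [Event.outWidth, sum_words_two]
          subst ho
          cases o
          · obtain rfl : a' = true := by simpa using haa
            exact (𝓜.separated_cross_inv p s x y _).symm
          · obtain rfl : a' = false := by simpa using haa
            exact (𝓜.separated_cross p s x y _).symm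
    | cap v i =>
      obtain ⟨p', c', d, s', hs, rfl⟩ := hc.1.exists_cap
      obtain ⟨p, t, ht, rfl, hst⟩ := split hs
      obtain ⟨⟨x, a⟩, t, rfl, hx, hst'⟩ := List.map_eq_cons_iff.mp hst
      obtain ⟨⟨y, a'⟩, s, rfl, hy, rfl⟩ := List.map_eq_cons_iff.mp hst'
      obtain rfl : a = a' :=
        (congrArg (fun z => z.1.2) hx).trans (congrArg (fun z => z.1.2) hy).symm
      refine pure (.cap v p.length) a p s [x, y] (by simp [Event.recolor]) (by
        simp [mem_words, Event.inWidth]) rfl ht ?_ ?_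
      · funext c
        obtain rfl : c'.2 = a := (congrArg (fun z => z.1.2) hx).symm
        by_cases hca : c = c'.2
        · subst hca
          simp [Diagram.layerEvents, hs, countLayer, List.countP_map, Function.comp_def,
            Event.moveTo]
        · simp [Diagram.layerEvents, hs, Ne.symm hca, hca]
      · intro o' ho' hne
        obtain rfl := List.length_eq_zero_iff.mp (mem_words.mp ho')
        rw [Event.after_cap hs rfl, layeredTypes_update]
        simp [Event.vertex]
    | cup v i c' d =>
      obtain ⟨c', a⟩ := c'
      have hi : i ≤ (τ v).length := by
        simpa [layeredTypes, Event.Admissible] using hc.1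
      have ht : τ v = (τ v).take i ++ (τ v).drop i := (List.take_append_drop _ _).symm
      have hp : ((τ v).take i).length = i := by simp [hi]
      generalize (τ v).take i = p, (τ v).drop i = s at ht hp
      subst hp
      have hs : 𝓜.layeredTypes τ v = p.map (fun z => (((𝓜.ty z.1).1, z.2), (𝓜.ty z.1).2)) ++
          s.map (fun z => (((𝓜.ty z.1).1, z.2), (𝓜.ty z.1).2)) := by simp [layeredTypes, ht]
      refine pure (.cup v p.length c' d) a p s [] (by simp [Event.recolor]) (by
        simp [mem_words, Event.inWidth]) rfl ht ?_ ?_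
      · funext c
        by_cases hca : c = a
        · subst hca
          simp [Diagram.layerEvents, hs, countLayer, List.countP_map, Function.comp_def,
            Event.moveTo, List.take_append]
        · simp [Diagram.layerEvents, hs, Ne.symm hca, hca]
      · intro o' ho' hne
        obtain ⟨u, w, rfl⟩ := List.length_eq_two.mp (mem_words.mp ho')
        obtain ⟨h1, h2⟩ := by_contra fun h => hne (𝓜.cup_eq_zero c' d u w h)
        rw [Event.after_cup (c', a) d hs (by simp), layeredTypes_update]
        simp [Event.vertex, h1, h2]

end Model

/-! ### Sorting of the strands in a band -/

section BandSort

variable {O V C D α : Type*} [DecidableEq O] [DecidableEq V] (Γ : Lattice O V)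

open RibbonHopfAlgebra (endWords)

theorem offset_congr {s : O → List (D × Bool)} {t : O → List (α × Bool)}
    (h : ∀ e, (s e).length = (t e).length) (z : O × Bool) : Γ.offset s z = Γ.offset t z := by
  simp only [Lattice.offset, h]

theorem exists_cross_endWords {f : O × Bool → List (D × Bool)} {t : O → List (α × Bool)}
    (ht : ∀ y, (f y).length = (t y.1).length) {z : O × Bool} {a c : List (D × Bool)} {n : ℕ}
    {x y : D × Bool} (hz : f z = a ++ x :: y :: c) (hn : a.length = n) :
    ∃ P S, endWords Γ f (Γ.vert z) = P ++ x :: y :: S ∧ P.length = Γ.offset t z + n ∧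
      ∀ o, (Event.cross (Γ.vert z) (Γ.offset t z + n) o).after (endWords Γ f) =
        endWords Γ (Function.update f z (a ++ y :: x :: c)) := by
  obtain ⟨P, S, hP, h⟩ := exists_endWords_update Γ f z t fun y _ => ht y
  have hf : endWords Γ f (Γ.vert z) = (P ++ a) ++ x :: y :: (c ++ S) := by
    have := congrFun (h (f z)) (Γ.vert z)
    rw [Function.update_eq_self, Function.update_self, hz] at this
    simpa using this
  refine ⟨P ++ a, c ++ S, hf, by simp [hP, hn], fun o => ?_⟩
  rw [Event.after_cross o hf (by simp [hP, hn]), h]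
  simp

/-- If two adjacent strands are exchanged in a band, a crossing at the terminal vertex followed by
one at the initial vertex restores the order at both ends. Any events that were possible before can
therefore follow these two crossings. -/
theorem exists_swap {s : O → List (D × Bool)} {t : O → List (α × Bool)}
    (ht : ∀ e, (s e).length = (t e).length) {e : O} {l₁ l₂ : List (D × Bool)} {x y : D × Bool}
    (hs : s e = l₁ ++ x :: y :: l₂) {n₁ n₂ : ℕ} (h₁ : l₁.length = n₁) (h₂ : l₂.length = n₂)
    (o₁ o₂ : Bool) :
    ∃ (st : V → List (D × Bool)) (P₁ S₁ P₂ S₂ : List (D × Bool)),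
      Γ.ends (Function.update s e (l₁ ++ y :: x :: l₂)) (Γ.vert (e, false)) =
        P₁ ++ (x.1, !x.2) :: (y.1, !y.2) :: S₁ ∧
      P₁.length = Γ.offset t (e, false) + n₂ ∧
      (Event.cross (Γ.vert (e, false)) (Γ.offset t (e, false) + n₂) o₁).after
        (Γ.ends (Function.update s e (l₁ ++ y :: x :: l₂))) = st ∧
      st (Γ.vert (e, true)) = P₂ ++ y :: x :: S₂ ∧
      P₂.length = Γ.offset t (e, true) + n₁ ∧
      (Event.cross (Γ.vert (e, true)) (Γ.offset t (e, true) + n₁) o₂).after st = Γ.ends s := by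
  set g : (O → List (D × Bool)) → O × Bool → List (D × Bool) := fun s z =>
    if z.2 then s z.1 else ((s z.1).map fun y => (y.1, !y.2)).reverse with hg
  set s' := Function.update s e (l₁ ++ y :: x :: l₂) with hs'
  have hlen : ∀ e', (s' e').length = (t e').length := by
    intro e'
    rw [← ht]
    by_cases he : e' = e
    · subst he
      simp [hs', hs]
    · simp [hs', he]
  have hglen : ∀ z, (g s' z).length = (t z.1).length := by
    rintro ⟨e', d⟩
    cases d <;> simp [hg, hlen]
  obtain ⟨P₁, S₁, h1, h2, h3⟩ := exists_cross_endWords Γ hglen (z := (e, false))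
    (a := (l₂.map fun y => (y.1, !y.2)).reverse) (c := (l₁.map fun y => (y.1, !y.2)).reverse)
    (x := (x.1, !x.2)) (y := (y.1, !y.2)) (n := n₂) (by simp [hg, hs']) (by simp [h₂])
  obtain ⟨P₂, S₂, h4, h5, h6⟩ := exists_cross_endWords Γ (z := (e, true)) (a := l₁) (c := l₂)
    (x := y) (y := x) (n := n₁) (t := t) (f := Function.update (g s') (e, false)
      ((l₂.map fun y => (y.1, !y.2)).reverse ++ (y.1, !y.2) :: (x.1, !x.2) ::
        (l₁.map fun y => (y.1, !y.2)).reverse)) (by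
      rintro ⟨e', d⟩
      by_cases he : e' = e
      · subst he
        cases d
        · rw [Function.update_self, ← ht, hs]
          simp
          omega
        · rw [Function.update_of_ne (by simp), hglen]
      · rw [Function.update_of_ne (by simp [he]), hglen]) (by simp [hg, hs']) h₁
  refine ⟨_, P₁, S₁, P₂, S₂, h1, h2, h3 o₁, h4, h5, (h6 o₂).trans ?_⟩
  change endWords Γ _ = endWords Γ (g s)
  congr 1
  funext ⟨e', d⟩
  by_cases he : e' = e
  · subst he
    cases d <;> simp [hg, hs]
  · cases d <;> simp [hg, hs', he]

namespace Diagram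

/-- A link diagram in two layers, the layer `true` above the layer `false`. -/
def IsLayered (M : Diagram O V (C × Bool)) : Prop :=
  M.IsLink Γ ∧ LayeredFrom (Γ.ends M.strands) M.events

/-- A layered diagram with the same layers that is equivalent to a given one. -/
def Rearranges (M M' : Diagram O V (C × Bool)) : Prop :=
  M'.IsLayered Γ ∧ (∀ a, M'.layer Γ a = M.layer Γ a) ∧
    Equivalent Γ (M'.recolor Prod.fst) (M.recolor Prod.fst)

variable {Γ}

theorem Rearranges.trans {M M' M'' : Diagram O V (C × Bool)} (h : Rearranges Γ M M')
    (h' : Rearranges Γ M' M'') : Rearranges Γ M M'' :=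
  ⟨h'.1, fun a => (h'.2.1 a).trans (h.2.1 a), h'.2.2.trans _ _ _ h.2.2⟩

/-- A cancelling pair of crossings is inserted at the initial vertex, and the first of them slides
through the band. The layers do not change, because crossings between layers belong to neither of
them. -/
theorem IsLayered.exists_swap {M : Diagram O V (C × Bool)} (hM : M.IsLayered Γ)
    (hrec : (M.recolor Prod.fst).IsLink Γ) {e : O}
    {l₁ l₂ : List ((C × Bool) × Bool)} {p q : C} {d d' : Bool}
    (hs : M.strands e = l₁ ++ ((p, true), d) :: ((q, false), d') :: l₂) :
    ∃ M', Rearranges Γ M M' ∧ M'.strands =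
      Function.update M.strands e (l₁ ++ ((q, false), d') :: ((p, true), d) :: l₂) := by
  obtain ⟨st, P₁, S₁, P₂, S₂, h1, h2, h3, h4, h5, h6⟩ :=
    LGFT.exists_swap Γ (fun _ => rfl) hs rfl rfl true false
  set s' := Function.update M.strands e (l₁ ++ ((q, false), d') :: ((p, true), d) :: l₂) with hs'
  set i₁ := Γ.offset M.strands (e, false) + l₂.length
  set i₂ := Γ.offset M.strands (e, true) + l₁.length
  -- The upper strand has to pass over at both ends. After the exchange it is on the left at the
  -- terminal vertex and on the right at the initial vertex, hence `true` and `false`.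
  refine ⟨⟨s', .cross (Γ.vert (e, false)) i₁ true :: .cross (Γ.vert (e, true)) i₂ false ::
    M.events⟩, ⟨⟨⟨?_, ?_, ?_⟩, ?_, ?_, ?_⟩, fun a => ?_, ?_⟩, rfl⟩
  · change i₁ + 1 < (Γ.ends s' (Γ.vert (e, false))).length
    rw [h1, ← h2]
    simp
  · change i₂ + 1 < (Event.after _ _ _).length
    rw [h3, h4, ← h5]
    simp
  · rw [h3, h6]
    exact hM.1
  · intro x y hx _ _
    rw [h1, ← h2] at hx
    simp at hx
    rw [← hx]
  · intro x y hx _ _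
    rw [h3, h4, ← h5] at hx
    simp at hx
    rw [← hx]
  · rw [h3, h6]
    exact hM.2
  · rw [layer, layer, Diagram.mk.injEq]
    refine ⟨funext fun e' => ?_, ?_⟩
    · by_cases he : e' = e
      · subst he
        cases a <;> simp [hs', hs]
      · simp [hs', he]
    · simp only [layerEvents, h3, h6]
      rw [h1, h4, ← h2, ← h5]
      cases a <;> simp
  · set r : (C × Bool) × Bool → C × Bool := fun x => (x.1.1, x.2)
    set s : O → List (C × Bool) := fun e => (M.strands e).map r with hsr
    have hse : s e = l₁.map r ++ (p, d) :: (q, d') :: l₂.map r := by simp [hsr, hs, r]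
    have hlen : ∀ e, (s e).length = (M.strands e).length := by simp [hsr]
    set s₂ := Function.update s e (l₁.map r ++ (q, d') :: (p, d) :: l₂.map r) with hs₂
    have hs₂' : (fun e => (s' e).map r) = s₂ := by
      funext e'
      by_cases he : e' = e
      · subst he
        simp [hs', hs₂, r]
      · simp [hs', hs₂, he, hsr]
    have hlen₂ : ∀ e, (s₂ e).length = (M.strands e).length := by
      intro e'
      rw [← hs₂']
      by_cases he : e' = e
      · subst he
        simp [hs', hs]
      · simp [hs', he]
    have ho₁ : i₁ = Γ.offset s₂ (e, false) + (l₂.map r).length := by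
      rw [offset_congr Γ hlen₂, List.length_map]
    have ho₂ : i₂ = Γ.offset s (e, true) + (l₁.map r).length := by
      rw [offset_congr Γ hlen, List.length_map]
    obtain ⟨st', P₁', S₁', P₂', S₂', k1, k2, k3, k4, k5, k6⟩ := LGFT.exists_swap Γ hlen hse
      (List.length_map (as := l₁) r) (List.length_map (as := l₂) r) true false
    change P₁'.length = i₁ at k2
    change P₂'.length = i₂ at k5
    set E := M.events.map (Event.recolor Prod.fst)
    have hrec' : Closes (Γ.ends s) E := hrec
    have hback : ∀ o, (Event.cross (Γ.vert (e, true)) i₂ o : Event V C).after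
        ((Event.cross (Γ.vert (e, true)) i₂ (!o) : Event V C).after (Γ.ends s)) = Γ.ends s ∧
        i₂ + 1 < (Γ.ends s (Γ.vert (e, true))).length ∧
        i₂ + 1 < ((Event.cross (Γ.vert (e, true)) i₂ (!o) : Event V C).after (Γ.ends s)
          (Γ.vert (e, true))).length := by
      intro o
      have hends : Γ.ends s (Γ.vert (e, true)) = P₂' ++ (p, d) :: (q, d') :: S₂' := by
        rw [← k6, Event.after_cross _ k4 k5.symm, Function.update_self]
      rw [Event.after_cross (!o) hends k5.symm, Event.after_cross o (Function.update_self _ _ _)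
        k5.symm, Function.update_idem, ← hends, Function.update_eq_self, hends]
      simp [← k5]
    -- The intermediate diagram, with the original strands and the cancelling pair. It is related to
    -- the original by a second Reidemeister move and to the new diagram by one slide.
    have hmid : IsLink Γ ⟨s, .cross (Γ.vert (e, true)) i₂ true ::
        .cross (Γ.vert (e, true)) i₂ false :: E⟩ :=
      ⟨(hback false).2.1, (hback false).2.2, by
        have := (hback false).1
        rw [Bool.not_false] at this
        rw [this]
        exact hrec'⟩
    have hlast : IsLink Γ ⟨s₂, .cross (Γ.vert (e, false)) i₁ true ::
        .cross (Γ.vert (e, true)) i₂ false :: E⟩ := by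
      refine ⟨?_, ?_, ?_⟩
      · change i₁ + 1 < (Γ.ends s₂ (Γ.vert (e, false))).length
        rw [k1, ← k2]
        simp
      · change i₂ + 1 < (Event.after _ _ _).length
        rw [k3, k4, ← k5]
        simp
      · rw [k3, k6]
        exact hrec'
    have h₁ : Equivalent Γ ⟨s, .cross (Γ.vert (e, true)) i₂ true ::
        .cross (Γ.vert (e, true)) i₂ false :: E⟩ ⟨s₂, .cross (Γ.vert (e, false)) i₁ true ::
        .cross (Γ.vert (e, true)) i₂ false :: E⟩ := by
      refine .rel _ _ ⟨hmid, hlast, ?_⟩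
      rw [ho₁, ho₂]
      exact .slide_cross s s₂ e _ _ _ _ _ _ hse hs₂
    have h₂ : Equivalent Γ ⟨s, .cross (Γ.vert (e, true)) i₂ true ::
        .cross (Γ.vert (e, true)) i₂ false :: E⟩ ⟨s, E⟩ :=
      .rel _ _ ⟨hmid, hrec, .inside s [] E _ _ (.reidemeister₂ _ _ true)⟩
    have : Equivalent Γ ⟨s₂, .cross (Γ.vert (e, false)) i₁ true ::
        .cross (Γ.vert (e, true)) i₂ false :: E⟩ ⟨s, E⟩ := (h₁.symm _ _).trans _ _ _ h₂
    rw [← hs₂'] at this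
    exact this

theorem IsLayered.exists_insert (t : List ((C × Bool) × Bool)) {M : Diagram O V (C × Bool)}
    (hM : M.IsLayered Γ) (hrec : (M.recolor Prod.fst).IsLink Γ) {e : O}
    {l₁ l₂ : List ((C × Bool) × Bool)} {p : C} {d : Bool} (ht : ∀ z ∈ t, z.1.2 = false)
    (hs : M.strands e = l₁ ++ ((p, true), d) :: (t ++ l₂)) :
    ∃ M', Rearranges Γ M M' ∧ M'.strands =
      Function.update M.strands e (l₁ ++ (t ++ ((p, true), d) :: l₂)) := by
  induction t generalizing l₁ M with
  | nil =>
    refine ⟨M, ⟨hM, fun _ => rfl, .refl _⟩, ?_⟩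
    rw [List.nil_append] at hs ⊢
    rw [← hs, Function.update_eq_self]
  | cons z t ih =>
    obtain ⟨⟨q, a⟩, d'⟩ := z
    obtain rfl : a = false := ht _ List.mem_cons_self
    obtain ⟨M₁, h₁, hs₁⟩ := hM.exists_swap hrec hs
    obtain ⟨M₂, h₂, hs₂⟩ := ih (l₁ := l₁ ++ [((q, false), d')]) h₁.1 (h₁.2.2.isLink_iff.mpr hrec)
      (fun z hz => ht z (List.mem_cons_of_mem _ hz)) (by simp [hs₁])
    refine ⟨M₂, h₁.trans h₂, ?_⟩
    rw [hs₂, hs₁, Function.update_idem]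
    simp

/-- Insertion sort: the tail is sorted, and then a first strand of the upper layer is moved past the
lower strands, whereas one of the lower layer is already in its place. -/
theorem IsLayered.exists_sort (t : List ((C × Bool) × Bool)) {M : Diagram O V (C × Bool)}
    (hM : M.IsLayered Γ) (hrec : (M.recolor Prod.fst).IsLink Γ) {e : O}
    {l₁ : List ((C × Bool) × Bool)} (hs : M.strands e = l₁ ++ t) :
    ∃ M', Rearranges Γ M M' ∧ M'.strands = Function.update M.strands e
      (l₁ ++ (t.filter (fun x => x.1.2 == false) ++ t.filter fun x => x.1.2 == true)) := by
  induction t generalizing l₁ M with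
  | nil =>
    refine ⟨M, ⟨hM, fun _ => rfl, .refl _⟩, ?_⟩
    simp [← hs]
  | cons z t ih =>
    obtain ⟨M₁, h₁, hs₁⟩ := ih (l₁ := l₁ ++ [z]) hM hrec (by simp [hs])
    obtain ⟨⟨p, _ | _⟩, d⟩ := z
    · refine ⟨M₁, h₁, ?_⟩
      rw [hs₁]
      simp
    · obtain ⟨M₂, h₂, hs₂⟩ := h₁.1.exists_insert (t.filter fun x => x.1.2 == false) (l₁ := l₁)
        (l₂ := t.filter fun x => x.1.2 == true) (p := p) (d := d) (e := e)
        (h₁.2.2.isLink_iff.mpr hrec) (fun z hz => by simpa using (List.mem_filter.mp hz).2)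
        (by simp [hs₁])
      refine ⟨M₂, h₁.trans h₂, ?_⟩
      rw [hs₂, hs₁, Function.update_idem]
      simp

theorem IsLayered.exists_sorted [Fintype O] {M : Diagram O V (C × Bool)} (hM : M.IsLayered Γ)
    (hrec : (M.recolor Prod.fst).IsLink Γ) : ∃ M', Rearranges Γ M M' ∧ ∀ e, M'.strands e =
      (M'.strands e).filter (fun x => x.1.2 == false) ++
        (M'.strands e).filter fun x => x.1.2 == true := by
  suffices h : ∀ S : Finset O, ∃ M', Rearranges Γ M M' ∧ ∀ e ∈ S, M'.strands e =
      (M'.strands e).filter (fun x => x.1.2 == false) ++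
        (M'.strands e).filter fun x => x.1.2 == true by
    obtain ⟨M', h, hs⟩ := h Finset.univ
    exact ⟨M', h, fun e => hs e (Finset.mem_univ e)⟩
  intro S
  induction S using Finset.induction_on with
  | empty => exact ⟨M, ⟨hM, fun _ => rfl, .refl _⟩, by simp⟩
  | insert e S _ ih =>
    obtain ⟨M₁, h₁, hs₁⟩ := ih
    obtain ⟨M₂, h₂, hs₂⟩ := h₁.1.exists_sort (M₁.strands e) (e := e) (l₁ := [])
      (h₁.2.2.isLink_iff.mpr hrec) rfl
    refine ⟨M₂, h₁.trans h₂, fun e' he' => ?_⟩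
    rw [hs₂]
    by_cases he : e' = e
    · subst he
      simp [List.filter_filter]
    · rw [Function.update_of_ne he]
      exact hs₁ e' (Finset.mem_of_mem_insert_of_ne he' he)

end Diagram

end BandSort

namespace Model

variable {b H : Type*} [CommRing b] {I : Ideal b} [IsAdicComplete I b] [Ring H] [Algebra b H]
  [IsAdicComplete I H] {𝓗 : RibbonHopfAlgebra I H} {C : Type*} {χ : C → H →ₗ[b] b}
  {Pt : Type*} [Fintype Pt] (𝓜 : Model 𝓗 χ Pt)
  {X : Type*} [Fintype X] [DecidableEq X]

/-! ### Separation of the two copies of a connection -/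

/-- The labels of the ends of edges that are replaced by cables. -/
def cableSystem (s : X → List (C × Bool)) : LabelSystem 𝓗 X (List Pt) where
  labels z := words Pt (s z.1).length
  func p a c := 𝓜.cable (s p) a c.reverse
  coef _ := 𝓜.wc
  func_mul p j j' a x hj hj' := by
    exact 𝓜.cable_mul (mem_words.mp hj) _ a x
  func_mul_antipode p j j' a x hj hj' := by
    rw [𝓜.cable_mul_antipode (mem_words.mp hj) (by simpa using mem_words.mp hj'),
      ← sum_words_reverse]
    simp

theorem flatMap_update {α J : Type*} [DecidableEq α] {l : List α} {z : α} (hz : z ∉ l)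
    (f : α → List J) (u : List J) : l.flatMap (Function.update f z u) = l.flatMap f :=
  List.flatMap_congr fun _ hy => Function.update_of_ne (ne_of_mem_of_not_mem hy hz) _ _

/-- Passing over the ends in `ys` one at a time amounts to passing over their concatenated word, by
`rPair_conv_right`. The words at the ends involved are separate arguments of `Ξ`, which otherwise
does not depend on them; so each crossing changes only these arguments. -/
theorem crossPast_sum (s : X → List (C × Bool)) {F : CConn I H X →ₗ[b] b} (hF : IsCont F)
    (a : X × Bool) (ys : List (X × Bool)) (hnd : (a :: ys).Nodup)
    (Ξ : (X × Bool → List Pt) → List Pt → List Pt → b)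
    (hΞ : ∀ f z u, z ∈ a :: ys → Ξ (Function.update f z u) = Ξ f)
    (h : ∀ x, F (AdicCompletion.of I _ (PiTensorProduct.tprod b x)) =
      (𝓜.cableSystem s).sum (fun f => Ξ f (f a) (ys.flatMap f)) x) :
    IsCont (F ∘ₗ 𝓗.crossPast a ys) ∧
      ∀ x, (F ∘ₗ 𝓗.crossPast a ys) (AdicCompletion.of I _ (PiTensorProduct.tprod b x)) =
        (𝓜.cableSystem s).sum (fun f => ∑ u ∈ words Pt (f a).length,
          ∑ w ∈ words Pt (ys.flatMap f).length,
            𝓗.rPair (𝓜.wc u (f a)) (𝓜.wc w (ys.flatMap f)) * Ξ f u w) x := by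
  induction ys generalizing Ξ with
  | nil =>
    refine ⟨hF, fun x => (h x).trans ?_⟩
    simp only [List.flatMap_nil, List.length_nil, sum_words_zero, wc_nil, 𝓗.rPair_counit_right]
    congr 1
    funext f
    exact (𝓜.sum_wc_one_smul' rfl fun u => Ξ f u []).symm
  | cons y ys ih =>
    obtain ⟨ha, hnd'⟩ := List.nodup_cons.mp hnd
    obtain ⟨hy, hys⟩ := List.nodup_cons.mp hnd'
    rw [List.mem_cons, not_or] at ha
    obtain ⟨hc, hsum⟩ := ih (List.nodup_cons.mpr ⟨ha.2, hys⟩) (fun f p q => Ξ f p (f y ++ q))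
      (fun f z u hz => by
        have hzy : y ≠ z := by
          rintro rfl
          rcases List.mem_cons.mp hz with h | h
          · exact ha.1 h.symm
          · exact hy h
        have hz' : z ∈ a :: y :: ys := by
          rcases List.mem_cons.mp hz with h | h <;> simp [h]
        rw [hΞ f z u hz', Function.update_of_ne hzy])
      (by simpa only [List.flatMap_cons] using h)
    refine ⟨hc.comp_cext _, fun x => ?_⟩
    have := (𝓜.cableSystem s).apply_crossing hc true ha.1 _ hsum x
    refine this.trans (Finset.sum_congr rfl fun f hf => ?_)
    congr 1
    have hfa : (f a).length = (s a.1).length := mem_words.mp (Fintype.mem_piFinset.mp hf a)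
    have hfy : (f y).length = (s y.1).length := mem_words.mp (Fintype.mem_piFinset.mp hf y)
    have h1 : ∀ u' v, ys.flatMap (Function.update (Function.update f a u') y v) =
        ys.flatMap f := fun u' v => by rw [flatMap_update hy, flatMap_update ha.2]
    have h2 : ∀ u' v, Ξ (Function.update (Function.update f a u') y v) = Ξ f := fun u' v => by
      rw [hΞ _ y v (by simp), hΞ _ a u' (by simp)]
    simp only [h1, h2, Function.update_self, Function.update_of_ne ha.1, List.flatMap_cons,
      List.length_append, sum_words_add]
    change ∑ u' ∈ words Pt (s a.1).length, ∑ v ∈ words Pt (s y.1).length,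
      (if true = true then 𝓗.rPair (𝓜.wc u' (f a)) (𝓜.wc v (f y)) else _) * _ = _
    simp only [if_true, Finset.mul_sum]
    rw [← hfa, ← hfy]
    calc _ = ∑ u' ∈ words Pt (f a).length, ∑ v ∈ words Pt (f y).length,
          ∑ u ∈ words Pt (f a).length, ∑ w ∈ words Pt (ys.flatMap f).length,
          𝓗.rPair (𝓜.wc u' (f a)) (𝓜.wc v (f y)) *
            (𝓗.rPair (𝓜.wc u u') (𝓜.wc w (ys.flatMap f)) * Ξ f u (v ++ w)) := by
          refine Finset.sum_congr rfl fun u' hu' => ?_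
          rw [mem_words.mp hu']
      _ = ∑ u ∈ words Pt (f a).length, ∑ w ∈ words Pt (ys.flatMap f).length,
          ∑ u' ∈ words Pt (f a).length, ∑ v ∈ words Pt (f y).length,
          𝓗.rPair (𝓜.wc u' (f a)) (𝓜.wc v (f y)) *
            (𝓗.rPair (𝓜.wc u u') (𝓜.wc w (ys.flatMap f)) * Ξ f u (v ++ w)) :=
          RibbonHopfAlgebra.sum₄_comm _
      _ = _ := by
          refine Finset.sum_congr rfl fun u hu => ?_
          symm
          rw [Finset.sum_comm]
          refine Finset.sum_congr rfl fun w _ => ?_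
          symm
          rw [Finset.sum_comm]
          refine Finset.sum_congr rfl fun v hv => ?_
          rw [wc_append _ (mem_words.mp hv), 𝓗.rPair_conv_right (𝓜.wc_mul _ _), mem_words.mp hu,
            Finset.sum_mul]
          refine Finset.sum_congr rfl fun u' _ => ?_
          ring

/-- The operators in ∇ at one vertex act on labels as the sorting operator `separated`, with the
prime copy as lower layer. In the induction the words of the ends already treated are absorbed into
`Ξ`. -/
theorem separate_sum (s : X → List (C × Bool)) (prime : X → Bool) (l : List (X × Bool))
    (hnd : l.Nodup) {F : CConn I H X →ₗ[b] b} (hF : IsCont F)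
    (Ξ : (X × Bool → List Pt) → List Pt → List Pt → b)
    (hΞ : ∀ f z u, z ∈ l → Ξ (Function.update f z u) = Ξ f)
    (h : ∀ x, F (AdicCompletion.of I _ (PiTensorProduct.tprod b x)) =
      (𝓜.cableSystem s).sum (fun f => Ξ f ((l.filter fun z => prime z.1).flatMap f)
        ((l.filter fun z => !prime z.1).flatMap f)) x) :
    IsCont (F ∘ₗ 𝓗.separate prime l) ∧
      ∀ x, (F ∘ₗ 𝓗.separate prime l) (AdicCompletion.of I _ (PiTensorProduct.tprod b x)) =
        (𝓜.cableSystem s).sum (fun f => 𝓜.separated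
          (l.flatMap fun z => (f z).map fun p => (p, !prime z.1)) (Ξ f)) x := by
  induction l generalizing F Ξ with
  | nil =>
    refine ⟨hF, fun x => (h x).trans ?_⟩
    simp [separated_nil]
  | cons a l ih =>
    obtain ⟨ha, hl⟩ := List.nodup_cons.mp hnd
    have hne : ∀ z ∈ l, a ≠ z := by
      rintro z hz rfl
      exact ha hz
    by_cases hp : prime a.1 = true
    · have hsep : 𝓗.separate prime (a :: l) = 𝓗.separate prime l := by
        rw [RibbonHopfAlgebra.separate, if_pos hp]
      rw [hsep]
      simp only [List.flatMap_cons, hp, Bool.not_true, separated_map_false_append]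
      refine ih hl hF (fun f p q => Ξ f (f a ++ p) q) (fun f z u hz => ?_) fun x => ?_
      · rw [hΞ f z u (List.mem_cons_of_mem _ hz), Function.update_of_ne (hne z hz)]
      · simpa [hp] using h x
    · rw [Bool.not_eq_true] at hp
      have hsep : 𝓗.separate prime (a :: l) =
          𝓗.crossPast a (l.filter fun y => prime y.1) ∘ₗ 𝓗.separate prime l := by
        rw [RibbonHopfAlgebra.separate, if_neg (by simp [hp])]
      have hsub : ∀ z ∈ a :: l.filter (fun y => prime y.1), z ∈ a :: l ∧
          z ∉ l.filter fun y => !prime y.1 := by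
        intro z hz
        rcases List.mem_cons.mp hz with rfl | hz
        · exact ⟨List.mem_cons_self, fun h => ha (List.mem_filter.mp h).1⟩
        · obtain ⟨h1, h2⟩ := List.mem_filter.mp hz
          exact ⟨List.mem_cons_of_mem _ h1, fun h => by simp [h2] at h⟩
      obtain ⟨hc, hsum⟩ := 𝓜.crossPast_sum s hF a (l.filter fun y => prime y.1)
        (List.nodup_cons.mpr ⟨fun h => ha (List.mem_filter.mp h).1, hl.filter _⟩)
        (fun f p q => Ξ f q (p ++ (l.filter fun z => !prime z.1).flatMap f))
        (fun f z u hz => by rw [hΞ f z u (hsub z hz).1, flatMap_update (hsub z hz).2])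
        (by simpa [hp] using h)
      rw [hsep]
      simp only [List.flatMap_cons, hp, Bool.not_false, separated_map_true_append]
      refine ih hl hc (fun f a₂ c₂ => 𝓜.merged [] (f a) a₂ c₂ (Ξ f)) (fun f z u hz => ?_)
        fun x => (hsum x).trans ?_
      · rw [hΞ f z u (List.mem_cons_of_mem _ hz), Function.update_of_ne (hne z hz)]
      · simp only [merged, List.nil_append]

end Model

/-! ### The ends of the two copies of a lattice -/

section Copies

variable {O V : Type*} (Γ : Lattice O V) {J : Type*}

/-- The ends of the two copies of the edges at a vertex. -/
def copyEnds (v : V) : List ((Σ _ : O, Fin 2) × Bool) :=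
  Γ.ends (fun e => [((⟨e, 0⟩ : Σ _ : O, Fin 2), true), (⟨e, 1⟩, true)]) v

theorem copyEnds_flatMap (f : (Σ _ : O, Fin 2) × Bool → List J) (v : V) :
    (copyEnds Γ v).flatMap f = RibbonHopfAlgebra.endWords Γ (fun z =>
      if z.2 then f (⟨z.1, 0⟩, true) ++ f (⟨z.1, 1⟩, true)
      else f (⟨z.1, 1⟩, false) ++ f (⟨z.1, 0⟩, false)) v := by
  rw [copyEnds, Lattice.ends, List.flatMap_assoc, RibbonHopfAlgebra.endWords]
  refine List.flatMap_congr fun z _ => ?_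
  obtain ⟨e, _ | _⟩ := z <;> simp

theorem filter_copyEnds_flatMap (p : (Σ _ : O, Fin 2) → Bool) (i : Fin 2)
    (hp : ∀ z, p z = true ↔ z.2 = i) (f : (Σ _ : O, Fin 2) × Bool → List J) (v : V) :
    ((copyEnds Γ v).filter fun z => p z.1).flatMap f =
      RibbonHopfAlgebra.endWords Γ (fun z => f (⟨z.1, i⟩, z.2)) v := by
  rw [copyEnds, Lattice.ends, List.filter_flatMap, List.flatMap_assoc, RibbonHopfAlgebra.endWords]
  refine List.flatMap_congr fun z _ => ?_
  obtain ⟨e, _ | _⟩ := z <;> fin_cases i <;> simp [List.filter_cons, hp]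

theorem nodup_copyEnds (v : V) : (copyEnds Γ v).Nodup := by
  rw [copyEnds, Lattice.ends, List.nodup_flatMap]
  refine ⟨?_, (Γ.nodup v).imp ?_⟩
  · rintro ⟨e, _ | _⟩ _ <;> simp
  · rintro ⟨e, _ | _⟩ ⟨e', _ | _⟩ h <;> simp_all [List.disjoint_left]

theorem vert_of_mem_copyEnds {v : V} {z : (Σ _ : O, Fin 2) × Bool} (h : z ∈ copyEnds Γ v) :
    Γ.vert (z.1.1, z.2) = v := by
  rw [copyEnds, Lattice.ends, List.mem_flatMap] at h
  obtain ⟨⟨e, _ | _⟩, hx, hz⟩ := h <;> rw [Γ.mem_star] at hx <;>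
    simp at hz <;> rcases hz with rfl | rfl <;> exact hx

end Copies

namespace Model

variable {b H : Type*} [CommRing b] {I : Ideal b} [IsAdicComplete I b] [Ring H] [Algebra b H]
  [IsAdicComplete I H] {𝓗 : RibbonHopfAlgebra I H} {C : Type*} {χ : C → H →ₗ[b] b}
  {Pt : Type*} [Fintype Pt] (𝓜 : Model 𝓗 χ Pt)
  {O : Type u} {V : Type*} [Fintype O] [DecidableEq O] [DecidableEq V] [Fintype V]
  (Γ : Lattice O V)

open RibbonHopfAlgebra (endWords)

/-- The words at the vertices, in two layers, that belong to words at the ends of the copies. -/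
def copyState (f : (Σ _ : O, Fin 2) × Bool → List Pt) (v : V) : List (Pt × Bool) :=
  (copyEnds Γ v).flatMap fun z => (f z).map fun p => (p, !(z.1.2 == 0))

/-- Different vertices have disjoint sets of ends, so the sortings simply accumulate. `ds` lists the
vertices that have been treated, and `vs` those that remain. -/
theorem separate_list_sum (s : (Σ _ : O, Fin 2) → List (C × Bool))
    (Ω : (V → List Pt) → (V → List Pt) → b) (vs ds : List V) (hnd : (ds ++ vs).Nodup)
    {F : CConn I H (Σ _ : O, Fin 2) →ₗ[b] b} (hF : IsCont F)
    (h : ∀ x, F (AdicCompletion.of I _ (PiTensorProduct.tprod b x)) =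
      (𝓜.cableSystem s).sum (fun f => 𝓜.separatedOver (copyState Γ f) ds Ω
        (endWords Γ fun z => f (⟨z.1, 0⟩, z.2)) (endWords Γ fun z => f (⟨z.1, 1⟩, z.2))) x) :
    IsCont (F ∘ₗ (vs.map fun v => 𝓗.separate (fun x : Σ _ : O, Fin 2 => x.2 == 0)
        (copyEnds Γ v)).prod) ∧
      ∀ x, (F ∘ₗ (vs.map fun v => 𝓗.separate (fun x : Σ _ : O, Fin 2 => x.2 == 0)
        (copyEnds Γ v)).prod) (AdicCompletion.of I _ (PiTensorProduct.tprod b x)) =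
      (𝓜.cableSystem s).sum (fun f => 𝓜.separatedOver (copyState Γ f) (ds ++ vs) Ω
        (endWords Γ fun z => f (⟨z.1, 0⟩, z.2)) (endWords Γ fun z => f (⟨z.1, 1⟩, z.2))) x := by
  induction vs generalizing ds F with
  | nil => exact ⟨hF, by simpa using h⟩
  | cons v vs ih =>
    have hp : ∀ z : Σ _ : O, Fin 2, (z.2 == 0) = true ↔ z.2 = 0 := by simp
    have hq : ∀ z : Σ _ : O, Fin 2, (!(z.2 == 0)) = true ↔ z.2 = 1 := by
      rintro ⟨e, i⟩
      fin_cases i <;> simp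
    have hv : v ∉ ds := fun hv => (List.nodup_append.mp hnd).2.2 v hv v List.mem_cons_self rfl
    have hne : ∀ z ∈ copyEnds Γ v, ∀ w ≠ v, z ∉ copyEnds Γ w := fun z hz w hw hz' =>
      hw ((vert_of_mem_copyEnds Γ hz').symm.trans (vert_of_mem_copyEnds Γ hz))
    have hinv : ∀ (i : Fin 2) (f : (Σ _ : O, Fin 2) × Bool → List Pt) (z u l),
        z ∈ copyEnds Γ v →
        Function.update (endWords Γ fun y => Function.update f z u (⟨y.1, i⟩, y.2)) v l =
        Function.update (endWords Γ fun y => f (⟨y.1, i⟩, y.2)) v l := by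
      intro i f z u l hz
      funext w
      by_cases hw : w = v
      · subst hw
        simp
      · rw [Function.update_of_ne hw, Function.update_of_ne hw,
          ← filter_copyEnds_flatMap Γ (fun y => y.2 == i) i (by simp),
          ← filter_copyEnds_flatMap Γ (fun y => y.2 == i) i (by simp),
          flatMap_update fun h => hne z hz w hw (List.mem_filter.mp h).1]
    obtain ⟨hc, hsum⟩ := 𝓜.separate_sum s (fun x : Σ _ : O, Fin 2 => x.2 == 0) (copyEnds Γ v)
      (nodup_copyEnds Γ v) hF (fun f p q => 𝓜.separatedOver (copyState Γ f) ds Ω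
        (Function.update (endWords Γ fun z => f (⟨z.1, 0⟩, z.2)) v p)
        (Function.update (endWords Γ fun z => f (⟨z.1, 1⟩, z.2)) v q)) (fun f z u hz => by
          funext p q
          rw [hinv 0 f z u p hz, hinv 1 f z u q hz, 𝓜.separatedOver_congr fun w hw => ?_]
          refine List.flatMap_congr fun y hy => ?_
          rw [Function.update_of_ne]
          rintro rfl
          exact hne y hz w (fun h => hv (h ▸ hw)) hy)
      (fun x => (h x).trans (by
        congr 1
        funext f
        rw [filter_copyEnds_flatMap Γ _ 0 hp, filter_copyEnds_flatMap Γ _ 1 hq,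
          Function.update_eq_self, Function.update_eq_self]))
    have := ih (ds ++ [v]) (by simpa using hnd) hc fun x => (hsum x).trans (by
      congr 1
      funext f
      conv_rhs => rw [separatedOver, List.foldl_append]
      rfl)
    simpa [List.map_cons, List.prod_cons, Module.End.mul_eq_comp, LinearMap.comp_assoc] using this

theorem tensorFunctional_tprod (F G : CConn I H O →ₗ[b] b) (y : (Σ _ : O, Fin 2) → H) :
    tensorFunctional F G (AdicCompletion.of I _ (PiTensorProduct.tprod b y)) =
      F (AdicCompletion.of I _ (PiTensorProduct.tprod b fun e => y ⟨e, 0⟩)) *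
        G (AdicCompletion.of I _ (PiTensorProduct.tprod b fun e => y ⟨e, 1⟩)) := by
  refine (cint_of (I := I) _ _).trans ?_
  simp only [LinearMap.comp_apply, LinearEquiv.coe_coe]
  rw [PiTensorProduct.reindex_tprod]
  have : (PiTensorProduct.tmulEquiv b H).symm (PiTensorProduct.tprod b fun i : O ⊕ O =>
      y ((copies O).symm i)) = PiTensorProduct.tprod b (fun e => y ⟨e, 0⟩) ⊗ₜ
        PiTensorProduct.tprod b (fun e => y ⟨e, 1⟩) := by
    rw [PiTensorProduct.tmulEquiv_symm_apply]
    rfl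
  refine (congrArg (fun t => LinearMap.mul' b b (TensorProduct.map (F ∘ₗ AdicCompletion.of I _)
    (G ∘ₗ AdicCompletion.of I _) t)) this).trans ?_
  simp

theorem sum_copies {A : Type*} [AddCommMonoid A] (n : (Σ _ : O, Fin 2) → ℕ)
    (G : (O × Bool → List Pt) → (O × Bool → List Pt) → A) :
    ∑ f ∈ Fintype.piFinset fun z : (Σ _ : O, Fin 2) × Bool => words Pt (n z.1),
      G (fun z => f (⟨z.1, 0⟩, z.2)) (fun z => f (⟨z.1, 1⟩, z.2)) =
    ∑ f₀ ∈ Fintype.piFinset fun z : O × Bool => words Pt (n ⟨z.1, 0⟩),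
      ∑ f₁ ∈ Fintype.piFinset fun z : O × Bool => words Pt (n ⟨z.1, 1⟩), G f₀ f₁ := by
  rw [← Finset.sum_product']
  refine Finset.sum_nbij' (fun f => (fun z => f (⟨z.1, 0⟩, z.2), fun z => f (⟨z.1, 1⟩, z.2)))
    (fun q z => if z.1.2 = 0 then q.1 (z.1.1, z.2) else q.2 (z.1.1, z.2)) ?_ ?_ ?_ ?_ ?_
  · intro f hf
    rw [Fintype.mem_piFinset] at hf
    simp only [Finset.mem_product, Fintype.mem_piFinset]
    exact ⟨fun z => hf _, fun z => hf _⟩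
  · rintro ⟨f₀, f₁⟩ hf
    simp only [Finset.mem_product, Fintype.mem_piFinset] at hf ⊢
    rintro ⟨⟨e, i⟩, d⟩
    fin_cases i
    · exact hf.1 (e, d)
    · exact hf.2 (e, d)
  · intro f _
    funext ⟨⟨e, i⟩, d⟩
    fin_cases i <;> rfl
  · rintro ⟨f₀, f₁⟩ _
    rfl
  · intro f _
    rfl

/-- The words at the ends of the bands that belong to words at the ends of the two copies. -/
def joinWords (f : (Σ _ : O, Fin 2) × Bool → List Pt) (z : O × Bool) : List Pt :=
  if z.2 then f (⟨z.1, 0⟩, true) ++ f (⟨z.1, 1⟩, true)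
  else f (⟨z.1, 1⟩, false) ++ f (⟨z.1, 0⟩, false)

theorem sum_joinWords {A : Type*} [AddCommMonoid A] (n : (Σ _ : O, Fin 2) → ℕ)
    (G : (O × Bool → List Pt) → A) :
    ∑ f ∈ Fintype.piFinset fun z : (Σ _ : O, Fin 2) × Bool => words Pt (n z.1),
      G (joinWords f) =
    ∑ g ∈ Fintype.piFinset fun z : O × Bool => words Pt (n ⟨z.1, 0⟩ + n ⟨z.1, 1⟩), G g := by
  refine Finset.sum_bij (fun f _ => joinWords f) ?_ ?_ ?_ fun f _ => rfl
  · intro f hf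
    simp only [Fintype.mem_piFinset, mem_words] at hf ⊢
    rintro ⟨e, _ | _⟩ <;> simp [joinWords, hf, add_comm]
  · intro f hf f' hf' h
    simp only [Fintype.mem_piFinset, mem_words] at hf hf'
    funext ⟨⟨e, i⟩, d⟩
    have := congrFun h (e, d)
    cases d <;> fin_cases i <;> simp only [joinWords, if_true, Bool.false_eq_true, if_false] at this
    · exact (List.append_inj this (by rw [hf, hf'])).2
    · exact (List.append_inj this (by rw [hf, hf'])).1
    · exact (List.append_inj this (by rw [hf, hf'])).1
    · exact (List.append_inj this (by rw [hf, hf'])).2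
  · intro g hg
    simp only [Fintype.mem_piFinset, mem_words] at hg
    -- The prime copy comes first at initial ends and last at terminal ends. A word is the first
    -- piece exactly when it belongs to the prime copy at an initial end or to the double prime copy
    -- at a terminal end.
    refine ⟨fun z => if (z.1.2 = 0) = (z.2 = true) then (g (z.1.1, z.2)).take (n ⟨z.1.1,
      if z.2 then 0 else 1⟩) else (g (z.1.1, z.2)).drop (n ⟨z.1.1, if z.2 then 0 else 1⟩), ?_, ?_⟩
    · simp only [Fintype.mem_piFinset, mem_words]
      rintro ⟨⟨e, i⟩, d⟩
      cases d <;> fin_cases i <;> simp [hg]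
    · funext ⟨e, d⟩
      cases d <;> simp [joinWords]

theorem wilson_mul_wilson_tprod (L : Fin 2 → Diagram O V C) (hL : ∀ i, (L i).IsLink Γ)
    (y : (Σ _ : O, Fin 2) → H) :
    tensorFunctional (𝓗.wilson Γ χ (L 0)) (𝓗.wilson Γ χ (L 1))
        (AdicCompletion.of I _ (PiTensorProduct.tprod b y)) =
      (𝓜.cableSystem fun p : Σ _ : O, Fin 2 => (L p.2).strands p.1).sum (fun f =>
        𝓜.value (L 0).events (endWords Γ fun z => f (⟨z.1, 0⟩, z.2)) *
          𝓜.value (L 1).events (endWords Γ fun z => f (⟨z.1, 1⟩, z.2))) y := by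
  rw [tensorFunctional_tprod, 𝓜.wilson_tprod Γ _ (hL 0), 𝓜.wilson_tprod Γ _ (hL 1),
    Finset.sum_mul_sum]
  refine (sum_copies (fun p : Σ _ : O, Fin 2 => ((L p.2).strands p.1).length) fun f₀ f₁ =>
    (∏ e, 𝓜.cable ((L 0).strands e) (f₀ (e, true)) (f₀ (e, false)).reverse (y ⟨e, 0⟩)) *
      𝓜.value (L 0).events (endWords Γ f₀) *
    ((∏ e, 𝓜.cable ((L 1).strands e) (f₁ (e, true)) (f₁ (e, false)).reverse (y ⟨e, 1⟩)) *
      𝓜.value (L 1).events (endWords Γ f₁))).symm.trans ?_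
  refine Finset.sum_congr rfl fun f _ => ?_
  rw [LabelSystem.prod, Fintype.prod_sigma]
  simp only [Fin.prod_univ_two, Finset.prod_mul_distrib]
  change _ = (∏ e, 𝓜.cable ((L 0).strands e) (f (⟨e, 0⟩, true)) (f (⟨e, 0⟩, false)).reverse
    (y ⟨e, 0⟩)) * (∏ e, 𝓜.cable ((L 1).strands e) (f (⟨e, 1⟩, true)) (f (⟨e, 1⟩, false)).reverse
    (y ⟨e, 1⟩)) * _
  ring

/-- The coproduct in a band convolves the cables of the two diagrams, and this convolution is the
cable of the concatenated strands. The product of observables is thus already a state sum for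
strands of both diagrams side by side, with the sorting operators at the vertices. -/
theorem star_tprod (L : Fin 2 → Diagram O V C) (hL : ∀ i, (L i).IsLink Γ) (x : O → H) :
    star 𝓗 Γ (𝓗.wilson Γ χ (L 0)) (𝓗.wilson Γ χ (L 1))
        (AdicCompletion.of I _ (PiTensorProduct.tprod b x)) =
      ∑ f ∈ Fintype.piFinset fun z : (Σ _ : O, Fin 2) × Bool =>
          words Pt ((L z.1.2).strands z.1.1).length,
        (∏ e, 𝓜.cable ((L 0).strands e ++ (L 1).strands e) (joinWords f (e, true))
          (joinWords f (e, false)).reverse (x e)) *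
        𝓜.separatedOver (copyState Γ f) (Finset.univ : Finset V).toList
          (fun α β => 𝓜.value (L 0).events α * 𝓜.value (L 1).events β)
          (endWords Γ fun z => f (⟨z.1, 0⟩, z.2)) (endWords Γ fun z => f (⟨z.1, 1⟩, z.2)) := by
  obtain ⟨hc, hsum⟩ := 𝓜.separate_list_sum Γ (fun p : Σ _ : O, Fin 2 => (L p.2).strands p.1)
    (fun α β => 𝓜.value (L 0).events α * 𝓜.value (L 1).events β) (Finset.univ : Finset V).toList []
    (Finset.nodup_toList _) (isCont_cint _) (𝓜.wilson_mul_wilson_tprod Γ L hL)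
  rw [star, RibbonHopfAlgebra.nabla, ← LinearMap.comp_assoc, LinearMap.comp_apply]
  refine (LinearMap.congr_fun hc _).trans ?_
  set E := 𝓜.cableSystem fun p : Σ _ : O, Fin 2 => (L p.2).strands p.1
  have hfun : ∀ {F : CConn I H (Σ _ : O, Fin 2) →ₗ[b] b}
      {Θ : ((Σ _ : O, Fin 2) × Bool → List Pt) → b},
      (∀ x, F (AdicCompletion.of I _ (PiTensorProduct.tprod b x)) = E.sum Θ x) →
      F ∘ₗ AdicCompletion.of I _ = ∑ f ∈ Fintype.piFinset E.labels,
        Θ f • prodFun fun p => E.func p (f (p, true)) (f (p, false)) := by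
    intro F Θ h
    ext y
    rw [LinearMap.compMultilinearMap_apply, LinearMap.comp_apply, h,
      LinearMap.compMultilinearMap_apply, LinearMap.sum_apply]
    refine Finset.sum_congr rfl fun f _ => ?_
    rw [LinearMap.smul_apply, prodFun_tprod, smul_eq_mul, mul_comm]
    rfl
  refine (congrArg (fun φ => cint I φ _) (hfun hsum)).trans ?_
  refine (map_sum (cintL (I := I) _) _ _).trans ?_
  refine Finset.sum_congr rfl fun f hf => ?_
  have hf : ∀ z, (f z).length = ((L z.1.2).strands z.1.1).length := fun z =>
    mem_words.mp (Fintype.mem_piFinset.mp hf z)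
  rw [map_smul, cintL_apply, 𝓗.cint_expand, smul_eq_mul, mul_comm]
  congr 1
  refine Finset.prod_congr rfl fun e _ => ?_
  simp only [joinWords, if_true, Bool.false_eq_true, if_false, List.reverse_append]
  rw [𝓜.cable_append (by simp [hf]) (by simp [hf])]
  simp only [List.ofFn_succ, List.ofFn_zero, RibbonHopfAlgebra.convList, 𝓗.conv_counit]
  rfl

/-- Cables that carry the strands of two layers one after the other. -/
theorem star_tprod_eq_cableSum {M : Diagram O V (C × Bool)} (hM : M.IsLayered Γ)
    (hs : ∀ e, M.strands e = (M.strands e).filter (fun x => x.1.2 == false) ++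
      (M.strands e).filter fun x => x.1.2 == true)
    (hlayer : ∀ a, (M.layer Γ a).IsLink Γ) (x : O → H) :
    star 𝓗 Γ (𝓗.wilson Γ χ (M.layer Γ false)) (𝓗.wilson Γ χ (M.layer Γ true))
        (AdicCompletion.of I _ (PiTensorProduct.tprod b x)) =
      𝓜.cableSum (M.recolor Prod.fst).strands
        (fun f => 𝓜.value (M.recolor Prod.fst).events (endWords Γ f)) x := by
  set L : Fin 2 → Diagram O V C := ![M.layer Γ false, M.layer Γ true]
  have hstr : ∀ e, (M.recolor Prod.fst).strands e = (L 0).strands e ++ (L 1).strands e := by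
    intro e
    change (M.strands e).map _ = _
    rw [hs e, List.map_append]
    rfl
  rw [cableSum]
  simp only [hstr, List.length_append]
  refine (𝓜.star_tprod Γ L (fun i => by fin_cases i <;> exact hlayer _) x).trans ?_
  refine Eq.trans ?_ (sum_joinWords (fun p => ((L p.2).strands p.1).length) _)
  refine Finset.sum_congr rfl fun f hf => ?_
  have hlen : ∀ z, (f z).length = ((L z.1.2).strands z.1.1).length := fun z =>
    mem_words.mp (Fintype.mem_piFinset.mp hf z)
  -- Words that do not match the strands make one of the cables vanish, so both terms are zero.
  by_cases hty : ∀ e, (joinWords f (e, true)).map 𝓜.ty = (L 0).strands e ++ (L 1).strands e ∧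
      (joinWords f (e, false)).reverse.map 𝓜.ty =
        ((L 0).strands e ++ (L 1).strands e).map fun y => (y.1, !y.2)
  swap
  · obtain ⟨e, he⟩ := not_forall.mp hty
    rw [Finset.prod_eq_zero (Finset.mem_univ e), zero_mul, zero_mul]
    rw [cable_eq_zero _ _ _ _ he, LinearMap.zero_apply]
  congr 1
  -- The words determine the layered state at the beginning of `M`. Here it is used that each band
  -- carries the lower strands before the upper ones, as the two copies do.
  have htypes : 𝓜.layeredTypes (copyState Γ f) = Γ.ends M.strands := by
    have hA : ∀ a e, ((M.layer Γ a).strands e).map (fun y => ((y.1, a), y.2)) =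
        (M.strands e).filter fun x => x.1.2 == a := by
      intro a e
      refine (List.map_map ..).trans ((List.map_congr_left fun z hz => ?_).trans (List.map_id _))
      have hz : z.1.2 = a := by simpa using (List.mem_filter.mp hz).2
      rw [← hz]
      rfl
    funext v
    rw [layeredTypes, copyState, List.map_flatMap, copyEnds_flatMap]
    refine List.flatMap_congr fun z _ => ?_
    obtain ⟨e, d⟩ := z
    obtain ⟨h1, h2⟩ := hty e
    simp only [joinWords, if_true, Bool.false_eq_true, if_false, List.reverse_append,
      List.map_append] at h1 h2
    obtain ⟨h3, h4⟩ := List.append_inj h1 (by simp [hlen])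
    obtain ⟨h5, h6⟩ := List.append_inj h2 (by simp [hlen])
    rw [List.map_reverse, List.reverse_eq_iff] at h5 h6
    have hT : ∀ (a : Bool) (l : List Pt), l.map (fun p => (((𝓜.ty p).1, a), (𝓜.ty p).2)) =
        (l.map 𝓜.ty).map fun y => ((y.1, a), y.2) := fun a l => by
      rw [List.map_map]
      rfl
    cases d
    · simp only [Bool.false_eq_true, if_false, List.map_map, Function.comp_def]
      refine (congrArg₂ (· ++ ·) (hT true _) (hT false _)).trans ?_
      rw [h5, h6, hs e, ← hA, ← hA, List.map_append, List.reverse_append, List.map_reverse,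
        List.map_reverse, List.map_map, List.map_map, List.map_map, List.map_map]
      rfl
    · simp only [if_true, List.map_map, Function.comp_def]
      refine (congrArg₂ (· ++ ·) (hT false _) (hT true _)).trans ?_
      rw [h3, h4, hs e, ← hA, ← hA]
      rfl
  have hfst : (fun v => (copyState Γ f v).map Prod.fst) = endWords Γ (joinWords f) := by
    funext v
    rw [copyState, List.map_flatMap]
    simp only [List.map_map, Function.comp_def, List.map_id']
    exact copyEnds_flatMap Γ f v
  have := 𝓜.value_layered (Finset.nodup_toList (Finset.univ : Finset V)) (by simp) M.events
    (copyState Γ f) (by rw [htypes]; exact hM.1) (by rw [htypes]; exact hM.2)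
    (endWords Γ fun z => f (⟨z.1, 0⟩, z.2)) (endWords Γ fun z => f (⟨z.1, 1⟩, z.2))
  rw [hfst, htypes] at this
  exact this.symm

end Model

/-! ### Models from modules -/

section MatrixModel

/-- A matrix representation of `H` that is the sum of representations of given colours. -/
structure ColouredMatrix (b H : Type*) [CommRing b] [Ring H] [Algebra b H] (C J : Type*)
    [Fintype J] where
  /-- the colour of a basis vector -/
  col : J → C
  /-- the matrix coefficients -/
  mat : J → J → H →ₗ[b] b
  mat_one_self : ∀ i, mat i i 1 = 1
  mat_one_ne : ∀ i j, i ≠ j → mat i j 1 = 0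
  mat_mul : ∀ i j x y, mat i j (x * y) = ∑ k, mat i k x * mat k j y
  mat_eq_zero : ∀ i j, col i ≠ col j → mat i j = 0

variable {b H : Type*} [CommRing b] {I : Ideal b} [IsAdicComplete I b] [Ring H] [Algebra b H]
  [IsAdicComplete I H] (𝓗 : RibbonHopfAlgebra I H) {C J : Type*} [Fintype J]
  (ρ : ColouredMatrix b H C J)

namespace ColouredMatrix

/-- The matrix coefficients of a representation and of its dual. -/
def coef : J × Bool → J × Bool → H →ₗ[b] b
  | (i, true), (j, true) => ρ.mat i j
  | (i, false), (j, false) => ρ.mat j i ∘ₗ 𝓗.antipode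
  | _, _ => 0

/-- The evaluations. -/
def cap : J × Bool → J × Bool → b
  | (i, false), (j, true) => ρ.mat i j 1
  -- In this order the evaluation is invariant only with the factor k, because S² is conjugation by
  -- k.
  | (i, true), (j, false) => ρ.mat j i 𝓗.charm
  | _, _ => 0

open Classical in
/-- The coevaluations. -/
def cup (c : C) : Bool → J × Bool → J × Bool → b
  | true, (i, true), (j, false) => if ρ.col i = c then ρ.mat i j 1 else 0
  | false, (i, false), (j, true) => if ρ.col i = c then ρ.mat j i 𝓗.charmInv else 0
  | _, _, _ => 0

theorem col_eq {i j : J} {x : H} (h : ρ.mat i j x ≠ 0) : ρ.col i = ρ.col j :=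
  by_contra fun h' => h (by rw [ρ.mat_eq_zero i j h', LinearMap.zero_apply])

theorem sum_mat (i j : J) (x y : H) : ∑ k, ρ.mat k j y * ρ.mat i k x = ρ.mat i j (x * y) := by
  simp only [ρ.mat_mul, mul_comm]

theorem sum_mat' (i j : J) (x y : H) : ∑ k, ρ.mat i k x * ρ.mat k j y = ρ.mat i j (x * y) :=
  (ρ.mat_mul i j x y).symm

theorem mat_one_comm (i j : J) : ρ.mat i j 1 = ρ.mat j i 1 := by
  by_cases h : i = j
  · rw [h]
  · rw [ρ.mat_one_ne i j h, ρ.mat_one_ne j i (Ne.symm h)]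

open Classical in
theorem ite_mat_self (i j : J) (x : H) :
    (if ρ.col i = ρ.col j then ρ.mat i j x else 0) = ρ.mat i j x :=
  ite_eq_left_iff.mpr fun h => by rw [ρ.mat_eq_zero i j h, LinearMap.zero_apply]

open Classical in
theorem ite_mat_self' (i j : J) (x : H) :
    (if ρ.col i = ρ.col j then ρ.mat j i x else 0) = ρ.mat j i x :=
  ite_eq_left_iff.mpr fun h => by rw [ρ.mat_eq_zero j i (Ne.symm h), LinearMap.zero_apply]

theorem ite_sum_zero {P : Prop} [Decidable P] (f : J → b) :
    ∑ k, (if P then f k else 0) = if P then ∑ k, f k else 0 := by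
  split_ifs <;> simp

open Classical in
theorem ite_mat (c : C) (i j : J) (x : H) :
    (if ρ.col i = c then ρ.mat i j x else 0) = if ρ.col j = c then ρ.mat i j x else 0 := by
  by_cases h : ρ.col i = ρ.col j
  · rw [h]
  · simp [ρ.mat_eq_zero i j h]

open Classical in
theorem sum_ite_mat (c : C) (i j : J) (x y : H) :
    ∑ k, (if ρ.col k = c then ρ.mat k j y * ρ.mat i k x else 0) =
      if ρ.col j = c then ρ.mat i j (x * y) else 0 := by
  have : ∀ k, (if ρ.col k = c then ρ.mat k j y * ρ.mat i k x else 0) =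
      if ρ.col j = c then ρ.mat k j y * ρ.mat i k x else 0 := fun k => by
    rw [← ite_zero_mul, ite_mat, ite_zero_mul]
  simp only [this]
  by_cases h : ρ.col j = c <;> simp [h, sum_mat]

open Classical in
theorem sum_ite_mat' (c : C) (i j : J) (x y : H) :
    ∑ k, (if ρ.col k = c then ρ.mat i k x * ρ.mat k j y else 0) =
      if ρ.col j = c then ρ.mat i j (x * y) else 0 := by
  simp only [mul_comm (ρ.mat i _ x), sum_ite_mat]

/-- Since k⁻¹ = S(k), the claim is S²(k) = k, and S² is conjugation by k. -/
theorem antipode_charmInv : 𝓗.antipode 𝓗.charmInv = 𝓗.charm := by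
  have h := 𝓗.antipode_antipode_mul_charm 𝓗.charm
  calc 𝓗.antipode 𝓗.charmInv = 𝓗.antipode (𝓗.antipode 𝓗.charm) * 𝓗.charm * 𝓗.charmInv := by
        rw [mul_assoc, 𝓗.charm_mul_charmInv, mul_one]
        rfl
    _ = _ := by rw [h, mul_assoc, 𝓗.charm_mul_charmInv, mul_one]

open Classical in
/-- The matrix model of a representation. -/
def model (χ : C → H →ₗ[b] b)
    (hχ : ∀ c, χ c = ∑ j ∈ Finset.univ.filter (ρ.col · = c), ρ.mat j j) :
    Model 𝓗 χ (J × Bool) where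
  ty z := (ρ.col z.1, z.2)
  coef := ρ.coef 𝓗
  cap := ρ.cap 𝓗
  cup := ρ.cup 𝓗
  coef_one_self := by
    rintro ⟨i, _ | _⟩
    · simp [coef, 𝓗.antipode_one, ρ.mat_one_self]
    · exact ρ.mat_one_self i
  coef_one_ne := by
    rintro ⟨i, _ | _⟩ ⟨j, _ | _⟩ h
    · simpa [coef, 𝓗.antipode_one] using ρ.mat_one_ne j i fun e => h (by rw [e])
    · rfl
    · rfl
    · exact ρ.mat_one_ne i j fun e => h (by rw [e])
  coef_mul := by
    rintro ⟨i, _ | _⟩ ⟨j, _ | _⟩ x y <;>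
      simp [coef, Fintype.sum_prod_type, 𝓗.antipode_mul_antidistrib, ρ.mat_mul, mul_comm]
  coef_eq_zero := by
    rintro ⟨i, _ | _⟩ ⟨j, _ | _⟩ h
    · rw [coef, ρ.mat_eq_zero j i fun e => h (by simp [e]), LinearMap.zero_comp]
    · rfl
    · rfl
    · exact ρ.mat_eq_zero i j fun e => h (by simp [e])
  cup_eq_zero := by
    rintro c (_ | _) ⟨i, _ | _⟩ ⟨j, _ | _⟩ h <;> simp only [cup, ite_eq_right_iff]
    · exact fun hc => by_contra fun h' => h (by simp [← hc, ρ.col_eq h'])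
    · exact fun hc => by_contra fun h' => h (by simp [← hc, ρ.col_eq h'])
  cap_coef := by
    rintro ⟨i, _ | _⟩ ⟨j, _ | _⟩ <;> ext h <;>
      simp [coef, cap, Fintype.sum_prod_type, LinearMap.sum_apply, sum_mat, sum_mat',
        𝓗.antipode_antipode_mul_charm]
  cup_coef := by
    rintro c (_ | _) ⟨i, _ | _⟩ ⟨j, _ | _⟩ <;> ext h <;>
      simp only [LinearMap.sum_apply, LinearMap.smul_apply, smul_eq_mul, LinearMap.comp_apply,
        LinearMap.add_apply, zero_smul, smul_zero, LinearMap.zero_comp, Fintype.sum_prod_type,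
        Fintype.sum_bool, coef, cup, zero_mul, mul_zero, zero_add, add_zero,
        LinearMap.zero_apply, Finset.sum_const_zero, ite_mul, sum_mat, sum_mat', sum_ite_mat,
        sum_ite_mat', ite_sum_zero, 𝓗.mul_charmInv, mul_one, one_mul, ← ite_mat (c := c) (i := i)]
  cap_cup := by
    rintro c d ⟨i, di⟩ ⟨j, dj⟩ h
    obtain ⟨rfl, rfl⟩ := Prod.mk.inj h
    cases d <;> cases dj <;>
      simp only [Fintype.sum_prod_type, Fintype.sum_bool, coef, cap, cup, zero_mul, mul_zero,
        zero_add, add_zero, LinearMap.zero_apply, LinearMap.comp_apply, Finset.sum_const_zero,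
        ite_mul, mul_ite, sum_mat, sum_mat', sum_ite_mat, sum_ite_mat', ite_sum_zero, mul_one,
        one_mul, 𝓗.antipode_one, 𝓗.charm_mul_charmInv, 𝓗.charmInv_mul_charm, antipode_charmInv,
        Bool.not_true, Bool.not_false, ite_mat_self, ite_mat_self', if_true]
    all_goals first | rfl | exact mat_one_comm ρ _ _
  cup_cap := by
    rintro c d ⟨i, di⟩ ⟨j, dj⟩ h
    obtain ⟨rfl, rfl⟩ := Prod.mk.inj h
    cases di <;> cases dj <;>
      simp only [Fintype.sum_prod_type, Fintype.sum_bool, coef, cap, cup, zero_mul, mul_zero,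
        zero_add, add_zero, LinearMap.zero_apply, LinearMap.comp_apply, Finset.sum_const_zero,
        ite_mul, mul_ite, sum_mat, sum_mat', sum_ite_mat, sum_ite_mat', ite_sum_zero, mul_one,
        one_mul, 𝓗.antipode_one, 𝓗.charm_mul_charmInv, 𝓗.charmInv_mul_charm, antipode_charmInv,
        Bool.not_true, Bool.not_false, ite_mat_self, ite_mat_self', if_true]
  cup_cap_right := by
    rintro c d ⟨i, di⟩ ⟨j, dj⟩ h
    obtain ⟨rfl, rfl⟩ := Prod.mk.inj h
    cases di <;> cases dj <;>
      simp only [Fintype.sum_prod_type, Fintype.sum_bool, coef, cap, cup, zero_mul, mul_zero,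
        zero_add, add_zero, LinearMap.zero_apply, LinearMap.comp_apply, Finset.sum_const_zero,
        ite_mul, mul_ite, sum_mat, sum_mat', sum_ite_mat, sum_ite_mat', ite_sum_zero, mul_one,
        one_mul, 𝓗.antipode_one, 𝓗.charm_mul_charmInv, 𝓗.charmInv_mul_charm, antipode_charmInv,
        Bool.not_true, Bool.not_false, ite_mat_self, ite_mat_self', if_true]
    all_goals rfl
  cup_cap_left := by
    rintro c d ⟨i, di⟩ ⟨j, dj⟩ h
    obtain ⟨rfl, rfl⟩ := Prod.mk.inj h
    cases d <;> cases di <;>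
      simp only [Fintype.sum_prod_type, Fintype.sum_bool, coef, cap, cup, zero_mul, mul_zero,
        zero_add, add_zero, LinearMap.zero_apply, LinearMap.comp_apply, Finset.sum_const_zero,
        ite_mul, mul_ite, sum_mat, sum_mat', sum_ite_mat, sum_ite_mat', ite_sum_zero, mul_one,
        one_mul, 𝓗.antipode_one, 𝓗.charm_mul_charmInv, 𝓗.charmInv_mul_charm, antipode_charmInv,
        Bool.not_true, Bool.not_false, ite_mat_self, ite_mat_self', if_true]
  trace_eq c := by
    refine ⟨(Finset.univ.filter (ρ.col · = c)).map ⟨fun j => (j, true), fun i j h => by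
      simpa using h⟩, fun z => ?_, ?_⟩
    · simp only [Finset.mem_map, Finset.mem_filter, Finset.mem_univ, true_and]
      constructor
      · rintro ⟨a, rfl, rfl⟩
        rfl
      · intro h
        exact ⟨z.1, congrArg Prod.fst h, Prod.ext rfl (congrArg Prod.snd h).symm⟩
    · rw [hχ, Finset.sum_map]
      rfl

end ColouredMatrix

end MatrixModel

/-! ### Matrix coefficients of a finite set of modules -/

section ModuleModel

variable {b H : Type*} [CommRing b] [Ring H] [Algebra b H] {C : Type*} (W : C → Type*)
  [∀ c, AddCommGroup (W c)] [∀ c, Module b (W c)] [∀ c, Module.Free b (W c)]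
  [∀ c, Module.Finite b (W c)] [∀ c, Module H (W c)] [∀ c, IsScalarTower b H (W c)]

variable (b H) in
/-- The matrix coefficients of a module with respect to a basis. -/
def entry (c : C) (i j : Module.Free.ChooseBasisIndex b (W c)) : H →ₗ[b] b :=
  (Module.Free.chooseBasis b (W c)).coord i ∘ₗ
    LinearMap.applyₗ (Module.Free.chooseBasis b (W c) j) ∘ₗ
      (Algebra.lsmul b b (W c) : H →ₐ[b] Module.End b (W c)).toLinearMap

theorem entry_apply (c : C) (i j : Module.Free.ChooseBasisIndex b (W c)) (x : H) :
    entry b H W c i j x = (Module.Free.chooseBasis b (W c)).repr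
      (x • Module.Free.chooseBasis b (W c) j) i := rfl

theorem entry_one (c : C) (i j : Module.Free.ChooseBasisIndex b (W c)) :
    entry b H W c i j 1 = if j = i then 1 else 0 := by
  rw [entry_apply, one_smul, Module.Basis.repr_self, Finsupp.single_apply]

theorem entry_mul (c : C) (i j : Module.Free.ChooseBasisIndex b (W c)) (x y : H) :
    entry b H W c i j (x * y) = ∑ k, entry b H W c i k x * entry b H W c k j y := by
  have h := (Module.Free.chooseBasis b (W c)).sum_repr (y • Module.Free.chooseBasis b (W c) j)
  simp only [entry_apply]
  rw [mul_smul]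
  conv_lhs => rw [← h]
  rw [Finset.smul_sum, map_sum, Finsupp.finsetSum_apply]
  refine Finset.sum_congr rfl fun k _ => ?_
  rw [smul_comm, map_smul, Finsupp.smul_apply, smul_eq_mul, mul_comm]

theorem character_eq_sum_entry (c : C) : character b H (W c) = ∑ i, entry b H W c i i := by
  classical
  ext x
  rw [character, LinearMap.comp_apply,
    LinearMap.trace_eq_matrix_trace b (Module.Free.chooseBasis b (W c)), Matrix.trace,
    LinearMap.sum_apply]
  refine Finset.sum_congr rfl fun i _ => ?_
  rw [Matrix.diag_apply, LinearMap.toMatrix_apply]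
  rfl

open Classical in
/-- The matrix representation of a finite sum of modules. -/
def moduleMatrix (S : Finset C) :
    ColouredMatrix b H C (Σ c : S, Module.Free.ChooseBasisIndex b (W c)) where
  col j := j.1
  mat i j := if h : j.1 = i.1 then entry b H W i.1 i.2 (h ▸ j.2) else 0
  mat_one_self i := by simp [entry_one]
  mat_one_ne := by
    rintro ⟨c, i⟩ ⟨d, j⟩ h
    by_cases hcd : d = c
    · subst hcd
      have : j ≠ i := fun e => h (by rw [e])
      simp [entry_one, this]
    · simp [hcd]
  mat_mul := by
    rintro ⟨c, i⟩ ⟨d, j⟩ x y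
    rw [Fintype.sum_sigma, Finset.sum_eq_single c]
    · by_cases hcd : d = c
      · subst hcd
        simp [entry_mul]
      · simp [hcd]
    · intro e _ he
      simp [he]
    · simp
  mat_eq_zero := by
    rintro ⟨c, i⟩ ⟨d, j⟩ h
    exact dif_neg fun e => h (congrArg Subtype.val (Eq.symm e))

open Classical in
-- A model prescribes the traces of all colours, but a finite matrix representation can contain only
-- those in `S`. The trace functions of the other colours are therefore set to zero.
theorem sum_moduleMatrix (S : Finset C) (c : C) :
    (if c ∈ S then character b H (W c) else 0) =
      ∑ j ∈ Finset.univ.filter ((moduleMatrix (b := b) (H := H) W S).col · = c),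
        (moduleMatrix (b := b) (H := H) W S).mat j j := by
  rw [Finset.sum_filter, Fintype.sum_sigma]
  split_ifs with hc
  · rw [Finset.sum_eq_single ⟨c, hc⟩]
    · rw [character_eq_sum_entry]
      refine Finset.sum_congr rfl fun i _ => ?_
      simp [moduleMatrix]
    · intro d _ hd
      refine Finset.sum_eq_zero fun i _ => if_neg fun e => hd (Subtype.ext e)
    · simp
  · refine (Finset.sum_eq_zero fun d _ => Finset.sum_eq_zero fun i _ => if_neg fun e => hc ?_).symm
    rw [← e]
    exact d.2

end ModuleModel

/-! ### Dependence of Wilson links on the colours -/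

section Congruence

/-- The colours of the cups of an event. -/
def Event.colours {V C : Type*} : Event V C → List C
  | .cup _ _ c _ => [c]
  | _ => []

variable {b H : Type*} [CommRing b] {I : Ideal b} [IsAdicComplete I b] [Ring H] [Algebra b H]
  [IsAdicComplete I H] (𝓗 : RibbonHopfAlgebra I H) {V C : Type*} [DecidableEq V]

/-- The colour of an edge comes from a strand in a band or from a local minimum, so no other trace
function is ever used. -/
theorem evalEvents_congr {χ χ' : C → H →ₗ[b] b} {S : Set C} (h : ∀ c ∈ S, χ c = χ' c)
    (es : List (Event V C)) : ∀ (X : Type u) [DecidableEq X] (col : X → C)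
    (st : V → List (X × Bool)), (∀ x, col x ∈ S) → (∀ e ∈ es, ∀ c ∈ e.colours, c ∈ S) →
      𝓗.evalEvents χ es X col st = 𝓗.evalEvents χ' es X col st := by
  induction es with
  | nil => exact fun X _ col st _ _ => rfl
  | cons e es ih =>
    intro X _ col st hcol hes
    have hes' : ∀ e ∈ es, ∀ c ∈ e.colours, c ∈ S := fun e he => hes e (List.mem_cons_of_mem _ he)
    cases e with
    | cross v i o =>
      simp only [RibbonHopfAlgebra.evalEvents, ih _ _ _ hcol hes']
    | cap v i =>
      simp only [RibbonHopfAlgebra.evalEvents, h _ (hcol _)]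
      split
      · split_ifs <;> exact congrArg (· ∘ₗ _) (ih _ _ _ (fun x => hcol x) hes')
      · split_ifs <;> exact congrArg (· ∘ₗ _) (ih _ _ _ (fun x => hcol x) hes')
      · rfl
    | cup v i c d =>
      simp only [RibbonHopfAlgebra.evalEvents]
      rw [ih _ _ _ _ hes']
      rintro (_ | x)
      · exact hes _ List.mem_cons_self c (by simp [Event.colours])
      · exact hcol x

theorem wilson_congr {O : Type u} [Fintype O] [DecidableEq O] (Γ : Lattice O V)
    {χ χ' : C → H →ₗ[b] b} {S : Set C} (h : ∀ c ∈ S, χ c = χ' c) (L : Diagram O V C)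
    (hs : ∀ e, ∀ x ∈ L.strands e, x.1 ∈ S) (he : ∀ e ∈ L.events, ∀ c ∈ e.colours, c ∈ S) :
    𝓗.wilson Γ χ L = 𝓗.wilson Γ χ' L := by
  rw [RibbonHopfAlgebra.wilson, RibbonHopfAlgebra.wilson, evalEvents_congr 𝓗 h _ _ _ _ _ he]
  exact fun x => hs _ _ (List.get_mem _ _)

open Classical in
/-- The colours of a diagram. -/
def Diagram.colours {O : Type u} [Fintype O] (L : Diagram O V C) : Finset C :=
  (Finset.univ.biUnion fun e => ((L.strands e).map Prod.fst).toFinset) ∪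
    (L.events.flatMap Event.colours).toFinset

theorem wilson_congr_of_subset {O : Type u} [Fintype O] [DecidableEq O] (Γ : Lattice O V)
    {χ χ' : C → H →ₗ[b] b} {S : Finset C} (h : ∀ c ∈ S, χ c = χ' c) (L : Diagram O V C)
    (hL : L.colours ⊆ S) : 𝓗.wilson Γ χ L = 𝓗.wilson Γ χ' L := by
  classical
  refine wilson_congr 𝓗 Γ (S := S) h L (fun e x hx => hL ?_) fun e he c hc => hL ?_
  · refine Finset.mem_union_left _ (Finset.mem_biUnion.mpr ⟨e, Finset.mem_univ _, ?_⟩)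
    exact List.mem_toFinset.mpr (List.mem_map_of_mem hx)
  · exact Finset.mem_union_right _ (List.mem_toFinset.mpr (List.mem_flatMap.mpr ⟨e, he, hc⟩))

end Congruence

/-! ### Continuity, invariance and the product formula -/

section Superposition

variable {b H : Type*} [CommRing b] {I : Ideal b} [IsAdicComplete I b] [Ring H] [Algebra b H]
  [IsAdicComplete I H] (𝓗 : RibbonHopfAlgebra I H) {O : Type u} {V C : Type*} [Fintype O]
  [DecidableEq O] [DecidableEq V]

theorem IsCont.comp_list_prod {M P : Type*} [AddCommGroup M] [Module b M] [AddCommGroup P]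
    [Module b P] [IsAdicComplete I P] (l : List (Module.End b (AdicCompletion I M)))
    (h : ∀ A ∈ l, ∀ F : AdicCompletion I M →ₗ[b] P, IsCont F → IsCont (F ∘ₗ A))
    {F : AdicCompletion I M →ₗ[b] P} (hF : IsCont F) : IsCont (F ∘ₗ l.prod) := by
  induction l generalizing F with
  | nil => exact hF
  | cons A l ih =>
    rw [List.prod_cons]
    exact ih (fun B hB => h B (List.mem_cons_of_mem _ hB)) (h A List.mem_cons_self F hF)

theorem IsCont.comp_expand (m : O → ℕ) {F : CConn I H (Σ e, Fin (m e)) →ₗ[b] b} (hF : IsCont F) :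
    IsCont (F ∘ₗ 𝓗.expand m) := by
  have h1 := hF.comp_cmap ((TensorProduct.lid b _).toLinearMap ∘ₗ
      TensorProduct.map ((PiTensorProduct.constantBaseRingEquiv O b).toLinearMap ∘ₗ
        PiTensorProduct.map (fun _ => 𝓗.counit.toLinearMap)) LinearMap.id ∘ₗ
      (PiTensorProduct.tmulEquiv b H).symm.toLinearMap)
  have h2 := IsCont.comp_list_prod ((Finset.univ : Finset O).toList.map fun e =>
      𝓗.spread (X := O ⊕ Σ e : O, Fin (m e)) (Sum.inl e)
        ((Function.Embedding.sigmaMk (β := fun e : O => Fin (m e)) e).trans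
          Function.Embedding.inr)) (fun A hA F hF => by
    obtain ⟨e, -, rfl⟩ := List.mem_map.mp hA
    exact hF.comp_cext _) h1
  exact h2.comp_cmap _

theorem isCont_wilson (Γ : Lattice O V) (χ : C → H →ₗ[b] b) (L : Diagram O V C) :
    IsCont (𝓗.wilson Γ χ L) := by
  have h := (isCont_evalEvents 𝓗 χ L.events (Σ e : O, Fin (L.strands e).length)
      (fun x => ((L.strands x.1).get x.2).1)
      (Γ.ends fun e => List.ofFn fun j : Fin (L.strands e).length =>
        ((⟨e, j⟩ : Σ e : O, Fin (L.strands e).length), ((L.strands e).get j).2)))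
  have h' : IsCont (_ ∘ₗ 𝓗.switches (fun x : Σ e : O, Fin (L.strands e).length =>
    ((L.strands x.1).get x.2).2)) := h.comp_cmap _
  exact h'.comp_expand 𝓗 _

variable {Γ : Lattice O V}

theorem isCont_crossPast {X : Type*} [DecidableEq X] (a : X × Bool) (l : List (X × Bool))
    {F : CConn I H X →ₗ[b] b} (hF : IsCont F) : IsCont (F ∘ₗ 𝓗.crossPast a l) := by
  induction l generalizing F with
  | nil => exact hF
  | cons y l ih => exact (ih hF).comp_cext _

theorem isCont_separate {X : Type*} [DecidableEq X] (p : X → Bool) (l : List (X × Bool))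
    {F : CConn I H X →ₗ[b] b} (hF : IsCont F) : IsCont (F ∘ₗ 𝓗.separate p l) := by
  induction l generalizing F with
  | nil => exact hF
  | cons a l ih =>
    rw [RibbonHopfAlgebra.separate]
    split_ifs
    · exact ih hF
    · exact ih (isCont_crossPast 𝓗 a _ hF)

theorem isCont_star [Fintype V] (Γ : Lattice O V) (f g : CConn I H O →ₗ[b] b) :
    IsCont (star 𝓗 Γ f g) := by
  have h : IsCont (tensorFunctional f g) := isCont_cint _
  have h' := IsCont.comp_list_prod ((Finset.univ : Finset V).toList.map fun v =>
    𝓗.separate (X := Σ _ : O, Fin 2) (fun x => x.2 == 0)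
      (Γ.ends (fun e => [(⟨e, 0⟩, true), (⟨e, 1⟩, true)]) v)) (fun A hA F hF => by
    obtain ⟨v, -, rfl⟩ := List.mem_map.mp hA
    exact isCont_separate 𝓗 _ _ hF) h
  exact h'.comp_expand 𝓗 _

/-- Density of the uncompleted tensor power, together with multilinearity, reduces equations between
functionals to connections that are pure tensors. -/
theorem IsCont.ext_tprod {X : Type*} {F G : CConn I H X →ₗ[b] b} (hF : IsCont F) (hG : IsCont G)
    (h : ∀ x : X → H, F (AdicCompletion.of I _ (PiTensorProduct.tprod b x)) =
      G (AdicCompletion.of I _ (PiTensorProduct.tprod b x))) : F = G := by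
  refine hF.ext hG fun y => ?_
  have : F ∘ₗ AdicCompletion.of I _ = G ∘ₗ AdicCompletion.of I _ :=
    PiTensorProduct.ext (MultilinearMap.ext h)
  exact LinearMap.congr_fun this y

namespace Model

variable {𝓗} {χ : C → H →ₗ[b] b} {Pt : Type*} [Fintype Pt] [Fintype V]

/-- Wilson links are invariants of equivalence. -/
theorem wilson_equivalent (𝓜 : Model 𝓗 χ Pt) {L L' : Diagram O V C} (hL : L.IsLink Γ)
    (h : Diagram.Equivalent Γ L L') : 𝓗.wilson Γ χ L = 𝓗.wilson Γ χ L' :=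
  (isCont_wilson 𝓗 Γ χ L).ext_tprod (isCont_wilson 𝓗 Γ χ L') fun x =>
    (𝓜.wilson_tprod Γ L hL x).trans ((𝓜.cableSum_equivalent Γ h x).trans
      (𝓜.wilson_tprod Γ L' (h.isLink_iff.mp hL) x).symm)

/-- The product of two Wilson links is that of their superposition. -/
theorem star_wilson (𝓜 : Model 𝓗 χ Pt) {L L' N : Diagram O V C} (hL : L.IsLink Γ)
    (hL' : L'.IsLink Γ) (hN : N.IsLink Γ) (h : Diagram.IsSuperposition Γ L L' N) :
    star 𝓗 Γ (𝓗.wilson Γ χ L) (𝓗.wilson Γ χ L') = 𝓗.wilson Γ χ N := by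
  obtain ⟨M, hM, hlay, h0, h1, hr⟩ := h
  -- Sorting the bands keeps both layers unchanged as diagrams. Therefore only the superposed
  -- diagram has to be replaced by an equivalent one.
  obtain ⟨M', ⟨hM', hlayer, hr'⟩, hs⟩ :=
    Diagram.IsLayered.exists_sorted ⟨hM, hlay⟩ (hr.isLink_iff.mpr hN)
  have hl0 := h0.isLink_iff.mpr hL
  have hl1 := h1.isLink_iff.mpr hL'
  have hr'' : Diagram.Equivalent Γ (M'.recolor Prod.fst) N := hr'.trans _ _ _ hr
  rw [← 𝓜.wilson_equivalent hl0 h0, ← 𝓜.wilson_equivalent hl1 h1,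
    ← 𝓜.wilson_equivalent (hr''.isLink_iff.mpr hN) hr'', ← hlayer, ← hlayer]
  refine (isCont_star 𝓗 Γ _ _).ext_tprod (isCont_wilson 𝓗 Γ χ _) fun x => ?_
  rw [𝓜.star_tprod_eq_cableSum Γ hM' hs, 𝓜.wilson_tprod Γ _ (hr''.isLink_iff.mpr hN)]
  · rfl
  · rintro (_ | _) <;> rw [hlayer] <;> assumption

end Model

end Superposition

end LGFT

end

theorem theorem8 {b H : Type*} [CommRing b] (I : Ideal b) [IsAdicComplete I b]
    [Ring H] [Algebra b H] [IsAdicComplete I H] (𝓗 : LGFT.RibbonHopfAlgebra I H)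
    {O V : Type*} [Fintype O] [DecidableEq O] [Fintype V] [DecidableEq V]
    (Γ : LGFT.Lattice O V)
    {C : Type*} (W : C → Type*) [∀ c, AddCommGroup (W c)] [∀ c, Module b (W c)]
    [∀ c, Module.Free b (W c)] [∀ c, Module.Finite b (W c)]
    [∀ c, Module H (W c)] [∀ c, IsScalarTower b H (W c)]
    (L L' N : LGFT.Diagram O V C) (hL : L.IsLink Γ) (hL' : L'.IsLink Γ) (hN : N.IsLink Γ)
    (h : LGFT.Diagram.IsSuperposition Γ L L' N) :
    LGFT.star 𝓗 Γ (𝓗.wilson Γ (fun c => LGFT.character b H (W c)) L)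
        (𝓗.wilson Γ (fun c => LGFT.character b H (W c)) L') =
      𝓗.wilson Γ (fun c => LGFT.character b H (W c)) N := by
  classical
  -- The set of all colours may be infinite, while a model has finitely many basis vectors. Only the
  -- colours of the three diagrams matter.
  set S : Finset C := L.colours ∪ L'.colours ∪ N.colours with hS
  set χ : C → H →ₗ[b] b := fun c => if c ∈ S then LGFT.character b H (W c) else 0 with hχ
  have hc : ∀ c ∈ S, LGFT.character b H (W c) = χ c := fun c hc => (if_pos hc).symm
  have hLS : L.colours ⊆ S := fun c h => by simp [hS, h]
  have hLS' : L'.colours ⊆ S := fun c h => by simp [hS, h]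
  have hNS : N.colours ⊆ S := fun c h => by simp [hS, h]
  rw [LGFT.wilson_congr_of_subset 𝓗 Γ hc L hLS, LGFT.wilson_congr_of_subset 𝓗 Γ hc L' hLS',
    LGFT.wilson_congr_of_subset 𝓗 Γ hc N hNS]
  exact ((LGFT.moduleMatrix (b := b) (H := H) W S).model 𝓗 χ
    fun c => LGFT.sum_moduleMatrix W S c).star_wilson hL hL' hN h
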